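/- **Conventions.** Let $e_1,\dots,e_7$ be the standard basis of $\mathbb R^7$, and let $\times$ be the cross product on $\mathbb R^7$ determined by $e_i\times e_j=e_k$ (together with cyclic permutations and antisymmetry) for $(i,j,k)=(1,2,3),(1,4,5),(1,7,6),(2,4,6),(2,5,7),(3,4,7),(3,6,5)$; extend it $\mathbb C$-bilinearly to $\mathbb C^7$. Let $G_2^{\mathbb C}$ be the group of complex linear automorphisms of $(\mathbb C^7,\times)$. Let $S^2=\mathbb C\cup\{\infty\}$ be the Riemann sphere with coordinate $z$, and $S^6\subset\mathbb R^7$ the unit sphere. A smooth map $f:S^2\to S^6$ is an *almost complex curve* if $\partial_yf=f\times\partial_xf$ in local complex coordinates $x+iy$; it is *linearly full* if its image lies in no proper linear subspace of $\mathbb R^7$. For a smooth map $\psi:S^2\to\mathbb CP^6$ with smooth nowhere zero local lifts $s$, the next element of its harmonic sequence is the smooth map locally spanned by $(\partial_z s)^{\perp}$ (the component of $\partial_z s$ orthogonal to $s$) after removal of its isolated zeros. The *directrix curve* of $f$ is the holomorphic curve $\psi_0:S^2\to\mathbb CP^6$ whose harmonic sequence $\psi_0,\psi_1,\dots$ contains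 $[f]$. If $\psi_0=[f_0]$ locally with $f_0$ holomorphic, its osculating curves are $\sigma_j=[f_0\wedge f_0'\wedge\dots\wedge f_0^{(j)}]$, $0\le j\le5$ (with common zeros removed); the ramification index $r_{j+1}(p)$ is the order of vanishing at $p$ of the derivative of $\sigma_j$, and $(r_1(p),\dots,r_6(p))$ is the *singularity type* of $f$ at $p$. The *higher order singularities* of $f$ are the points at which this is not $(0,\dots,0)$; $f$ is *$k$-point ramified* if there are exactly $k$ of them ($k=0$: totally unramified). For positive integers $k_1,k_2$ put $f_{k_1,k_2}(z)=\sum_{j=1}^7a_j(z)e_j$ where $$a_1=-\tfrac{3\sqrt{30}\,k_2(k_1+k_2)}{(3k_1+k_2)(2k_1+k_2)}z^{k_1+k_2}+\tfrac{\sqrt{30}}2z^{3k_1+k_2},\qquad a_5=i\tfrac{3\sqrt{30}\,k_2(k_1+k_2)}{(3k_1+k_2)(2k_1+k_2)}z^{k_1+k_2}+i\tfrac{\sqrt{30}}2z^{3k_1+k_2},$$ $$a_2=\tfrac{15\sqrt3\,k_1k_2}{(3k_1+2k_2)(2k_1+k_2)}z^{k_1}+\sqrt3\,z^{3k_1+2k_2},\qquad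 a_6=-i\tfrac{15\sqrt3\,k_1k_2}{(3k_1+2k_2)(2k_1+k_2)}z^{k_1}+i\sqrt3\,z^{3k_1+2k_2},$$ $$a_3=i\tfrac{45\sqrt2\,k_1k_2^2(k_1+k_2)}{(3k_1+2k_2)(3k_1+k_2)(2k_1+k_2)^2}+i\tfrac{\sqrt2}2z^{4k_1+2k_2},\qquad a_7=-\tfrac{45\sqrt2\,k_1k_2^2(k_1+k_2)}{(3k_1+2k_2)(3k_1+k_2)(2k_1+k_2)^2}+\tfrac{\sqrt2}2z^{4k_1+2k_2},$$ $$a_4=-\tfrac{6\sqrt5\,k_2}{2k_1+k_2}z^{2k_1+k_2},$$ and let $[f_{k_1,k_2}]:S^2\to\mathbb CP^6$ be the corresponding holomorphic curve (extended to $z=\infty$). **Theorem.** Let $f:S^2\to S^6$ be a linearly full almost complex curve which is $k$-point ramified with $k\le2$, and whose higher order singularities (if any) lie in $\{0,\infty\}$. Then $f$ has a unique directrix curve $\psi_0$, and there are positive integers $k_1,k_2$ such that: 1. $f$ has the same singularity type $(k_1-1,\,k_2-1,\,k_1-1,\,k_1-1,\,k_2-1,\,k_1-1)$ at $z=0$ and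 at $z=\infty$; 2. $\psi_0$ is $G_2^{\mathbb C}$-equivalent to $[f_{k_1,k_2}]$: there is $A\in G_2^{\mathbb C}$ with $[f_{k_1,k_2}(z)]=A\,\psi_0(z)$ for all $z\in S^2$; 3. $[f_{k_1,k_2}]$ is $S^1$-symmetric: there is a continuous homomorphism $\rho:S^1\to U(7)$, acting non-trivially on $\mathbb CP^6$, with $[f_{k_1,k_2}(e^{i\theta}z)]=\rho(e^{i\theta})[f_{k_1,k_2}(z)]$ for all $\theta$ and $z$. -/

import Mathlib

open scoped LinearAlgebra.Projectivization ContDiff Topology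

noncomputable section

namespace SixSphere

/-! ### The cross product, the six-sphere and the complexified exceptional group -/

/-- The cross product on `R⁷` (coordinates indexed from `0`), given by its values on the standard
basis `e₁, …, e₇`: `e_i × e_j = e_k`, together with its cyclic permutations and antisymmetry, for
`(i, j, k) = (1,2,3), (1,4,5), (1,7,6), (2,4,6), (2,5,7), (3,4,7), (3,6,5)`. -/
def cross {R : Type*} [CommRing R] (x y : Fin 7 → R) : Fin 7 → R :=
  ![(x 1 * y 2 - x 2 * y 1) + (x 3 * y 4 - x 4 * y 3) + (x 6 * y 5 - x 5 * y 6),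
    (x 2 * y 0 - x 0 * y 2) + (x 3 * y 5 - x 5 * y 3) + (x 4 * y 6 - x 6 * y 4),
    (x 0 * y 1 - x 1 * y 0) + (x 3 * y 6 - x 6 * y 3) + (x 5 * y 4 - x 4 * y 5),
    (x 4 * y 0 - x 0 * y 4) + (x 5 * y 1 - x 1 * y 5) + (x 6 * y 2 - x 2 * y 6),
    (x 0 * y 3 - x 3 * y 0) + (x 6 * y 1 - x 1 * y 6) + (x 2 * y 5 - x 5 * y 2),
    (x 0 * y 6 - x 6 * y 0) + (x 1 * y 3 - x 3 * y 1) + (x 4 * y 2 - x 2 * y 4),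
    (x 5 * y 0 - x 0 * y 5) + (x 1 * y 4 - x 4 * y 1) + (x 2 * y 3 - x 3 * y 2)]

/-- `ℝ⁷` with its Euclidean inner product. -/
abbrev R7 := EuclideanSpace ℝ (Fin 7)

/-- `ℂ⁷` with its standard Hermitian inner product. -/
abbrev C7 := EuclideanSpace ℂ (Fin 7)

/-- The complex projective space `ℂP⁶`. -/
abbrev CP6 := ℙ ℂ C7

/-- The unit sphere `S⁶` of `ℝ⁷`. -/
abbrev S6 := Metric.sphere (0 : R7) 1

/-- The cross product of `ℝ⁷`. -/
def crossR (x y : R7) : R7 := WithLp.toLp 2 (cross x.ofLp y.ofLp)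

/-- The `ℂ`-bilinear extension of the cross product to `ℂ⁷`. -/
def crossC (x y : C7) : C7 := WithLp.toLp 2 (cross x.ofLp y.ofLp)

/-- `G₂^ℂ`, the group of automorphisms of `(ℂ⁷, ×)`. -/
def G2C : Subgroup (C7 ≃ₗ[ℂ] C7) where
  carrier := {A | ∀ x y, A (crossC x y) = crossC (A x) (A y)}
  mul_mem' := by
    intro A B hA hB x y
    simp only [Set.mem_ofPred_eq] at hA hB
    simp [LinearEquiv.mul_apply, hB x y, hA]
  one_mem' := by
    intro x y
    rfl
  inv_mem' := by
    intro A hA x y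
    simp only [Set.mem_ofPred_eq] at hA
    apply A.injective
    rw [hA]
    change A (A.symm _) = crossC (A (A.symm _)) (A (A.symm _))
    simp

/-! ### The Riemann sphere `S² = ℂ ∪ {∞}` and maps defined on it -/

/-- The two inverse charts of the Riemann sphere `ℂ ∪ {∞}`: `z ↦ z` (for `false`), and
`w ↦ 1 / w`, `0 ↦ ∞` (for `true`). -/
def chart : Bool → ℂ → OnePoint ℂ
  | false, z => (z : OnePoint ℂ)
  | true, w => if w = 0 then OnePoint.infty else ((w⁻¹ : ℂ) : OnePoint ℂ)

/-- `f : S² → S⁶` is an almost complex curve: it is smooth and `∂_y f = f × ∂_x f` in the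
complex coordinates `x + i y` of the sphere. -/
def IsAlmostComplexCurve (f : OnePoint ℂ → S6) : Prop :=
  ∀ c : Bool, ContDiff ℝ ∞ (fun z : ℂ => (f (chart c z) : R7)) ∧
    ∀ z : ℂ, fderiv ℝ (fun z : ℂ => (f (chart c z) : R7)) z Complex.I =
      crossR (f (chart c z)) (fderiv ℝ (fun z : ℂ => (f (chart c z) : R7)) z 1)

/-- `f : S² → S⁶` is linearly full: its image lies in no proper linear subspace of `ℝ⁷`
(equivalently, in no proper totally geodesic subsphere of `S⁶`). -/
def IsLinearlyFull (f : OnePoint ℂ → S6) : Prop :=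
  ∀ W : Submodule ℝ R7, (∀ p, (f p : R7) ∈ W) → W = ⊤

/-- The inclusion `ℝ⁷ ⊆ ℂ⁷`. -/
def toC (x : R7) : C7 := WithLp.toLp 2 (fun i => ((x i : ℝ) : ℂ))

theorem toC_ne_zero (x : S6) : toC (x : R7) ≠ 0 := by
  intro h
  have hx : (x : R7) = 0 := by
    ext i
    have := congrArg (fun v : C7 => v i) h
    simpa [toC] using this
  have := x.2
  simp [hx] at this

/-- The map `[f] : S² → ℂP⁶` determined by `f : S² → S⁶ ⊆ ℝ⁷ ⊆ ℂ⁷`. -/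
def projMap (f : OnePoint ℂ → S6) (p : OnePoint ℂ) : CP6 :=
  Projectivization.mk ℂ (toC (f p)) (toC_ne_zero (f p))

/-- `s` is a nowhere vanishing lift of `ψ` over the open set `U` of the chart `c`
(`s z` spans the line `ψ z`, so it is automatically non-zero). -/
def IsLift (ψ : OnePoint ℂ → CP6) (c : Bool) (U : Set ℂ) (s : ℂ → C7) : Prop :=
  IsOpen U ∧ ∀ z ∈ U, (ψ (chart c z)).submodule = Submodule.span ℂ {s z}

/-- `ψ : S² → ℂP⁶` is a holomorphic curve. -/
def IsHolomorphicCurve (ψ : OnePoint ℂ → CP6) : Prop :=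
  ∀ (c : Bool) (z₀ : ℂ), ∃ (U : Set ℂ) (s : ℂ → C7), z₀ ∈ U ∧ IsLift ψ c U s ∧
    DifferentiableOn ℂ s U

/-! ### Harmonic sequences and directrix curves -/

/-- The Wirtinger derivative `∂_z = (∂_x - i ∂_y) / 2`. -/
def dz (s : ℂ → C7) (z : ℂ) : C7 :=
  (1 / 2 : ℂ) • (fderiv ℝ s z 1 - Complex.I • fderiv ℝ s z Complex.I)

/-- For a lift `s` of `ψ`, the component of `∂_z s` orthogonal to the line `ψ`. -/
def delPerp (s : ℂ → C7) (z : ℂ) : C7 :=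
  (Submodule.span ℂ {s z})ᗮ.starProjection (dz s z)

/-- `χ` is the next element after `ψ` in the harmonic sequence: near each point `z₀` there are
smooth nowhere vanishing lifts `s` of `ψ` and `t` of `χ` with
`(∂_z s)^⊥ = (z - z₀)^m t`. In particular `(∂_z s)^⊥` is not identically zero, it spans `χ`
away from isolated zeros, and `χ` is the smooth extension across these zeros. -/
def IsNext (ψ χ : OnePoint ℂ → CP6) : Prop :=
  ∀ (c : Bool) (z₀ : ℂ), ∃ (U : Set ℂ) (s t : ℂ → C7) (m : ℕ), z₀ ∈ U ∧
    IsLift ψ c U s ∧ ContDiffOn ℝ ∞ s U ∧ IsLift χ c U t ∧ ContDiffOn ℝ ∞ t U ∧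
    ∀ z ∈ U, delPerp s z = (z - z₀) ^ m • t z

/-- `φ` is the directrix curve of `ψ`: the holomorphic curve whose harmonic sequence
`φ = ψ₀, ψ₁, ψ₂, …` contains `ψ`. -/
def IsDirectrix (φ ψ : OnePoint ℂ → CP6) : Prop :=
  IsHolomorphicCurve φ ∧ ∃ (k : ℕ) (Ψ : ℕ → OnePoint ℂ → CP6),
    Ψ 0 = φ ∧ Ψ k = ψ ∧ ∀ j < k, IsNext (Ψ j) (Ψ (j + 1))

/-! ### Osculating curves, ramification and singularity type -/

/-- The Plücker coordinates of `s ∧ s' ∧ ⋯ ∧ s^(j)`. -/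
def osculating (j : ℕ) (s : ℂ → C7) (z : ℂ) : (Fin (j + 1) ↪o Fin 7) → ℂ :=
  fun I => Matrix.det (Matrix.of fun a b : Fin (j + 1) => iteratedDeriv (a : ℕ) s z (I b))

/-- The coordinates of `g ∧ g'`; for a nowhere vanishing lift `g` of a curve in a projective
space, its order of vanishing is that of the derivative of the curve `[g]`. -/
def wedgeDeriv {ι : Type*} [Fintype ι] (g : ℂ → ι → ℂ) (z : ℂ) : ι × ι → ℂ :=
  fun I => g z I.1 * deriv g z I.2 - g z I.2 * deriv g z I.1

/-- The `j`-th osculating curve `σ_j` of the holomorphic curve `φ` has ramification index `r`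
at `p`. Near `p` the curve `σ_j` is `[g]`, where `g` is obtained from `s ∧ s' ∧ ⋯ ∧ s^(j)` by
removing its zero at `p`, and `r` is the order of vanishing of the derivative of `[g]`. -/
def HasRamificationIndex (φ : OnePoint ℂ → CP6) (j : ℕ) (p : OnePoint ℂ) (r : ℕ∞) : Prop :=
  ∃ (c : Bool) (z₀ : ℂ) (U : Set ℂ) (s : ℂ → C7) (m : ℕ)
    (g : ℂ → (Fin (j + 1) ↪o Fin 7) → ℂ),
    chart c z₀ = p ∧ z₀ ∈ U ∧ IsLift φ c U s ∧ DifferentiableOn ℂ s U ∧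
    AnalyticAt ℂ g z₀ ∧ g z₀ ≠ 0 ∧
    (∀ᶠ z in 𝓝 z₀, osculating j s z = (z - z₀) ^ m • g z) ∧
    analyticOrderAt (wedgeDeriv g) z₀ = r

/-- The holomorphic curve `φ` has singularity type `(r₁, …, r₆)` at `p`, where `r_{j+1}` is the
ramification index of `σ_j`, `j = 0, …, 5`. -/
def HasSingularityType (φ : OnePoint ℂ → CP6) (p : OnePoint ℂ) (r : Fin 6 → ℕ) : Prop :=
  ∀ j : Fin 6, HasRamificationIndex φ j p (r j)

/-- The set of higher order singularities of (the directrix curve of) an element `ψ` of a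
harmonic sequence: the points where some `σ_j`, `j = 0, …, 5`, has positive ramification index. -/
def higherOrderSingularities (ψ : OnePoint ℂ → CP6) : Set (OnePoint ℂ) :=
  {p | ∃ φ, IsDirectrix φ ψ ∧ ∃ (j : Fin 6) (r : ℕ∞), HasRamificationIndex φ j p r ∧ r ≠ 0}

/-- `ψ` is `k`-point ramified (totally unramified for `k = 0`). -/
def IsPointRamified (k : ℕ) (ψ : OnePoint ℂ → CP6) : Prop :=
  (higherOrderSingularities ψ).encard = k

/-! ### Equivalence and symmetry -/

/-- The map of `ℂP⁶` induced by a linear automorphism of `ℂ⁷`. -/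
def projAct (A : C7 ≃ₗ[ℂ] C7) : CP6 → CP6 :=
  Projectivization.map A.toLinearMap A.injective

/-- `G₂^ℂ`-equivalence of curves in `ℂP⁶`. -/
def G2CEquivalent (φ φ' : OnePoint ℂ → CP6) : Prop :=
  ∃ A ∈ G2C, ∀ p, φ' p = projAct A (φ p)

/-- `ψ` is `S¹`-symmetric (with fixed points `0`, `∞`): the rotations `z ↦ e^{iθ} z` of `S²`
correspond under `ψ` to a continuous action of `S¹` on `ℂP⁶` by holomorphic isometries
(induced by unitary maps of `ℂ⁷`), which is not trivial. -/
def IsS1Symmetric (ψ : OnePoint ℂ → CP6) : Prop :=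
  ∃ ρ : Circle →* (C7 ≃ₗᵢ[ℂ] C7), (∀ v, Continuous fun θ => ρ θ v) ∧
    (∃ θ p, projAct (ρ θ).toLinearEquiv p ≠ p) ∧
    ∀ (θ : Circle) (p : OnePoint ℂ),
      ψ (OnePoint.map (fun z : ℂ => (θ : ℂ) * z) p) = projAct (ρ θ).toLinearEquiv (ψ p)

/-! ### The explicit curve -/

/-- The square root of a natural number, as a complex number. -/
def csqrt (n : ℕ) : ℂ := ((Real.sqrt n : ℝ) : ℂ)

/-- The polynomial `f₀(z) = ∑ a_j(z) e_j`. -/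
def examplePoly (k l : ℕ) (z : ℂ) : C7 :=
  let K : ℂ := k
  let L : ℂ := l
  let A : ℂ := 3 * csqrt 30 * L * (K + L) / ((3 * K + L) * (2 * K + L))
  let B : ℂ := 15 * csqrt 3 * K * L / ((3 * K + 2 * L) * (2 * K + L))
  let C : ℂ := 45 * csqrt 2 * K * L ^ 2 * (K + L) /
    ((3 * K + 2 * L) * (3 * K + L) * (2 * K + L) ^ 2)
  !₂[-A * z ^ (k + l) + csqrt 30 / 2 * z ^ (3 * k + l),
    B * z ^ k + csqrt 3 * z ^ (3 * k + 2 * l),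
    Complex.I * C + Complex.I * (csqrt 2 / 2) * z ^ (4 * k + 2 * l),
    -(6 * csqrt 5 * L / (2 * K + L)) * z ^ (2 * k + l),
    Complex.I * A * z ^ (k + l) + Complex.I * (csqrt 30 / 2) * z ^ (3 * k + l),
    -Complex.I * B * z ^ k + Complex.I * csqrt 3 * z ^ (3 * k + 2 * l),
    -C + csqrt 2 / 2 * z ^ (4 * k + 2 * l)]

/-- The leading coefficient of the polynomial `f₀`, of degree `4 k + 2 l`. -/
def exampleLead : C7 :=
  !₂[0, 0, Complex.I * (csqrt 2 / 2), 0, 0, 0, csqrt 2 / 2]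

theorem csqrt_ne_zero {n : ℕ} (hn : n ≠ 0) : csqrt n ≠ 0 := by
  have : 0 < (n : ℝ) := by exact_mod_cast Nat.pos_of_ne_zero hn
  simpa [csqrt] using (Real.sqrt_pos.mpr this).ne'

theorem exampleLead_ne_zero : exampleLead ≠ 0 := by
  intro h
  have := congrArg (fun v : C7 => v 6) h
  simp [exampleLead, csqrt_ne_zero] at this

theorem examplePoly_ne_zero (k l : ℕ+) (z : ℂ) : examplePoly k l z ≠ 0 := by
  intro h
  have h3 := congrArg (fun v : C7 => v 2) h
  have h7 := congrArg (fun v : C7 => v 6) h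
  have hk : ((k : ℕ) : ℂ) ≠ 0 := by exact_mod_cast k.pos.ne'
  have hl : ((l : ℕ) : ℂ) ≠ 0 := by exact_mod_cast l.pos.ne'
  have e1 : ((k : ℕ) : ℂ) + (l : ℕ) ≠ 0 := by exact_mod_cast (by have := k.pos; omega : (k : ℕ) + (l : ℕ) ≠ 0)
  have e2 : 3 * ((k : ℕ) : ℂ) + 2 * (l : ℕ) ≠ 0 := by
    exact_mod_cast (by have := k.pos; omega : 3 * (k : ℕ) + 2 * (l : ℕ) ≠ 0)
  have e3 : 3 * ((k : ℕ) : ℂ) + (l : ℕ) ≠ 0 := by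
    exact_mod_cast (by have := k.pos; omega : 3 * (k : ℕ) + (l : ℕ) ≠ 0)
  have e4 : 2 * ((k : ℕ) : ℂ) + (l : ℕ) ≠ 0 := by
    exact_mod_cast (by have := k.pos; omega : 2 * (k : ℕ) + (l : ℕ) ≠ 0)
  simp only [examplePoly, PiLp.toLp_apply, PiLp.zero_apply, Matrix.cons_val] at h3 h7
  set C : ℂ := 45 * csqrt 2 * ((k : ℕ) : ℂ) * ((l : ℕ) : ℂ) ^ 2 * (((k : ℕ) : ℂ) + (l : ℕ)) /
    ((3 * ((k : ℕ) : ℂ) + 2 * (l : ℕ)) * (3 * ((k : ℕ) : ℂ) + (l : ℕ)) *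
      (2 * ((k : ℕ) : ℂ) + (l : ℕ)) ^ 2) with hC
  have hC0 : C ≠ 0 := by
    rw [hC]
    have h2 := csqrt_ne_zero (n := 2) (by norm_num)
    simp [h2, hk, hl, e1, e2, e3, e4]
  apply hC0
  linear_combination (-Complex.I / 2) * h3 - h7 / 2 + (C / 2 +
    csqrt 2 / 4 * z ^ (4 * (k : ℕ) + 2 * (l : ℕ))) * Complex.I_sq

/-- The holomorphic curve `S² → ℂP⁶` determined by the polynomial `f₀`; its value at `∞` is the
limit `[lim f₀(z) / z^(4 k + 2 l)]`. -/
def exampleCurve (k l : ℕ+) : OnePoint ℂ → CP6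
  | OnePoint.infty => Projectivization.mk ℂ exampleLead exampleLead_ne_zero
  | OnePoint.some z => Projectivization.mk ℂ (examplePoly k l z) (examplePoly_ne_zero k l z)

end SixSphere

end

/-! In a complex coordinate let F be the curve, regarded as a map into ℂ⁷. Almost complexity says
that F × F_z = i F_z, and the argument studies the binormal H = F_z × F_zz.

Existence of the directrix. The function F_zzz · F_zzz is holomorphic and defines a sextic
differential on the sphere, so it vanishes (`IsACPair.sextic_eq_zero`). This forces ∂_z H to be
parallel to H, which makes conj H / |H|² holomorphic where H ≠ 0. A maximum principle for |H|² with
Gaussian weights gives strong unique continuation, so H has only zeros of finite order. Hence conj H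
/ |H|² is rational, and after clearing common factors it spans the same line as a polynomial vector
p without zeros (`IsACPair.exists_directrixPoly`). Gram–Schmidt applied to a holomorphic frame
adapted to p, p', p'', p''' produces the lines of conj H, conj ∂_z̄H, conj F_z, F in this order, so
[p] is a directrix curve. Conversely, in any harmonic sequence through [F] the operator ∂_z̄ steps
back along these same lines and can only stop at conj H; this gives uniqueness.

Algebra of p. The vectors conj H, conj F_z, conj F_zz span a totally isotropic space. Hence p, p',
p'' are mutually null, p × p' = p × p'' = 0, and p × p''' is a multiple of p.

Monomial form. Adapted frames identify the ramification indices with the orders of vanishing in the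
osculating flag, so the Wronskian of p has no zero outside 0 and is therefore c z^k. Choose linear
combinations of the components having distinct orders at 0 and distinct degrees. The order and the
degree of the Wronskian are the sum of the orders and the sum of the degrees, each diminished by the
same constant. They agree, so every combination is a monomial and p = ∑ z^{m_i} v_i with independent
v_i (`exists_monomial_form`).

Rigidity. Write θ = z d/dz. The null relations for p become relations among the θ^a p, with p × θ³p
= c z^e p. Leibniz recursions followed by Vandermonde inversion determine all v_i · v_j and (v_i ×
v_j) · v_k from m, c and e. Two systems with the same m and e are therefore related by an element of
`G2C`, up to a scalar (`IsNullSystem.exists_equiv`). Comparing a system with its own rescaling z ↦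
2z gives m_i + m_{6-i} = 2e, and the lowest coefficient of θp × θ²p gives m_1 + m_2 = e. Two
positive integers k, l thus determine all the exponents. The explicit curve is a system with these
exponents, which gives the equivalence. The symmetry i ↦ 6 - i of the exponents gives equal
singularity types at 0 and ∞. Finally the coefficient vectors of the explicit curve are Hermitian
orthogonal, so multiplying them by the powers e^{i m_j θ} is unitary; this is the circle symmetry.
-/

noncomputable section

/-! ### Algebra of the bilinear form, conjugation and the cross product on ℂ⁷. -/

namespace SixSphere

/-- The complex bilinear form on `ℂ⁷` extending the Euclidean inner product. -/
def dotC (x y : C7) : ℂ := ∑ i, x i * y i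

/-- Complex conjugation on `ℂ⁷`. -/
def conjC (x : C7) : C7 := WithLp.toLp 2 fun i => (starRingEnd ℂ) (x i)

@[simp] theorem conjC_apply (x : C7) (i : Fin 7) : conjC x i = (starRingEnd ℂ) (x i) := rfl

@[simp] theorem conjC_conjC (x : C7) : conjC (conjC x) = x := by ext i; simp

@[simp] theorem conjC_zero : conjC 0 = 0 := by ext i; simp

theorem conjC_eq_zero {x : C7} : conjC x = 0 ↔ x = 0 :=
  ⟨fun h => by rw [← conjC_conjC x, h, conjC_zero], fun h => by rw [h, conjC_zero]⟩

@[simp] theorem conjC_add (x y : C7) : conjC (x + y) = conjC x + conjC y := by ext i; simp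
@[simp] theorem conjC_sub (x y : C7) : conjC (x - y) = conjC x - conjC y := by ext i; simp
@[simp] theorem conjC_neg (x : C7) : conjC (-x) = -conjC x := by ext i; simp
@[simp] theorem conjC_smul (c : ℂ) (x : C7) :
    conjC (c • x) = (starRingEnd ℂ) c • conjC x := by ext i; simp

theorem norm_conjC (x : C7) : ‖conjC x‖ = ‖x‖ := by
  simp [EuclideanSpace.norm_eq]

theorem inner_eq_dotC (x y : C7) : inner ℂ x y = dotC (conjC x) y := by
  simp [dotC, PiLp.inner_apply, mul_comm]

theorem dotC_comm (x y : C7) : dotC x y = dotC y x := by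
  simp [dotC, mul_comm]

theorem conj_dotC (x y : C7) : (starRingEnd ℂ) (dotC x y) = dotC (conjC x) (conjC y) := by
  simp [dotC, map_sum]

theorem dotC_conjC_self (x : C7) : dotC (conjC x) x = ((‖x‖ ^ 2 : ℝ) : ℂ) := by
  rw [← inner_eq_dotC, inner_self_eq_norm_sq_to_K]; norm_cast

theorem dotC_self_conjC (x : C7) : dotC x (conjC x) = ((‖x‖ ^ 2 : ℝ) : ℂ) := by
  rw [dotC_comm, dotC_conjC_self]

@[simp] theorem dotC_add_left (x y z : C7) : dotC (x + y) z = dotC x z + dotC y z := by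
  simp [dotC, add_mul, Finset.sum_add_distrib]
@[simp] theorem dotC_add_right (x y z : C7) : dotC x (y + z) = dotC x y + dotC x z := by
  simp [dotC, mul_add, Finset.sum_add_distrib]
@[simp] theorem dotC_smul_left (c : ℂ) (x y : C7) : dotC (c • x) y = c * dotC x y := by
  simp [dotC, Finset.mul_sum, mul_assoc]
@[simp] theorem dotC_smul_right (c : ℂ) (x y : C7) : dotC x (c • y) = c * dotC x y := by
  simp [dotC, Finset.mul_sum, mul_left_comm]
@[simp] theorem dotC_neg_left (x y : C7) : dotC (-x) y = -dotC x y := by simp [dotC]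
@[simp] theorem dotC_neg_right (x y : C7) : dotC x (-y) = -dotC x y := by simp [dotC]
@[simp] theorem dotC_sub_left (x y z : C7) : dotC (x - y) z = dotC x z - dotC y z := by
  simp [sub_eq_add_neg]
@[simp] theorem dotC_sub_right (x y z : C7) : dotC x (y - z) = dotC x y - dotC x z := by
  simp [sub_eq_add_neg]
@[simp] theorem dotC_zero_left (x : C7) : dotC 0 x = 0 := by simp [dotC]
@[simp] theorem dotC_zero_right (x : C7) : dotC x 0 = 0 := by simp [dotC]

theorem dotC_nondegenerate {x : C7} (h : ∀ y, dotC x y = 0) : x = 0 := by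
  have := h (conjC x)
  rw [dotC_self_conjC] at this
  simpa using this

theorem crossC_apply (x y : C7) (i : Fin 7) : crossC x y i = cross x.ofLp y.ofLp i := rfl

@[simp] theorem crossC_add_left (x y z : C7) : crossC (x + y) z = crossC x z + crossC y z := by
  ext i; fin_cases i <;> simp [crossC, cross] <;> ring
@[simp] theorem crossC_add_right (x y z : C7) : crossC x (y + z) = crossC x y + crossC x z := by
  ext i; fin_cases i <;> simp [crossC, cross] <;> ring
@[simp] theorem crossC_smul_left (c : ℂ) (x y : C7) : crossC (c • x) y = c • crossC x y := by
  ext i; fin_cases i <;> simp [crossC, cross] <;> ring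
@[simp] theorem crossC_smul_right (c : ℂ) (x y : C7) : crossC x (c • y) = c • crossC x y := by
  ext i; fin_cases i <;> simp [crossC, cross] <;> ring
theorem crossC_anticomm (x y : C7) : crossC x y = -crossC y x := by
  ext i; fin_cases i <;> simp [crossC, cross] <;> ring
@[simp] theorem crossC_neg_left (x y : C7) : crossC (-x) y = -crossC x y := by
  simpa using crossC_smul_left (-1) x y
@[simp] theorem crossC_neg_right (x y : C7) : crossC x (-y) = -crossC x y := by
  simpa using crossC_smul_right (-1) x y
@[simp] theorem crossC_sub_right (x y z : C7) : crossC x (y - z) = crossC x y - crossC x z := by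
  simp [sub_eq_add_neg]
@[simp] theorem crossC_zero_left (x : C7) : crossC 0 x = 0 := by
  simpa using crossC_smul_left 0 x x
@[simp] theorem crossC_zero_right (x : C7) : crossC x 0 = 0 := by
  simpa using crossC_smul_right 0 x x
@[simp] theorem crossC_self (x : C7) : crossC x x = 0 := by
  ext i; fin_cases i <;> simp [crossC, cross] <;> ring

theorem conjC_crossC (x y : C7) : conjC (crossC x y) = crossC (conjC x) (conjC y) := by
  ext i; fin_cases i <;> simp [crossC, cross]

/-- Skewness of x ×; together with anticommutativity it makes the triple product alternating. -/
theorem dotC_crossC_left (x y z : C7) : dotC (crossC x y) z = -dotC y (crossC x z) := by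
  simp [dotC, Fin.sum_univ_seven, crossC, cross]; ring

@[simp] theorem dotC_crossC_self_left (x y : C7) : dotC (crossC x y) x = 0 := by
  simp [dotC, Fin.sum_univ_seven, crossC, cross]; ring

@[simp] theorem dotC_crossC_self_right (x y : C7) : dotC (crossC x y) y = 0 := by
  simp [dotC, Fin.sum_univ_seven, crossC, cross]; ring

/-- Polarization of `crossC_crossC_self`. It takes the place of associativity: it allows two factors
of a double cross product to be interchanged at the cost of scalar multiples of the arguments. -/
theorem crossC_crossC_add (x y z : C7) : crossC x (crossC y z) + crossC y (crossC x z) =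
    -(2 * dotC x y) • z + dotC x z • y + dotC y z • x := by
  ext i; fin_cases i <;> simp [dotC, Fin.sum_univ_seven, crossC, cross] <;> ring

theorem crossC_crossC_self (x z : C7) :
    crossC x (crossC x z) = -dotC x x • z + dotC x z • x := by
  ext i; fin_cases i <;> simp [dotC, Fin.sum_univ_seven, crossC, cross] <;> ring

/-- The cross product of `ℂ⁷` as a continuous bilinear map. -/
def crossL : C7 →L[ℂ] C7 →L[ℂ] C7 :=
  LinearMap.toContinuousLinearMap
    ((LinearMap.toContinuousLinearMap : (C7 →ₗ[ℂ] C7) ≃ₗ[ℂ] (C7 →L[ℂ] C7)).toLinearMap ∘ₗ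
      LinearMap.mk₂ ℂ crossC crossC_add_left crossC_smul_left crossC_add_right
        fun c x y => crossC_smul_right c x y)

@[simp] theorem crossL_apply (x y : C7) : crossL x y = crossC x y := rfl

/-- The bilinear form of `ℂ⁷` as a continuous bilinear map. -/
def dotL : C7 →L[ℂ] C7 →L[ℂ] ℂ :=
  LinearMap.toContinuousLinearMap
    ((LinearMap.toContinuousLinearMap : (C7 →ₗ[ℂ] ℂ) ≃ₗ[ℂ] (C7 →L[ℂ] ℂ)).toLinearMap ∘ₗ
      LinearMap.mk₂ ℂ dotC dotC_add_left dotC_smul_left dotC_add_right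
        fun c x y => dotC_smul_right c x y)

@[simp] theorem dotL_apply (x y : C7) : dotL x y = dotC x y := rfl

/-- Complex conjugation on `ℂ⁷` as a continuous real linear map. -/
def conjL : C7 →L[ℝ] C7 :=
  LinearMap.toContinuousLinearMap
    { toFun := conjC
      map_add' := conjC_add
      map_smul' := fun c x => by ext i; simp }

@[simp] theorem conjL_apply (x : C7) : conjL x = conjC x := rfl

/-! ### The eigenspaces of `F ×` on `ℂ⁷`, for a vector `F` with `F · F = 1` -/

section Eigen

variable {F x y u v : C7}

theorem dotC_eigen (hx : crossC F x = Complex.I • x) : dotC F x = 0 := by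
  have := dotC_crossC_self_left F x
  rw [hx, dotC_smul_left, dotC_comm] at this
  simpa using this

theorem dotC_eigen_neg (hx : crossC F x = -Complex.I • x) : dotC F x = 0 := by
  have := dotC_crossC_self_left F x
  rw [hx, dotC_smul_left, dotC_comm] at this
  simpa using this

/-- Since F × is skew, eigenvectors whose eigenvalues do not sum to zero are orthogonal. -/
theorem dotC_eigen_eigen (hx : crossC F x = Complex.I • x) (hy : crossC F y = Complex.I • y) :
    dotC x y = 0 := by
  have := dotC_crossC_left F x y
  rw [hx, hy, dotC_smul_left, dotC_smul_right] at this
  have h2 : (2 * Complex.I) * dotC x y = 0 := by linear_combination this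
  simpa using h2

theorem dotC_eigen_neg_neg (hx : crossC F x = -Complex.I • x) (hy : crossC F y = -Complex.I • y) :
    dotC x y = 0 := by
  have := dotC_crossC_left F x y
  rw [hx, hy, dotC_smul_left, dotC_smul_right] at this
  have h2 : (2 * Complex.I) * dotC x y = 0 := by linear_combination -this
  simpa using h2

/-- All pairings among F, x and y vanish, so the double cross product identity reduces to F × (x ×
y) = -x × (F × y). -/
theorem crossC_eigen_eigen (hx : crossC F x = Complex.I • x) (hy : crossC F y = Complex.I • y) :
    crossC F (crossC x y) = -Complex.I • crossC x y := by
  have := crossC_crossC_add F x y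
  rw [hy, dotC_eigen hx, dotC_eigen hy, dotC_eigen_eigen hx hy, crossC_smul_right] at this
  simp only [mul_zero, neg_zero, zero_smul, add_zero] at this
  rw [neg_smul]
  exact eq_neg_of_add_eq_zero_left this

/-- The double cross product identities for (F, x, v) and (F, v, x) both contain F × (x × v), with
opposite signs. Adding them leaves -2i x × v = 2 (x · v) F. -/
theorem crossC_eigen_eigen_neg (hx : crossC F x = Complex.I • x)
    (hv : crossC F v = -Complex.I • v) : crossC x v = (Complex.I * dotC x v) • F := by
  have h1 := crossC_crossC_add F x v
  have h2 := crossC_crossC_add F v x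
  rw [hv, dotC_eigen hx, dotC_eigen_neg hv, crossC_smul_right] at h1
  rw [hx, dotC_eigen hx, dotC_eigen_neg hv, crossC_smul_right, crossC_anticomm v x,
    crossC_neg_right, dotC_comm v x] at h2
  simp only [mul_zero, neg_zero, zero_smul, add_zero, zero_add] at h1 h2
  have h3 : (2 * Complex.I) • crossC x v = (-2 * dotC x v) • F := by
    have : -(2 * Complex.I) • crossC x v = (2 * dotC x v) • F := by
      linear_combination (norm := module) h1 + h2
    rw [neg_smul, neg_eq_iff_eq_neg] at this
    rw [this]; module
  have h4 := congrArg (fun w => (-Complex.I / 2) • w) h3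
  simp only [smul_smul] at h4
  have e1 : -Complex.I / 2 * (2 * Complex.I) = 1 := by
    linear_combination -Complex.I_sq
  rw [e1, one_smul] at h4
  rw [h4]; congr 1; ring

theorem crossC_eigen_self (hx : crossC F x = Complex.I • x) : crossC x F = -Complex.I • x := by
  rw [crossC_anticomm, hx, neg_smul]

theorem eigen_conj (hF : conjC F = F) (hx : crossC F x = Complex.I • x) :
    crossC F (conjC x) = -Complex.I • conjC x := by
  have := congrArg conjC hx
  rw [conjC_crossC, hF, conjC_smul, Complex.conj_I] at this
  exact this

theorem eigen_neg_conj (hF : conjC F = F) (hx : crossC F x = -Complex.I • x) :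
    crossC F (conjC x) = Complex.I • conjC x := by
  have := congrArg conjC hx
  rw [conjC_crossC, hF, conjC_smul, map_neg, Complex.conj_I, neg_neg] at this
  exact this

theorem crossC_crossC_eigen (hx : crossC F x = Complex.I • x) (hy : crossC F y = Complex.I • y) :
    crossC x (crossC x y) = 0 := by
  rw [crossC_crossC_self, dotC_eigen_eigen hx hx, dotC_eigen_eigen hx hy]; simp

/-- Two vectors of the `-i` eigenspace with vanishing cross product are parallel. -/
theorem parallel_of_crossC_eq_zero (hF : conjC F = F) (hu : crossC F u = -Complex.I • u)
    (hv : crossC F v = -Complex.I • v) (huv : crossC u v = 0) :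
    dotC (conjC u) u • v = dotC (conjC u) v • u := by
  have hub := eigen_neg_conj hF hu
  have h := crossC_crossC_add u (conjC u) v
  rw [huv, crossC_zero_right, add_zero, dotC_eigen_neg_neg hu hv,
    crossC_eigen_eigen_neg hub hv, crossC_smul_right, crossC_anticomm u F, hu,
    dotC_comm u (conjC u)] at h
  have h2 : (2 * dotC (conjC u) u) • v = (2 * dotC (conjC u) v) • u := by
    -- The vector conj u × v is a multiple of F, and u × F is a multiple of u.
    have e : (Complex.I * dotC (conjC u) v) • -(-Complex.I • u) = (-dotC (conjC u) v) • u := by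
      rw [neg_smul, neg_neg, smul_smul]; congr 1
      linear_combination dotC (conjC u) v * Complex.I_sq
    rw [e] at h
    linear_combination (norm := module) h
  have := congrArg (fun w => (1 / 2 : ℂ) • w) h2
  simpa [smul_smul] using this

/-- On the i-eigenspace the triple product behaves like a volume form, and this is the resulting
identity of three-dimensional vector algebra. It later tests whether ∂_z H is parallel to H. -/
theorem crossC_crossC_eigen_triple {a : C7} (hx : crossC F x = Complex.I • x)
    (hy : crossC F y = Complex.I • y) (ha : crossC F a = Complex.I • a) :
    crossC (crossC x a) (crossC x y) = (2 * dotC (crossC x a) y) • x := by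
  have hu := crossC_eigen_eigen hx ha
  set u := crossC x a with hudef
  have h := crossC_crossC_add u x y
  rw [crossC_anticomm u y, crossC_eigen_eigen_neg hy hu, dotC_eigen_eigen hx hy, crossC_neg_right,
    crossC_smul_right, crossC_eigen_self hx, hudef, dotC_crossC_self_left, ← hudef] at h
  rw [eq_sub_of_add_eq h, dotC_comm y u]
  have : (Complex.I * dotC u y) • (-Complex.I • x) = dotC u y • x := by
    rw [smul_smul]; congr 1; linear_combination -dotC u y * Complex.I_sq
  rw [this]; module

/-- Lagrange's identity on the i-eigenspace: move conj x × to the other side of the pairing and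
expand conj y × (x × y). For x = F_z and y = F_zz it computes |H|². -/
theorem norm_crossC_eigen (hF : conjC F = F) (hx : crossC F x = Complex.I • x)
    (hy : crossC F y = Complex.I • y) :
    dotC (conjC (crossC x y)) (crossC x y) = 2 * (dotC (conjC x) x * dotC (conjC y) y -
      dotC (conjC x) y * dotC (conjC y) x) := by
  have hxb := eigen_conj hF hx
  have hyb := eigen_conj hF hy
  have h := crossC_crossC_add (conjC y) x y
  rw [crossC_anticomm (conjC y) y, crossC_eigen_eigen_neg hy hyb, crossC_neg_right,
    crossC_smul_right, crossC_eigen_self hx, dotC_eigen_eigen hx hy] at h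
  rw [conjC_crossC, crossC_anticomm (conjC x), dotC_neg_left, dotC_crossC_left,
    neg_neg, eq_sub_of_add_eq h]
  simp only [dotC_add_right, dotC_sub_right, dotC_smul_right, dotC_neg_right, neg_smul,
    dotC_comm y (conjC y), zero_mul]
  linear_combination (-dotC (conjC y) y * dotC (conjC x) x) * Complex.I_sq

end Eigen

/-! ### Wirtinger calculus -/

section Wirtinger

variable {E F G : Type*} [NormedAddCommGroup E] [NormedSpace ℂ E] [NormedAddCommGroup F]
  [NormedSpace ℂ F] [NormedAddCommGroup G] [NormedSpace ℂ G]

/-- The Wirtinger derivative `∂_z`. -/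
def Dz (s : ℂ → E) (z : ℂ) : E :=
  (1 / 2 : ℂ) • (fderiv ℝ s z 1 - Complex.I • fderiv ℝ s z Complex.I)

/-- The Wirtinger derivative `∂_z̄`. -/
def Db (s : ℂ → E) (z : ℂ) : E :=
  (1 / 2 : ℂ) • (fderiv ℝ s z 1 + Complex.I • fderiv ℝ s z Complex.I)

theorem dz_eq_Dz (s : ℂ → C7) : dz s = Dz s := rfl

theorem fderiv_one_eq (s : ℂ → E) (z : ℂ) : fderiv ℝ s z 1 = Dz s z + Db s z := by
  simp only [Dz, Db]; module

theorem fderiv_I_eq (s : ℂ → E) (z : ℂ) :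
    fderiv ℝ s z Complex.I = Complex.I • (Dz s z - Db s z) := by
  have h : (Complex.I * Complex.I) • fderiv ℝ s z Complex.I = -fderiv ℝ s z Complex.I := by
    rw [Complex.I_mul_I, neg_one_smul]
  have : Complex.I • (Dz s z - Db s z) = -((Complex.I * Complex.I) • fderiv ℝ s z Complex.I) := by
    simp only [Dz, Db]; module
  rw [this, h, neg_neg]

theorem fderiv_eq_Dz_Db (s : ℂ → E) (z v : ℂ) :
    fderiv ℝ s z v = v • Dz s z + (starRingEnd ℂ) v • Db s z := by
  have hv : v = v.re • (1 : ℂ) + v.im • Complex.I := by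
    simp [Complex.re_add_im]
  have hc : (starRingEnd ℂ) v = (v.re : ℂ) - v.im * Complex.I := by
    apply Complex.ext <;> simp
  have hv' : v = (v.re : ℂ) + v.im * Complex.I := (Complex.re_add_im v).symm
  conv_lhs => rw [hv]
  rw [map_add, map_smul, map_smul, fderiv_one_eq, fderiv_I_eq, hc]
  conv_rhs => rw [hv']
  simp only [Complex.ofReal_re, Complex.ofReal_im, Complex.add_re, Complex.add_im, Complex.mul_re,
    Complex.mul_im, Complex.I_re, Complex.I_im, mul_zero, mul_one, sub_zero, add_zero, zero_add,
    ← Complex.coe_smul]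
  module

theorem norm_fderiv_le (s : ℂ → E) (z : ℂ) : ‖fderiv ℝ s z‖ ≤ ‖Dz s z‖ + ‖Db s z‖ := by
  refine ContinuousLinearMap.opNorm_le_bound _ (by positivity) fun v => ?_
  rw [fderiv_eq_Dz_Db]
  refine (norm_add_le _ _).trans ?_
  rw [norm_smul, norm_smul, Complex.norm_conj]
  linarith

theorem Dz_congr {s t : ℂ → E} {z : ℂ} (h : s =ᶠ[𝓝 z] t) : Dz s z = Dz t z := by
  simp [Dz, h.fderiv_eq]

theorem Db_congr {s t : ℂ → E} {z : ℂ} (h : s =ᶠ[𝓝 z] t) : Db s z = Db t z := by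
  simp [Db, h.fderiv_eq]

@[simp] theorem Dz_const (c : E) (z : ℂ) : Dz (fun _ => c) z = 0 := by simp [Dz]
@[simp] theorem Db_const (c : E) (z : ℂ) : Db (fun _ => c) z = 0 := by simp [Db]

theorem Dz_add {s t : ℂ → E} {z : ℂ} (hs : DifferentiableAt ℝ s z) (ht : DifferentiableAt ℝ t z) :
    Dz (fun w => s w + t w) z = Dz s z + Dz t z := by
  simp only [Dz, fderiv_fun_add hs ht, add_apply]; module

theorem Db_add {s t : ℂ → E} {z : ℂ} (hs : DifferentiableAt ℝ s z) (ht : DifferentiableAt ℝ t z) :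
    Db (fun w => s w + t w) z = Db s z + Db t z := by
  simp only [Db, fderiv_fun_add hs ht, add_apply]; module

theorem Dz_clm (L : E →L[ℂ] F) {s : ℂ → E} {z : ℂ} (hs : DifferentiableAt ℝ s z) :
    Dz (fun w => L (s w)) z = L (Dz s z) := by
  have : fderiv ℝ (fun w => L (s w)) z = (L.restrictScalars ℝ).comp (fderiv ℝ s z) :=
    ((L.restrictScalars ℝ).hasFDerivAt.comp z hs.hasFDerivAt).fderiv
  simp [Dz, this]

theorem Db_clm (L : E →L[ℂ] F) {s : ℂ → E} {z : ℂ} (hs : DifferentiableAt ℝ s z) :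
    Db (fun w => L (s w)) z = L (Db s z) := by
  have : fderiv ℝ (fun w => L (s w)) z = (L.restrictScalars ℝ).comp (fderiv ℝ s z) :=
    ((L.restrictScalars ℝ).hasFDerivAt.comp z hs.hasFDerivAt).fderiv
  simp [Db, this]

theorem fderiv_bilin (B : E →L[ℂ] F →L[ℂ] G) {s : ℂ → E} {t : ℂ → F} {z : ℂ}
    (hs : DifferentiableAt ℝ s z) (ht : DifferentiableAt ℝ t z) (v : ℂ) :
    fderiv ℝ (fun w => B (s w) (t w)) z v = B (s z) (fderiv ℝ t z v) + B (fderiv ℝ s z v) (t z) := by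
  have := (B.bilinearRestrictScalars ℝ).hasFDerivAt_of_bilinear hs.hasFDerivAt ht.hasFDerivAt
  have h2 : fderiv ℝ (fun w => B (s w) (t w)) z = _ := this.fderiv
  rw [h2]
  simp

theorem Dz_bilin (B : E →L[ℂ] F →L[ℂ] G) {s : ℂ → E} {t : ℂ → F} {z : ℂ}
    (hs : DifferentiableAt ℝ s z) (ht : DifferentiableAt ℝ t z) :
    Dz (fun w => B (s w) (t w)) z = B (Dz s z) (t z) + B (s z) (Dz t z) := by
  simp only [Dz, fderiv_bilin B hs ht, map_smul, map_sub, smul_apply,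
    sub_apply]
  module

theorem Db_bilin (B : E →L[ℂ] F →L[ℂ] G) {s : ℂ → E} {t : ℂ → F} {z : ℂ}
    (hs : DifferentiableAt ℝ s z) (ht : DifferentiableAt ℝ t z) :
    Db (fun w => B (s w) (t w)) z = B (Db s z) (t z) + B (s z) (Db t z) := by
  simp only [Db, fderiv_bilin B hs ht, map_smul, map_add, smul_apply,
    add_apply]
  module

theorem Dz_smul {s : ℂ → ℂ} {t : ℂ → E} {z : ℂ}
    (hs : DifferentiableAt ℝ s z) (ht : DifferentiableAt ℝ t z) :
    Dz (fun w => s w • t w) z = Dz s z • t z + s z • Dz t z :=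
  Dz_bilin (ContinuousLinearMap.lsmul ℂ ℂ) hs ht

theorem Db_smul {s : ℂ → ℂ} {t : ℂ → E} {z : ℂ}
    (hs : DifferentiableAt ℝ s z) (ht : DifferentiableAt ℝ t z) :
    Db (fun w => s w • t w) z = Db s z • t z + s z • Db t z :=
  Db_bilin (ContinuousLinearMap.lsmul ℂ ℂ) hs ht

theorem Dz_const_smul (c : ℂ) {t : ℂ → E} {z : ℂ} (ht : DifferentiableAt ℝ t z) :
    Dz (fun w => c • t w) z = c • Dz t z := by
  rw [Dz_smul (differentiableAt_const c) ht]; simp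

theorem Db_const_smul (c : ℂ) {t : ℂ → E} {z : ℂ} (ht : DifferentiableAt ℝ t z) :
    Db (fun w => c • t w) z = c • Db t z := by
  rw [Db_smul (differentiableAt_const c) ht]; simp

theorem Dz_sub {s t : ℂ → E} {z : ℂ} (hs : DifferentiableAt ℝ s z) (ht : DifferentiableAt ℝ t z) :
    Dz (fun w => s w - t w) z = Dz s z - Dz t z := by
  simp only [Dz, fderiv_fun_sub hs ht, sub_apply]; module

theorem Db_sub {s t : ℂ → E} {z : ℂ} (hs : DifferentiableAt ℝ s z) (ht : DifferentiableAt ℝ t z) :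
    Db (fun w => s w - t w) z = Db s z - Db t z := by
  simp only [Db, fderiv_fun_sub hs ht, sub_apply]; module

theorem Dz_sum {ι : Type*} {I : Finset ι} {s : ι → ℂ → E} {z : ℂ}
    (hs : ∀ i ∈ I, DifferentiableAt ℝ (s i) z) :
    Dz (fun w => ∑ i ∈ I, s i w) z = ∑ i ∈ I, Dz (s i) z := by
  simp only [Dz, fderiv_fun_sum hs, sum_apply, Finset.smul_sum,
    ← Finset.sum_sub_distrib]

theorem Db_sum {ι : Type*} {I : Finset ι} {s : ι → ℂ → E} {z : ℂ}
    (hs : ∀ i ∈ I, DifferentiableAt ℝ (s i) z) :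
    Db (fun w => ∑ i ∈ I, s i w) z = ∑ i ∈ I, Db (s i) z := by
  simp only [Db, fderiv_fun_sum hs, sum_apply, Finset.smul_sum,
    ← Finset.sum_add_distrib]

theorem Db_eq_zero_iff {s : ℂ → E} {z : ℂ} (hs : DifferentiableAt ℝ s z) :
    Db s z = 0 ↔ DifferentiableAt ℂ s z := by
  rw [differentiableAt_complex_iff_differentiableAt_real, and_iff_right hs]
  constructor
  · intro h
    rw [fderiv_I_eq, fderiv_one_eq, h]; simp
  · intro h
    rw [Db, h, smul_smul, Complex.I_mul_I]; simp

theorem Db_of_differentiableAt {s : ℂ → E} {z : ℂ} (hs : DifferentiableAt ℂ s z) : Db s z = 0 :=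
  (Db_eq_zero_iff (hs.restrictScalars ℝ)).2 hs

theorem Dz_of_differentiableAt {s : ℂ → E} {z : ℂ} (hs : DifferentiableAt ℂ s z) :
    Dz s z = deriv s z := by
  have h := hs.hasDerivAt.hasFDerivAt.restrictScalars ℝ
  rw [Dz, h.fderiv]
  simp [smul_smul]
  module

theorem fderiv_comp_holo {s : ℂ → E} {φ : ℂ → ℂ} {w : ℂ} (hs : DifferentiableAt ℝ s (φ w))
    (hφ : DifferentiableAt ℂ φ w) (v : ℂ) :
    fderiv ℝ (fun w => s (φ w)) w v = fderiv ℝ s (φ w) (deriv φ w * v) := by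
  have h := hs.hasFDerivAt.comp w (hφ.hasDerivAt.hasFDerivAt.restrictScalars ℝ)
  have h2 : fderiv ℝ (fun w => s (φ w)) w = _ := h.fderiv
  rw [h2]
  simp [mul_comm]

theorem Dz_comp_holo {s : ℂ → E} {φ : ℂ → ℂ} {w : ℂ} (hs : DifferentiableAt ℝ s (φ w))
    (hφ : DifferentiableAt ℂ φ w) :
    Dz (fun w => s (φ w)) w = deriv φ w • Dz s (φ w) := by
  rw [Dz, fderiv_comp_holo hs hφ, fderiv_comp_holo hs hφ, fderiv_eq_Dz_Db, fderiv_eq_Dz_Db]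
  simp only [mul_one, map_mul, Complex.conj_I]
  have h : (Complex.I * Complex.I) = -1 := Complex.I_mul_I
  match_scalars
  · linear_combination -deriv φ w / 2 * h
  · linear_combination (starRingEnd ℂ) (deriv φ w) / 2 * h

theorem Db_comp_holo {s : ℂ → E} {φ : ℂ → ℂ} {w : ℂ} (hs : DifferentiableAt ℝ s (φ w))
    (hφ : DifferentiableAt ℂ φ w) :
    Db (fun w => s (φ w)) w = (starRingEnd ℂ) (deriv φ w) • Db s (φ w) := by
  rw [Db, fderiv_comp_holo hs hφ, fderiv_comp_holo hs hφ, fderiv_eq_Dz_Db, fderiv_eq_Dz_Db]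
  simp only [mul_one, map_mul, Complex.conj_I]
  have h : (Complex.I * Complex.I) = -1 := Complex.I_mul_I
  match_scalars
  · linear_combination deriv φ w / 2 * h
  · linear_combination -(starRingEnd ℂ) (deriv φ w) / 2 * h

theorem fderiv_conjC {s : ℂ → C7} {z : ℂ} (hs : DifferentiableAt ℝ s z) (v : ℂ) :
    fderiv ℝ (fun w => conjC (s w)) z v = conjC (fderiv ℝ s z v) := by
  have h := conjL.hasFDerivAt.comp z hs.hasFDerivAt
  have h2 : fderiv ℝ (fun w => conjC (s w)) z = _ := h.fderiv
  rw [h2]; rfl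

theorem Dz_conjC {s : ℂ → C7} {z : ℂ} (hs : DifferentiableAt ℝ s z) :
    Dz (fun w => conjC (s w)) z = conjC (Db s z) := by
  have h2 : (starRingEnd ℂ) 2 = 2 := Complex.conj_ofNat 2
  simp [Dz, Db, fderiv_conjC hs, h2]; module

theorem Db_conjC {s : ℂ → C7} {z : ℂ} (hs : DifferentiableAt ℝ s z) :
    Db (fun w => conjC (s w)) z = conjC (Dz s z) := by
  have h2 : (starRingEnd ℂ) 2 = 2 := Complex.conj_ofNat 2
  simp [Dz, Db, fderiv_conjC hs, sub_eq_add_neg, h2]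

theorem contDiffOn_Dz {s : ℂ → E} {U : Set ℂ} (hU : IsOpen U) (hs : ContDiffOn ℝ ∞ s U) :
    ContDiffOn ℝ ∞ (Dz s) U := by
  have h := hs.fderiv_of_isOpen hU (m := ∞) (by simp)
  exact contDiffOn_const.smul ((h.clm_apply contDiffOn_const).sub
    (contDiffOn_const.smul (h.clm_apply contDiffOn_const)))

theorem contDiffOn_Db {s : ℂ → E} {U : Set ℂ} (hU : IsOpen U) (hs : ContDiffOn ℝ ∞ s U) :
    ContDiffOn ℝ ∞ (Db s) U := by
  have h := hs.fderiv_of_isOpen hU (m := ∞) (by simp)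
  exact contDiffOn_const.smul ((h.clm_apply contDiffOn_const).add
    (contDiffOn_const.smul (h.clm_apply contDiffOn_const)))

theorem contDiff_Dz {s : ℂ → E} (hs : ContDiff ℝ ∞ s) : ContDiff ℝ ∞ (Dz s) := by
  rw [← contDiffOn_univ] at hs ⊢; exact contDiffOn_Dz isOpen_univ hs

theorem contDiff_Db {s : ℂ → E} (hs : ContDiff ℝ ∞ s) : ContDiff ℝ ∞ (Db s) := by
  rw [← contDiffOn_univ] at hs ⊢; exact contDiffOn_Db isOpen_univ hs

theorem Smooth.diff {s : ℂ → E} (hs : ContDiff ℝ ∞ s) (z : ℂ) : DifferentiableAt ℝ s z :=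
  (hs.differentiable (by simp)).differentiableAt

theorem SmoothOn.diff {s : ℂ → E} {U : Set ℂ} (hU : IsOpen U) (hs : ContDiffOn ℝ ∞ s U) {z : ℂ}
    (hz : z ∈ U) : DifferentiableAt ℝ s z :=
  ((hs.contDiffAt (hU.mem_nhds hz)).differentiableAt (by simp))

theorem fderiv_fderiv_apply {E : Type*} [NormedAddCommGroup E] [NormedSpace ℝ E] {s : ℂ → E} {z : ℂ}
    (hs : ContDiffAt ℝ ∞ s z) (v w : ℂ) :
    fderiv ℝ (fun ζ => fderiv ℝ s ζ v) z w = fderiv ℝ (fderiv ℝ s) z w v := by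
  have h : DifferentiableAt ℝ (fderiv ℝ s) z :=
    (hs.fderiv_right (m := 1) (WithTop.coe_le_coe.2 (le_top : (1 + 1 : ℕ∞) ≤ ⊤))).differentiableAt (by simp)
  rw [fderiv_clm_apply h (differentiableAt_const v)]
  simp

theorem Dz_Db_comm {s : ℂ → E} {z : ℂ} (hs : ContDiffAt ℝ ∞ s z) : Dz (Db s) z = Db (Dz s) z := by
  have h : DifferentiableAt ℝ (fderiv ℝ s) z :=
    (hs.fderiv_right (m := 1) (WithTop.coe_le_coe.2 (le_top : (1 + 1 : ℕ∞) ≤ ⊤))).differentiableAt (by simp)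
  have h1 : DifferentiableAt ℝ (fun ζ => fderiv ℝ s ζ 1) z := h.clm_apply (differentiableAt_const _)
  have hI : DifferentiableAt ℝ (fun ζ => fderiv ℝ s ζ Complex.I) z :=
    h.clm_apply (differentiableAt_const _)
  have hsymm := (hs.isSymmSndFDerivAt (n := ∞) (by simpa using ENat.LEInfty.out)) 1 Complex.I
  have e1 : ∀ w, fderiv ℝ (Db s) z w = (1 / 2 : ℂ) • (fderiv ℝ (fderiv ℝ s) z w 1 +
      Complex.I • fderiv ℝ (fderiv ℝ s) z w Complex.I) := by
    intro w
    have : Db s = fun ζ => (1 / 2 : ℂ) • (fderiv ℝ s ζ 1 + Complex.I • fderiv ℝ s ζ Complex.I) := rfl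
    have hI' : DifferentiableAt ℝ (fun ζ => Complex.I • fderiv ℝ s ζ Complex.I) z := hI.const_smul _
    rw [this, fderiv_fun_const_smul (h1.fun_add hI'), fderiv_fun_add h1 hI', fderiv_fun_const_smul hI]
    simp only [smul_apply, add_apply,
      fderiv_fderiv_apply hs]
  have e2 : ∀ w, fderiv ℝ (Dz s) z w = (1 / 2 : ℂ) • (fderiv ℝ (fderiv ℝ s) z w 1 -
      Complex.I • fderiv ℝ (fderiv ℝ s) z w Complex.I) := by
    intro w
    have : Dz s = fun ζ => (1 / 2 : ℂ) • (fderiv ℝ s ζ 1 - Complex.I • fderiv ℝ s ζ Complex.I) := rfl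
    have hI' : DifferentiableAt ℝ (fun ζ => Complex.I • fderiv ℝ s ζ Complex.I) z := hI.const_smul _
    rw [this, fderiv_fun_const_smul (h1.fun_sub hI'), fderiv_fun_sub h1 hI', fderiv_fun_const_smul hI]
    simp only [smul_apply, sub_apply,
      fderiv_fderiv_apply hs]
  rw [Dz, Db, e1, e1, e2, e2, hsymm]
  module

end Wirtinger

section Bilinear

variable {E F G : Type*} [NormedAddCommGroup E] [NormedSpace ℂ E] [NormedAddCommGroup F]
  [NormedSpace ℂ F] [NormedAddCommGroup G] [NormedSpace ℂ G]

theorem contDiffOn_bilin (B : E →L[ℂ] F →L[ℂ] G) {s : ℂ → E} {t : ℂ → F} {U : Set ℂ}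
    (hs : ContDiffOn ℝ ∞ s U) (ht : ContDiffOn ℝ ∞ t U) :
    ContDiffOn ℝ ∞ (fun w => B (s w) (t w)) U :=
  (B.bilinearRestrictScalars ℝ).isBoundedBilinearMap.contDiff.comp_contDiffOn (hs.prodMk ht)

theorem contDiff_bilin (B : E →L[ℂ] F →L[ℂ] G) {s : ℂ → E} {t : ℂ → F}
    (hs : ContDiff ℝ ∞ s) (ht : ContDiff ℝ ∞ t) : ContDiff ℝ ∞ (fun w => B (s w) (t w)) :=
  (B.bilinearRestrictScalars ℝ).isBoundedBilinearMap.contDiff.comp (hs.prodMk ht)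

theorem contDiff_crossC {s t : ℂ → C7} (hs : ContDiff ℝ ∞ s) (ht : ContDiff ℝ ∞ t) :
    ContDiff ℝ ∞ (fun w => crossC (s w) (t w)) := contDiff_bilin crossL hs ht

theorem contDiff_dotC {s t : ℂ → C7} (hs : ContDiff ℝ ∞ s) (ht : ContDiff ℝ ∞ t) :
    ContDiff ℝ ∞ (fun w => dotC (s w) (t w)) := contDiff_bilin dotL hs ht

theorem contDiffOn_dotC {s t : ℂ → C7} {U : Set ℂ} (hs : ContDiffOn ℝ ∞ s U)
    (ht : ContDiffOn ℝ ∞ t U) : ContDiffOn ℝ ∞ (fun w => dotC (s w) (t w)) U :=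
  contDiffOn_bilin dotL hs ht

theorem contDiff_conjC {s : ℂ → C7} (hs : ContDiff ℝ ∞ s) :
    ContDiff ℝ ∞ (fun w => conjC (s w)) := conjL.contDiff.comp hs

theorem contDiffOn_conjC {s : ℂ → C7} {U : Set ℂ} (hs : ContDiffOn ℝ ∞ s U) :
    ContDiffOn ℝ ∞ (fun w => conjC (s w)) U := conjL.contDiff.comp_contDiffOn hs

variable {s t : ℂ → C7} {z : ℂ}

theorem Dz_crossC (hs : DifferentiableAt ℝ s z) (ht : DifferentiableAt ℝ t z) :
    Dz (fun w => crossC (s w) (t w)) z = crossC (Dz s z) (t z) + crossC (s z) (Dz t z) :=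
  Dz_bilin crossL hs ht

theorem Db_crossC (hs : DifferentiableAt ℝ s z) (ht : DifferentiableAt ℝ t z) :
    Db (fun w => crossC (s w) (t w)) z = crossC (Db s z) (t z) + crossC (s z) (Db t z) :=
  Db_bilin crossL hs ht

theorem Dz_dotC (hs : DifferentiableAt ℝ s z) (ht : DifferentiableAt ℝ t z) :
    Dz (fun w => dotC (s w) (t w)) z = dotC (Dz s z) (t z) + dotC (s z) (Dz t z) :=
  Dz_bilin dotL hs ht

theorem Db_dotC (hs : DifferentiableAt ℝ s z) (ht : DifferentiableAt ℝ t z) :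
    Db (fun w => dotC (s w) (t w)) z = dotC (Db s z) (t z) + dotC (s z) (Db t z) :=
  Db_bilin dotL hs ht

theorem Db_inv {q : ℂ → ℂ} (hq : DifferentiableAt ℝ q z) (h0 : q z ≠ 0) :
    Db (fun w => (q w)⁻¹) z = -Db q z / q z ^ 2 := by
  have hi : DifferentiableAt ℝ (fun w => (q w)⁻¹) z := hq.inv h0
  have h1 := Db_smul hq hi
  have h2 : (fun w => q w • (q w)⁻¹) =ᶠ[𝓝 z] fun _ => 1 := by
    filter_upwards [hq.continuousAt.eventually_ne h0] with w hw
    simp [hw]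
  rw [Db_congr h2, Db_const, smul_eq_mul, smul_eq_mul] at h1
  field_simp at h1 ⊢
  linear_combination -h1

end Bilinear

/-! ### Almost complex curves in a complex coordinate -/

/-- A smooth map `F : ℂ → S⁶ ⊆ ℂ⁷` with `F × ∂_z F = i ∂_z F`. -/
structure IsACLift (F : ℂ → C7) : Prop where
  smooth : ContDiff ℝ ∞ F
  real : ∀ z, conjC (F z) = F z
  unit : ∀ z, dotC (F z) (F z) = 1
  eigen : ∀ z, crossC (F z) (Dz F z) = Complex.I • Dz F z

/-- `∂_z F × ∂_z² F`. -/
def binormal (F : ℂ → C7) (z : ℂ) : C7 := crossC (Dz F z) (Dz (Dz F) z)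

/-- `|∂_z F|²`. -/
def energy (F : ℂ → C7) (z : ℂ) : ℂ := dotC (Dz F z) (conjC (Dz F z))

namespace IsACLift

variable {F : ℂ → C7}

theorem smooth_Dz (h : IsACLift F) : ContDiff ℝ ∞ (Dz F) := contDiff_Dz h.smooth
theorem smooth_Dz2 (h : IsACLift F) : ContDiff ℝ ∞ (Dz (Dz F)) := contDiff_Dz h.smooth_Dz
theorem smooth_Dz3 (h : IsACLift F) : ContDiff ℝ ∞ (Dz (Dz (Dz F))) := contDiff_Dz h.smooth_Dz2
theorem smooth_binormal (h : IsACLift F) : ContDiff ℝ ∞ (binormal F) :=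
  contDiff_crossC h.smooth_Dz h.smooth_Dz2
theorem smooth_energy (h : IsACLift F) : ContDiff ℝ ∞ (energy F) :=
  contDiff_dotC h.smooth_Dz (contDiff_conjC h.smooth_Dz)

theorem Db_eq (h : IsACLift F) (z : ℂ) : Db F z = conjC (Dz F z) := by
  rw [← Db_conjC (Smooth.diff h.smooth z)]
  simp only [h.real]

theorem energy_eq (F : ℂ → C7) (z : ℂ) : energy F z = ((‖Dz F z‖ ^ 2 : ℝ) : ℂ) :=
  dotC_self_conjC _

/-- The harmonic map equation. Applying ∂_z̄ to F × F_z = i F_z gives an equation for W = ∂_z̄F_z.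
Since F is real, W is real too, and subtracting the conjugate equation expresses W through F_z ×
conj F_z, a multiple of F. -/
theorem Db_Dz (h : IsACLift F) (z : ℂ) : Db (Dz F) z = -energy F z • F z := by
  have hX := Smooth.diff h.smooth_Dz z
  have hF := Smooth.diff h.smooth z
  have h1 : Db (fun w => crossC (F w) (Dz F w)) z = Db (fun w => Complex.I • Dz F w) z := by
    simp only [h.eigen]
  rw [Db_crossC hF hX, Db_const_smul _ hX, h.Db_eq] at h1
  have hW : conjC (Db (Dz F) z) = Db (Dz F) z := by
    rw [← Dz_conjC hX, ← Dz_Db_comm h.smooth.contDiffAt]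
    congr 1; ext w : 1; exact (h.Db_eq w).symm
  have h2 := congrArg conjC h1
  rw [conjC_add, conjC_crossC, conjC_crossC, conjC_conjC, hW, h.real, conjC_smul, hW,
    Complex.conj_I] at h2
  have hxx : crossC (Dz F z) (conjC (Dz F z)) = (Complex.I * energy F z) • F z :=
    crossC_eigen_eigen_neg (h.eigen z) (eigen_conj (h.real z) (h.eigen z))
  rw [crossC_anticomm, hxx] at h1
  rw [hxx] at h2
  have h3 : (2 * Complex.I) • Db (Dz F) z = (-(2 * Complex.I * energy F z)) • F z := by
    linear_combination (norm := module) h2 - h1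
  have h4 := congrArg (fun w => (-Complex.I / 2) • w) h3
  simp only [smul_smul] at h4
  rw [show -Complex.I / 2 * (2 * Complex.I) = 1 by linear_combination -Complex.I_sq, one_smul] at h4
  rw [h4]; congr 1
  linear_combination energy F z * Complex.I_sq

theorem eigen2 (h : IsACLift F) (z : ℂ) :
    crossC (F z) (Dz (Dz F) z) = Complex.I • Dz (Dz F) z := by
  have hX := Smooth.diff h.smooth_Dz z
  have h1 : Dz (fun w => crossC (F w) (Dz F w)) z = Dz (fun w => Complex.I • Dz F w) z := by
    simp only [h.eigen]
  rwa [Dz_crossC (Smooth.diff h.smooth z) hX, Dz_const_smul _ hX, crossC_self, zero_add] at h1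

/-- Third order is the first at which F_z × (·) contributes: F_zzz leaves the i-eigenspace, and its
defect is exactly the binormal. -/
theorem eigen3 (h : IsACLift F) (z : ℂ) :
    crossC (F z) (Dz (Dz (Dz F)) z) + binormal F z = Complex.I • Dz (Dz (Dz F)) z := by
  have hX := Smooth.diff h.smooth_Dz2 z
  have h1 : Dz (fun w => crossC (F w) (Dz (Dz F) w)) z =
      Dz (fun w => Complex.I • Dz (Dz F) w) z := by
    simp only [h.eigen2]
  rw [Dz_crossC (Smooth.diff h.smooth z) hX, Dz_const_smul _ hX] at h1
  rw [← h1, add_comm]; rfl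

theorem eigen_binormal (h : IsACLift F) (z : ℂ) :
    crossC (F z) (binormal F z) = -Complex.I • binormal F z :=
  crossC_eigen_eigen (h.eigen z) (h.eigen2 z)

theorem dot_F_Dz (h : IsACLift F) (z : ℂ) : dotC (F z) (Dz F z) = 0 := dotC_eigen (h.eigen z)

theorem dot_F_conj (h : IsACLift F) (z : ℂ) : dotC (F z) (conjC (Dz F z)) = 0 :=
  dotC_eigen_neg (eigen_conj (h.real z) (h.eigen z))

theorem Db_conj_Dz (h : IsACLift F) (z : ℂ) :
    Db (fun w => conjC (Dz F w)) z = conjC (Dz (Dz F) z) := Db_conjC (Smooth.diff h.smooth_Dz z)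

theorem Dz_conj_Dz (h : IsACLift F) (z : ℂ) :
    Dz (fun w => conjC (Dz F w)) z = -energy F z • F z := by
  rw [Dz_conjC (Smooth.diff h.smooth_Dz z), h.Db_Dz, conjC_smul, h.real, energy_eq, map_neg,
    Complex.conj_ofReal]

theorem Dz_energy (h : IsACLift F) (z : ℂ) :
    Dz (energy F) z = dotC (Dz (Dz F) z) (conjC (Dz F z)) := by
  have := Dz_dotC (Smooth.diff h.smooth_Dz z) (Smooth.diff (contDiff_conjC h.smooth_Dz) z)
  rw [h.Dz_conj_Dz, dotC_smul_right, dotC_comm (Dz F z) (F z), h.dot_F_Dz, mul_zero,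
    add_zero] at this
  exact this

theorem Db_energy (h : IsACLift F) (z : ℂ) :
    Db (energy F) z = dotC (Dz F z) (conjC (Dz (Dz F) z)) := by
  have := Db_dotC (Smooth.diff h.smooth_Dz z) (Smooth.diff (contDiff_conjC h.smooth_Dz) z)
  rw [h.Db_conj_Dz, h.Db_Dz, dotC_smul_left, h.dot_F_conj, mul_zero, zero_add] at this
  exact this

theorem Db_Dz2 (h : IsACLift F) (z : ℂ) :
    Db (Dz (Dz F)) z = -(Dz (energy F) z • F z) - energy F z • Dz F z := by
  rw [← Dz_Db_comm h.smooth_Dz.contDiffAt]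
  have e : Db (Dz F) = fun w => (-1 : ℂ) • (energy F w • F w) := by
    ext1 w; rw [h.Db_Dz]; module
  have h1 := Smooth.diff h.smooth_energy z
  have h2 := Smooth.diff h.smooth z
  rw [e, Dz_const_smul _ (h1.fun_smul h2), Dz_smul h1 h2]
  module

theorem Db_binormal (h : IsACLift F) (z : ℂ) :
    Db (binormal F) z = -(Complex.I * energy F z) • Dz (Dz F) z +
      (Complex.I * Dz (energy F) z) • Dz F z := by
  have := Db_crossC (Smooth.diff h.smooth_Dz z) (Smooth.diff h.smooth_Dz2 z)
  rw [h.Db_Dz, h.Db_Dz2, crossC_smul_left, h.eigen2, crossC_sub_right, crossC_neg_right,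
    crossC_smul_right, crossC_smul_right, crossC_self, crossC_eigen_self (h.eigen z)] at this
  refine Eq.trans this ?_
  module

theorem Dz_binormal (h : IsACLift F) (z : ℂ) :
    Dz (binormal F) z = crossC (Dz F z) (Dz (Dz (Dz F)) z) := by
  have := Dz_crossC (Smooth.diff h.smooth_Dz z) (Smooth.diff h.smooth_Dz2 z)
  rw [crossC_self, zero_add] at this
  exact this

/-- Only the shape matters. It keeps the second derivative of the directrix polynomial in the span
of conj H, conj F_z and conj F_zz. -/
theorem Db_Db_binormal (h : IsACLift F) (z : ℂ) :
    ∃ a b : ℂ, Db (Db (binormal F)) z = a • Dz F z + b • Dz (Dz F) z := by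
  have h1 := Smooth.diff h.smooth_energy z
  have h2 := Smooth.diff h.smooth_Dz z
  have h3 := Smooth.diff h.smooth_Dz2 z
  have h4 := Smooth.diff (contDiff_Dz h.smooth_energy) z
  have e' : Db (binormal F) = fun w => (-Complex.I) • (energy F w • Dz (Dz F) w -
      Dz (energy F) w • Dz F w) := by
    ext1 w; rw [h.Db_binormal]; module
  rw [e', Db_const_smul _ ((h1.fun_smul h3).fun_sub (h4.fun_smul h2)), Db_sub (h1.fun_smul h3) (h4.fun_smul h2),
    Db_smul h1 h3, Db_smul h4 h2, h.Db_Dz, h.Db_Dz2]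
  exact ⟨Complex.I * (energy F z ^ 2 + Db (Dz (energy F)) z), -Complex.I * Db (energy F) z,
    by module⟩

theorem dot_Dz_Dz2 (h : IsACLift F) (z : ℂ) : dotC (Dz F z) (Dz (Dz F) z) = 0 :=
  dotC_eigen_eigen (h.eigen z) (h.eigen2 z)

theorem dot_F_Dz3 (h : IsACLift F) (z : ℂ) : dotC (F z) (Dz (Dz (Dz F)) z) = 0 := by
  have := congrArg (dotC (F z)) (h.eigen3 z)
  rw [dotC_add_right, dotC_comm, dotC_crossC_self_left, dotC_eigen_neg (h.eigen_binormal z),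
    dotC_smul_right] at this
  simpa using this.symm

theorem dot_Dz_Dz3 (h : IsACLift F) (z : ℂ) : dotC (Dz F z) (Dz (Dz (Dz F)) z) = 0 := by
  have := Dz_dotC (Smooth.diff h.smooth_Dz z) (Smooth.diff h.smooth_Dz2 z)
  simp only [h.dot_Dz_Dz2, Dz_const] at this
  rw [dotC_eigen_eigen (h.eigen2 z) (h.eigen2 z), zero_add] at this
  exact this.symm

theorem dot_Dz2_Dz3 (h : IsACLift F) (z : ℂ) : dotC (Dz (Dz F) z) (Dz (Dz (Dz F)) z) = 0 := by
  have := Dz_dotC (Smooth.diff h.smooth_Dz2 z) (Smooth.diff h.smooth_Dz2 z)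
  simp only [dotC_eigen_eigen (h.eigen2 _) (h.eigen2 _), Dz_const] at this
  rw [dotC_comm (Dz (Dz (Dz F)) z)] at this
  have h2 : 2 * dotC (Dz (Dz F) z) (Dz (Dz (Dz F)) z) = 0 := by linear_combination -this
  simpa using h2

/-- The sextic differential of an almost complex curve is holomorphic. -/
theorem differentiable_sextic (h : IsACLift F) :
    Differentiable ℂ (fun z => dotC (Dz (Dz (Dz F)) z) (Dz (Dz (Dz F)) z)) := by
  intro z
  have hT := Smooth.diff h.smooth_Dz3 z
  rw [← Db_eq_zero_iff (Smooth.diff (contDiff_dotC h.smooth_Dz3 h.smooth_Dz3) z),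
    Db_dotC hT hT, dotC_comm (Db _ z), ← Dz_Db_comm h.smooth_Dz2.contDiffAt]
  -- After commuting derivatives, ∂_z̄ F_zzz is a combination of F, F_z and F_zz, and F_zzz is
  -- orthogonal to all three.
  have e : Db (Dz (Dz F)) = fun w => (-1 : ℂ) • (Dz (energy F) w • F w + energy F w • Dz F w) := by
    ext1 w; rw [h.Db_Dz2]; module
  have h1 := Smooth.diff h.smooth_energy z
  have h2 := Smooth.diff h.smooth_Dz z
  have h3 := Smooth.diff h.smooth z
  have h4 := Smooth.diff (contDiff_Dz h.smooth_energy) z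
  rw [e, Dz_const_smul _ ((h4.fun_smul h3).fun_add (h1.fun_smul h2)), Dz_add (h4.fun_smul h3) (h1.fun_smul h2),
    Dz_smul h4 h3, Dz_smul h1 h2]
  simp only [dotC_comm (Dz (Dz (Dz F)) z)]
  simp [h.dot_F_Dz3, h.dot_Dz_Dz3, h.dot_Dz2_Dz3]

theorem norm_binormal (h : IsACLift F) (z : ℂ) :
    dotC (conjC (binormal F z)) (binormal F z) = 2 * (energy F z *
      dotC (Dz (Dz F) z) (conjC (Dz (Dz F) z)) - Dz (energy F) z * Db (energy F) z) := by
  rw [h.Dz_energy, h.Db_energy]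
  have := norm_crossC_eigen (h.real z) (h.eigen z) (h.eigen2 z)
  rw [binormal, this, energy, dotC_comm (conjC (Dz F z)), dotC_comm (conjC (Dz F z)),
    dotC_comm (conjC (Dz (Dz F) z)), dotC_comm (conjC (Dz (Dz F) z))]

/-- With |F_z|² locally bounded, this is a differential inequality |∂_z̄ H|² ≤ C |H|², the input for
unique continuation. -/
theorem norm_Db_binormal (h : IsACLift F) (z : ℂ) :
    2 * ‖Db (binormal F) z‖ ^ 2 = ‖Dz F z‖ ^ 2 * ‖binormal F z‖ ^ 2 := by
  have e : (starRingEnd ℂ) (Dz (energy F) z) = Db (energy F) z := by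
    rw [h.Dz_energy, h.Db_energy, conj_dotC, conjC_conjC, dotC_comm]
  have e2 : (starRingEnd ℂ) (Db (energy F) z) = Dz (energy F) z := by rw [← e, Complex.conj_conj]
  have e3 : (starRingEnd ℂ) (energy F z) = energy F z := by
    rw [energy_eq, Complex.conj_ofReal]
  have key : 2 * dotC (Db (binormal F) z) (conjC (Db (binormal F) z)) =
      energy F z * dotC (conjC (binormal F z)) (binormal F z) := by
    rw [h.norm_binormal, h.Db_binormal]
    simp only [conjC_add, conjC_smul, map_mul, map_neg, Complex.conj_I, e, e3, dotC_add_left,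
      dotC_add_right, dotC_smul_left, dotC_smul_right, ← h.Dz_energy, ← h.Db_energy]
    rw [show dotC (Dz F z) (conjC (Dz F z)) = energy F z from rfl]
    linear_combination (-2 * energy F z * (energy F z * dotC (Dz (Dz F) z) (conjC (Dz (Dz F) z)) -
      Dz (energy F) z * Db (energy F) z)) * Complex.I_sq
  rw [dotC_self_conjC, dotC_conjC_self, energy_eq] at key
  exact_mod_cast key

/-- The vector ∂_z̄ H lies in the i-eigenspace of F × and H in the -i-eigenspace, and for real F
these are Hermitian orthogonal. -/
theorem inner_Db_binormal (h : IsACLift F) (z : ℂ) :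
    inner ℂ (binormal F z) (Db (binormal F) z) = 0 := by
  have hb := eigen_neg_conj (h.real z) (h.eigen_binormal z)
  rw [inner_eq_dotC, h.Db_binormal, dotC_add_right, dotC_smul_right, dotC_smul_right,
    dotC_eigen_eigen hb (h.eigen z), dotC_eigen_eigen hb (h.eigen2 z)]
  simp

theorem norm_Db_Dz (h : IsACLift F) (z : ℂ) : ‖Db (Dz F) z‖ = ‖Dz F z‖ ^ 2 := by
  have hF : ‖F z‖ = 1 := by
    have h1 := dotC_conjC_self (F z)
    rw [h.real, h.unit] at h1
    have h2 : ‖F z‖ ^ 2 = 1 := by exact_mod_cast h1.symm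
    exact (pow_eq_one_iff_of_nonneg (norm_nonneg _) (by norm_num)).1 h2
  rw [h.Db_Dz, norm_smul, hF, norm_neg, energy_eq]
  simp

theorem inner_Db_Dz (h : IsACLift F) (z : ℂ) : inner ℂ (Dz F z) (Db (Dz F) z) = 0 := by
  rw [inner_eq_dotC, h.Db_Dz, dotC_smul_right, dotC_comm, h.dot_F_conj, mul_zero]

/-- If the sextic differential vanishes, then `∂_z` preserves the line spanned by the binormal. -/
theorem Dz_binormal_parallel (h : IsACLift F) (z : ℂ)
    (hU : dotC (Dz (Dz (Dz F)) z) (Dz (Dz (Dz F)) z) = 0) :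
    dotC (conjC (binormal F z)) (binormal F z) • Dz (binormal F) z =
      dotC (conjC (binormal F z)) (Dz (binormal F) z) • binormal F z := by
  -- By `eigen3` the -i-component of F_zzz is -(i/2) H; removing it leaves a vector a of the
  -- i-eigenspace.
  set a := Dz (Dz (Dz F)) z + (Complex.I / 2) • binormal F z with ha
  have hT : Dz (Dz (Dz F)) z = a - (Complex.I / 2) • binormal F z := by rw [ha]; module
  have hH := h.eigen_binormal z
  have hFa : crossC (F z) a = Complex.I • a := by
    have h3 := h.eigen3 z
    rw [ha, crossC_add_right, crossC_smul_right, hH, eq_sub_of_add_eq h3, smul_smul, smul_add,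
      smul_smul, show Complex.I / 2 * -Complex.I = 1 / 2 by linear_combination -Complex.I_sq / 2,
      show Complex.I * (Complex.I / 2) = -1 / 2 by linear_combination Complex.I_sq / 2]
    module
  -- Each eigenspace is isotropic, so F_zzz · F_zzz equals the cross term -i (a · H).
  have haH : dotC a (binormal F z) = 0 := by
    rw [hT] at hU
    simp only [dotC_sub_left, dotC_sub_right, dotC_smul_left, dotC_smul_right,
      dotC_eigen_eigen hFa hFa, dotC_eigen_neg_neg hH hH, dotC_comm (binormal F z) a] at hU
    have : Complex.I * dotC a (binormal F z) = 0 := by linear_combination -hU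
    simpa using this
  have hu : Dz (binormal F) z = crossC (Dz F z) a := by
    rw [h.Dz_binormal, hT, crossC_sub_right, crossC_smul_right, binormal,
      crossC_crossC_eigen (h.eigen z) (h.eigen2 z), smul_zero, sub_zero]
  have huE : crossC (F z) (Dz (binormal F) z) = -Complex.I • Dz (binormal F) z := by
    rw [hu]; exact crossC_eigen_eigen (h.eigen z) hFa
  refine parallel_of_crossC_eq_zero (h.real z) hH huE ?_
  rw [crossC_anticomm, hu]
  -- Here ∂_z H = F_z × a, and (F_z × a) × (F_z × F_zz) = -2 (a · H) F_z = 0.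
  have := crossC_crossC_eigen_triple (h.eigen z) (h.eigen2 z) hFa
  rw [dotC_crossC_left, show crossC (Dz F z) (Dz (Dz F) z) = binormal F z from rfl, haH] at this
  rw [this]; simp

end IsACLift

/-! ### The two coordinates of the Riemann sphere -/

theorem chart_not (c : Bool) {w : ℂ} (hw : w ≠ 0) : chart (!c) w = chart c w⁻¹ := by
  cases c <;> simp [chart, hw]

/-- The inclusion `ℝ⁷ ⊆ ℂ⁷` as a continuous real linear map. -/
def toCL : R7 →L[ℝ] C7 :=
  LinearMap.toContinuousLinearMap
    { toFun := toC
      map_add' := fun x y => by ext i; simp [toC]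
      map_smul' := fun c x => by ext i; simp [toC] }

@[simp] theorem toCL_apply (x : R7) : toCL x = toC x := rfl

theorem toC_crossR (x y : R7) : toC (crossR x y) = crossC (toC x) (toC y) := by
  ext i; fin_cases i <;> simp [toC, crossC, crossR, cross]

/-- The map `f` in the complex coordinate `c`, as a map to `ℂ⁷`. -/
def coordLift (f : OnePoint ℂ → S6) (c : Bool) (z : ℂ) : C7 := toC (f (chart c z))

theorem coordLift_not (f : OnePoint ℂ → S6) (c : Bool) {w : ℂ} (hw : w ≠ 0) :
    coordLift f (!c) w = coordLift f c w⁻¹ := by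
  rw [coordLift, chart_not c hw]; rfl

/-- The unit vector F is orthogonal to its derivatives, so F × squares to -1 on them. The equation
F_y = F × F_x then says that F_x - i F_y is an i-eigenvector. -/
theorem isACLift_coordLift {f : OnePoint ℂ → S6} (hf : IsAlmostComplexCurve f) (c : Bool) :
    IsACLift (coordLift f c) := by
  obtain ⟨hs, he⟩ := hf c
  have hd : ∀ z v, fderiv ℝ (coordLift f c) z v =
      toC (fderiv ℝ (fun z : ℂ => (f (chart c z) : R7)) z v) := by
    intro z v
    have h := toCL.hasFDerivAt.comp z ((hs.differentiable (by simp)) z).hasFDerivAt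
    have h2 : fderiv ℝ (coordLift f c) z = _ := h.fderiv
    rw [h2]; rfl
  have hsm : ContDiff ℝ ∞ (coordLift f c) := toCL.contDiff.comp hs
  have hu : ∀ z, dotC (coordLift f c z) (coordLift f c z) = 1 := by
    intro z
    have h1 : ‖(f (chart c z) : R7)‖ = 1 := by simp
    have h2 := EuclideanSpace.norm_sq_eq (f (chart c z) : R7)
    rw [h1] at h2
    simp only [dotC, coordLift, toC]
    have : (1 : ℝ) = ∑ i, ((f (chart c z) : R7) i) * ((f (chart c z) : R7) i) := by
      simpa [sq] using h2
    exact_mod_cast this.symm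
  refine ⟨hsm, fun z => ?_, hu, fun z => ?_⟩
  · ext i; simp [coordLift, toC]
  · have h1 : fderiv ℝ (coordLift f c) z Complex.I =
        crossC (coordLift f c z) (fderiv ℝ (coordLift f c) z 1) := by
      rw [hd, hd, he, toC_crossR]; rfl
    have h0 := fderiv_bilin dotL (Smooth.diff hsm z) (Smooth.diff hsm z) 1
    simp only [dotL_apply, hu] at h0
    rw [dotC_comm (fderiv ℝ (coordLift f c) z 1)] at h0
    have h0' : dotC (coordLift f c z) (fderiv ℝ (coordLift f c) z 1) = 0 := by
      have : 2 * dotC (coordLift f c z) (fderiv ℝ (coordLift f c) z 1) = 0 := by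
        rw [two_mul, ← h0]; simp
      simpa using this
    have h2 : crossC (coordLift f c z) (fderiv ℝ (coordLift f c) z Complex.I) =
        -fderiv ℝ (coordLift f c) z 1 := by
      rw [h1, crossC_crossC_self, h0', hu]; simp
    rw [Dz, crossC_smul_right, crossC_sub_right, crossC_smul_right, h2, ← h1, smul_comm]
    congr 1
    rw [smul_sub, smul_smul, Complex.I_mul_I]; module

/-- A pair of maps `ℂ → S⁶` which are the two coordinate expressions of a map on the sphere. -/
structure IsACPair (F G : ℂ → C7) : Prop where
  left : IsACLift F
  right : IsACLift G
  inv : ∀ w, w ≠ 0 → G w = F w⁻¹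

theorem IsACPair.symm {F G : ℂ → C7} (h : IsACPair F G) : IsACPair G F :=
  ⟨h.right, h.left, fun w hw => by rw [h.inv _ (inv_ne_zero hw), inv_inv]⟩

theorem isACPair_coordLift {f : OnePoint ℂ → S6} (hf : IsAlmostComplexCurve f) (c : Bool) :
    IsACPair (coordLift f c) (coordLift f !c) :=
  ⟨isACLift_coordLift hf c, isACLift_coordLift hf !c, fun _ hw => coordLift_not f c hw⟩

theorem differentiableAt_inv_pow (n : ℕ) {w : ℂ} (hw : w ≠ 0) :
    DifferentiableAt ℂ (fun w : ℂ => (w ^ n)⁻¹) w :=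
  (differentiableAt_id.pow n).inv (pow_ne_zero n hw)

theorem Dz_inv_pow_smul {s : ℂ → C7} (n : ℕ) {w : ℂ} (hs : DifferentiableAt ℝ s w⁻¹)
    (hw : w ≠ 0) : Dz (fun w => (w ^ n)⁻¹ • s w⁻¹) w =
      (-(w ^ (n + 2))⁻¹) • Dz s w⁻¹ + (-n * (w ^ (n + 1))⁻¹ : ℂ) • s w⁻¹ := by
  have h1 := differentiableAt_inv_pow n hw
  have h2 : DifferentiableAt ℂ (fun w : ℂ => w⁻¹) w := differentiableAt_inv hw
  have h3 : DifferentiableAt ℝ (fun w => s w⁻¹) w := hs.comp w (h2.restrictScalars ℝ)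
  rw [Dz_smul (h1.restrictScalars ℝ) h3, Dz_comp_holo hs h2, Dz_of_differentiableAt h1]
  have h4 : deriv (fun w : ℂ => (w ^ n)⁻¹) w = -n * (w ^ (n + 1))⁻¹ := by
    have := ((hasDerivAt_pow n w).inv (pow_ne_zero n hw)).deriv
    refine this.trans ?_
    rcases n with _ | n
    · simp
    · simp; field_simp; ring
  rw [h4, deriv_inv]
  rw [smul_smul, add_comm]
  congr 2
  field_simp
  ring

namespace IsACPair

variable {F G : ℂ → C7}

theorem Dz_eq (h : IsACPair F G) {w : ℂ} (hw : w ≠ 0) : Dz G w = -((w ^ 2)⁻¹ • Dz F w⁻¹) := by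
  have e : G =ᶠ[𝓝 w] fun w => (w ^ 0)⁻¹ • F w⁻¹ := by
    filter_upwards [isOpen_ne.mem_nhds hw] with v hv
    simp [h.inv v hv]
  rw [Dz_congr e, Dz_inv_pow_smul 0 (Smooth.diff h.left.smooth _) hw]
  simp

theorem Dz2_eq (h : IsACPair F G) {w : ℂ} (hw : w ≠ 0) :
    Dz (Dz G) w = (w ^ 4)⁻¹ • Dz (Dz F) w⁻¹ + (2 * (w ^ 3)⁻¹) • Dz F w⁻¹ := by
  have e : Dz G =ᶠ[𝓝 w] fun w => (-1 : ℂ) • ((w ^ 2)⁻¹ • Dz F w⁻¹) := by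
    filter_upwards [isOpen_ne.mem_nhds hw] with v hv
    rw [h.Dz_eq hv]; module
  have hX := Smooth.diff h.left.smooth_Dz w⁻¹
  have hi : DifferentiableAt ℝ (fun w : ℂ => w⁻¹) w :=
    (differentiableAt_inv hw : DifferentiableAt ℂ _ w).restrictScalars ℝ
  have hX' : DifferentiableAt ℝ (fun w => Dz F w⁻¹) w := hX.comp w hi
  rw [Dz_congr e, Dz_const_smul _ (((differentiableAt_inv_pow 2 hw).restrictScalars ℝ).fun_smul hX'),
    Dz_inv_pow_smul 2 hX hw]
  push_cast
  module

/-- The lower coefficients are left unnamed, since F_z and F_zz are null and orthogonal to F_zzz and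
so do not affect the sextic differential. -/
theorem Dz3_eq (h : IsACPair F G) {w : ℂ} (hw : w ≠ 0) : ∃ a b : ℂ,
    Dz (Dz (Dz G)) w = (-(w ^ 6)⁻¹) • Dz (Dz (Dz F)) w⁻¹ + a • Dz (Dz F) w⁻¹ + b • Dz F w⁻¹ := by
  have e : Dz (Dz G) =ᶠ[𝓝 w] fun w => (w ^ 4)⁻¹ • Dz (Dz F) w⁻¹ +
      (2 : ℂ) • ((w ^ 3)⁻¹ • Dz F w⁻¹) := by
    filter_upwards [isOpen_ne.mem_nhds hw] with v hv
    rw [h.Dz2_eq hv]; module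
  have hX := Smooth.diff h.left.smooth_Dz w⁻¹
  have hY := Smooth.diff h.left.smooth_Dz2 w⁻¹
  have hi : DifferentiableAt ℝ (fun w : ℂ => w⁻¹) w :=
    (differentiableAt_inv hw : DifferentiableAt ℂ _ w).restrictScalars ℝ
  have hX' : DifferentiableAt ℝ (fun w => Dz F w⁻¹) w := hX.comp w hi
  have hY' : DifferentiableAt ℝ (fun w => Dz (Dz F) w⁻¹) w := hY.comp w hi
  have h3 := ((differentiableAt_inv_pow 3 hw).restrictScalars ℝ).fun_smul hX'
  have h3' : DifferentiableAt ℝ (fun w => (2 : ℂ) • ((w ^ 3)⁻¹ • Dz F w⁻¹)) w := h3.const_smul (2 : ℂ)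
  have h4 := ((differentiableAt_inv_pow 4 hw).restrictScalars ℝ).fun_smul hY'
  rw [Dz_congr e, Dz_add h4 h3', Dz_const_smul _ h3,
    Dz_inv_pow_smul 4 hY hw, Dz_inv_pow_smul 3 hX hw]
  refine ⟨-4 * (w ^ 5)⁻¹ - 2 * (w ^ 5)⁻¹, 2 * (-3 * (w ^ 4)⁻¹), ?_⟩
  push_cast
  module

theorem binormal_eq (h : IsACPair F G) {w : ℂ} (hw : w ≠ 0) :
    binormal G w = (-(w ^ 6)⁻¹) • binormal F w⁻¹ := by
  rw [binormal, h.Dz_eq hw, h.Dz2_eq hw, binormal]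
  simp only [crossC_neg_left, crossC_smul_left, crossC_add_right, crossC_smul_right, crossC_self]
  match_scalars
  field_simp

/-- A holomorphic sextic differential on the sphere vanishes. Under z ↦ 1/z its coefficient is
multiplied by z⁻¹², so the entire function tends to zero at infinity and Liouville's theorem
applies. -/
theorem sextic_eq_zero (h : IsACPair F G) (z : ℂ) :
    dotC (Dz (Dz (Dz F)) z) (Dz (Dz (Dz F)) z) = 0 := by
  set S := fun z => dotC (Dz (Dz (Dz F)) z) (Dz (Dz (Dz F)) z) with hS
  set R := fun z => dotC (Dz (Dz (Dz G)) z) (Dz (Dz (Dz G)) z) with hR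
  have e : ∀ z, z ≠ 0 → S z = (z⁻¹) ^ 12 * R z⁻¹ := by
    intro z hz
    obtain ⟨a, b, hab⟩ := h.symm.Dz3_eq hz
    have hY : dotC (Dz (Dz G) z⁻¹) (Dz (Dz G) z⁻¹) = 0 :=
      dotC_eigen_eigen (h.right.eigen2 _) (h.right.eigen2 _)
    have hX : dotC (Dz G z⁻¹) (Dz G z⁻¹) = 0 :=
      dotC_eigen_eigen (h.right.eigen _) (h.right.eigen _)
    simp only [hS, hR, hab, dotC_add_left, dotC_add_right, dotC_smul_left, dotC_smul_right,
      h.right.dot_Dz2_Dz3, h.right.dot_Dz_Dz3, h.right.dot_Dz_Dz2, hX, hY,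
      dotC_comm (Dz (Dz (Dz G)) z⁻¹) (Dz (Dz G) z⁻¹), dotC_comm (Dz (Dz (Dz G)) z⁻¹) (Dz G z⁻¹),
      dotC_comm (Dz (Dz G) z⁻¹) (Dz G z⁻¹)]
    field_simp
    ring
  have hlim : Filter.Tendsto S (Filter.cocompact ℂ) (𝓝 0) := by
    have h1 : Filter.Tendsto (fun z : ℂ => z⁻¹) (Filter.cocompact ℂ) (𝓝 0) :=
      (Metric.cobounded_eq_cocompact (α := ℂ)) ▸ Filter.tendsto_inv₀_cobounded
    have hRc : Continuous R := (h.right.differentiable_sextic).continuous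
    have h2 : Filter.Tendsto (fun z : ℂ => (z⁻¹) ^ 12 * R z⁻¹) (Filter.cocompact ℂ) (𝓝 0) := by
      have := ((continuous_pow 12).mul hRc).tendsto (0 : ℂ)
      have h3 := this.comp h1
      simp only [Pi.mul_apply, ne_eq, OfNat.ofNat_ne_zero, not_false_eq_true, zero_pow,
        zero_mul] at h3
      exact h3
    refine h2.congr' ?_
    have : {(0 : ℂ)}ᶜ ∈ Filter.cocompact ℂ := isCompact_singleton.compl_mem_cocompact
    filter_upwards [this] with z hz
    exact (e z hz).symm
  exact h.left.differentiable_sextic.apply_eq_of_tendsto_cocompact z hlim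

/-- `∂_z` preserves the line spanned by the binormal. -/
theorem Dz_binormal_parallel (h : IsACPair F G) (z : ℂ) :
    dotC (conjC (binormal F z)) (binormal F z) • Dz (binormal F) z =
      dotC (conjC (binormal F z)) (Dz (binormal F) z) • binormal F z :=
  h.left.Dz_binormal_parallel z (h.sextic_eq_zero z)

/-- The conjugate binormal, suitably normalized, is holomorphic. -/
theorem differentiableAt_normalized (h : IsACPair F G) {z : ℂ} (hz : binormal F z ≠ 0) :
    DifferentiableAt ℂ (fun w => (dotC (conjC (binormal F w)) (binormal F w))⁻¹ •
      conjC (binormal F w)) z := by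
  have hH := Smooth.diff h.left.smooth_binormal z
  have hHc := Smooth.diff (contDiff_conjC h.left.smooth_binormal) z
  set q := fun w => dotC (conjC (binormal F w)) (binormal F w) with hq
  have hqd : DifferentiableAt ℝ q z :=
    Smooth.diff (contDiff_dotC (contDiff_conjC h.left.smooth_binormal) h.left.smooth_binormal) z
  have hq0 : q z ≠ 0 := by
    simp only [hq, dotC_conjC_self]
    simpa using hz
  have hqi : DifferentiableAt ℝ (fun w => (q w)⁻¹) z := hqd.inv hq0
  rw [← Db_eq_zero_iff (hqi.fun_smul hHc), Db_smul hqi hHc, Db_inv hqd hq0, Db_conjC hH]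
  have hβ : Dz (binormal F) z =
      ((q z)⁻¹ * dotC (conjC (binormal F z)) (Dz (binormal F) z)) • binormal F z := by
    have := h.Dz_binormal_parallel z
    rw [mul_smul, ← this, smul_smul, inv_mul_cancel₀ hq0, one_smul]
  set β := (q z)⁻¹ * dotC (conjC (binormal F z)) (Dz (binormal F) z)
  -- Because ∂_z̄ H is orthogonal to H, only the derivative of conj H contributes. Thus |H|² and
  -- conj H have the same logarithmic ∂_z̄-derivative, and their quotient is holomorphic.
  have hDq : Db q z = (starRingEnd ℂ) β * q z := by
    have h0 := h.left.inner_Db_binormal z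
    rw [inner_eq_dotC] at h0
    rw [hq, Db_dotC hHc hH, Db_conjC hH, h0, hβ, conjC_smul, dotC_smul_left, add_zero]
  rw [hDq, hβ, conjC_smul, smul_smul, ← add_smul]
  convert zero_smul ℂ _
  field_simp
  ring

end IsACPair

/-! ### A maximum principle -/

/-- Restrict to the line through z in direction w. A positive second derivative would make the point
a local minimum as well, hence the restriction locally constant, contradicting positivity. -/
theorem second_deriv_nonpos_of_isLocalMax {v : ℂ → ℝ} {z : ℂ} (hv : ContDiffAt ℝ ∞ v z)
    (hmax : IsLocalMax v z) (w : ℂ) : fderiv ℝ (fderiv ℝ v) z w w ≤ 0 := by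
  set ℓ : ℝ → ℂ := fun t => z + t • w with hℓ
  have hℓd : ∀ t, HasDerivAt ℓ w t := fun t => by
    simpa [hℓ] using ((hasDerivAt_id t).smul_const w).const_add z
  have hℓ0 : ℓ 0 = z := by simp [hℓ]
  have hℓc : ContinuousAt ℓ 0 := (hℓd 0).continuousAt
  have hdiff : ∀ᶠ ζ in 𝓝 z, DifferentiableAt ℝ v ζ := by
    have := (hv.of_le (m := 1) (WithTop.coe_le_coe.2 (le_top : (1 : ℕ∞) ≤ ⊤))).eventually (by simp)
    exact this.mono fun ζ h => h.differentiableAt (by simp)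
  have hd2 : DifferentiableAt ℝ (fderiv ℝ v) z :=
    (hv.fderiv_right (m := 1) (WithTop.coe_le_coe.2 (le_top : (1 + 1 : ℕ∞) ≤ ⊤))).differentiableAt
      (by simp)
  have hg1 : ∀ᶠ t in 𝓝 (0 : ℝ), deriv (fun t => v (ℓ t)) t = fderiv ℝ v (ℓ t) w := by
    have : ∀ᶠ t in 𝓝 (0 : ℝ), DifferentiableAt ℝ v (ℓ t) := by
      rw [← hℓ0] at hdiff; exact hℓc.eventually hdiff
    filter_upwards [this] with t ht
    exact (ht.hasFDerivAt.comp_hasDerivAt t (hℓd t)).deriv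
  have hg2 : deriv (deriv fun t => v (ℓ t)) 0 = fderiv ℝ (fderiv ℝ v) z w w := by
    rw [Filter.EventuallyEq.deriv_eq hg1]
    have h1 : HasDerivAt (fun t => fderiv ℝ v (ℓ t)) (fderiv ℝ (fderiv ℝ v) z w) 0 := by
      rw [← hℓ0] at hd2
      have := hd2.hasFDerivAt.comp_hasDerivAt 0 (hℓd 0)
      rwa [hℓ0] at this
    have h2 := h1.clm_apply (hasDerivAt_const (0 : ℝ) w)
    simpa using h2.deriv
  have hmax' : IsLocalMax (fun t => v (ℓ t)) 0 := by
    have : IsLocalMax v (ℓ 0) := by rwa [hℓ0]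
    exact this.comp_continuous hℓc
  by_contra hcon
  push Not at hcon
  have hmin : IsLocalMin (fun t => v (ℓ t)) 0 := by
    refine isLocalMin_of_deriv_deriv_pos (by rw [hg2]; exact hcon) hmax'.deriv_eq_zero ?_
    have : ContinuousAt v (ℓ 0) := by rw [hℓ0]; exact hv.continuousAt
    exact this.comp hℓc
  have hconst : (fun t => v (ℓ t)) =ᶠ[𝓝 0] fun _ => v (ℓ 0) := by
    filter_upwards [hmax', hmin] with t h1 h2 using le_antisymm h1 h2
  have h3 : deriv (deriv fun t => v (ℓ t)) 0 = 0 := by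
    rw [hconst.deriv.deriv_eq]; simp
  rw [hg2] at h3
  exact hcon.ne' h3

theorem Dz_Db_eq {E : Type*} [NormedAddCommGroup E] [NormedSpace ℂ E] {s : ℂ → E} {z : ℂ}
    (hs : ContDiffAt ℝ ∞ s z) : Dz (Db s) z = (1 / 4 : ℂ) • (fderiv ℝ (fderiv ℝ s) z 1 1 +
      fderiv ℝ (fderiv ℝ s) z Complex.I Complex.I) := by
  have h : DifferentiableAt ℝ (fderiv ℝ s) z :=
    (hs.fderiv_right (m := 1) (WithTop.coe_le_coe.2 (le_top : (1 + 1 : ℕ∞) ≤ ⊤))).differentiableAt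
      (by simp)
  have h1 : DifferentiableAt ℝ (fun ζ => fderiv ℝ s ζ 1) z := h.clm_apply (differentiableAt_const _)
  have hI : DifferentiableAt ℝ (fun ζ => fderiv ℝ s ζ Complex.I) z :=
    h.clm_apply (differentiableAt_const _)
  have hI' : DifferentiableAt ℝ (fun ζ => Complex.I • fderiv ℝ s ζ Complex.I) z := hI.const_smul _
  have hsymm := (hs.isSymmSndFDerivAt (n := ∞) (by simpa using ENat.LEInfty.out)) 1 Complex.I
  have e1 : ∀ w, fderiv ℝ (Db s) z w = (1 / 2 : ℂ) • (fderiv ℝ (fderiv ℝ s) z w 1 +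
      Complex.I • fderiv ℝ (fderiv ℝ s) z w Complex.I) := by
    intro w
    have : Db s = fun ζ => (1 / 2 : ℂ) • (fderiv ℝ s ζ 1 + Complex.I • fderiv ℝ s ζ Complex.I) := rfl
    rw [this, fderiv_fun_const_smul (h1.fun_add hI'), fderiv_fun_add h1 hI',
      fderiv_fun_const_smul hI]
    simp only [smul_apply, add_apply, fderiv_fderiv_apply hs]
  rw [Dz, e1, e1, hsymm]
  have hII : (Complex.I * Complex.I) • fderiv ℝ (fderiv ℝ s) z Complex.I Complex.I =
      -fderiv ℝ (fderiv ℝ s) z Complex.I Complex.I := by rw [Complex.I_mul_I, neg_one_smul]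
  rw [← neg_eq_iff_eq_neg] at hII
  conv_rhs => rw [← hII]
  module

theorem Dz_Db_re_nonpos {V : ℂ → ℂ} {z : ℂ} (hV : ContDiffAt ℝ ∞ V z)
    (hmax : IsLocalMax (fun ζ => (V ζ).re) z) : (Dz (Db V) z).re ≤ 0 := by
  have hv : ContDiffAt ℝ ∞ (fun ζ => (V ζ).re) z := Complex.reCLM.contDiff.contDiffAt.comp z hV
  have hdiff : ∀ᶠ ζ in 𝓝 z, DifferentiableAt ℝ V ζ := by
    have := (hV.of_le (m := 1) (WithTop.coe_le_coe.2 (le_top : (1 : ℕ∞) ≤ ⊤))).eventually (by simp)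
    exact this.mono fun ζ h => h.differentiableAt (by simp)
  have e : ∀ w, (fderiv ℝ (fderiv ℝ V) z w w).re =
      fderiv ℝ (fderiv ℝ fun ζ => (V ζ).re) z w w := by
    intro w
    rw [← fderiv_fderiv_apply hv, ← fderiv_fderiv_apply hV]
    have h1 : (fun ζ => fderiv ℝ (fun ζ => (V ζ).re) ζ w) =ᶠ[𝓝 z]
        fun ζ => (fderiv ℝ V ζ w).re := by
      filter_upwards [hdiff] with ζ hζ
      have := (Complex.reCLM.hasFDerivAt.comp ζ hζ.hasFDerivAt).fderiv
      have h2 : fderiv ℝ (fun ζ => (V ζ).re) ζ = _ := this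
      rw [h2]; rfl
    rw [h1.fderiv_eq]
    have hd : DifferentiableAt ℝ (fun ζ => fderiv ℝ V ζ w) z :=
      ((hV.fderiv_right (m := 1)
        (WithTop.coe_le_coe.2 (le_top : (1 + 1 : ℕ∞) ≤ ⊤))).differentiableAt (by simp)).clm_apply
        (differentiableAt_const _)
    have h3 : fderiv ℝ (fun ζ => (fderiv ℝ V ζ w).re) z = _ :=
      (Complex.reCLM.hasFDerivAt.comp z hd.hasFDerivAt).fderiv
    rw [h3]; rfl
  rw [Dz_Db_eq hV]
  have h1 := second_deriv_nonpos_of_isLocalMax hv hmax 1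
  have hI := second_deriv_nonpos_of_isLocalMax hv hmax Complex.I
  rw [← e] at h1 hI
  have : ((1 / 4 : ℂ) • (fderiv ℝ (fderiv ℝ V) z 1 1 +
      fderiv ℝ (fderiv ℝ V) z Complex.I Complex.I)).re = (1 / 4 : ℝ) *
      ((fderiv ℝ (fderiv ℝ V) z 1 1).re + (fderiv ℝ (fderiv ℝ V) z Complex.I Complex.I).re) := by
    rw [smul_eq_mul, show (1 / 4 : ℂ) = ((1 / 4 : ℝ) : ℂ) by norm_num, Complex.re_ofReal_mul,
      Complex.add_re]
  rw [this]; linarith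

theorem Dz_Db_zero_of_isLocalMax {V : ℂ → ℂ} {z : ℂ} (hV : DifferentiableAt ℝ V z)
    (hreal : ∀ᶠ ζ in 𝓝 z, (V ζ).im = 0)
    (hmax : IsLocalMax (fun ζ => (V ζ).re) z) : Dz V z = 0 ∧ Db V z = 0 := by
  have h0 : fderiv ℝ V z = 0 := by
    ext1 w
    apply Complex.ext
    · have h3 : fderiv ℝ (fun ζ => (V ζ).re) z = _ :=
        (Complex.reCLM.hasFDerivAt.comp z hV.hasFDerivAt).fderiv
      have := hmax.fderiv_eq_zero
      rw [h3] at this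
      simpa using congrArg (fun L => L w) this
    · have h3 : fderiv ℝ (fun ζ => (V ζ).im) z = _ :=
        (Complex.imCLM.hasFDerivAt.comp z hV.hasFDerivAt).fderiv
      have h4 : (fun ζ => (V ζ).im) =ᶠ[𝓝 z] fun _ => 0 := hreal
      have := h4.fderiv_eq (𝕜 := ℝ)
      rw [h3] at this
      simpa using congrArg (fun L => L w) this
  simp [Dz, Db, h0]

theorem Dz_cexp {g : ℂ → ℂ} {z : ℂ} (hg : DifferentiableAt ℝ g z) :
    Dz (fun w => Complex.exp (g w)) z = Complex.exp (g z) * Dz g z := by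
  simp [Dz, hg.hasFDerivAt.cexp.fderiv]; ring

theorem Db_cexp {g : ℂ → ℂ} {z : ℂ} (hg : DifferentiableAt ℝ g z) :
    Db (fun w => Complex.exp (g w)) z = Complex.exp (g z) * Db g z := by
  simp [Db, hg.hasFDerivAt.cexp.fderiv]; ring

@[simp] theorem Dz_conj_id (z : ℂ) : Dz (fun w => (starRingEnd ℂ) w) z = 0 := by
  have : fderiv ℝ (fun w : ℂ => (starRingEnd ℂ) w) z = Complex.conjCLE.toContinuousLinearMap :=
    Complex.conjCLE.toContinuousLinearMap.hasFDerivAt.fderiv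
  simp [Dz, this]

@[simp] theorem Db_conj_id (z : ℂ) : Db (fun w => (starRingEnd ℂ) w) z = 1 := by
  have : fderiv ℝ (fun w : ℂ => (starRingEnd ℂ) w) z = Complex.conjCLE.toContinuousLinearMap :=
    Complex.conjCLE.toContinuousLinearMap.hasFDerivAt.fderiv
  simp [Db, this]; norm_num

theorem Dz_weight (c : ℝ) (a z : ℂ) :
    Dz (fun w => (c : ℂ) * ((w - a) * (starRingEnd ℂ) (w - a))) z =
      c * (starRingEnd ℂ) (z - a) := by
  have h1 : DifferentiableAt ℂ (fun w : ℂ => (c : ℂ) * (w - a)) z :=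
    (differentiableAt_id.sub_const a).const_mul _
  have h2 : DifferentiableAt ℝ (fun w : ℂ => (starRingEnd ℂ) w) z :=
    Complex.conjCLE.toContinuousLinearMap.differentiableAt
  have h3 : DifferentiableAt ℝ (fun w : ℂ => (starRingEnd ℂ) w - (starRingEnd ℂ) a) z :=
    h2.sub_const _
  have e : (fun w => (c : ℂ) * ((w - a) * (starRingEnd ℂ) (w - a))) =
      fun w => ((c : ℂ) * (w - a)) • ((starRingEnd ℂ) w - (starRingEnd ℂ) a) := by
    ext w; simp; ring
  rw [e, Dz_smul (h1.restrictScalars ℝ) h3, Dz_sub h2 (differentiableAt_const _), Dz_conj_id,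
    Dz_const, Dz_of_differentiableAt h1]
  have : deriv (fun w : ℂ => (c : ℂ) * (w - a)) z = c := by
    simp
  rw [this]; simp

theorem Db_weight (c : ℝ) (a z : ℂ) :
    Db (fun w => (c : ℂ) * ((w - a) * (starRingEnd ℂ) (w - a))) z = c * (z - a) := by
  have h1 : DifferentiableAt ℂ (fun w : ℂ => (c : ℂ) * (w - a)) z :=
    (differentiableAt_id.sub_const a).const_mul _
  have h2 : DifferentiableAt ℝ (fun w : ℂ => (starRingEnd ℂ) w) z :=
    Complex.conjCLE.toContinuousLinearMap.differentiableAt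
  have h3 : DifferentiableAt ℝ (fun w : ℂ => (starRingEnd ℂ) w - (starRingEnd ℂ) a) z :=
    h2.sub_const _
  have e : (fun w => (c : ℂ) * ((w - a) * (starRingEnd ℂ) (w - a))) =
      fun w => ((c : ℂ) * (w - a)) • ((starRingEnd ℂ) w - (starRingEnd ℂ) a) := by
    ext w; simp; ring
  rw [e, Db_smul (h1.restrictScalars ℝ) h3, Db_sub h2 (differentiableAt_const _), Db_conj_id,
    Db_const, Db_of_differentiableAt h1]
  simp

theorem contDiff_weight (c : ℝ) (a : ℂ) :
    ContDiff ℝ ∞ (fun w : ℂ => (c : ℂ) * ((w - a) * (starRingEnd ℂ) (w - a))) := by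
  have h1 : ContDiff ℝ ∞ (fun w : ℂ => w - a) := contDiff_id.sub contDiff_const
  have h2 : ContDiff ℝ ∞ (fun w : ℂ => (starRingEnd ℂ) (w - a)) :=
    Complex.conjCLE.toContinuousLinearMap.contDiff.comp h1
  exact contDiff_const.mul (h1.mul h2)

/-- The weighted norm of a quasi-holomorphic map has no local maximum. -/
theorem not_isLocalMax_weighted {K : ℂ → C7} {U : Set ℂ} (hU : IsOpen U) {z : ℂ} (hz : z ∈ U)
    (a : ℂ) {M c : ℝ} (hK : ContDiffOn ℝ ∞ K U)
    (horth : ∀ ζ ∈ U, inner ℂ (K ζ) (Db K ζ) = 0) (hbd : ‖Db K z‖ ^ 2 ≤ M * ‖K z‖ ^ 2)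
    (hne : K z ≠ 0) (hc : M < c) :
    ¬ IsLocalMax (fun ζ => ‖K ζ‖ ^ 2 * Real.exp (c * ‖ζ - a‖ ^ 2)) z := by
  intro hmax
  have hKc := contDiffOn_conjC hK
  have hX := contDiffOn_Dz hU hK
  have hB := contDiffOn_Db hU hK
  have hXc := contDiffOn_conjC hX
  set p : ℂ → ℂ := fun ζ => dotC (conjC (K ζ)) (K ζ) with hp
  have hpU : ContDiffOn ℝ ∞ p U := contDiffOn_dotC hKc hK
  set g : ℂ → ℂ := fun w => (c : ℂ) * ((w - a) * (starRingEnd ℂ) (w - a)) with hg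
  have hgs : ContDiff ℝ ∞ g := contDiff_weight c a
  set E : ℂ → ℂ := fun w => Complex.exp (g w) with hE
  have hEs : ContDiff ℝ ∞ E := hgs.cexp
  have hDbp : ∀ ζ ∈ U, Db p ζ = dotC (conjC (Dz K ζ)) (K ζ) := by
    intro ζ hζ
    have h0 := horth ζ hζ
    rw [inner_eq_dotC] at h0
    rw [hp, Db_dotC (SmoothOn.diff hU hKc hζ) (SmoothOn.diff hU hK hζ),
      Db_conjC (SmoothOn.diff hU hK hζ), h0, add_zero]
  have hDzp : ∀ ζ ∈ U, Dz p ζ = dotC (conjC (K ζ)) (Dz K ζ) := by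
    intro ζ hζ
    have h0 := horth ζ hζ
    rw [inner_eq_dotC] at h0
    have h1 := congrArg (starRingEnd ℂ) h0
    rw [conj_dotC, conjC_conjC, map_zero, dotC_comm] at h1
    rw [hp, Dz_dotC (SmoothOn.diff hU hKc hζ) (SmoothOn.diff hU hK hζ),
      Dz_conjC (SmoothOn.diff hU hK hζ), h1, zero_add]
  -- A quarter of the Laplacian of |K|². Differentiating the orthogonality relation converts the
  -- term containing the mixed derivative of K into -|∂_z̄ K|².
  have hDD : Dz (Db p) z = ((‖Dz K z‖ ^ 2 - ‖Db K z‖ ^ 2 : ℝ) : ℂ) := by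
    have e : Db p =ᶠ[𝓝 z] fun ζ => dotC (conjC (Dz K ζ)) (K ζ) := by
      filter_upwards [hU.mem_nhds hz] with ζ hζ using hDbp ζ hζ
    rw [Dz_congr e, Dz_dotC (SmoothOn.diff hU hXc hz) (SmoothOn.diff hU hK hz),
      Dz_conjC (SmoothOn.diff hU hX hz), dotC_conjC_self,
      ← Dz_Db_comm (hK.contDiffAt (hU.mem_nhds hz))]
    have e2 : (fun ζ => dotC (conjC (K ζ)) (Db K ζ)) =ᶠ[𝓝 z] fun _ => 0 := by
      filter_upwards [hU.mem_nhds hz] with ζ hζ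
      rw [← inner_eq_dotC, horth ζ hζ]
    have h2 := Dz_congr e2
    rw [Dz_const, Dz_dotC (SmoothOn.diff hU hKc hz) (SmoothOn.diff hU hB hz),
      Dz_conjC (SmoothOn.diff hU hK hz), dotC_conjC_self] at h2
    have h3 := congrArg (starRingEnd ℂ) h2
    rw [map_add, conj_dotC, conjC_conjC, map_zero, Complex.conj_ofReal, dotC_comm (K z)] at h3
    push_cast at h3 ⊢
    linear_combination h3
  have hVre : (fun ζ => ‖K ζ‖ ^ 2 * Real.exp (c * ‖ζ - a‖ ^ 2)) = fun ζ => (p ζ * E ζ).re := by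
    ext ζ
    have h1 : g ζ = ((c * ‖ζ - a‖ ^ 2 : ℝ) : ℂ) := by
      simp only [hg, Complex.mul_conj, Complex.normSq_eq_norm_sq]; push_cast; ring
    simp only [hp, hE, h1, dotC_conjC_self]
    rw [← Complex.ofReal_exp, ← Complex.ofReal_mul, Complex.ofReal_re]
  have hVim : ∀ ζ, (p ζ * E ζ).im = 0 := by
    intro ζ
    have h1 : g ζ = ((c * ‖ζ - a‖ ^ 2 : ℝ) : ℂ) := by
      simp only [hg, Complex.mul_conj, Complex.normSq_eq_norm_sq]; push_cast; ring
    simp only [hp, hE, h1, dotC_conjC_self]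
    rw [← Complex.ofReal_exp, ← Complex.ofReal_mul, Complex.ofReal_im]
  rw [hVre] at hmax
  have hpE : ContDiffOn ℝ ∞ (fun ζ => p ζ * E ζ) U := hpU.mul hEs.contDiffOn
  obtain ⟨c1, c2⟩ := Dz_Db_zero_of_isLocalMax (V := fun ζ => p ζ * E ζ) (SmoothOn.diff hU hpE hz)
    (Filter.Eventually.of_forall hVim) hmax
  have c3 := Dz_Db_re_nonpos (V := fun ζ => p ζ * E ζ) (hpE.contDiffAt (hU.mem_nhds hz)) hmax
  have hgd := fun ζ => Smooth.diff hgs ζ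
  have hEd := fun ζ => Smooth.diff hEs ζ
  have hDbV : ∀ ζ ∈ U, Db (fun ζ => p ζ * E ζ) ζ = E ζ * (Db p ζ + (c * (ζ - a)) * p ζ) := by
    intro ζ hζ
    have := Db_smul (SmoothOn.diff hU hpU hζ) (hEd ζ)
    simp only [smul_eq_mul] at this
    rw [this, hE, Db_cexp (hgd ζ), hg, Db_weight]
    ring
  have hDzV : Dz (fun ζ => p ζ * E ζ) z = E z * (Dz p z + (c * (starRingEnd ℂ) (z - a)) * p z) := by
    have := Dz_smul (SmoothOn.diff hU hpU hz) (hEd z)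
    simp only [smul_eq_mul] at this
    rw [this, hE, Dz_cexp (hgd z), hg, Dz_weight]
    ring
  have hE0 : E z ≠ 0 := Complex.exp_ne_zero _
  rw [hDzV] at c1
  rw [hDbV z hz] at c2
  have d1 := (mul_eq_zero.1 c1).resolve_left hE0
  have d2 := (mul_eq_zero.1 c2).resolve_left hE0
  have hlin : DifferentiableAt ℂ (fun ζ : ℂ => (c : ℂ) * (ζ - a)) z :=
    (differentiableAt_id.sub_const a).const_mul _
  have hlinz : Dz (fun ζ : ℂ => (c : ℂ) * (ζ - a)) z = c := by
    rw [Dz_of_differentiableAt hlin]; simp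
  have hDzDb : Dz (Db fun ζ => p ζ * E ζ) z =
      E z * (Dz (Db p) z + c * p z - c ^ 2 * ((z - a) * (starRingEnd ℂ) (z - a)) * p z) := by
    have e : Db (fun ζ => p ζ * E ζ) =ᶠ[𝓝 z] fun ζ => E ζ • (Db p ζ + (c * (ζ - a)) • p ζ) := by
      filter_upwards [hU.mem_nhds hz] with ζ hζ
      rw [hDbV ζ hζ]; rfl
    have hd1 := SmoothOn.diff hU (contDiffOn_Db hU hpU) hz
    have hd2 := (hlin.restrictScalars ℝ).fun_smul (SmoothOn.diff hU hpU hz)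
    rw [Dz_congr e, Dz_smul (hEd z) (hd1.fun_add hd2), Dz_add hd1 hd2,
      Dz_smul (hlin.restrictScalars ℝ) (SmoothOn.diff hU hpU hz), hlinz, hE, Dz_cexp (hgd z), hg,
      Dz_weight]
    simp only [smul_eq_mul]
    rw [d2]
    linear_combination (Complex.exp (c * ((z - a) * (starRingEnd ℂ) (z - a))) * c * (z - a)) * d1
  have hEreal : E z = ((Real.exp (c * ‖z - a‖ ^ 2) : ℝ) : ℂ) := by
    have h1 : g z = ((c * ‖z - a‖ ^ 2 : ℝ) : ℂ) := by
      simp only [hg, Complex.mul_conj, Complex.normSq_eq_norm_sq]; push_cast; ring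
    rw [Complex.ofReal_exp, ← h1]
  have hpz : p z = ((‖K z‖ ^ 2 : ℝ) : ℂ) := dotC_conjC_self _
  rw [hDzDb, hDD, hEreal, hpz, Complex.mul_conj, Complex.normSq_eq_norm_sq] at c3
  have c4 : Real.exp (c * ‖z - a‖ ^ 2) * (‖Dz K z‖ ^ 2 - ‖Db K z‖ ^ 2 + c * ‖K z‖ ^ 2 -
      c ^ 2 * ‖z - a‖ ^ 2 * ‖K z‖ ^ 2) ≤ 0 := by
    rw [← Complex.ofReal_re (Real.exp (c * ‖z - a‖ ^ 2) * (‖Dz K z‖ ^ 2 - ‖Db K z‖ ^ 2 +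
      c * ‖K z‖ ^ 2 - c ^ 2 * ‖z - a‖ ^ 2 * ‖K z‖ ^ 2))]
    convert c3 using 2
    push_cast; ring
  -- Criticality of the weighted norm prescribes the component of ∂_z K along K. By Cauchy–Schwarz
  -- |∂_z K|² then dominates the negative term coming from the weight, so that c |K|² ≤ |∂_z̄ K|² ≤
  -- M |K|² would follow.
  have hCS : c ^ 2 * ‖z - a‖ ^ 2 * ‖K z‖ ^ 2 ≤ ‖Dz K z‖ ^ 2 := by
    have h1 : inner ℂ (K z) (Dz K z) = -(c * (starRingEnd ℂ) (z - a)) * p z := by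
      rw [inner_eq_dotC, ← hDzp z hz]; linear_combination d1
    have h2 := norm_inner_le_norm (𝕜 := ℂ) (K z) (Dz K z)
    rw [h1, hpz, norm_mul, norm_neg, norm_mul, Complex.norm_conj, Complex.norm_real,
      Complex.norm_real, Real.norm_of_nonneg (sq_nonneg ‖K z‖), Real.norm_eq_abs] at h2
    have hKpos : 0 < ‖K z‖ := norm_pos_iff.2 hne
    have h3 : |c| * ‖z - a‖ * ‖K z‖ ≤ ‖Dz K z‖ := by
      have : ‖K z‖ * (|c| * ‖z - a‖ * ‖K z‖) ≤ ‖K z‖ * ‖Dz K z‖ := by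
        calc _ = |c| * ‖z - a‖ * ‖K z‖ ^ 2 := by ring
          _ ≤ _ := h2
      exact le_of_mul_le_mul_left this hKpos
    calc c ^ 2 * ‖z - a‖ ^ 2 * ‖K z‖ ^ 2 = (|c| * ‖z - a‖ * ‖K z‖) ^ 2 := by
          rw [mul_pow, mul_pow, sq_abs]
      _ ≤ _ := by gcongr
  have hexp := Real.exp_pos (c * ‖z - a‖ ^ 2)
  have c5 : ‖Dz K z‖ ^ 2 - ‖Db K z‖ ^ 2 + c * ‖K z‖ ^ 2 -
      c ^ 2 * ‖z - a‖ ^ 2 * ‖K z‖ ^ 2 ≤ 0 := by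
    by_contra hcon
    push Not at hcon
    exact absurd c4 (not_le.2 (mul_pos hexp hcon))
  have hKpos : 0 < ‖K z‖ ^ 2 := by positivity
  nlinarith [mul_lt_mul_of_pos_right hc hKpos]

/-- Strong unique continuation for quasi-holomorphic maps. -/
theorem eq_zero_of_flat {H : ℂ → C7} (hH : ContDiff ℝ ∞ H)
    (horth : ∀ z, inner ℂ (H z) (Db H z) = 0) {C : ℂ → ℝ} (hC : Continuous C)
    (hbd : ∀ z, ‖Db H z‖ ^ 2 ≤ C z * ‖H z‖ ^ 2) (a : ℂ)
    (hflat : ∀ n : ℕ, ∃ B, ∀ z ∈ Metric.closedBall a 1, ‖H z‖ ≤ B * ‖z - a‖ ^ n) (z : ℂ) :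
    H z = 0 := by
  by_contra hz0
  set R := ‖z - a‖ + 1 with hR
  have hR1 : 1 ≤ R := by rw [hR]; linarith [norm_nonneg (z - a)]
  obtain ⟨M, hM⟩ := (isCompact_closedBall a R).exists_bound_of_continuousOn hC.continuousOn
  have hMC : ∀ w ∈ Metric.closedBall a R, C w ≤ M := fun w hw =>
    (le_abs_self _).trans (hM w hw)
  obtain ⟨B, hB⟩ := (isCompact_closedBall a R).exists_bound_of_continuousOn
    hH.continuous.continuousOn
  set c := M + 1 with hc
  have hHa : H a = 0 := by
    obtain ⟨B, hB⟩ := hflat 1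
    have := hB a (by simp)
    simpa using this
  have hza : z ≠ a := fun h => hz0 (h ▸ hHa)
  -- Dividing H by the holomorphic function (ζ - a)^N preserves both the orthogonality and the
  -- differential inequality. Flatness makes the quotient continuous at a, so its weighted norm
  -- attains its maximum over the disc on the circle of radius R. Since R exceeds |z - a|, the
  -- resulting bound decays geometrically in N.
  have key : ∀ N : ℕ, 1 ≤ N → ‖H z‖ ^ 2 * Real.exp (c * ‖z - a‖ ^ 2) ≤
      B ^ 2 * Real.exp (c * R ^ 2) * ((‖z - a‖ / R) ^ 2) ^ N := by
    intro N hN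
    set K : ℂ → C7 := fun ζ => ((ζ - a) ^ N)⁻¹ • H ζ with hK
    set u : ℂ → ℝ := fun ζ => ‖K ζ‖ ^ 2 * Real.exp (c * ‖ζ - a‖ ^ 2) with hu
    have hKa : K a = 0 := by simp [hK, hHa]
    have hKs : ContDiffOn ℝ ∞ K {a}ᶜ := by
      have h1 : ContDiffOn ℝ ∞ (fun ζ : ℂ => (ζ - a) ^ N) {a}ᶜ :=
        ((contDiff_id.sub contDiff_const).pow N).contDiffOn
      exact (h1.inv fun ζ hζ => pow_ne_zero _ (sub_ne_zero.2 hζ)).smul hH.contDiffOn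
    have hKc : Continuous K := by
      rw [continuous_iff_continuousAt]
      intro ζ
      by_cases hζ : ζ = a
      · subst hζ
        obtain ⟨B, hB⟩ := hflat (N + 1)
        rw [ContinuousAt, hKa]
        refine squeeze_zero_norm' (a := fun w => B * ‖w - ζ‖) ?_ ?_
        · filter_upwards [Metric.closedBall_mem_nhds ζ one_pos] with w hw
          by_cases hwζ : w = ζ
          · subst hwζ; simp [hKa]
          · rw [hK, norm_smul, norm_inv, norm_pow]
            have hpos : 0 < ‖w - ζ‖ := norm_pos_iff.2 (sub_ne_zero.2 hwζ)
            rw [inv_mul_le_iff₀ (pow_pos hpos N)]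
            calc _ ≤ _ := hB w hw
              _ = _ := by ring
        · have : Continuous fun w : ℂ => B * ‖w - ζ‖ := by fun_prop
          simpa using this.tendsto ζ
      · exact (hKs.contDiffAt (isOpen_compl_singleton.mem_nhds hζ)).continuousAt
    have huc : Continuous u := by
      have : Continuous fun ζ : ℂ => Real.exp (c * ‖ζ - a‖ ^ 2) := by fun_prop
      exact (hKc.norm.pow 2).mul this
    obtain ⟨ζ, hζ, hζmax⟩ := (isCompact_closedBall a R).exists_isMaxOn
      ⟨a, by simp; linarith⟩ huc.continuousOn
    have hzR : z ∈ Metric.closedBall a R := by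
      rw [Metric.mem_closedBall, dist_eq_norm]; linarith
    have hKz : K z ≠ 0 := smul_ne_zero (inv_ne_zero (pow_ne_zero _ (sub_ne_zero.2 hza))) hz0
    have huz : 0 < u z := mul_pos (by positivity) (Real.exp_pos _)
    have huζ : u z ≤ u ζ := hζmax hzR
    have hKζ : K ζ ≠ 0 := by
      intro h0
      have : u ζ = 0 := by simp [hu, h0]
      linarith
    have hζa : ζ ≠ a := fun h => hKζ (h ▸ hKa)
    have hDbK : ∀ w ∈ ({a}ᶜ : Set ℂ), Db K w = ((w - a) ^ N)⁻¹ • Db H w := by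
      intro w hw
      have h1 : DifferentiableAt ℂ (fun ζ : ℂ => ((ζ - a) ^ N)⁻¹) w :=
        ((differentiableAt_id.sub_const a).pow N).inv (pow_ne_zero _ (sub_ne_zero.2 hw))
      rw [hK, Db_smul (h1.restrictScalars ℝ) (Smooth.diff hH w), Db_of_differentiableAt h1]
      simp
    have hζR : ‖ζ - a‖ = R := by
      by_contra hne
      have hlt : ζ ∈ Metric.ball a R := by
        rw [Metric.mem_ball, dist_eq_norm]
        rw [Metric.mem_closedBall, dist_eq_norm] at hζ
        exact lt_of_le_of_ne hζ hne
      refine not_isLocalMax_weighted isOpen_compl_singleton hζa a (M := M) (c := c) hKs ?_ ?_ hKζ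
        (by rw [hc]; linarith) ?_
      · intro w hw
        rw [hDbK w hw, hK, inner_smul_left, inner_smul_right, horth]; simp
      · rw [hDbK ζ hζa, hK, norm_smul, norm_smul, mul_pow, mul_pow]
        have h1 := (hbd ζ).trans (mul_le_mul_of_nonneg_right (hMC ζ hζ) (sq_nonneg _))
        calc _ ≤ ‖((ζ - a) ^ N)⁻¹‖ ^ 2 * (M * ‖H ζ‖ ^ 2) := by gcongr
          _ = _ := by ring
      · exact hζmax.isLocalMax (Filter.mem_of_superset (Metric.isOpen_ball.mem_nhds hlt)
          Metric.ball_subset_closedBall)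
    have h1 : u ζ ≤ (R ^ N)⁻¹ ^ 2 * B ^ 2 * Real.exp (c * R ^ 2) := by
      simp only [hu, hK, hζR, norm_smul, norm_inv, norm_pow, mul_pow]
      have := hB ζ hζ
      gcongr
    have h2 : u z = (‖z - a‖ ^ N)⁻¹ ^ 2 * (‖H z‖ ^ 2 * Real.exp (c * ‖z - a‖ ^ 2)) := by
      simp only [hu, hK, norm_smul, norm_inv, norm_pow, mul_pow]; ring
    rw [h2] at huζ
    have hpos : 0 < ‖z - a‖ := norm_pos_iff.2 (sub_ne_zero.2 hza)
    have h3 := huζ.trans h1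
    have hRpos : 0 < R := by linarith
    rw [inv_pow, inv_mul_le_iff₀ (by positivity)] at h3
    refine h3.trans (le_of_eq ?_)
    rw [show ((‖z - a‖ / R) ^ 2) ^ N = (‖z - a‖ ^ N) ^ 2 * ((R ^ N)⁻¹) ^ 2 by
      rw [← mul_pow, ← div_eq_mul_inv, ← div_pow, ← pow_mul, ← pow_mul, mul_comm]]
    ring
  have hlt : (‖z - a‖ / R) ^ 2 < 1 := by
    have : ‖z - a‖ / R < 1 := by
      rw [div_lt_one (by linarith)]; linarith
    have h0 : 0 ≤ ‖z - a‖ / R := by positivity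
    nlinarith
  have hlim : Filter.Tendsto (fun N : ℕ => B ^ 2 * Real.exp (c * R ^ 2) *
      ((‖z - a‖ / R) ^ 2) ^ N) Filter.atTop (𝓝 0) := by
    simpa using (tendsto_pow_atTop_nhds_zero_of_lt_one (sq_nonneg _) hlt).const_mul
      (B ^ 2 * Real.exp (c * R ^ 2))
  have hle : ‖H z‖ ^ 2 * Real.exp (c * ‖z - a‖ ^ 2) ≤ 0 :=
    ge_of_tendsto hlim ((Filter.eventually_ge_atTop 1).mono key)
  have : 0 < ‖H z‖ ^ 2 * Real.exp (c * ‖z - a‖ ^ 2) :=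
    mul_pos (by positivity) (Real.exp_pos _)
  linarith

/-! ### Orders of vanishing of smooth maps -/

section Vanish

variable {E F G : Type*} [NormedAddCommGroup E] [NormedSpace ℂ E] [NormedAddCommGroup F]
  [NormedSpace ℂ F] [NormedAddCommGroup G] [NormedSpace ℂ G]

/-- All Wirtinger derivatives of order less than `n` vanish at `a`. -/
def VanishesToOrder (a : ℂ) : ℕ → (ℂ → E) → Prop
  | 0, _ => True
  | n + 1, s => s a = 0 ∧ VanishesToOrder a n (Dz s) ∧ VanishesToOrder a n (Db s)

variable {a : ℂ}

theorem VanishesToOrder.pred {n : ℕ} {s : ℂ → E} (h : VanishesToOrder a (n + 1) s) :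
    VanishesToOrder a n s := by
  induction n generalizing s with
  | zero => trivial
  | succ n ih => exact ⟨h.1, ih h.2.1, ih h.2.2⟩

theorem VanishesToOrder.add {n : ℕ} {s t : ℂ → E} (hs : ContDiff ℝ ∞ s) (ht : ContDiff ℝ ∞ t)
    (h1 : VanishesToOrder a n s) (h2 : VanishesToOrder a n t) :
    VanishesToOrder a n (fun z => s z + t z) := by
  induction n generalizing s t with
  | zero => trivial
  | succ n ih =>
    refine ⟨by simp [h1.1, h2.1], ?_, ?_⟩
    · have e : Dz (fun z => s z + t z) = fun z => Dz s z + Dz t z :=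
        funext fun z => Dz_add (Smooth.diff hs z) (Smooth.diff ht z)
      rw [e]; exact ih (contDiff_Dz hs) (contDiff_Dz ht) h1.2.1 h2.2.1
    · have e : Db (fun z => s z + t z) = fun z => Db s z + Db t z :=
        funext fun z => Db_add (Smooth.diff hs z) (Smooth.diff ht z)
      rw [e]; exact ih (contDiff_Db hs) (contDiff_Db ht) h1.2.2 h2.2.2

/-- Transfers the vanishing order through an equation ∂_z̄ t = B(s, t) with smooth coefficient s. -/
theorem VanishesToOrder.bilin (B : E →L[ℂ] F →L[ℂ] G) {n : ℕ} {s : ℂ → E} {t : ℂ → F}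
    (hs : ContDiff ℝ ∞ s) (ht : ContDiff ℝ ∞ t) (h : VanishesToOrder a n t) :
    VanishesToOrder a n (fun z => B (s z) (t z)) := by
  induction n generalizing s t with
  | zero => trivial
  | succ n ih =>
    refine ⟨by simp [h.1], ?_, ?_⟩
    · have e : Dz (fun z => B (s z) (t z)) = fun z => B (Dz s z) (t z) + B (s z) (Dz t z) :=
        funext fun z => Dz_bilin B (Smooth.diff hs z) (Smooth.diff ht z)
      rw [e]
      exact (ih (contDiff_Dz hs) ht h.pred).add (contDiff_bilin B (contDiff_Dz hs) ht)
        (contDiff_bilin B hs (contDiff_Dz ht)) (ih hs (contDiff_Dz ht) h.2.1)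
    · have e : Db (fun z => B (s z) (t z)) = fun z => B (Db s z) (t z) + B (s z) (Db t z) :=
        funext fun z => Db_bilin B (Smooth.diff hs z) (Smooth.diff ht z)
      rw [e]
      exact (ih (contDiff_Db hs) ht h.pred).add (contDiff_bilin B (contDiff_Db hs) ht)
        (contDiff_bilin B hs (contDiff_Db ht)) (ih hs (contDiff_Db ht) h.2.2)

theorem VanishesToOrder.bound {n : ℕ} {s : ℂ → E} (hs : ContDiff ℝ ∞ s)
    (h : VanishesToOrder a n s) :
    ∃ B, ∀ z ∈ Metric.closedBall a 1, ‖s z‖ ≤ B * ‖z - a‖ ^ n := by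
  induction n generalizing s with
  | zero =>
    obtain ⟨B, hB⟩ := (isCompact_closedBall a 1).exists_bound_of_continuousOn
      hs.continuous.continuousOn
    exact ⟨B, fun z hz => by simpa using hB z hz⟩
  | succ n ih =>
    obtain ⟨B1, hB1⟩ := ih (contDiff_Dz hs) h.2.1
    obtain ⟨B2, hB2⟩ := ih (contDiff_Db hs) h.2.2
    have hB0 : 0 ≤ B1 + B2 := by
      have h1 := (norm_nonneg _).trans (hB1 (a + 1) (by simp))
      have h2 := (norm_nonneg _).trans (hB2 (a + 1) (by simp))
      simp at h1 h2
      linarith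
    refine ⟨B1 + B2, fun z hz => ?_⟩
    rw [Metric.mem_closedBall, dist_eq_norm] at hz
    have hbd : ∀ w ∈ Metric.closedBall a ‖z - a‖, ‖fderiv ℝ s w‖ ≤ (B1 + B2) * ‖z - a‖ ^ n := by
      intro w hw
      have hw1 : w ∈ Metric.closedBall a 1 := Metric.closedBall_subset_closedBall hz hw
      rw [Metric.mem_closedBall, dist_eq_norm] at hw
      refine (norm_fderiv_le s w).trans ?_
      calc _ ≤ (B1 + B2) * ‖w - a‖ ^ n := by rw [add_mul]; exact add_le_add (hB1 w hw1) (hB2 w hw1)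
        _ ≤ _ := by gcongr
    have := (convex_closedBall a ‖z - a‖).norm_image_sub_le_of_norm_fderiv_le (𝕜 := ℝ)
      (fun w _ => Smooth.diff hs w) hbd (Metric.mem_closedBall_self (norm_nonneg _))
      (by rw [Metric.mem_closedBall, dist_eq_norm] : z ∈ Metric.closedBall a ‖z - a‖)
    rw [h.1, sub_zero] at this
    calc _ ≤ _ := this
      _ = _ := by ring

/-- When ∂_z̄ s vanishes to the same order as s, the leading Taylor term contains no conjugate
variable. Induction on ∂_z s yields its coefficient, and integrating the monomial divides by n + 1.
-/
theorem VanishesToOrder.exists_leading {n : ℕ} {s : ℂ → E} (hs : ContDiff ℝ ∞ s)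
    (h : VanishesToOrder a n s) (hb : VanishesToOrder a n (Db s)) :
    ∃ c : E, VanishesToOrder a (n + 1) (fun z => s z + -((z - a) ^ n • c)) := by
  induction n generalizing s with
  | zero => exact ⟨s a, by simp, trivial, trivial⟩
  | succ n ih =>
    have hcomm : Db (Dz s) = Dz (Db s) := funext fun z => (Dz_Db_comm hs.contDiffAt).symm
    obtain ⟨c, hc⟩ := ih (contDiff_Dz hs) h.2.1 (by rw [hcomm]; exact hb.2.1)
    have hpow : ∀ z, HasDerivAt (fun z : ℂ => -((z - a) ^ (n + 1) • ((n + 1 : ℂ)⁻¹ • c)))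
        (-((z - a) ^ n • c)) z := by
      intro z
      have h1 : HasDerivAt (fun z : ℂ => (z - a) ^ (n + 1)) ((n + 1) * (z - a) ^ n) z := by
        have := ((hasDerivAt_id z).sub_const a).fun_pow (n + 1)
        simpa using this
      have h2 := (h1.smul_const ((n + 1 : ℂ)⁻¹ • c)).fun_neg
      have e : -((z - a) ^ n • c) = -(((n + 1) * (z - a) ^ n) • ((n + 1 : ℂ)⁻¹ • c)) := by
        have : (n + 1 : ℂ) ≠ 0 := by exact_mod_cast Nat.succ_ne_zero n
        rw [smul_smul]; congr 2
        field_simp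
      rw [e]; exact h2
    refine ⟨(n + 1 : ℂ)⁻¹ • c, by simp [h.1], ?_, ?_⟩
    · have e : Dz (fun z => s z + -((z - a) ^ (n + 1) • ((n + 1 : ℂ)⁻¹ • c))) =
          fun z => Dz s z + -((z - a) ^ n • c) := by
        funext z
        rw [Dz_add (Smooth.diff hs z) ((hpow z).differentiableAt.restrictScalars ℝ),
          Dz_of_differentiableAt (hpow z).differentiableAt, (hpow z).deriv]
      rw [e]; exact hc
    · have e : Db (fun z => s z + -((z - a) ^ (n + 1) • ((n + 1 : ℂ)⁻¹ • c))) = Db s := by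
        funext z
        rw [Db_add (Smooth.diff hs z) ((hpow z).differentiableAt.restrictScalars ℝ),
          Db_of_differentiableAt (hpow z).differentiableAt, add_zero]
      rw [e]; exact hb

end Vanish

/-- A smooth solution of a linear `∂̄`-equation which is not flat at `a` is bounded below by a
power of the distance to `a`. -/
theorem exists_lower_bound {E : Type*} [NormedAddCommGroup E] [NormedSpace ℂ E] {H : ℂ → E}
    (hH : ContDiff ℝ ∞ H) {a : ℂ} (hb : ∀ n, VanishesToOrder a n H → VanishesToOrder a n (Db H))
    (hnf : ∃ n, ¬ VanishesToOrder a n H) :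
    ∃ (m : ℕ) (r δ : ℝ), 0 < r ∧ 0 < δ ∧ ∀ z, ‖z - a‖ < r → δ * ‖z - a‖ ^ m ≤ ‖H z‖ := by
  classical
  obtain ⟨m, hm, hm1⟩ : ∃ m, VanishesToOrder a m H ∧ ¬ VanishesToOrder a (m + 1) H := by
    have h0 := Nat.find_spec hnf
    have hpos : Nat.find hnf ≠ 0 := by
      intro h; rw [h] at h0; exact h0 trivial
    obtain ⟨m, hm⟩ := Nat.exists_eq_succ_of_ne_zero hpos
    refine ⟨m, ?_, ?_⟩
    · have := Nat.find_min hnf (m := m) (by omega)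
      exact not_not.1 this
    · rw [hm] at h0; exact h0
  obtain ⟨c, hc⟩ := hm.exists_leading hH (hb m hm)
  have hpoly : ContDiff ℝ ∞ (fun z : ℂ => -((z - a) ^ m • c)) :=
    (((contDiff_id.sub contDiff_const).pow m).smul contDiff_const).neg
  have hc0 : c ≠ 0 := by
    rintro rfl
    simp only [smul_zero, neg_zero, add_zero] at hc
    exact hm1 hc
  obtain ⟨B, hB⟩ := hc.bound (hH.add hpoly)
  have hcpos : 0 < ‖c‖ := norm_pos_iff.2 hc0
  -- Within this radius the remainder B |z - a|^(m+1) is at most half of the leading term |c| |z -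
  -- a|^m.
  refine ⟨m, min 1 (‖c‖ / (2 * (|B| + 1))), ‖c‖ / 2, by positivity, by positivity, fun z hz => ?_⟩
  have hz1 := (lt_min_iff.1 hz).1
  have hz2 := (lt_min_iff.1 hz).2
  have h1 := hB z (by rw [Metric.mem_closedBall, dist_eq_norm]; exact hz1.le)
  rw [lt_div_iff₀ (by positivity)] at hz2
  have h2 : B * ‖z - a‖ ≤ ‖c‖ / 2 := by
    have := mul_le_mul_of_nonneg_right (le_abs_self B) (norm_nonneg (z - a))
    nlinarith [norm_nonneg (z - a)]
  have h3 : ‖(z - a) ^ m • c‖ ≤ ‖H z‖ + ‖H z + -((z - a) ^ m • c)‖ := by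
    have : (z - a) ^ m • c = H z - (H z + -((z - a) ^ m • c)) := by abel
    conv_lhs => rw [this]
    exact norm_sub_le _ _
  rw [norm_smul, norm_pow] at h3
  have h4 : B * ‖z - a‖ ^ (m + 1) ≤ ‖c‖ / 2 * ‖z - a‖ ^ m := by
    calc _ = B * ‖z - a‖ * ‖z - a‖ ^ m := by ring
      _ ≤ _ := by gcongr
  linarith

namespace IsACLift

variable {F : ℂ → C7}

/-- Unlike `Db_binormal`, this form is linear in H with a smooth coefficient, so ∂_z̄ H vanishes
wherever H does and to at least the same order. -/
theorem Db_binormal' (h : IsACLift F) (z : ℂ) :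
    Db (binormal F) z = (Complex.I / 2) • crossC (conjC (Dz F z)) (binormal F z) := by
  have hx := h.eigen z
  have hy := h.eigen2 z
  have hxb := eigen_conj (h.real z) hx
  have h1 := crossC_crossC_add (conjC (Dz F z)) (Dz F z) (Dz (Dz F) z)
  rw [crossC_anticomm (conjC _) (Dz (Dz F) z), crossC_eigen_eigen_neg hy hxb, crossC_neg_right,
    crossC_smul_right, crossC_eigen_self hx, dotC_eigen_eigen hx hy,
    dotC_comm (conjC (Dz F z)) (Dz F z), dotC_comm (conjC (Dz F z)), ← h.Dz_energy,
    show dotC (Dz F z) (conjC (Dz F z)) = energy F z from rfl] at h1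
  rw [h.Db_binormal, binormal, eq_sub_of_add_eq h1]
  have hI : (Complex.I * Complex.I) • Dz F z = -Dz F z := by
    rw [Complex.I_mul_I, neg_one_smul]
  rw [zero_smul, add_zero]
  have e : (Complex.I * Dz (energy F) z) • -Complex.I • Dz F z = Dz (energy F) z • Dz F z := by
    rw [← neg_eq_iff_eq_neg] at hI
    conv_rhs => rw [← hI]
    module
  rw [e]
  module

/-- If H were flat at a, unique continuation with C = |F_z|² would make it vanish identically. Its
order is thus finite, and its leading term is a nonzero multiple of a power of z - a. -/
theorem exists_lower_bound_binormal (h : IsACLift F) (hne : ∃ z, binormal F z ≠ 0) (a : ℂ) :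
    ∃ (m : ℕ) (r δ : ℝ), 0 < r ∧ 0 < δ ∧
      ∀ z, ‖z - a‖ < r → δ * ‖z - a‖ ^ m ≤ ‖binormal F z‖ := by
  refine exists_lower_bound h.smooth_binormal (fun n hn => ?_) ?_
  · have e : Db (binormal F) = fun z => crossL ((Complex.I / 2) • conjC (Dz F z))
        (binormal F z) := by
      funext z; rw [h.Db_binormal' z, crossL_apply, crossC_smul_left]
    rw [e]
    exact hn.bilin crossL ((contDiff_conjC h.smooth_Dz).const_smul (Complex.I / 2)) h.smooth_binormal
  · by_contra hcon
    push Not at hcon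
    obtain ⟨z, hz⟩ := hne
    refine hz (eq_zero_of_flat h.smooth_binormal h.inner_Db_binormal
      (C := fun z => ‖Dz F z‖ ^ 2) (h.smooth_Dz.continuous.norm.pow 2) (fun w => ?_) a
      (fun n => (hcon n).bound h.smooth_binormal) z)
    have := h.norm_Db_binormal w
    nlinarith [sq_nonneg ‖Db (binormal F) w‖]

theorem exists_lower_bound_Dz (h : IsACLift F) (hne : ∃ z, Dz F z ≠ 0) (a : ℂ) :
    ∃ (m : ℕ) (r δ : ℝ), 0 < r ∧ 0 < δ ∧ ∀ z, ‖z - a‖ < r → δ * ‖z - a‖ ^ m ≤ ‖Dz F z‖ := by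
  refine exists_lower_bound h.smooth_Dz (fun n hn => ?_) ?_
  · have e : Db (Dz F) = fun z => (ContinuousLinearMap.lsmul ℂ ℂ).flip (F z)
        (dotL (-conjC (Dz F z)) (Dz F z)) := by
      funext z
      rw [h.Db_Dz z, dotL_apply, dotC_neg_left, dotC_comm]; rfl
    rw [e]
    exact (hn.bilin dotL (contDiff_conjC h.smooth_Dz).neg h.smooth_Dz).bilin _ h.smooth
      (contDiff_bilin dotL (contDiff_conjC h.smooth_Dz).neg h.smooth_Dz)
  · by_contra hcon
    push Not at hcon
    obtain ⟨z, hz⟩ := hne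
    refine hz (eq_zero_of_flat h.smooth_Dz h.inner_Db_Dz
      (C := fun z => ‖Dz F z‖ ^ 2) (h.smooth_Dz.continuous.norm.pow 2) (fun w => ?_) a
      (fun n => (hcon n).bound h.smooth_Dz) z)
    rw [h.norm_Db_Dz w]
    exact le_of_eq (by ring)

end IsACLift

/-- A subset of the plane without accumulation points is countable. -/
theorem countable_of_isolated {Z : Set ℂ}
    (h : ∀ a, ∃ r > 0, ∀ z ∈ Z, ‖z - a‖ < r → z = a) : Z.Countable := by
  choose r hr hZ using h
  obtain ⟨S, hS, hcov⟩ := TopologicalSpace.countable_cover_nhds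
    (fun a => Metric.ball_mem_nhds a (hr a))
  refine hS.mono fun z hz => ?_
  have : z ∈ ⋃ x ∈ S, Metric.ball x (r x) := hcov ▸ Set.mem_univ z
  obtain ⟨a, ha, hza⟩ := Set.mem_iUnion₂.1 this
  rw [Metric.mem_ball, dist_eq_norm] at hza
  rw [hZ a z hz hza]; exact ha

/-! ### Linear fullness -/

theorem Dz_mul {a b : ℂ → ℂ} {z : ℂ} (ha : DifferentiableAt ℝ a z) (hb : DifferentiableAt ℝ b z) :
    Dz (fun w => a w * b w) z = Dz a z * b z + a z * Dz b z := Dz_smul ha hb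

theorem Db_mul {a b : ℂ → ℂ} {z : ℂ} (ha : DifferentiableAt ℝ a z) (hb : DifferentiableAt ℝ b z) :
    Db (fun w => a w * b w) z = Db a z * b z + a z * Db b z := Db_smul ha hb

theorem chart_surj (c : Bool) (p : OnePoint ℂ) : (∃ z, chart c z = p) ∨ chart (!c) 0 = p := by
  induction p using OnePoint.rec with
  | infty => cases c <;> simp [chart]
  | coe z =>
    cases c
    · left; exact ⟨z, rfl⟩
    · by_cases hz : z = 0
      · right; simp [chart, hz]
      · left; exact ⟨z⁻¹, by simp [chart, hz]⟩

theorem eq_zero_of_ne_zero_eq_zero {E : Type*} [NormedAddCommGroup E] {g : ℂ → E}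
    (hg : Continuous g) (a : ℂ) (h : ∀ z, z ≠ a → g z = 0) : g a = 0 := by
  have hd : Dense ({a}ᶜ : Set ℂ) := dense_compl_singleton a
  have := hd.induction (P := fun z => g z = 0) (fun z hz => h z hz)
    (isClosed_eq hg continuous_const)
  exact this a

theorem IsACLift.continuous {F : ℂ → C7} (h : IsACLift F) : Continuous F := h.smooth.continuous

theorem IsACLift.continuous_dotC {F : ℂ → C7} (h : IsACLift F) (v : C7) :
    Continuous fun z => dotC v (F z) := (dotL v).continuous.comp h.continuous

/-- The image of `F` lies in no complex hyperplane. -/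
def IsFullLift (F : ℂ → C7) : Prop := ∀ v, (∀ z, dotC v (F z) = 0) → v = 0

/-- The annihilator of a real curve is closed under conjugation, so it suffices to treat the real
vectors v + conj v and i (v - conj v). -/
theorem isFullLift_of_real {F : ℂ → C7} (hF : ∀ z, conjC (F z) = F z)
    (h : ∀ v, conjC v = v → (∀ z, dotC v (F z) = 0) → v = 0) : IsFullLift F := by
  intro v hv
  have hv' : ∀ z, dotC (conjC v) (F z) = 0 := fun z => by
    have := congrArg (starRingEnd ℂ) (hv z)
    rwa [conj_dotC, hF, map_zero] at this
  have h1 := h (v + conjC v) (by simp [add_comm]) fun z => by simp [hv, hv']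
  have h2 := h (Complex.I • (v - conjC v)) (by simp; module) fun z => by simp [hv, hv']
  have h3 : v - conjC v = 0 := (smul_eq_zero.1 h2).resolve_left Complex.I_ne_zero
  have h4 : (2 : ℂ) • v = 0 := by
    calc (2 : ℂ) • v = (v + conjC v) + (v - conjC v) := by module
      _ = 0 := by rw [h1, h3, add_zero]
  simpa using h4

theorem isFullLift_coordLift {f : OnePoint ℂ → S6} (hfull : IsLinearlyFull f)
    (hac : IsAlmostComplexCurve f) (c : Bool) : IsFullLift (coordLift f c) := by
  have hP := isACPair_coordLift hac c
  refine isFullLift_of_real hP.left.real fun v hvr hv => ?_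
  set r : R7 := WithLp.toLp 2 fun i => (v i).re with hr
  have hvr' : v = toC r := by
    ext i
    have := congrArg (fun w : C7 => w i) hvr
    simp only [conjC_apply] at this
    simpa [toC, hr] using (Complex.conj_eq_iff_re.1 this).symm
  have hdot : ∀ x : R7, dotC v (toC x) = ((inner ℝ r x : ℝ) : ℂ) := by
    intro x
    rw [hvr']
    simp [dotC, toC, PiLp.inner_apply, mul_comm]
  have hall : ∀ p, inner ℝ r (f p : R7) = 0 := by
    intro p
    have h0 : dotC v (toC (f p)) = 0 := by
      rcases chart_surj c p with ⟨z, rfl⟩ | rfl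
      · exact hv z
      · refine eq_zero_of_ne_zero_eq_zero (hP.right.continuous_dotC v) 0 fun w hw => ?_
        rw [hP.inv w hw]; exact hv _
    rw [hdot] at h0
    exact_mod_cast h0
  have htop := hfull (Submodule.span ℝ {r})ᗮ fun p =>
    Submodule.mem_orthogonal_singleton_iff_inner_right.2 (hall p)
  have hr0 : r = 0 := by
    have : r ∈ (Submodule.span ℝ {r})ᗮ := htop ▸ Submodule.mem_top
    have h2 := Submodule.mem_orthogonal_singleton_iff_inner_right.1 this
    simpa using h2
  rw [hvr', hr0]; ext i; simp [toC]

/-- Two complex equations are four real ones on a seven-dimensional real space. -/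
theorem exists_real_orthogonal (u w : C7) : ∃ v : C7, v ≠ 0 ∧ conjC v = v ∧ dotC v u = 0 ∧
    dotC v w = 0 := by
  let L : R7 →ₗ[ℝ] ℂ × ℂ :=
    { toFun := fun r => (dotC (toC r) u, dotC (toC r) w)
      map_add' := fun x y => by
        have : toC (x + y) = toC x + toC y := toCL.map_add x y
        simp [this]
      map_smul' := fun c x => by
        have : toC (c • x) = (c : ℂ) • toC x := by ext i; simp [toC]
        simp only [this, dotC_smul_left]; rfl }
  have hker : LinearMap.ker L ≠ ⊥ := by
    apply LinearMap.ker_ne_bot_of_finrank_lt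
    simp [Complex.finrank_real_complex]
  obtain ⟨r, hr, hr0⟩ := Submodule.exists_mem_ne_zero_of_ne_bot hker
  have hr' : (dotC (toC r) u, dotC (toC r) w) = 0 := hr
  rw [Prod.mk_eq_zero] at hr'
  refine ⟨toC r, fun h => hr0 ?_, by ext i; simp [toC], hr'.1, hr'.2⟩
  ext i
  have := congrArg (fun w : C7 => w i) h
  simpa [toC] using this

theorem IsACLift.Dz_ne_zero {F : ℂ → C7} (h : IsACLift F) (hfull : IsFullLift F) :
    ∃ z, Dz F z ≠ 0 := by
  by_contra hcon
  push Not at hcon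
  obtain ⟨v, hv0, -, hv, -⟩ := exists_real_orthogonal (F 0) 0
  refine hv0 (hfull v fun z => ?_)
  have hc : F z = F 0 := by
    refine is_const_of_fderiv_eq_zero (𝕜 := ℝ) (h.smooth.differentiable (by simp)) (fun w => ?_) z 0
    ext1 v
    rw [fderiv_eq_Dz_Db, h.Db_eq, hcon]; simp
  rw [hc, hv]

/-- If H vanished identically, F_zz would be parallel to F_z and the span of F, F_z, conj F_z would
not vary. A real vector orthogonal to it at one point would stay orthogonal to the curve,
contradicting fullness. -/
theorem IsACLift.binormal_ne_zero {F : ℂ → C7} (h : IsACLift F) (hfull : IsFullLift F) :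
    ∃ z, binormal F z ≠ 0 := by
  by_contra hcon
  push Not at hcon
  have hX := h.Dz_ne_zero hfull
  obtain ⟨z₀, hz₀⟩ := hX
  -- Removing a countable set from the plane leaves a connected dense set, on which a function with
  -- zero derivative is constant.
  have hZ : {z | Dz F z = 0}.Countable := by
    refine countable_of_isolated fun a => ?_
    obtain ⟨m, r, δ, hr, hδ, hb⟩ := h.exists_lower_bound_Dz ⟨z₀, hz₀⟩ a
    refine ⟨r, hr, fun z hz hza => ?_⟩
    have h1 := hb z hza
    rw [Set.mem_ofPred_eq] at hz
    rw [hz, norm_zero] at h1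
    by_contra hne
    have : 0 < δ * ‖z - a‖ ^ m := mul_pos hδ (pow_pos (norm_pos_iff.2 (sub_ne_zero.2 hne)) _)
    linarith
  set Ω : Set ℂ := {z | Dz F z = 0}ᶜ with hΩ
  have hΩo : IsOpen Ω := (isClosed_eq h.smooth_Dz.continuous continuous_const).isOpen_compl
  have hΩc : IsPreconnected Ω :=
    (hZ.isPathConnected_compl_of_one_lt_rank (by simp)).isConnected.isPreconnected
  have hΩd : Dense Ω := hZ.dense_compl ℝ
  have hen : ∀ z ∈ Ω, energy F z ≠ 0 := by
    intro z hz
    rw [energy_eq]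
    have : Dz F z ≠ 0 := hz
    simpa using this
  have hpar : ∀ z, energy F z • Dz (Dz F) z = Dz (energy F) z • Dz F z := by
    intro z
    have hc := congrArg conjC (hcon z)
    rw [binormal, conjC_crossC, conjC_zero] at hc
    have h1 := parallel_of_crossC_eq_zero (h.real z) (eigen_conj (h.real z) (h.eigen z))
      (eigen_conj (h.real z) (h.eigen2 z)) hc
    rw [conjC_conjC] at h1
    have h2 := congrArg conjC h1
    rw [conjC_smul, conjC_smul, conjC_conjC, conjC_conjC, conj_dotC, conj_dotC, conjC_conjC,
      conjC_conjC, dotC_comm, dotC_comm _ (Dz (Dz F) z), ← h.Dz_energy] at h2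
    exact h2
  obtain ⟨v, hv0, hvr, hvF, hvX⟩ := exists_real_orthogonal (F z₀) (Dz F z₀)
  refine hv0 (hfull v ?_)
  set u : ℂ → ℂ := fun z => dotC v (F z) with hu
  set p : ℂ → ℂ := fun z => dotC v (Dz F z) with hp
  set q : ℂ → ℂ := fun z => dotC v (conjC (Dz F z)) with hq
  have hcs : ContDiff ℝ ∞ fun _ : ℂ => v := contDiff_const
  have hus : ContDiff ℝ ∞ u := contDiff_dotC hcs h.smooth
  have hps : ContDiff ℝ ∞ p := contDiff_dotC hcs h.smooth_Dz
  have hqs : ContDiff ℝ ∞ q := contDiff_dotC hcs (contDiff_conjC h.smooth_Dz)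
  have hDdot : ∀ (s : ℂ → C7) (z : ℂ), DifferentiableAt ℝ s z →
      Dz (fun z => dotC v (s z)) z = dotC v (Dz s z) := fun s z hs => Dz_clm (dotL v) hs
  have hBdot : ∀ (s : ℂ → C7) (z : ℂ), DifferentiableAt ℝ s z →
      Db (fun z => dotC v (s z)) z = dotC v (Db s z) := fun s z hs => Db_clm (dotL v) hs
  have hXd := fun z => Smooth.diff h.smooth_Dz z
  have hXcd := fun z => Smooth.diff (contDiff_conjC h.smooth_Dz) z
  have d1 : ∀ z, Dz u z = p z := fun z => hDdot _ z (Smooth.diff h.smooth z)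
  have d2 : ∀ z, Db u z = q z := fun z => by
    rw [hu, hBdot _ z (Smooth.diff h.smooth z), h.Db_eq]
  have d3 : ∀ z, energy F z * Dz p z = Dz (energy F) z * p z := fun z => by
    rw [hp, hDdot _ z (hXd z), ← dotC_smul_right, hpar, dotC_smul_right]
  have d4 : ∀ z, Db p z = -energy F z * u z := fun z => by
    rw [hp, hBdot _ z (hXd z), h.Db_Dz, dotC_smul_right]
  have d5 : ∀ z, Dz q z = -energy F z * u z := fun z => by
    rw [hq, hDdot _ z (hXcd z), h.Dz_conj_Dz, dotC_smul_right]
  have d6 : ∀ z, energy F z * Db q z = Db (energy F) z * q z := fun z => by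
    have h2 := congrArg conjC (hpar z)
    rw [conjC_smul, conjC_smul, h.Dz_energy, conj_dotC, conjC_conjC,
      dotC_comm (conjC (Dz (Dz F) z)), ← h.Db_energy, energy_eq, Complex.conj_ofReal,
      ← energy_eq] at h2
    rw [hq, hBdot _ z (hXcd z), h.Db_conj_Dz, ← dotC_smul_right, h2, dotC_smul_right]
  have hes := h.smooth_energy
  -- The quotient M / |F_z|² is the squared length of the projection of v to the span of F, F_z and
  -- conj F_z. It is constant, and it vanishes at the base point.
  set M : ℂ → ℂ := fun z => u z * u z * energy F z + 2 * (p z * q z) with hM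
  have ed := fun z => Smooth.diff hes z
  have ud := fun z => Smooth.diff hus z
  have pd := fun z => Smooth.diff hps z
  have qd := fun z => Smooth.diff hqs z
  have hMs : ContDiff ℝ ∞ M :=
    ((hus.mul hus).mul hes).add (contDiff_const.mul (hps.mul hqs))
  have md := fun z => Smooth.diff hMs z
  have hDM : ∀ z, energy F z * Dz M z = Dz (energy F) z * M z := by
    intro z
    rw [hM, Dz_add (((ud z).fun_mul (ud z)).fun_mul (ed z))
      (((pd z).fun_mul (qd z)).const_mul 2), Dz_mul ((ud z).fun_mul (ud z)) (ed z),
      Dz_mul (ud z) (ud z), Dz_mul (differentiableAt_const _) ((pd z).fun_mul (qd z)),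
      Dz_mul (pd z) (qd z), Dz_const, d1, d5]
    linear_combination 2 * q z * d3 z
  have hBM : ∀ z, energy F z * Db M z = Db (energy F) z * M z := by
    intro z
    rw [hM, Db_add (((ud z).fun_mul (ud z)).fun_mul (ed z))
      (((pd z).fun_mul (qd z)).const_mul 2), Db_mul ((ud z).fun_mul (ud z)) (ed z),
      Db_mul (ud z) (ud z), Db_mul (differentiableAt_const _) ((pd z).fun_mul (qd z)),
      Db_mul (pd z) (qd z), Db_const, d2, d4]
    linear_combination 2 * p z * d6 z
  have hMe : ∀ z ∈ Ω, M z = 0 := by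
    have hder : ∀ z ∈ Ω, fderiv ℝ (fun w => M w * (energy F w)⁻¹) z = 0 := by
      intro z hz
      have he := hen z hz
      have hi : DifferentiableAt ℝ (fun w => (energy F w)⁻¹) z := (ed z).fun_inv he
      have k1 : Dz (fun w => energy F w * (energy F w)⁻¹) z = 0 := by
        have : (fun w => energy F w * (energy F w)⁻¹) =ᶠ[𝓝 z] fun _ => 1 := by
          filter_upwards [hΩo.mem_nhds hz] with w hw
          exact mul_inv_cancel₀ (hen w hw)
        rw [Dz_congr this, Dz_const]
      have k2 : Db (fun w => energy F w * (energy F w)⁻¹) z = 0 := by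
        have : (fun w => energy F w * (energy F w)⁻¹) =ᶠ[𝓝 z] fun _ => 1 := by
          filter_upwards [hΩo.mem_nhds hz] with w hw
          exact mul_inv_cancel₀ (hen w hw)
        rw [Db_congr this, Db_const]
      rw [Dz_mul (ed z) hi] at k1
      rw [Db_mul (ed z) hi] at k2
      ext1 w
      rw [fderiv_eq_Dz_Db, Dz_mul (md z) hi, Db_mul (md z) hi]
      have l1 : Dz M z * (energy F z)⁻¹ + M z * Dz (fun w => (energy F w)⁻¹) z = 0 := by
        apply mul_left_cancel₀ he
        linear_combination (energy F z)⁻¹ * hDM z + M z * k1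
      have l2 : Db M z * (energy F z)⁻¹ + M z * Db (fun w => (energy F w)⁻¹) z = 0 := by
        apply mul_left_cancel₀ he
        linear_combination (energy F z)⁻¹ * hBM z + M z * k2
      rw [l1, l2]; simp
    have hdiff : DifferentiableOn ℝ (fun w => M w * (energy F w)⁻¹) Ω := fun z hz =>
      ((md z).fun_mul ((ed z).fun_inv (hen z hz))).differentiableWithinAt
    obtain ⟨a, ha⟩ := hΩo.exists_is_const_of_fderiv_eq_zero hΩc hdiff hder
    intro z hz
    have h0 := ha z₀ hz₀
    have hM0 : M z₀ = 0 := by simp [hM, hu, hp, hvF, hvX]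
    rw [hM0, zero_mul] at h0
    have h1 := ha z hz
    rw [← h0] at h1
    exact (mul_eq_zero.1 h1).resolve_right (inv_ne_zero (hen z hz))
  have hue : ∀ z ∈ Ω, u z = 0 := by
    intro z hz
    have h1 := hMe z hz
    have hq' : q z = starRingEnd ℂ (p z) := by rw [hp, conj_dotC, hvr]
    have hu' : u z = ((u z).re : ℂ) := by
      refine (Complex.conj_eq_iff_re.1 ?_).symm
      rw [hu, conj_dotC, hvr, h.real]
    simp only [hM, hq', Complex.mul_conj] at h1
    rw [energy_eq, hu'] at h1
    have h2 : (u z).re * (u z).re * ‖Dz F z‖ ^ 2 + 2 * Complex.normSq (p z) = 0 := by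
      exact_mod_cast h1
    have h3 : 0 < ‖Dz F z‖ ^ 2 := by
      have : Dz F z ≠ 0 := hz
      positivity
    have h4 : (u z).re * (u z).re * ‖Dz F z‖ ^ 2 ≤ 0 := by
      linarith [Complex.normSq_nonneg (p z)]
    have h5 : (u z).re * (u z).re ≤ 0 := by
      by_contra hc; push Not at hc
      exact absurd (mul_pos hc h3) (not_lt.2 h4)
    rw [hu', mul_self_eq_zero.1 (le_antisymm h5 (mul_self_nonneg _)), Complex.ofReal_zero]
  intro z
  exact hΩd.induction (P := fun z => u z = 0) (fun z hz => hue z hz)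
    (isClosed_eq hus.continuous continuous_const) z

/-! ### Polynomial vectors -/

open Polynomial in
-- Cauchy's estimates on circles of growing radius kill the Taylor coefficients of degree greater
-- than M.
theorem exists_polynomial_of_growth {g : ℂ → ℂ} (hg : Differentiable ℂ g) {M : ℕ} {C R : ℝ}
    (h : ∀ z, R ≤ ‖z‖ → ‖g z‖ ≤ C * ‖z‖ ^ M) : ∃ p : ℂ[X], ∀ z, g z = p.eval z := by
  have hder : ∀ n, M < n → iteratedDeriv n g 0 = 0 := by
    intro n hn
    have hb : ∀ r : ℝ, max R 1 ≤ r → ‖iteratedDeriv n g 0‖ ≤ n.factorial * C * r⁻¹ := by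
      intro r hr
      have hr1 : 1 ≤ r := (le_max_right _ _).trans hr
      have hr0 : 0 < r := by linarith
      have h1 := Complex.norm_iteratedDeriv_le_of_forall_mem_sphere_norm_le (c := 0) (C := C * r ^ M)
        n hr0 hg.diffContOnCl (fun z hz => by
          have hz' : ‖z‖ = r := by simpa using hz
          simpa [hz'] using h z (by rw [hz']; exact (le_max_left _ _).trans hr))
      have hC : 0 ≤ C := by
        have h2 := (norm_nonneg _).trans (h (r : ℂ) (by
          rw [Complex.norm_real, Real.norm_of_nonneg hr0.le]; exact (le_max_left _ _).trans hr))
        rw [Complex.norm_real, Real.norm_of_nonneg hr0.le] at h2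
        exact nonneg_of_mul_nonneg_left h2 (by positivity)
      refine h1.trans ?_
      rw [mul_div_assoc, mul_assoc, mul_div_assoc]
      gcongr
      obtain ⟨d, rfl⟩ := Nat.exists_eq_add_of_lt hn
      rw [div_le_iff₀ (by positivity), show M + d + 1 = 1 + (M + d) by ring, pow_add, pow_one,
        inv_mul_cancel_left₀ hr0.ne']
      exact pow_le_pow_right₀ hr1 (by omega)
    have ht : Filter.Tendsto (fun r : ℝ => n.factorial * C * r⁻¹) Filter.atTop (𝓝 0) := by
      simpa using tendsto_inv_atTop_zero.const_mul ((n.factorial : ℝ) * C)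
    have := ge_of_tendsto ht ((Filter.eventually_ge_atTop (max R 1)).mono hb)
    simpa using this
  refine ⟨∑ n ∈ Finset.range (M + 1), Polynomial.C ((n.factorial : ℂ)⁻¹ * iteratedDeriv n g 0) *
    X ^ n, fun z => ?_⟩
  rw [← Complex.taylorSeries_eq_of_entire' (c := 0) (z := z) hg,
    tsum_eq_sum (s := Finset.range (M + 1)) (fun n hn => by
      rw [hder n (by simpa [Nat.lt_succ_iff] using hn)]; simp)]
  simp [eval_finsetSum]

open Polynomial in
/-- A vector function which is holomorphic off a finite set, with poles there, and which has
polynomial growth, is rational. -/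
theorem exists_rational {k : ℂ → C7} (Z : Finset ℂ)
    (hk : ∀ z, z ∉ Z → DifferentiableAt ℂ k z) (hk0 : ∀ z ∈ Z, k z = 0)
    (hpole : ∀ a, ∃ (m : ℕ) (r C : ℝ), 0 < r ∧ ∀ z, ‖z - a‖ < r → ‖z - a‖ ^ m * ‖k z‖ ≤ C)
    {M : ℕ} {C R : ℝ} (hinf : ∀ z, R ≤ ‖z‖ → ‖k z‖ ≤ C * ‖z‖ ^ M) :
    ∃ (q : ℂ[X]) (p : Fin 7 → ℂ[X]), (∀ z, z ∉ Z → q.eval z ≠ 0) ∧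
      ∀ z i, q.eval z * k z i = (p i).eval z := by
  choose m r B hr hB using hpole
  -- One factor more than the pole order makes q k tend to 0 at each point of Z. This matches the
  -- value 0 prescribed there, so the singularity is removable without redefining k.
  set q : ℂ[X] := ∏ a ∈ Z, (X - Polynomial.C a) ^ (m a + 1) with hq
  have hqe : ∀ z, q.eval z = ∏ a ∈ Z, (z - a) ^ (m a + 1) := fun z => by
    simp [hq, eval_prod]
  have hd : Differentiable ℂ fun z => q.eval z • k z := by
    intro z
    by_cases hz : z ∈ Z
    · refine (Complex.analyticAt_of_differentiable_on_punctured_nhds_of_continuousAt ?_ ?_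
        ).differentiableAt
      · have h1 : ∀ᶠ w in 𝓝[≠] z, w ∉ Z.erase z :=
          nhdsWithin_le_nhds ((Z.erase z).finite_toSet.isClosed.isOpen_compl.mem_nhds (by simp))
        filter_upwards [h1, self_mem_nhdsWithin] with w hw hwz
        refine (q.differentiable w).smul (hk w fun h => hw ?_)
        exact Finset.mem_erase.2 ⟨hwz, h⟩
      · rw [ContinuousAt, hk0 z hz, smul_zero]
        have hb : ∀ᶠ w in 𝓝 z, ‖q.eval w • k w‖ ≤
            ‖∏ a ∈ Z.erase z, (w - a) ^ (m a + 1)‖ * (‖w - z‖ * B z) := by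
          filter_upwards [Metric.ball_mem_nhds z (hr z)] with w hw
          rw [Metric.mem_ball, dist_eq_norm] at hw
          rw [norm_smul, hqe, ← Finset.mul_prod_erase Z _ hz, norm_mul, norm_pow, pow_succ]
          have := hB z w hw
          calc _ = ‖∏ a ∈ Z.erase z, (w - a) ^ (m a + 1)‖ * (‖w - z‖ *
                (‖w - z‖ ^ m z * ‖k w‖)) := by ring
            _ ≤ _ := by gcongr
        refine squeeze_zero_norm' hb ?_
        have hc : Continuous fun w => ‖∏ a ∈ Z.erase z, (w - a) ^ (m a + 1)‖ * (‖w - z‖ * B z) := by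
          fun_prop
        simpa using hc.tendsto z
    · exact (q.differentiable z).smul (hk z hz)
  have hgrow : ∀ z, max R 1 ≤ ‖z‖ → ‖q.eval z • k z‖ ≤ ((∏ a ∈ Z, (‖a‖ + 1) ^ (m a + 1)) * C) *
      ‖z‖ ^ ((∑ a ∈ Z, (m a + 1)) + M) := by
    intro z hz
    have h1 : 1 ≤ ‖z‖ := (le_max_right _ _).trans hz
    have h2 := hinf z ((le_max_left _ _).trans hz)
    have h3 : ‖q.eval z‖ ≤ (∏ a ∈ Z, (‖a‖ + 1) ^ (m a + 1)) * ‖z‖ ^ (∑ a ∈ Z, (m a + 1)) := by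
      rw [hqe, ← Finset.prod_pow_eq_pow_sum, ← Finset.prod_mul_distrib, norm_prod]
      refine Finset.prod_le_prod (fun _ _ => norm_nonneg _) fun a _ => ?_
      rw [norm_pow, ← mul_pow]
      gcongr
      calc ‖z - a‖ ≤ ‖z‖ + ‖a‖ := norm_sub_le _ _
        _ ≤ (‖a‖ + 1) * ‖z‖ := by nlinarith [norm_nonneg a]
    rw [norm_smul]
    calc _ ≤ ((∏ a ∈ Z, (‖a‖ + 1) ^ (m a + 1)) * ‖z‖ ^ (∑ a ∈ Z, (m a + 1))) * (C * ‖z‖ ^ M) :=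
          mul_le_mul h3 h2 (norm_nonneg _) (by positivity)
      _ = _ := by rw [pow_add]; ring
  have hcomp : ∀ i, ∃ p : ℂ[X], ∀ z, q.eval z * k z i = p.eval z := by
    intro i
    refine exists_polynomial_of_growth (g := fun z => q.eval z * k z i) (fun z => ?_)
      (fun z hz => le_trans ?_ (hgrow z hz))
    · exact ((EuclideanSpace.proj (𝕜 := ℂ) i).differentiableAt).comp z (hd z)
    · exact PiLp.norm_apply_le (q.eval z • k z) i
  choose p hp using hcomp
  refine ⟨q, p, fun z hz => ?_, fun z i => hp i z⟩
  rw [hqe, Finset.prod_ne_zero_iff]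
  intro a ha
  exact pow_ne_zero _ (sub_ne_zero.2 fun h => hz (h ▸ ha))

open Polynomial in
-- The factor d generates the ideal of the components; dividing its expression in terms of them by d
-- is the Bézout identity.
theorem exists_coprime_factor {n : ℕ} {g : Fin n → ℂ[X]} (hg : ∃ i, g i ≠ 0) :
    ∃ (d : ℂ[X]) (p a : Fin n → ℂ[X]), (∀ i, g i = d * p i) ∧ ∑ i, a i * p i = 1 := by
  obtain ⟨d, hd⟩ := (IsPrincipalIdealRing.principal (Ideal.span (Set.range g))).principal
  have hdiv : ∀ i, ∃ p, g i = d * p := fun i => by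
    have : g i ∈ Ideal.span {d} := by
      have := Ideal.subset_span (Set.mem_range_self (f := g) i)
      rwa [hd] at this
    exact Ideal.mem_span_singleton.1 this
  choose p hp using hdiv
  have hmem : d ∈ Ideal.span (Set.range g) := by
    rw [hd]; exact Submodule.mem_span_singleton_self d
  obtain ⟨a, ha⟩ := Ideal.mem_span_range_iff_exists_fun.1 hmem
  refine ⟨d, p, a, hp, ?_⟩
  have hd0 : d ≠ 0 := by
    rintro rfl
    obtain ⟨i, hi⟩ := hg
    exact hi (by rw [hp i, zero_mul])
  apply mul_left_cancel₀ hd0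
  rw [mul_one, Finset.mul_sum]
  conv_rhs => rw [← ha]
  refine Finset.sum_congr rfl fun i _ => ?_
  rw [hp i]; ring

open Polynomial in
/-- The map `ℂ → ℂ⁷` given by seven polynomials. -/
def pvec (p : Fin 7 → ℂ[X]) (z : ℂ) : C7 := WithLp.toLp 2 fun i => (p i).eval z

open Polynomial in
/-- Componentwise derivative of a vector of polynomials. -/
def pderiv (p : Fin 7 → ℂ[X]) : Fin 7 → ℂ[X] := fun i => derivative (p i)

section
open Polynomial

variable (p : Fin 7 → ℂ[X])

@[simp] theorem pvec_apply (z : ℂ) (i : Fin 7) : pvec p z i = (p i).eval z := rfl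

theorem hasDerivAt_pvec (z : ℂ) : HasDerivAt (pvec p) (pvec (pderiv p) z) z := by
  have h : HasDerivAt (fun z i => (p i).eval z) (fun i => (pderiv p i).eval z) z :=
    hasDerivAt_pi.2 fun i => (p i).hasDerivAt z
  exact ((PiLp.continuousLinearEquiv 2 ℂ fun _ : Fin 7 => ℂ).symm.toContinuousLinearMap.hasFDerivAt
    ).comp_hasDerivAt z h

theorem differentiable_pvec : Differentiable ℂ (pvec p) := fun z =>
  (hasDerivAt_pvec p z).differentiableAt

theorem continuous_pvec : Continuous (pvec p) := (differentiable_pvec p).continuous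

theorem deriv_pvec : deriv (pvec p) = pvec (pderiv p) := funext fun z => (hasDerivAt_pvec p z).deriv

theorem iteratedDeriv_pvec (n : ℕ) : iteratedDeriv n (pvec p) = pvec (pderiv^[n] p) := by
  induction n generalizing p with
  | zero => simp
  | succ n ih => rw [iteratedDeriv_succ', deriv_pvec, ih, Function.iterate_succ_apply]

theorem contDiff_pvec {n : WithTop ℕ∞} : ContDiff ℂ n (pvec p) := by
  exact (differentiable_pvec p).contDiff

theorem smooth_pvec : ContDiff ℝ ∞ (pvec p) := (contDiff_pvec p).restrict_scalars ℝ

theorem Dz_pvec (z : ℂ) : Dz (pvec p) z = pvec (pderiv p) z := by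
  rw [Dz_of_differentiableAt (differentiable_pvec p z), deriv_pvec]

end

/-! ### The polynomial of the directrix curve -/

open Polynomial in
/-- `p` is a polynomial vector without zeros which spans the line of the conjugate of the
binormal of `F`. -/
structure IsDirectrixPoly (F : ℂ → C7) (p : Fin 7 → ℂ[X]) : Prop where
  bezout : ∃ a : Fin 7 → ℂ[X], ∑ i, a i * p i = 1
  parallel : ∀ z, binormal F z ≠ 0 → ∃ κ : ℂ, pvec p z = κ • conjC (binormal F z)

theorem IsACLift.isolated_binormal {F : ℂ → C7} (h : IsACLift F) (hne : ∃ z, binormal F z ≠ 0)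
    (a : ℂ) : ∃ r > 0, ∀ z ∈ {z | binormal F z = 0}, ‖z - a‖ < r → z = a := by
  obtain ⟨m, r, δ, hr, hδ, hb⟩ := h.exists_lower_bound_binormal hne a
  refine ⟨r, hr, fun z hz hza => ?_⟩
  have h1 := hb z hza
  rw [Set.mem_ofPred_eq] at hz
  rw [hz, norm_zero] at h1
  by_contra hn
  have : 0 < δ * ‖z - a‖ ^ m := mul_pos hδ (pow_pos (norm_pos_iff.2 (sub_ne_zero.2 hn)) _)
  linarith

theorem IsACLift.dense_binormal {F : ℂ → C7} (h : IsACLift F) (hne : ∃ z, binormal F z ≠ 0) :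
    Dense {z | binormal F z ≠ 0} :=
  (countable_of_isolated (h.isolated_binormal hne)).dense_compl ℝ

theorem norm_normalized (v : C7) : ‖(dotC (conjC v) v)⁻¹ • conjC v‖ = ‖v‖⁻¹ := by
  rw [norm_smul, dotC_conjC_self, norm_inv, norm_conjC, Complex.norm_real, norm_pow, norm_norm]
  by_cases hv : ‖v‖ = 0
  · simp [hv]
  · field_simp

/-- The map conj H / |H|² has norm 1/|H|. Lower bounds for |H| near finite points limit its poles,
and the lower bound in the other chart limits its growth at infinity. It is hence rational, and
removing the common factor of the numerators leaves a vector without zeros. -/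
theorem IsACPair.exists_directrixPoly {F G : ℂ → C7} (hP : IsACPair F G) (hfull : IsFullLift F) :
    ∃ p, IsDirectrixPoly F p := by
  have hne := hP.left.binormal_ne_zero hfull
  have hneG : ∃ w, binormal G w ≠ 0 := by
    by_contra hcon
    push Not at hcon
    have h1 : ∀ z, z ≠ 0 → binormal F z = 0 := fun z hz => by
      rw [hP.symm.binormal_eq hz, hcon, smul_zero]
    obtain ⟨z, hz⟩ := hne
    by_cases h0 : z = 0
    · subst h0
      exact hz (eq_zero_of_ne_zero_eq_zero hP.left.smooth_binormal.continuous 0 h1)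
    · exact hz (h1 z h0)
  obtain ⟨m, r, δ, hr, hδ, hb⟩ := hP.right.exists_lower_bound_binormal hneG 0
  -- The extra exponent 6 is the weight of the binormal under the change of coordinate.
  have hlow : ∀ z : ℂ, r⁻¹ + 1 ≤ ‖z‖ → δ ≤ ‖binormal F z‖ * ‖z‖ ^ (m + 6) := by
    intro z hz
    have hz0 : 0 < ‖z‖ := lt_of_lt_of_le (by positivity) hz
    have hz1 : z ≠ 0 := norm_pos_iff.1 hz0
    have h1 := hb z⁻¹ (by
      rw [sub_zero, norm_inv]
      exact inv_lt_of_inv_lt₀ hr (by linarith))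
    rw [hP.binormal_eq (inv_ne_zero hz1), inv_inv, sub_zero, norm_smul, norm_neg, inv_pow, inv_inv,
      norm_pow, norm_inv, inv_pow, ← div_eq_mul_inv, div_le_iff₀ (by positivity)] at h1
    calc δ ≤ _ := h1
      _ = _ := by rw [pow_add]; ring
  have hfin : {z | binormal F z = 0}.Finite := by
    have hsub : {z | binormal F z = 0} ⊆ Metric.closedBall 0 (r⁻¹ + 1) := by
      intro z hz
      rw [mem_closedBall_zero_iff]
      by_contra hc
      push Not at hc
      have h1 := hlow z hc.le
      rw [Set.mem_ofPred_eq] at hz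
      rw [hz, norm_zero, zero_mul] at h1
      linarith
    have hcomp : IsCompact {z | binormal F z = 0} :=
      (isCompact_closedBall (0 : ℂ) (r⁻¹ + 1)).of_isClosed_subset
        (isClosed_eq hP.left.smooth_binormal.continuous continuous_const) hsub
    refine hcomp.finite (isDiscrete_iff_forall_mem_exists_isOpen.2 fun a ha => ?_)
    obtain ⟨r, hr, hZ⟩ := hP.left.isolated_binormal hne a
    refine ⟨Metric.ball a r, Metric.isOpen_ball, ?_⟩
    ext z
    constructor
    · rintro ⟨h1, h2⟩
      exact hZ z h2 (by rwa [Metric.mem_ball, dist_eq_norm] at h1)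
    · rintro rfl
      exact ⟨Metric.mem_ball_self hr, ha⟩
  set k : ℂ → C7 := fun w => (dotC (conjC (binormal F w)) (binormal F w))⁻¹ •
      conjC (binormal F w) with hk
  have hkn : ∀ z, ‖k z‖ = ‖binormal F z‖⁻¹ := fun z => norm_normalized _
  obtain ⟨q, g, hq, hg⟩ := exists_rational (k := k) hfin.toFinset
    (fun z hz => hP.differentiableAt_normalized (by simpa using hz))
    (fun z hz => by
      have hz' : binormal F z = 0 := by simpa using hz
      simp [hk, hz'])
    (fun a => by
      obtain ⟨m, r, δ, hr, hδ, hb⟩ := hP.left.exists_lower_bound_binormal hne a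
      refine ⟨m, r, δ⁻¹, hr, fun z hz => ?_⟩
      have h1 := hb z hz
      rw [hkn]
      by_cases h0 : ‖binormal F z‖ = 0
      · rw [h0, inv_zero, mul_zero]; positivity
      · rw [← div_eq_mul_inv, div_le_iff₀ (lt_of_le_of_ne (norm_nonneg _) (Ne.symm h0)),
          inv_mul_eq_div, le_div_iff₀ hδ]
        linarith)
    (M := m + 6) (C := δ⁻¹) (R := r⁻¹ + 1) (fun z hz => by
      have h1 := hlow z hz
      rw [hkn]
      by_cases h0 : ‖binormal F z‖ = 0
      · rw [h0, inv_zero]; positivity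
      · rw [inv_le_comm₀ (lt_of_le_of_ne (norm_nonneg _) (Ne.symm h0)) (by
          have : 0 < ‖z‖ := lt_of_lt_of_le (by positivity) hz
          positivity), mul_inv, inv_inv]
        have : 0 < ‖z‖ := lt_of_lt_of_le (by positivity) hz
        rw [← div_eq_mul_inv, div_le_iff₀ (by positivity)]
        exact h1)
  have hg' : ∀ z, q.eval z • k z = pvec g z := fun z => by ext i; exact hg z i
  obtain ⟨z₀, hz₀⟩ := hne
  have hkz : ∀ z, binormal F z ≠ 0 → k z ≠ 0 := fun z hz => by
    rw [← norm_ne_zero_iff, hkn]; exact inv_ne_zero (norm_ne_zero_iff.2 hz)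
  have hqz : ∀ z, binormal F z ≠ 0 → q.eval z ≠ 0 := fun z hz => hq z (by simpa using hz)
  have hgne : ∃ i, g i ≠ 0 := by
    by_contra hcon
    push Not at hcon
    have h1 := hg' z₀
    have h2 : pvec g z₀ = 0 := by ext i; simp [hcon i]
    rw [h2] at h1
    exact (smul_ne_zero (hqz _ hz₀) (hkz _ hz₀)) h1
  obtain ⟨d, p, a, hdp, hap⟩ := exists_coprime_factor hgne
  refine ⟨p, ⟨a, hap⟩, fun z hz => ?_⟩
  have h1 : d.eval z • pvec p z = q.eval z • k z := by
    rw [hg']; ext i; simp [hdp i]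
  have hdz : d.eval z ≠ 0 := by
    intro h0
    rw [h0, zero_smul] at h1
    exact (smul_ne_zero (hqz _ hz) (hkz _ hz)) h1.symm
  refine ⟨(d.eval z)⁻¹ * q.eval z * (dotC (conjC (binormal F z)) (binormal F z))⁻¹, ?_⟩
  rw [mul_smul, mul_smul]
  change _ = (d.eval z)⁻¹ • q.eval z • k z
  rw [← h1, smul_smul, inv_mul_cancel₀ hdz, one_smul]

theorem eq_zero_of_dense {E : Type*} [NormedAddCommGroup E] {S : Set ℂ} (hS : Dense S) {g : ℂ → E}
    (hg : Continuous g) (h : ∀ z ∈ S, g z = 0) (z : ℂ) : g z = 0 :=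
  hS.induction (P := fun z => g z = 0) h (isClosed_eq hg continuous_const) z

namespace IsDirectrixPoly

open Polynomial

variable {F : ℂ → C7} {p : Fin 7 → ℂ[X]}

theorem ne_zero (hp : IsDirectrixPoly F p) (z : ℂ) : pvec p z ≠ 0 := by
  intro h0
  obtain ⟨a, ha⟩ := hp.bezout
  have h1 := congrArg (Polynomial.eval z) ha
  have h2 : ∀ i, (p i).eval z = 0 := fun i => by
    rw [← pvec_apply, h0]; rfl
  simp [eval_finsetSum, h2] at h1

theorem exists_smooth (hF : IsACLift F) (hp : IsDirectrixPoly F p) :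
    ∃ κ : ℂ → ℂ, ∀ z, binormal F z ≠ 0 → ContDiffAt ℝ ∞ κ z ∧ κ z ≠ 0 ∧
      pvec p z = κ z • conjC (binormal F z) := by
  set q : ℂ → ℂ := fun z => dotC (conjC (binormal F z)) (binormal F z) with hq
  refine ⟨fun z => dotC (pvec p z) (binormal F z) * (q z)⁻¹, fun z hz => ?_⟩
  have hqz : q z ≠ 0 := by
    simp only [hq, dotC_conjC_self]; simpa using hz
  have hqs : ContDiff ℝ ∞ q := contDiff_dotC (contDiff_conjC hF.smooth_binormal) hF.smooth_binormal
  obtain ⟨κ, hκ⟩ := hp.parallel z hz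
  have h1 : dotC (pvec p z) (binormal F z) * (q z)⁻¹ = κ := by
    rw [hκ, dotC_smul_left, mul_assoc, mul_inv_cancel₀ hqz, mul_one]
  refine ⟨(contDiff_dotC (smooth_pvec p) hF.smooth_binormal).contDiffAt.mul
    (hqs.contDiffAt.inv hqz), ?_, by simp only [h1]; exact hκ⟩
  simp only [h1]
  rintro rfl
  exact hp.ne_zero z (by rw [hκ, zero_smul])

/-- Differentiating p = κ conj H turns ∂_z into ∂_z̄ acting on H, and both ∂_z̄ H and ∂_z̄² H are
combinations of F_z and F_zz. -/
theorem exists_deriv (hF : IsACLift F) (hp : IsDirectrixPoly F p) {z : ℂ} (hz : binormal F z ≠ 0) :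
    (∃ κ : ℂ, κ ≠ 0 ∧ pvec p z = κ • conjC (binormal F z)) ∧
    (∃ a b c : ℂ, pvec (pderiv p) z = a • conjC (binormal F z) + b • conjC (Dz F z) +
      c • conjC (Dz (Dz F) z)) ∧
    (∃ a b c : ℂ, pvec (pderiv (pderiv p)) z = a • conjC (binormal F z) + b • conjC (Dz F z) +
      c • conjC (Dz (Dz F) z)) := by
  obtain ⟨κ, hκ⟩ := hp.exists_smooth hF
  have hopen : ∀ᶠ w in 𝓝 z, binormal F w ≠ 0 :=
    (isClosed_eq hF.smooth_binormal.continuous continuous_const).isOpen_compl.mem_nhds hz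
  have hBs := hF.smooth_binormal
  have hBd := fun w => Smooth.diff hBs w
  have hd : ∀ w, Dz (fun w => conjC (binormal F w)) w = conjC (Db (binormal F) w) :=
    fun w => Dz_conjC (hBd w)
  have hκd : ∀ w, binormal F w ≠ 0 → DifferentiableAt ℝ κ w := fun w hw =>
    (hκ w hw).1.differentiableAt (by simp)
  have h1 : ∀ w, binormal F w ≠ 0 → pvec (pderiv p) w =
      Dz κ w • conjC (binormal F w) + κ w • conjC (Db (binormal F) w) := by
    intro w hw
    have he : pvec p =ᶠ[𝓝 w] fun w => κ w • conjC (binormal F w) := by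
      filter_upwards [(isClosed_eq hBs.continuous continuous_const).isOpen_compl.mem_nhds hw]
        with v hv using (hκ v hv).2.2
    rw [← Dz_pvec, Dz_congr he, Dz_smul (hκd w hw) (Smooth.diff (contDiff_conjC hBs) w), hd]
  refine ⟨⟨κ z, (hκ z hz).2⟩, ?_, ?_⟩
  · rw [h1 z hz, hF.Db_binormal]
    exact ⟨Dz κ z, κ z * -(Complex.I * starRingEnd ℂ (Dz (energy F) z)),
      κ z * (Complex.I * starRingEnd ℂ (energy F z)), by simp; module⟩
  · obtain ⟨a, b, hab⟩ := hF.Db_Db_binormal z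
    have he : pvec (pderiv p) =ᶠ[𝓝 z] fun w =>
        Dz κ w • conjC (binormal F w) + κ w • conjC (Db (binormal F) w) :=
      hopen.mono fun w hw => h1 w hw
    have hDκ : DifferentiableAt ℝ (Dz κ) z := by
      have hU : IsOpen {w | binormal F w ≠ 0} :=
        (isClosed_eq hBs.continuous continuous_const).isOpen_compl
      exact SmoothOn.diff hU (contDiffOn_Dz hU fun w hw => (hκ w hw).1.contDiffWithinAt) hz
    have hc1 := Smooth.diff (contDiff_conjC hBs) z
    have hc2 := Smooth.diff (contDiff_conjC (contDiff_Db hBs)) z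
    rw [← Dz_pvec, Dz_congr he, Dz_add (hDκ.fun_smul hc1) ((hκd z hz).fun_smul hc2),
      Dz_smul hDκ hc1, Dz_smul (hκd z hz) hc2, hd, Dz_conjC (Smooth.diff (contDiff_Db hBs) z), hab,
      hF.Db_binormal]
    refine ⟨Dz (Dz κ) z, Dz κ z * -(Complex.I * starRingEnd ℂ (Dz (energy F) z)) * 2 +
      κ z * starRingEnd ℂ a,
      Dz κ z * (Complex.I * starRingEnd ℂ (energy F z)) * 2 + κ z * starRingEnd ℂ b, ?_⟩
    simp
    module

/-- The pairings of H with F_z and F_zz vanish because the triple product is alternating, the others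
because each eigenspace is isotropic. -/
theorem dot_conj_span (hF : IsACLift F) (z a b c a' b' c' : ℂ) :
    dotC (a • conjC (binormal F z) + b • conjC (Dz F z) + c • conjC (Dz (Dz F) z))
      (a' • conjC (binormal F z) + b' • conjC (Dz F z) + c' • conjC (Dz (Dz F) z)) = 0 := by
  have h1 : dotC (binormal F z) (binormal F z) = 0 :=
    dotC_eigen_neg_neg (hF.eigen_binormal z) (hF.eigen_binormal z)
  have h2 : dotC (binormal F z) (Dz F z) = 0 := dotC_crossC_self_left _ _
  have h3 : dotC (binormal F z) (Dz (Dz F) z) = 0 := dotC_crossC_self_right _ _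
  have h4 : dotC (Dz F z) (Dz F z) = 0 := dotC_eigen_eigen (hF.eigen z) (hF.eigen z)
  have h5 : dotC (Dz F z) (Dz (Dz F) z) = 0 := hF.dot_Dz_Dz2 z
  have h6 : dotC (Dz (Dz F) z) (Dz (Dz F) z) = 0 := dotC_eigen_eigen (hF.eigen2 z) (hF.eigen2 z)
  simp only [dotC_add_left, dotC_add_right, dotC_smul_left, dotC_smul_right, ← conj_dotC, h1, h2,
    h3, h4, h5, h6, dotC_comm (Dz F z) (binormal F z), dotC_comm (Dz (Dz F) z) (binormal F z),
    dotC_comm (Dz (Dz F) z) (Dz F z)]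
  simp

/-- The cross product of H with F_z or F_zz is a multiple of F whose coefficient is their pairing,
which vanishes. -/
theorem cross_binormal_conj_span (hF : IsACLift F) (z a b c : ℂ) :
    crossC (conjC (binormal F z))
      (a • conjC (binormal F z) + b • conjC (Dz F z) + c • conjC (Dz (Dz F) z)) = 0 := by
  have h2 : crossC (binormal F z) (Dz F z) = 0 := by
    rw [crossC_anticomm, crossC_eigen_eigen_neg (hF.eigen z) (hF.eigen_binormal z), binormal,
      dotC_comm, dotC_crossC_self_left]
    simp
  have h3 : crossC (binormal F z) (Dz (Dz F) z) = 0 := by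
    rw [crossC_anticomm, crossC_eigen_eigen_neg (hF.eigen2 z) (hF.eigen_binormal z), binormal,
      dotC_comm, dotC_crossC_self_right]
    simp
  simp only [crossC_add_right, crossC_smul_right, ← conjC_crossC, h2, h3]
  simp

theorem cross_conj_span (hF : IsACLift F) (z a b c a' b' c' : ℂ) :
    ∃ d : ℂ, crossC
      (a • conjC (binormal F z) + b • conjC (Dz F z) + c • conjC (Dz (Dz F) z))
      (a' • conjC (binormal F z) + b' • conjC (Dz F z) + c' • conjC (Dz (Dz F) z)) =
      d • conjC (binormal F z) := by
  have h1 := cross_binormal_conj_span hF z 0 1 0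
  have h2 := cross_binormal_conj_span hF z 0 0 1
  simp only [zero_smul, one_smul, zero_add, add_zero] at h1 h2
  have h3 : crossC (conjC (Dz F z)) (conjC (Dz (Dz F) z)) = conjC (binormal F z) := by
    rw [← conjC_crossC]; rfl
  have h4 : crossC (conjC (Dz (Dz F) z)) (conjC (Dz F z)) = -conjC (binormal F z) := by
    rw [crossC_anticomm, h3]
  refine ⟨b * c' - c * b', ?_⟩
  simp only [crossC_add_left, crossC_add_right, crossC_smul_left, crossC_smul_right, h1, h2, h3, h4,
    crossC_anticomm (conjC (Dz F z)) (conjC (binormal F z)),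
    crossC_anticomm (conjC (Dz (Dz F) z)) (conjC (binormal F z)), crossC_self]
  module

theorem mem_conj_span (hF : IsACLift F) (hp : IsDirectrixPoly F p) {z : ℂ}
    (hz : binormal F z ≠ 0) {i : ℕ} (hi : i ≤ 2) :
    ∃ a b c : ℂ, pvec (pderiv^[i] p) z = a • conjC (binormal F z) + b • conjC (Dz F z) +
      c • conjC (Dz (Dz F) z) := by
  obtain ⟨⟨κ, -, h0⟩, h1, h2⟩ := hp.exists_deriv hF hz
  interval_cases i
  · exact ⟨κ, 0, 0, by simp [h0]⟩
  · exact h1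
  · exact h2

theorem dot_deriv (hF : IsACLift F) (hne : ∃ z, binormal F z ≠ 0) (hp : IsDirectrixPoly F p)
    {i j : ℕ} (hi : i ≤ 2) (hj : j ≤ 2) (z : ℂ) :
    dotC (pvec (pderiv^[i] p) z) (pvec (pderiv^[j] p) z) = 0 := by
  refine eq_zero_of_dense (hF.dense_binormal hne) (g := fun z => dotC (pvec (pderiv^[i] p) z)
    (pvec (pderiv^[j] p) z)) ?_ (fun z hz => ?_) z
  · exact (contDiff_dotC (smooth_pvec _) (smooth_pvec _)).continuous
  · obtain ⟨a, b, c, h1⟩ := hp.mem_conj_span hF hz hi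
    obtain ⟨a', b', c', h2⟩ := hp.mem_conj_span hF hz hj
    simp only [h1, h2]
    exact dot_conj_span hF ..

theorem cross_deriv (hF : IsACLift F) (hne : ∃ z, binormal F z ≠ 0) (hp : IsDirectrixPoly F p)
    {i : ℕ} (hi : i ≤ 2) (z : ℂ) : crossC (pvec p z) (pvec (pderiv^[i] p) z) = 0 := by
  refine eq_zero_of_dense (hF.dense_binormal hne) (g := fun z => crossC (pvec p z)
    (pvec (pderiv^[i] p) z)) ?_ (fun z hz => ?_) z
  · exact (contDiff_crossC (smooth_pvec _) (smooth_pvec _)).continuous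
  · obtain ⟨⟨κ, -, h0⟩, -⟩ := hp.exists_deriv hF hz
    obtain ⟨a, b, c, h1⟩ := hp.mem_conj_span hF hz hi
    simp only [h0, h1, crossC_smul_left, cross_binormal_conj_span hF, smul_zero]

/-- Differentiating p × p'' = 0 gives p × p''' = -p' × p'', and on the span of conj H, conj F_z,
conj F_zz every cross product is a multiple of conj H. -/
theorem cross_deriv_three (hF : IsACLift F) (hne : ∃ z, binormal F z ≠ 0)
    (hp : IsDirectrixPoly F p) :
    ∃ g : ℂ[X], ∀ z, crossC (pvec p z) (pvec (pderiv^[3] p) z) = g.eval z • pvec p z := by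
  set w : Fin 7 → ℂ[X] := cross p (pderiv^[3] p) with hw
  have hwe : ∀ z, crossC (pvec p z) (pvec (pderiv^[3] p) z) = pvec w z := by
    intro z; ext i; fin_cases i <;> simp [crossC, cross, pvec, hw]
  have hd : ∀ z, crossC (pvec p z) (pvec (pderiv^[3] p) z) =
      -crossC (pvec (pderiv p) z) (pvec (pderiv (pderiv p)) z) := by
    intro z
    have h0 : ∀ w, crossC (pvec p w) (pvec (pderiv (pderiv p)) w) = 0 := fun w =>
      hp.cross_deriv hF hne (i := 2) le_rfl w
    have h1 := Dz_crossC (Smooth.diff (smooth_pvec p) z)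
      (Smooth.diff (smooth_pvec (pderiv (pderiv p))) z)
    simp only [h0, Dz_const, Dz_pvec] at h1
    exact eq_neg_of_add_eq_zero_right h1.symm
  have hpar : ∀ i j z, (w i).eval z * (p j).eval z = (w j).eval z * (p i).eval z := by
    intro i j z
    rw [← sub_eq_zero]
    refine eq_zero_of_dense (hF.dense_binormal hne) (g := fun z =>
      (w i).eval z * (p j).eval z - (w j).eval z * (p i).eval z) (by fun_prop) (fun z hz => ?_) z
    obtain ⟨⟨κ, hκ, h0⟩, ⟨a, b, c, h1⟩, ⟨a', b', c', h2⟩⟩ := hp.exists_deriv hF hz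
    obtain ⟨d, h3⟩ := cross_conj_span hF z a b c a' b' c'
    have h4 : pvec w z = (-d * κ⁻¹) • pvec p z := by
      rw [← hwe, hd, h1, h2, h3, h0, smul_smul, mul_assoc, inv_mul_cancel₀ hκ]; simp
    have h5 : ∀ i, (w i).eval z = (-d * κ⁻¹) * (p i).eval z := fun i =>
      congrArg (fun v : C7 => v i) h4
    simp only [h5]; ring
  -- The Bézout relation turns pointwise proportionality w ∥ p into w = g p with the polynomial g =
  -- ∑ a_i w_i.
  obtain ⟨a, ha⟩ := hp.bezout
  refine ⟨∑ i, a i * w i, fun z => ?_⟩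
  rw [hwe]
  ext j
  have h1 := congrArg (Polynomial.eval z) ha
  simp only [eval_finsetSum, eval_mul, eval_one] at h1
  simp only [PiLp.smul_apply, pvec_apply, smul_eq_mul, eval_finsetSum, eval_mul, Finset.sum_mul]
  calc (w j).eval z = (∑ i, (a i).eval z * (p i).eval z) * (w j).eval z := by rw [h1, one_mul]
    _ = _ := by
      rw [Finset.sum_mul]
      refine Finset.sum_congr rfl fun i _ => ?_
      linear_combination -(a i).eval z * hpar i j z

/-- Fullness passes from F to p. A vector w annihilating H is carried by repeated ∂_z̄ down the
chain from H through F_z to F: it annihilates F_z, then F. -/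
theorem eq_zero_of_dot_eq_zero (hF : IsACLift F) (hfull : IsFullLift F)
    (hne : ∃ z, binormal F z ≠ 0) (hp : IsDirectrixPoly F p) {v : C7}
    (hv : ∀ z, dotC v (pvec p z) = 0) : v = 0 := by
  set w := conjC v with hw
  suffices w = 0 from conjC_eq_zero.1 this
  have hdense := hF.dense_binormal hne
  have h0 : ∀ z, dotC w (binormal F z) = 0 := by
    refine eq_zero_of_dense hdense ((dotL w).continuous.comp hF.smooth_binormal.continuous)
      fun z hz => ?_
    obtain ⟨⟨κ, hκ, h0⟩, -⟩ := hp.exists_deriv hF hz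
    have h1 := hv z
    rw [h0, dotC_smul_right] at h1
    have h2 := congrArg (starRingEnd ℂ) ((mul_eq_zero.1 h1).resolve_left hκ)
    rw [conj_dotC, conjC_conjC, map_zero] at h2
    exact h2
  have hBdot : ∀ (s : ℂ → C7) (z : ℂ), ContDiff ℝ ∞ s →
      Db (fun z => dotC w (s z)) z = dotC w (Db s z) := fun s z hs =>
    Db_clm (dotL w) (Smooth.diff hs z)
  have hcs : ContDiff ℝ ∞ fun _ : ℂ => w := contDiff_const
  have xd := fun z => Smooth.diff (contDiff_dotC hcs hF.smooth_Dz) z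
  have yd := fun z => Smooth.diff (contDiff_dotC hcs hF.smooth_Dz2) z
  have ed := fun z => Smooth.diff hF.smooth_energy z
  have e1d := fun z => Smooth.diff (contDiff_Dz hF.smooth_energy) z
  have h1 : ∀ z, energy F z * dotC w (Dz (Dz F) z) - Dz (energy F) z * dotC w (Dz F z) = 0 := by
    intro z
    have h2 := hBdot _ z hF.smooth_binormal
    simp only [h0, Db_const, hF.Db_binormal, dotC_add_right, dotC_smul_right] at h2
    apply mul_left_cancel₀ Complex.I_ne_zero
    linear_combination h2
  have hDDe : ∀ z, Db (Dz (energy F)) z = -energy F z ^ 2 +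
      dotC (Dz (Dz F) z) (conjC (Dz (Dz F) z)) := by
    intro z
    have e : Dz (energy F) = fun z => dotC (Dz (Dz F) z) (conjC (Dz F z)) :=
      funext hF.Dz_energy
    rw [e, Db_dotC (Smooth.diff hF.smooth_Dz2 z) (Smooth.diff (contDiff_conjC hF.smooth_Dz) z),
      hF.Db_Dz2, hF.Db_conj_Dz, dotC_sub_left, dotC_neg_left, dotC_smul_left, dotC_smul_left,
      hF.dot_F_conj]
    simp only [energy]; ring
  -- The ∂_z̄-derivative of the relation between w · F_zz and w · F_z, combined with that relation,
  -- leaves the Gram determinant of F_z and F_zz as the coefficient of w · F_z.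
  have h2 : ∀ z, (dotC (conjC (binormal F z)) (binormal F z)) * dotC w (Dz F z) = 0 := by
    intro z
    have h3 : Db (fun z => energy F z * dotC w (Dz (Dz F) z) -
        Dz (energy F) z * dotC w (Dz F z)) z = 0 := by
      simp only [h1, Db_const]
    rw [Db_sub ((ed z).fun_mul (yd z)) ((e1d z).fun_mul (xd z)), Db_mul (ed z) (yd z),
      Db_mul (e1d z) (xd z), hBdot _ z hF.smooth_Dz2, hBdot _ z hF.smooth_Dz, hF.Db_Dz2, hF.Db_Dz,
      hDDe] at h3
    simp only [dotC_sub_right, dotC_neg_right, dotC_smul_right] at h3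
    rw [hF.norm_binormal]
    linear_combination 2 * Db (energy F) z * h1 z - 2 * energy F z * h3
  have h4 : ∀ z, dotC w (Dz F z) = 0 := by
    refine eq_zero_of_dense hdense ((dotL w).continuous.comp hF.smooth_Dz.continuous)
      fun z hz => ?_
    refine (mul_eq_zero.1 (h2 z)).resolve_left ?_
    rw [dotC_conjC_self]
    have : binormal F z ≠ 0 := hz
    simpa using this
  have h5 : ∀ z, energy F z * dotC w (F z) = 0 := by
    intro z
    have h6 := hBdot _ z hF.smooth_Dz
    simp only [h4, Db_const, hF.Db_Dz, dotC_smul_right] at h6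
    linear_combination h6
  refine hfull w (eq_zero_of_dense hdense (hF.continuous_dotC w) fun z hz => ?_)
  refine (mul_eq_zero.1 (h5 z)).resolve_left fun he => hz ?_
  rw [IsACLift.energy_eq] at he
  have : Dz F z = 0 := by simpa using he
  simp [binormal, this]

end IsDirectrixPoly

/-! ### Wronskians of polynomials -/

section Wronskian

open Polynomial

variable {n : ℕ}

/-- The Wronskian determinant of polynomials. -/
def wronski (q : Fin n → ℂ[X]) (z : ℂ) : ℂ :=
  Matrix.det (Matrix.of fun i j : Fin n => (derivative^[(j : ℕ)] (q i)).eval z)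

theorem pow_mul_eval_iterate_derivative (q : ℂ[X]) (j : ℕ) (z : ℂ) :
    z ^ j * (derivative^[j] q).eval z =
      ∑ k ∈ q.support, q.coeff k * (k.descFactorial j : ℂ) * z ^ k := by
  conv_lhs => rw [q.as_sum_support_C_mul_X_pow]
  rw [iterate_derivative_sum, eval_finsetSum, Finset.mul_sum]
  refine Finset.sum_congr rfl fun k _ => ?_
  rw [iterate_derivative_C_mul, iterate_derivative_X_pow_eq_natCast_mul]
  simp only [eval_mul, eval_C, eval_natCast, eval_pow, eval_X]
  by_cases h : j ≤ k
  · rw [← Nat.sub_add_cancel h]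
    simp only [Nat.add_sub_cancel, pow_add]; ring
  · rw [Nat.descFactorial_eq_zero_iff_lt.2 (not_le.1 h)]; simp

/-- Falling factorials are monic polynomials of each degree, so up to the row factors this is a
Vandermonde determinant. -/
theorem det_descFactorial_ne_zero {c : Fin n → ℂ} (hc : ∀ i, c i ≠ 0) {m : Fin n → ℕ}
    (hm : Function.Injective m) :
    Matrix.det (Matrix.of fun i j : Fin n => c i * ((m i).descFactorial j : ℂ)) ≠ 0 := by
  have h1 := Matrix.det_mul_column c (Matrix.of fun i j : Fin n => ((m i).descFactorial j : ℂ))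
  simp only [Matrix.of_apply] at h1
  rw [h1]
  refine mul_ne_zero (Finset.prod_ne_zero_iff.2 fun i _ => hc i) ?_
  have h2 := Matrix.det_eval_matrixOfPolynomials_eq_det_vandermonde (fun i : Fin n => (m i : ℂ))
    (fun j => descPochhammer ℂ j) (fun j => descPochhammer_natDegree ℂ j)
    (fun j => monic_descPochhammer ℂ j)
  have h3 : (Matrix.of fun i j : Fin n => ((m i).descFactorial j : ℂ)) =
      Matrix.of fun i j : Fin n => (descPochhammer ℂ j).eval (m i : ℂ) := by
    ext i j; simp [descPochhammer_eval_eq_descFactorial]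
  rw [h3, ← h2, Matrix.det_vandermonde_ne_zero_iff]
  exact fun i j h => hm (Nat.cast_injective (R := ℂ) h)

/-- Multiply column j by z^j, so that every monomial is merely scaled by a falling factorial, and
take the lowest power of z out of each row. At 0 only the trailing coefficients survive, giving the
previous determinant. -/
theorem wronski_low (q : Fin n → ℂ[X]) (hq : ∀ i, q i ≠ 0)
    (hm : Function.Injective fun i => (q i).natTrailingDegree) :
    ∃ h : ℂ → ℂ, Continuous h ∧ h 0 ≠ 0 ∧
      ∀ z, z ^ (∑ j : Fin n, (j : ℕ)) * wronski q z =
        z ^ (∑ i, (q i).natTrailingDegree) * h z := by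
  set M : ℂ → Matrix (Fin n) (Fin n) ℂ := fun z => Matrix.of fun i j : Fin n =>
    ∑ k ∈ (q i).support, (q i).coeff k * (k.descFactorial j : ℂ) *
      z ^ (k - (q i).natTrailingDegree) with hM
  refine ⟨fun z => (M z).det, Continuous.matrix_det (by fun_prop), ?_, fun z => ?_⟩
  · have : M 0 = Matrix.of fun i j : Fin n => (q i).trailingCoeff *
        ((q i).natTrailingDegree.descFactorial j : ℂ) := by
      ext i j
      simp only [hM, Matrix.of_apply]
      rw [Finset.sum_eq_single (q i).natTrailingDegree]
      · simp [trailingCoeff]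
      · intro k hk hk'
        have : k - (q i).natTrailingDegree ≠ 0 := by
          have := natTrailingDegree_le_of_mem_supp k hk
          omega
        simp [this]
      · intro h
        exact absurd (natTrailingDegree_mem_support_of_nonzero (hq i)) h
    simp only [this]
    exact det_descFactorial_ne_zero (fun i => trailingCoeff_nonzero_iff_nonzero.2 (hq i)) hm
  · have h1 := Matrix.det_mul_row (fun j : Fin n => z ^ (j : ℕ))
      (Matrix.of fun i j : Fin n => (derivative^[(j : ℕ)] (q i)).eval z)
    have h2 := Matrix.det_mul_column (fun i : Fin n => z ^ (q i).natTrailingDegree) (M z)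
    rw [Finset.prod_pow_eq_pow_sum] at h1 h2
    rw [wronski, ← h1, ← h2]
    congr 1
    ext i j
    simp only [Matrix.of_apply, hM, pow_mul_eval_iterate_derivative, Finset.mul_sum]
    refine Finset.sum_congr rfl fun k hk => ?_
    have := natTrailingDegree_le_of_mem_supp k hk
    rw [mul_left_comm, ← pow_add, Nat.add_sub_cancel' this]

theorem wronski_high (q : Fin n → ℂ[X]) (hq : ∀ i, q i ≠ 0)
    (hm : Function.Injective fun i => (q i).natDegree) :
    ∃ h : ℂ → ℂ, Continuous h ∧ h 0 ≠ 0 ∧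
      ∀ z, z ≠ 0 → z⁻¹ ^ (∑ j : Fin n, (j : ℕ)) * wronski q z⁻¹ =
        z⁻¹ ^ (∑ i, (q i).natDegree) * h z := by
  set M : ℂ → Matrix (Fin n) (Fin n) ℂ := fun z => Matrix.of fun i j : Fin n =>
    ∑ k ∈ (q i).support, (q i).coeff k * (k.descFactorial j : ℂ) *
      z ^ ((q i).natDegree - k) with hM
  refine ⟨fun z => (M z).det, Continuous.matrix_det (by fun_prop), ?_, fun z hz => ?_⟩
  · have : M 0 = Matrix.of fun i j : Fin n => (q i).leadingCoeff *
        ((q i).natDegree.descFactorial j : ℂ) := by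
      ext i j
      simp only [hM, Matrix.of_apply]
      rw [Finset.sum_eq_single (q i).natDegree]
      · simp
      · intro k hk hk'
        have : (q i).natDegree - k ≠ 0 := by
          have := le_natDegree_of_mem_supp k hk
          omega
        simp [this]
      · intro h
        exact absurd (natDegree_mem_support_of_nonzero (hq i)) h
    simp only [this]
    exact det_descFactorial_ne_zero (fun i => leadingCoeff_ne_zero.2 (hq i)) hm
  · have h1 := Matrix.det_mul_row (fun j : Fin n => z⁻¹ ^ (j : ℕ))
      (Matrix.of fun i j : Fin n => (derivative^[(j : ℕ)] (q i)).eval z⁻¹)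
    have h2 := Matrix.det_mul_column (fun i : Fin n => z⁻¹ ^ (q i).natDegree) (M z)
    rw [Finset.prod_pow_eq_pow_sum] at h1 h2
    rw [wronski, ← h1, ← h2]
    congr 1
    ext i j
    simp only [Matrix.of_apply, hM, pow_mul_eval_iterate_derivative, Finset.mul_sum]
    refine Finset.sum_congr rfl fun k hk => ?_
    have := le_natDegree_of_mem_supp k hk
    obtain ⟨e, he⟩ := Nat.exists_eq_add_of_le this
    rw [he, Nat.add_sub_cancel_left, mul_left_comm, pow_add, mul_assoc (z⁻¹ ^ k), ← mul_pow,
      inv_mul_cancel₀ hz, one_pow, mul_one]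

/-- Combinations of the polynomials `p` by an invertible matrix. -/
def combine (B : Matrix (Fin n) (Fin n) ℂ) (p : Fin n → ℂ[X]) : Fin n → ℂ[X] :=
  fun i => ∑ j, C (B i j) * p j

theorem combine_mul (A B : Matrix (Fin n) (Fin n) ℂ) (p : Fin n → ℂ[X]) :
    combine (A * B) p = combine A (combine B p) := by
  ext1 i
  simp only [combine, Matrix.mul_apply, map_sum, Finset.sum_mul, Finset.mul_sum, C_mul, mul_assoc]
  exact Finset.sum_comm

theorem combine_one (p : Fin n → ℂ[X]) : combine (1 : Matrix (Fin n) (Fin n) ℂ) p = p := by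
  ext1 i
  simp only [combine, Matrix.one_apply]
  rw [Finset.sum_eq_single i] <;> simp +contextual [eq_comm]

theorem wronski_combine (B : Matrix (Fin n) (Fin n) ℂ) (p : Fin n → ℂ[X]) (z : ℂ) :
    wronski (combine B p) z = B.det * wronski p z := by
  rw [wronski, wronski, ← Matrix.det_mul]
  congr 1
  ext i j
  simp [combine, Matrix.mul_apply, iterate_derivative_sum, eval_finsetSum,
    iterate_derivative_C_mul]

theorem combine_ne_zero {p : Fin n → ℂ[X]}
    (hp : ∀ v : Fin n → ℂ, ∑ i, C (v i) * p i = 0 → v = 0) {B : Matrix (Fin n) (Fin n) ℂ}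
    (hB : B.det ≠ 0) (i : Fin n) : combine B p i ≠ 0 := by
  intro h
  have h1 := hp (B i) h
  exact hB (Matrix.det_eq_zero_of_row_eq_zero i fun j => congrFun h1 j)

theorem exists_sub_smul_low {a b : ℂ[X]} (hb : b ≠ 0)
    (h : a.natTrailingDegree = b.natTrailingDegree) (hd : b.natDegree ≤ a.natDegree) :
    ∃ c : ℂ, a - C c * b = 0 ∨ (a.natTrailingDegree < (a - C c * b).natTrailingDegree ∧
      (a - C c * b).natDegree ≤ a.natDegree) := by
  refine ⟨a.trailingCoeff / b.trailingCoeff, ?_⟩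
  rw [or_iff_not_imp_left]
  intro h0
  have hb' := trailingCoeff_nonzero_iff_nonzero.2 hb
  constructor
  · refine lt_of_le_of_ne ?_ ?_
    · refine le_natTrailingDegree h0 fun k hk => ?_
      rw [coeff_sub, coeff_C_mul, coeff_eq_zero_of_lt_natTrailingDegree hk,
        coeff_eq_zero_of_lt_natTrailingDegree (h ▸ hk)]
      simp
    · intro h1
      refine trailingCoeff_nonzero_iff_nonzero.2 h0 ?_
      rw [trailingCoeff, ← h1, coeff_sub, coeff_C_mul]
      have e1 : a.coeff a.natTrailingDegree = a.trailingCoeff := rfl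
      have e2 : b.coeff a.natTrailingDegree = b.trailingCoeff := by rw [h]; rfl
      rw [e1, e2, div_mul_cancel₀ _ hb', sub_self]
  · refine (natDegree_sub_le _ _).trans (max_le le_rfl ((natDegree_C_mul_le _ _).trans hd))

theorem exists_sub_smul_high {a b : ℂ[X]} (hb : b ≠ 0)
    (h : a.natDegree = b.natDegree) (hd : a.natTrailingDegree ≤ b.natTrailingDegree) :
    ∃ c : ℂ, a - C c * b = 0 ∨ (a.natTrailingDegree ≤ (a - C c * b).natTrailingDegree ∧
      (a - C c * b).natDegree < a.natDegree) := by
  refine ⟨a.leadingCoeff / b.leadingCoeff, ?_⟩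
  rw [or_iff_not_imp_left]
  intro h0
  have hb' := leadingCoeff_ne_zero.2 hb
  constructor
  · refine le_natTrailingDegree h0 fun k hk => ?_
    rw [coeff_sub, coeff_C_mul, coeff_eq_zero_of_lt_natTrailingDegree hk,
      coeff_eq_zero_of_lt_natTrailingDegree (hk.trans_le hd)]
    simp
  · refine lt_of_le_of_ne ?_ ?_
    · refine (natDegree_sub_le _ _).trans (max_le le_rfl ((natDegree_C_mul_le _ _).trans h.ge))
    · intro h1
      refine leadingCoeff_ne_zero.2 h0 ?_
      rw [leadingCoeff, h1, coeff_sub, coeff_C_mul]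
      have e1 : a.coeff a.natDegree = a.leadingCoeff := rfl
      have e2 : b.coeff a.natDegree = b.leadingCoeff := by rw [h]; rfl
      rw [e1, e2, div_mul_cancel₀ _ hb', sub_self]

/-- Linearly independent polynomials have combinations with distinct degrees and with
distinct orders of vanishing at `0`. -/
theorem exists_distinct {p : Fin n → ℂ[X]}
    (hp : ∀ v : Fin n → ℂ, ∑ i, C (v i) * p i = 0 → v = 0) :
    ∃ B : Matrix (Fin n) (Fin n) ℂ, B.det ≠ 0 ∧
      (Function.Injective fun i => (combine B p i).natTrailingDegree) ∧
      (Function.Injective fun i => (combine B p i).natDegree) := by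
  classical
  -- The total spread between degree and order at 0. For a minimizing invertible matrix no row
  -- operation can shrink it.
  set f : Matrix (Fin n) (Fin n) ℂ → ℕ := fun B => ∑ i, ((combine B p i).natDegree -
    (combine B p i).natTrailingDegree) with hf
  obtain ⟨B, hB, hmin⟩ : ∃ B : Matrix (Fin n) (Fin n) ℂ, B.det ≠ 0 ∧
      ∀ B' : Matrix (Fin n) (Fin n) ℂ, B'.det ≠ 0 → f B ≤ f B' := by
    have hne : ({B : Matrix (Fin n) (Fin n) ℂ | B.det ≠ 0}).Nonempty := ⟨1, by simp⟩
    exact ⟨Function.argminOn f _ hne, Function.argminOn_mem f _ hne,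
      fun B' hB' => Function.argminOn_le f _ hB'⟩
  have key : ∀ i j, i ≠ j → ∀ c : ℂ, let r := combine B p i - C c * combine B p j
      r ≠ 0 ∧ ¬ (r.natDegree - r.natTrailingDegree <
        (combine B p i).natDegree - (combine B p i).natTrailingDegree) := by
    intro i j hij c r
    set B' := B.updateRow i (B i + (-c) • B j) with hB'
    have hdet : B'.det ≠ 0 := by
      rw [hB', Matrix.det_updateRow_add_smul_self _ hij]; exact hB
    have e1 : combine B' p i = r := by
      simp only [combine, hB', Matrix.updateRow_self, r, Pi.add_apply, Pi.smul_apply, smul_eq_mul,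
        C_add, C_mul, C_neg, add_mul, Finset.sum_add_distrib, Finset.mul_sum, sub_eq_add_neg,
        ← Finset.sum_neg_distrib]
      congr 1
      exact Finset.sum_congr rfl fun k _ => by ring
    have e2 : ∀ k, k ≠ i → combine B' p k = combine B p k := fun k hk => by
      simp [combine, hB', Matrix.updateRow_ne hk]
    refine ⟨e1 ▸ combine_ne_zero hp hdet i, fun hlt => ?_⟩
    refine absurd (hmin B' hdet) (not_le.2 ?_)
    refine Finset.sum_lt_sum (fun k _ => ?_) ⟨i, Finset.mem_univ i, by rw [e1]; exact hlt⟩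
    by_cases hk : k = i
    · rw [hk, e1]; exact hlt.le
    · rw [e2 k hk]
  have hq := combine_ne_zero hp hB
  -- With equal orders, cancelling the lowest term in the combination of larger degree raises its
  -- order without raising its degree, which would shrink the spread.
  have aux1 : ∀ i j, i ≠ j → (combine B p i).natTrailingDegree = (combine B p j).natTrailingDegree →
      (combine B p j).natDegree ≤ (combine B p i).natDegree → False := by
    intro i j hij h1 h2
    obtain ⟨c, hc⟩ := exists_sub_smul_low (hq j) h1 h2
    obtain ⟨k1, k2⟩ := key i j hij c
    rcases hc with hc | ⟨hc1, hc2⟩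
    · exact k1 hc
    · have := natTrailingDegree_le_natDegree (combine B p i - C c * combine B p j)
      omega
  have aux2 : ∀ i j, i ≠ j → (combine B p i).natDegree = (combine B p j).natDegree →
      (combine B p i).natTrailingDegree ≤ (combine B p j).natTrailingDegree → False := by
    intro i j hij h1 h2
    obtain ⟨c, hc⟩ := exists_sub_smul_high (hq j) h1 h2
    obtain ⟨k1, k2⟩ := key i j hij c
    rcases hc with hc | ⟨hc1, hc2⟩
    · exact k1 hc
    · have := natTrailingDegree_le_natDegree (combine B p i - C c * combine B p j)
      omega
  refine ⟨B, hB, fun i j h => ?_, fun i j h => ?_⟩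
  · by_contra hij
    rcases le_total (combine B p j).natDegree (combine B p i).natDegree with h2 | h2
    · exact aux1 i j hij h h2
    · exact aux1 j i (Ne.symm hij) (Eq.symm h) h2
  · by_contra hij
    rcases le_total (combine B p i).natTrailingDegree (combine B p j).natTrailingDegree with h2 | h2
    · exact aux2 i j hij h h2
    · exact aux2 j i (Ne.symm hij) (Eq.symm h) h2

theorem exists_wronski_ne_zero {p : Fin n → ℂ[X]}
    (hp : ∀ v : Fin n → ℂ, ∑ i, C (v i) * p i = 0 → v = 0) : ∃ z, wronski p z ≠ 0 := by
  obtain ⟨B, hB, hm, -⟩ := exists_distinct hp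
  obtain ⟨h, hc, h0, hz⟩ := wronski_low _ (combine_ne_zero hp hB) hm
  by_contra hcon
  push Not at hcon
  have h1 : ∀ z, z ≠ 0 → h z = 0 := by
    intro z hz0
    have h2 := hz z
    rw [wronski_combine, hcon, mul_zero, mul_zero] at h2
    exact (mul_eq_zero.1 h2.symm).resolve_left (pow_ne_zero _ hz0)
  exact h0 (eq_zero_of_ne_zero_eq_zero hc 0 h1)

theorem pow_eq_of_mul_pow_eq {c : ℂ} (hc : c ≠ 0) {a b : ℕ} {h : ℂ → ℂ} (hh : Continuous h)
    (h0 : h 0 ≠ 0) (H : ∀ z, z ≠ 0 → c * z ^ a = z ^ b * h z) : a = b := by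
  rcases lt_trichotomy a b with hab | hab | hab
  · exfalso
    obtain ⟨d, rfl⟩ := Nat.exists_eq_add_of_lt hab
    refine hc ?_
    have := eq_zero_of_ne_zero_eq_zero (g := fun z => c - z ^ (d + 1) * h z) (by fun_prop) 0
      fun z hz => by
        apply mul_left_cancel₀ (pow_ne_zero a hz)
        linear_combination H z hz
    simpa using this
  · exact hab
  · exfalso
    obtain ⟨d, rfl⟩ := Nat.exists_eq_add_of_lt hab
    refine h0 ?_
    have := eq_zero_of_ne_zero_eq_zero (g := fun z => c * z ^ (d + 1) - h z) (by fun_prop) 0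
      fun z hz => by
        apply mul_left_cancel₀ (pow_ne_zero b hz)
        linear_combination H z hz
    simpa using this

theorem exists_wronski_polynomial (p : Fin n → ℂ[X]) : ∃ w : ℂ[X], ∀ z, wronski p z = w.eval z := by
  refine ⟨Matrix.det (Matrix.of fun i j : Fin n => derivative^[(j : ℕ)] (p i)), fun z => ?_⟩
  rw [← coe_evalRingHom, RingHom.map_det]
  rfl

theorem eq_monomial_of_eval_ne_zero {w : ℂ[X]} (h : ∀ z, z ≠ 0 → w.eval z ≠ 0) :
    ∃ (c : ℂ) (k : ℕ), c ≠ 0 ∧ w = C c * X ^ k := by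
  have hw : w ≠ 0 := by rintro rfl; exact h 1 one_ne_zero (by simp)
  have hs := IsAlgClosed.splits w
  have hr : w.roots = Multiset.replicate w.roots.card 0 :=
    Multiset.eq_replicate_card.2 fun z hz => by
      by_contra h0
      exact h z h0 ((mem_roots hw).1 hz)
  refine ⟨w.leadingCoeff, w.roots.card, leadingCoeff_ne_zero.2 hw, ?_⟩
  conv_lhs => rw [hs.eq_prod_roots, hr]
  simp

/-- The Wronskian is a monomial. Its order at 0 is the sum of the orders, and its degree the sum of
the degrees, both diminished by n(n-1)/2. The two sums therefore coincide, and the termwise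
inequality between order and degree becomes equality. -/
theorem sum_eq_of_wronski {q : Fin n → ℂ[X]} (hq : ∀ i, q i ≠ 0)
    (hm : Function.Injective fun i => (q i).natTrailingDegree)
    (hd : Function.Injective fun i => (q i).natDegree) (hw : ∀ z, z ≠ 0 → wronski q z ≠ 0)
    (i : Fin n) : (q i).natTrailingDegree = (q i).natDegree := by
  obtain ⟨w, hwe⟩ := exists_wronski_polynomial q
  obtain ⟨c, k, hc, hck⟩ := eq_monomial_of_eval_ne_zero fun z hz => hwe z ▸ hw z hz
  have hW : ∀ z, wronski q z = c * z ^ k := fun z => by rw [hwe, hck]; simp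
  obtain ⟨g, hg, hg0, hgz⟩ := wronski_low q hq hm
  obtain ⟨h, hh, hh0, hhz⟩ := wronski_high q hq hd
  have e1 := pow_eq_of_mul_pow_eq hc (a := (∑ j : Fin n, (j : ℕ)) + k) hg hg0 fun z _ => by
    rw [← hgz, hW, pow_add]; ring
  have e2 := pow_eq_of_mul_pow_eq hc (b := (∑ j : Fin n, (j : ℕ)) + k) hh hh0
    (a := ∑ i, (q i).natDegree) fun z hz => by
    have := hhz z hz
    rw [hW, mul_left_comm, ← pow_add, inv_pow, inv_pow] at this
    have hz1 := pow_ne_zero (∑ i, (q i).natDegree) hz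
    have hz2 := pow_ne_zero ((∑ j : Fin n, (j : ℕ)) + k) hz
    field_simp at this
    linear_combination this
  have hsum : ∑ i, (q i).natTrailingDegree = ∑ i, (q i).natDegree := by rw [← e1, e2]
  exact (Finset.sum_eq_sum_iff_of_le fun i _ => natTrailingDegree_le_natDegree (q i)).1 hsum i
    (Finset.mem_univ i)

theorem eq_C_mul_X_pow {q : ℂ[X]} (h : q.natTrailingDegree = q.natDegree) :
    q = C q.leadingCoeff * X ^ q.natDegree := by
  ext k
  rw [coeff_C_mul_X_pow]
  split_ifs with hk
  · rw [hk]; rfl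
  · rcases lt_or_gt_of_ne hk with hk | hk
    · exact coeff_eq_zero_of_lt_natTrailingDegree (h ▸ hk)
    · exact coeff_eq_zero_of_natDegree_lt hk

theorem linearIndependent_of_det_ne_zero {A : Matrix (Fin 7) (Fin 7) ℂ} (hA : A.det ≠ 0) :
    LinearIndependent ℂ fun i => (WithLp.toLp 2 (A i) : C7) := by
  have h1 : LinearIndependent ℂ A.row := Matrix.linearIndependent_rows_of_det_ne_zero hA
  exact h1.map' (WithLp.linearEquiv 2 ℂ (Fin 7 → ℂ)).symm.toLinearMap
    (LinearEquiv.ker _)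

theorem exists_monomial_form {p : Fin 7 → ℂ[X]} (hw : ∀ z, z ≠ 0 → wronski p z ≠ 0)
    (h0 : pvec p 0 ≠ 0) : ∃ (m : Fin 7 → ℕ) (v : Fin 7 → C7), StrictMono m ∧ m 0 = 0 ∧
      LinearIndependent ℂ v ∧ ∀ z, pvec p z = ∑ i, z ^ m i • v i := by
  have hp : ∀ v : Fin 7 → ℂ, ∑ i, C (v i) * p i = 0 → v = 0 := by
    intro v hv
    refine Matrix.eq_zero_of_vecMul_eq_zero (hw 1 one_ne_zero) ?_
    ext j
    have h1 := congrArg (fun q : ℂ[X] => (derivative^[(j : ℕ)] q).eval 1) hv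
    simpa [iterate_derivative_sum, eval_finsetSum, iterate_derivative_C_mul, Matrix.vecMul,
      dotProduct] using h1
  obtain ⟨B, hB, hm, hd⟩ := exists_distinct hp
  have hq := combine_ne_zero hp hB
  have heq := sum_eq_of_wronski hq hm hd fun z hz => by
    rw [wronski_combine]; exact mul_ne_zero hB (hw z hz)
  set d : Fin 7 → ℕ := fun i => (combine B p i).natDegree with hdd
  set c : Fin 7 → ℂ := fun i => (combine B p i).leadingCoeff with hcc
  have hc : ∀ i, c i ≠ 0 := fun i => leadingCoeff_ne_zero.2 (hq i)
  have hmon : ∀ i, combine B p i = C (c i) * X ^ d i := fun i => eq_C_mul_X_pow (heq i)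
  -- Recovering p from the monomials c_i z^{d_i} through B⁻¹, the vector attached to z^{d_i} is c_i
  -- times the i-th column of B⁻¹.
  set A : Matrix (Fin 7) (Fin 7) ℂ := Matrix.of fun i j => c i * B⁻¹.transpose i j with hA
  have hAdet : A.det ≠ 0 := by
    rw [hA, Matrix.det_mul_column, Matrix.det_transpose]
    refine mul_ne_zero (Finset.prod_ne_zero_iff.2 fun i _ => hc i) ?_
    have h1 := congrArg Matrix.det (Matrix.nonsing_inv_mul B (isUnit_iff_ne_zero.2 hB))
    rw [Matrix.det_mul, Matrix.det_one] at h1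
    exact left_ne_zero_of_mul_eq_one h1
  have hpe : ∀ z, pvec p z = ∑ i, z ^ d i • (WithLp.toLp 2 (A i) : C7) := by
    intro z
    have h1 : p = combine B⁻¹ (combine B p) := by
      rw [← combine_mul, Matrix.nonsing_inv_mul B (isUnit_iff_ne_zero.2 hB), combine_one]
    ext j
    have h2 : (p j).eval z = (combine B⁻¹ (combine B p) j).eval z := by rw [← h1]
    rw [pvec_apply, h2, combine]
    simp only [hmon, eval_finsetSum, eval_mul, eval_C, eval_pow, eval_X, hA]
    simp
    exact Finset.sum_congr rfl fun i _ => by ring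
  set σ := Tuple.sort d with hσ
  have hmono : StrictMono (d ∘ σ) :=
    (Tuple.monotone_sort d).strictMono_of_injective (hd.comp σ.injective)
  refine ⟨d ∘ σ, (fun i => (WithLp.toLp 2 (A i) : C7)) ∘ σ, hmono, ?_,
    (linearIndependent_of_det_ne_zero hAdet).comp σ σ.injective, fun z => ?_⟩
  -- If the smallest exponent were positive, p would vanish at 0.
  · by_contra hne
    refine h0 ?_
    rw [hpe]
    refine Finset.sum_eq_zero fun i _ => ?_
    have h1 : d (σ 0) ≤ d i := by
      have := hmono.monotone (Fin.zero_le (σ.symm i))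
      simpa using this
    have h2 : d (σ 0) ≠ 0 := hne
    rw [zero_pow (by omega), zero_smul]
  · rw [hpe]
    exact (Equiv.sum_comp σ fun i => z ^ d i • (WithLp.toLp 2 (A i) : C7)).symm

end Wronskian

/-! ### Null curves with monomial coefficients -/

theorem sum_coeff_eq_zero {ι : Type*} [Fintype ι] (n : ι → ℕ) (w : ι → ℂ)
    (h : ∀ z : ℂ, z ≠ 0 → ∑ k, w k * z ^ n k = 0) (s : ℕ) :
    ∑ k, (if n k = s then w k else 0) = 0 := by
  set q : Polynomial ℂ := ∑ k, Polynomial.C (w k) * Polynomial.X ^ n k with hq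
  have hq0 : q = 0 := by
    refine Polynomial.eq_zero_of_infinite_isRoot q (Set.Infinite.mono (s := {0}ᶜ) ?_ ?_)
    · intro z hz
      have := h z hz
      simpa [hq, Polynomial.IsRoot, Polynomial.eval_finsetSum] using this
    · exact (Set.finite_singleton 0).infinite_compl
  have := congrArg (fun q : Polynomial ℂ => q.coeff s) hq0
  simpa [hq, Polynomial.finsetSum_coeff, Polynomial.coeff_C_mul_X_pow, eq_comm] using this

theorem eq_zero_of_pow_sum {m : Fin 7 → ℕ} (hm : Function.Injective m) {x : Fin 7 → ℂ}
    (h : ∀ b ≤ 6, ∑ j, (m j : ℂ) ^ b * x j = 0) (j : Fin 7) : x j = 0 := by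
  have : x = 0 := by
    refine Matrix.eq_zero_of_forall_pow_sum_mul_pow_eq_zero (f := fun j => (m j : ℂ))
      (fun i j hij => hm (Nat.cast_injective (R := ℂ) hij)) fun i => ?_
    simpa only [mul_comm] using h i (by omega)
  rw [this]; rfl

/-! ### Coefficients of symmetric bilinear expressions. -/

section Bilinear

variable {m : Fin 7 → ℕ}

/-- The coefficient of `z ^ s` in `∑ m_i ^ a m_j ^ b D_ij z ^ (m_i + m_j)`. -/
def coeffTwo (m : Fin 7 → ℕ) (D : Fin 7 → Fin 7 → ℂ) (s a b : ℕ) : ℂ :=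
  ∑ i, ∑ j, if m i + m j = s then (m i : ℂ) ^ a * (m j : ℂ) ^ b * D i j else 0

/-- The Leibniz rule for θ = z d/dz, which multiplies the coefficient of z^s by s. -/
theorem coeffTwo_leibniz (D : Fin 7 → Fin 7 → ℂ) (s a b : ℕ) :
    coeffTwo m D s (a + 1) b + coeffTwo m D s a (b + 1) = s * coeffTwo m D s a b := by
  simp only [coeffTwo, Finset.mul_sum, ← Finset.sum_add_distrib]
  refine Finset.sum_congr rfl fun i _ => Finset.sum_congr rfl fun j _ => ?_
  split_ifs with h
  · rw [← h]; push_cast; ring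
  · simp

theorem coeffTwo_symm {D : Fin 7 → Fin 7 → ℂ} (hD : ∀ i j, D i j = D j i) (s a b : ℕ) :
    coeffTwo m D s a b = coeffTwo m D s b a := by
  rw [coeffTwo, Finset.sum_comm]
  refine Finset.sum_congr rfl fun i _ => Finset.sum_congr rfl fun j _ => ?_
  rw [hD, add_comm (m j), mul_comm ((m j : ℂ) ^ a)]

theorem coeffTwo_eq_zero {D : Fin 7 → Fin 7 → ℂ} {a b : ℕ}
    (h : ∀ z : ℂ, z ≠ 0 → ∑ i, ∑ j, (m i : ℂ) ^ a * (m j : ℂ) ^ b * D i j * z ^ (m i + m j) = 0)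
    (s : ℕ) : coeffTwo m D s a b = 0 := by
  have := sum_coeff_eq_zero (fun x : Fin 7 × Fin 7 => m x.1 + m x.2)
    (fun x => (m x.1 : ℂ) ^ a * (m x.2 : ℂ) ^ b * D x.1 x.2)
    (fun z hz => by rw [Fintype.sum_prod_type]; exact h z hz) s
  rw [Fintype.sum_prod_type] at this
  exact this

/-- For given s and j at most one i has m_i + m_j = s, so for each s the moments b = 0, …, 6 form an
invertible Vandermonde system for the D i j. -/
theorem eq_zero_of_coeffTwo (hm : Function.Injective m) {D : Fin 7 → Fin 7 → ℂ}
    (h : ∀ s b, b ≤ 6 → coeffTwo m D s 0 b = 0) (i j : Fin 7) : D i j = 0 := by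
  have h1 := eq_zero_of_pow_sum hm (x := fun j' => ∑ i', if m i' + m j' = m i + m j then D i' j'
    else 0) (fun b hb => by
      refine Eq.trans ?_ (h (m i + m j) b hb)
      rw [coeffTwo, Finset.sum_comm]
      refine Finset.sum_congr rfl fun j' _ => ?_
      rw [Finset.mul_sum]
      refine Finset.sum_congr rfl fun i' _ => ?_
      split_ifs <;> simp) j
  rw [Finset.sum_eq_single i] at h1
  · simpa using h1
  · intro i' _ hi'
    rw [if_neg]
    intro h2
    exact hi' (hm (by omega))
  · simp

end Bilinear

/-! ### Coefficients of alternating trilinear expressions. -/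

section Trilinear

variable {m : Fin 7 → ℕ} {W : Fin 7 → Fin 7 → Fin 7 → ℂ}

/-- The coefficient of `z ^ s` in `∑ m_i ^ a m_j ^ b m_k ^ c W_ijk z ^ (m_i + m_j + m_k)`. -/
def coeffThree (m : Fin 7 → ℕ) (W : Fin 7 → Fin 7 → Fin 7 → ℂ) (s a b c : ℕ) : ℂ :=
  ∑ i, ∑ j, ∑ k, if m i + m j + m k = s then
    (m i : ℂ) ^ a * (m j : ℂ) ^ b * (m k : ℂ) ^ c * W i j k else 0

theorem coeffThree_leibniz (W : Fin 7 → Fin 7 → Fin 7 → ℂ) (s a b c : ℕ) :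
    coeffThree m W s (a + 1) b c + coeffThree m W s a (b + 1) c + coeffThree m W s a b (c + 1) =
      s * coeffThree m W s a b c := by
  simp only [coeffThree, Finset.mul_sum, ← Finset.sum_add_distrib]
  refine Finset.sum_congr rfl fun i _ => Finset.sum_congr rfl fun j _ =>
    Finset.sum_congr rfl fun k _ => ?_
  split_ifs with h
  · rw [← h]; push_cast; ring
  · simp

theorem coeffThree_swap (h : ∀ i j k, W i j k = -W j i k) (s a b c : ℕ) :
    coeffThree m W s a b c = -coeffThree m W s b a c := by
  rw [coeffThree, Finset.sum_comm]
  simp only [coeffThree, ← Finset.sum_neg_distrib]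
  refine Finset.sum_congr rfl fun i _ => Finset.sum_congr rfl fun j _ =>
    Finset.sum_congr rfl fun k _ => ?_
  rw [h, add_comm (m j)]
  split_ifs <;> ring

theorem coeffThree_swap' (h : ∀ i j k, W i j k = -W i k j) (s a b c : ℕ) :
    coeffThree m W s a b c = -coeffThree m W s a c b := by
  simp only [coeffThree, ← Finset.sum_neg_distrib]
  refine Finset.sum_congr rfl fun i _ => ?_
  rw [Finset.sum_comm]
  refine Finset.sum_congr rfl fun j _ => Finset.sum_congr rfl fun k _ => ?_
  rw [h, add_right_comm]
  split_ifs <;> ring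

theorem coeffThree_eq_zero {a b c : ℕ}
    (h : ∀ z : ℂ, z ≠ 0 → ∑ i, ∑ j, ∑ k, (m i : ℂ) ^ a * (m j : ℂ) ^ b * (m k : ℂ) ^ c * W i j k *
      z ^ (m i + m j + m k) = 0) (s : ℕ) : coeffThree m W s a b c = 0 := by
  have := sum_coeff_eq_zero (fun x : Fin 7 × Fin 7 × Fin 7 => m x.1 + m x.2.1 + m x.2.2)
    (fun x => (m x.1 : ℂ) ^ a * (m x.2.1 : ℂ) ^ b * (m x.2.2 : ℂ) ^ c * W x.1 x.2.1 x.2.2)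
    (fun z hz => by simp only [Fintype.sum_prod_type]; exact h z hz) s
  simp only [Fintype.sum_prod_type] at this
  exact this

/-- Vandermonde inversion in b and then in c; once s, j and k are given, i is determined. -/
theorem eq_zero_of_coeffThree (hm : Function.Injective m)
    (h : ∀ s b c, b ≤ 6 → c ≤ 6 → coeffThree m W s 0 b c = 0) (i j k : Fin 7) : W i j k = 0 := by
  have h1 := eq_zero_of_pow_sum hm (x := fun k' => ∑ i', if m i' + m j + m k' = m i + m j + m k
    then W i' j k' else 0) (fun c hc => by
      refine eq_zero_of_pow_sum hm (x := fun j' => ∑ k', (m k' : ℂ) ^ c *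
        ∑ i', if m i' + m j' + m k' = m i + m j + m k then W i' j' k' else 0) (fun b hb => ?_) j
      refine Eq.trans ?_ (h (m i + m j + m k) b c hb hc)
      rw [coeffThree, Finset.sum_comm]
      refine Finset.sum_congr rfl fun j' _ => ?_
      rw [Finset.sum_comm, Finset.mul_sum]
      refine Finset.sum_congr rfl fun k' _ => ?_
      rw [Finset.mul_sum, Finset.mul_sum]
      refine Finset.sum_congr rfl fun i' _ => ?_
      split_ifs <;> simp [mul_assoc]) k
  rw [Finset.sum_eq_single i] at h1
  · simpa using h1
  · intro i' _ hi'
    rw [if_neg]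
    intro h2
    exact hi' (hm (by omega))
  · simp

/-- The Leibniz recursion moves known zeros upward and alternation supplies the diagonal ones. Among
indices up to 6 the entry (0, 5, 6) is the last to be reached. -/
theorem alternating_vanish {T : ℕ → ℕ → ℕ → ℂ} {s : ℂ}
    (L : ∀ a b c, T (a + 1) b c + T a (b + 1) c + T a b (c + 1) = s * T a b c)
    (A : ∀ a b c, T a b c = -T b a c) (A' : ∀ a b c, T a b c = -T a c b)
    (h : ∀ b c, b ≤ 3 → T 0 b c = 0) {b c : ℕ} (hb : b ≤ 6) (hc : c ≤ 6) : T 0 b c = 0 := by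
  have Z : ∀ a c, T a a c = 0 := fun a c => self_eq_neg.1 (A a a c)
  have Z' : ∀ a c, T a c c = 0 := fun a c => self_eq_neg.1 (A' a c c)
  have a1 : ∀ b c, b ≤ 2 → T 1 b c = 0 := fun b c hb => by
    have := L 0 b c
    rw [h (b + 1) c (by omega), h b (c + 1) (by omega), h b c (by omega)] at this
    linear_combination this
  have a2 : ∀ c, T 1 3 c = 0 := fun c => by
    have := L 1 2 c
    rw [Z 2 c, a1 2 (c + 1) le_rfl, a1 2 c le_rfl] at this
    linear_combination this
  have a3 : ∀ c, T 0 4 c = 0 := fun c => by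
    have := L 0 3 c
    rw [a2, h 3 (c + 1) le_rfl, h 3 c le_rfl] at this
    linear_combination this
  have a4 : ∀ c, T 0 5 c = -T 1 4 c := fun c => by
    have := L 0 4 c
    rw [a3, a3] at this
    linear_combination this
  have a5 : ∀ c, T 1 4 c = -T 2 3 c := fun c => by
    have := L 1 3 c
    rw [a2, a2] at this
    linear_combination this
  have a6 : T 2 3 5 = 0 := by
    have e1 := a4 5
    rw [Z', a5] at e1
    linear_combination -e1
  have a7 : T 2 3 6 = -T 2 4 5 := by
    have := L 2 3 5
    rw [Z, a6] at this
    linear_combination this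
  have a8 : T 2 4 5 = T 2 3 6 := by
    have e1 := L 1 4 5
    have e2 := a5 6
    rw [Z', a5 5, a6] at e1
    linear_combination e1 - e2
  -- The recursion reduces this entry to T 2 3 6, which equals both T 2 4 5 and -T 2 4 5.
  have a9 : T 0 5 6 = 0 := by
    rw [a4, a5]
    linear_combination (1 / 2 : ℂ) * a7 - (1 / 2 : ℂ) * a8
  rcases Nat.lt_or_ge b 4 with hb4 | hb4
  · exact h b c (by omega)
  rcases Nat.lt_or_ge c 4 with hc4 | hc4
  · rw [A', h c b (by omega), neg_zero]
  rcases eq_or_ne b c with rfl | hbc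
  · exact Z' _ _
  rcases eq_or_ne b 4 with rfl | hb'
  · exact a3 _
  rcases eq_or_ne c 4 with rfl | hc'
  · rw [A', a3, neg_zero]
  obtain ⟨rfl, rfl⟩ | ⟨rfl, rfl⟩ : (b = 5 ∧ c = 6) ∨ (b = 6 ∧ c = 5) := by omega
  · exact a9
  · rw [A', a9, neg_zero]

theorem coeffThree_vanish (h1 : ∀ i j k, W i j k = -W j i k) (h2 : ∀ i j k, W i j k = -W i k j)
    {s : ℕ} (h : ∀ b c, b ≤ 3 → coeffThree m W s 0 b c = 0) (b c : ℕ) (hb : b ≤ 6) (hc : c ≤ 6) :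
    coeffThree m W s 0 b c = 0 :=
  alternating_vanish (coeffThree_leibniz W s) (coeffThree_swap h1 s) (coeffThree_swap' h2 s) h hb hc

end Trilinear

/-- `(z d/dz) ^ a` applied to `∑ z ^ m_i v_i`. -/
def gsum (m : Fin 7 → ℕ) (v : Fin 7 → C7) (a : ℕ) (z : ℂ) : C7 :=
  ∑ i, ((m i : ℂ) ^ a * z ^ m i) • v i

theorem dotC_sum_left {ι : Type*} (s : Finset ι) (f : ι → C7) (y : C7) :
    dotC (∑ i ∈ s, f i) y = ∑ i ∈ s, dotC (f i) y := map_sum (dotL.flip y) f s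

theorem dotC_sum_right {ι : Type*} (s : Finset ι) (f : ι → C7) (y : C7) :
    dotC y (∑ i ∈ s, f i) = ∑ i ∈ s, dotC y (f i) := map_sum (dotL y) f s

theorem crossC_sum_left {ι : Type*} (s : Finset ι) (f : ι → C7) (y : C7) :
    crossC (∑ i ∈ s, f i) y = ∑ i ∈ s, crossC (f i) y := map_sum (crossL.flip y) f s

theorem crossC_sum_right {ι : Type*} (s : Finset ι) (f : ι → C7) (y : C7) :
    crossC y (∑ i ∈ s, f i) = ∑ i ∈ s, crossC y (f i) := map_sum (crossL y) f s

section

variable (m : Fin 7 → ℕ) (v : Fin 7 → C7)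

theorem dotC_gsum (a b : ℕ) (z : ℂ) : dotC (gsum m v a z) (gsum m v b z) =
    ∑ i, ∑ j, (m i : ℂ) ^ a * (m j : ℂ) ^ b * dotC (v i) (v j) * z ^ (m i + m j) := by
  simp only [gsum, dotC_sum_left]
  simp only [dotC_sum_right, dotC_smul_left, dotC_smul_right]
  refine Finset.sum_congr rfl fun i _ => Finset.sum_congr rfl fun j _ => ?_
  ring

theorem dotC_crossC_gsum (a b c : ℕ) (z : ℂ) :
    dotC (crossC (gsum m v a z) (gsum m v b z)) (gsum m v c z) =
    ∑ i, ∑ j, ∑ k, (m i : ℂ) ^ a * (m j : ℂ) ^ b * (m k : ℂ) ^ c *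
      dotC (crossC (v i) (v j)) (v k) * z ^ (m i + m j + m k) := by
  simp only [gsum, crossC_sum_left, dotC_sum_left]
  simp only [crossC_sum_right, dotC_sum_left]
  simp only [dotC_sum_right,
    crossC_smul_left, crossC_smul_right, dotC_smul_left, dotC_smul_right]
  refine Finset.sum_congr rfl fun i _ => Finset.sum_congr rfl fun j _ =>
    Finset.sum_congr rfl fun k _ => ?_
  ring

end

/-- The coefficients of a null curve `∑ z ^ m_i v_i` all of whose ramification is at `0, ∞`. -/
structure IsNullSystem (m : Fin 7 → ℕ) (v : Fin 7 → C7) (c : ℂ) (e : ℕ) : Prop where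
  mono : StrictMono m
  indep : LinearIndependent ℂ v
  ne_zero : c ≠ 0
  dot : ∀ a b z, a ≤ 2 → b ≤ 2 → z ≠ 0 → dotC (gsum m v a z) (gsum m v b z) = 0
  dot' : ∀ z, z ≠ 0 → dotC (gsum m v 0 z) (gsum m v 3 z) = 0
  cross : ∀ b z, b ≤ 2 → z ≠ 0 → crossC (gsum m v 0 z) (gsum m v b z) = 0
  cross' : ∀ z, z ≠ 0 → crossC (gsum m v 0 z) (gsum m v 3 z) = (c * z ^ e) • gsum m v 0 z

/-! ### Rigidity and exponents of null systems. -/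

namespace IsNullSystem

variable {m : Fin 7 → ℕ} {v u : Fin 7 → C7} {c c' : ℂ} {e : ℕ}

theorem gsum_ne_zero (hv : IsNullSystem m v c e) {z : ℂ} (hz : z ≠ 0) : gsum m v 0 z ≠ 0 := by
  intro h
  have := Fintype.linearIndependent_iff.1 hv.indep _ h 0
  simp [hz] at this

/-- Put P = ∑ z^{m_i} v_i and T = θ³P. Since T × P = -c z^e P, applying T × twice to P gives (c
z^e)² P, while the double cross product identity gives -(T · T) P. -/
theorem dot_three (hv : IsNullSystem m v c e) {z : ℂ} (hz : z ≠ 0) :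
    dotC (gsum m v 3 z) (gsum m v 3 z) = -(c * z ^ e) ^ 2 := by
  have h1 := crossC_crossC_self (gsum m v 3 z) (gsum m v 0 z)
  rw [crossC_anticomm (gsum m v 3 z) (gsum m v 0 z), hv.cross' z hz, crossC_neg_right,
    crossC_smul_right, crossC_anticomm, hv.cross' z hz, dotC_comm (gsum m v 3 z) (gsum m v 0 z),
    hv.dot' z hz, zero_smul, add_zero, ← smul_neg, neg_neg, smul_smul] at h1
  have h2 := smul_left_injective ℂ (hv.gsum_ne_zero hz) h1
  linear_combination h2

theorem span_eq_top (hv : IsNullSystem m v c e) : ⊤ ≤ Submodule.span ℂ (Set.range v) := by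
  rw [hv.indep.span_eq_top_of_card_eq_finrank (by simp)]

theorem eq_zero_of_dot (hv : IsNullSystem m v c e) {x : C7} (h : ∀ i, dotC x (v i) = 0) : x = 0 := by
  refine dotC_nondegenerate fun y => ?_
  have hy : y ∈ Submodule.span ℂ (Set.range v) := hv.span_eq_top trivial
  induction hy using Submodule.span_induction with
  | mem x hx => obtain ⟨i, rfl⟩ := hx; exact h i
  | zero => simp
  | add x y _ _ hx hy => simp [hx, hy]
  | smul a x _ hx => simp [hx]

/-- The products θ^aP · θ^bP are known for a, b ≤ 2 and for a = b = 3, up to the factor (c'/c)².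
Symmetry and the Leibniz rule extend the comparison to a = 0, b ≤ 6, and Vandermonde inversion
isolates the individual pairings. -/
theorem dot_eq (hv : IsNullSystem m v c e) (hu : IsNullSystem m u c' e) (i j : Fin 7) :
    dotC (u i) (u j) = (c' / c) ^ 2 * dotC (v i) (v j) := by
  set D : Fin 7 → Fin 7 → ℂ := fun i j => dotC (u i) (u j) - (c' / c) ^ 2 * dotC (v i) (v j)
    with hD
  have hc := hv.ne_zero
  have key : ∀ a b, (∀ z, z ≠ 0 → dotC (gsum m u a z) (gsum m u b z) =
      (c' / c) ^ 2 * dotC (gsum m v a z) (gsum m v b z)) → ∀ s, coeffTwo m D s a b = 0 := by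
    intro a b h
    refine coeffTwo_eq_zero fun z hz => ?_
    have h1 := h z hz
    rw [dotC_gsum, dotC_gsum, ← sub_eq_zero, Finset.mul_sum, ← Finset.sum_sub_distrib] at h1
    rw [← h1]
    refine Finset.sum_congr rfl fun i _ => ?_
    rw [Finset.mul_sum, ← Finset.sum_sub_distrib]
    refine Finset.sum_congr rfl fun j _ => ?_
    simp only [hD]; ring
  have hsymm := coeffTwo_symm (m := m) (D := D) fun i j => by
    simp only [hD, dotC_comm (u i), dotC_comm (v i)]
  have L := coeffTwo_leibniz (m := m) D
  suffices ∀ s b, b ≤ 6 → coeffTwo m D s 0 b = 0 from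
    sub_eq_zero.1 (eq_zero_of_coeffTwo hv.mono.injective this i j)
  intro s
  have k1 : ∀ a b, a ≤ 2 → b ≤ 2 → coeffTwo m D s a b = 0 := fun a b ha hb =>
    key a b (fun z hz => by rw [hv.dot a b z ha hb hz, hu.dot a b z ha hb hz, mul_zero]) s
  have k2 : coeffTwo m D s 3 3 = 0 := key 3 3 (fun z hz => by
    rw [hv.dot_three hz, hu.dot_three hz]; field_simp) s
  have next : ∀ a b, coeffTwo m D s a b = 0 → coeffTwo m D s (a + 1) b = 0 →
      coeffTwo m D s a (b + 1) = 0 := fun a b h1 h2 => by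
    have := L s a b
    rw [h1, h2] at this
    linear_combination this
  -- By symmetry the two Leibniz terms above the diagonal coincide.
  have diag : ∀ a, coeffTwo m D s a a = 0 → coeffTwo m D s a (a + 1) = 0 := fun a h => by
    have := L s a a
    rw [hsymm s (a + 1) a, h] at this
    linear_combination (1 / 2 : ℂ) * this
  have b23 := diag 2 (k1 2 2 le_rfl le_rfl)
  have b13 := next 1 2 (k1 1 2 (by norm_num) le_rfl) (k1 2 2 le_rfl le_rfl)
  have b03 := next 0 2 (k1 0 2 (by norm_num) le_rfl) (k1 1 2 (by norm_num) le_rfl)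
  have b24 := next 2 3 b23 k2
  have b14 := next 1 3 b13 b23
  have b04 := next 0 3 b03 b13
  have b15 := next 1 4 b14 b24
  have b05 := next 0 4 b04 b14
  have b06 := next 0 5 b05 b15
  intro b hb
  interval_cases b
  · exact k1 0 0 (by norm_num) (by norm_num)
  · exact k1 0 1 (by norm_num) (by norm_num)
  · exact k1 0 2 (by norm_num) (by norm_num)
  · exact b03
  · exact b04
  · exact b05
  · exact b06

/-- For b ≤ 3 the product P × θ^bP is zero or a known multiple of P, so its pairing with θ^dP is
governed by `dot_eq`; alternation and the Leibniz rule supply the remaining values. -/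
theorem cross_eq (hv : IsNullSystem m v c e) (hu : IsNullSystem m u c' e) (i j k : Fin 7) :
    dotC (crossC (u i) (u j)) (u k) = (c' / c) ^ 3 * dotC (crossC (v i) (v j)) (v k) := by
  set W : Fin 7 → Fin 7 → Fin 7 → ℂ := fun i j k => dotC (crossC (u i) (u j)) (u k) -
    (c' / c) ^ 3 * dotC (crossC (v i) (v j)) (v k) with hW
  have hc := hv.ne_zero
  have key : ∀ a b d, (∀ z, z ≠ 0 → dotC (crossC (gsum m u a z) (gsum m u b z)) (gsum m u d z) =
      (c' / c) ^ 3 * dotC (crossC (gsum m v a z) (gsum m v b z)) (gsum m v d z)) →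
      ∀ s, coeffThree m W s a b d = 0 := by
    intro a b d h
    refine coeffThree_eq_zero fun z hz => ?_
    have h1 := h z hz
    rw [dotC_crossC_gsum, dotC_crossC_gsum, ← sub_eq_zero, Finset.mul_sum,
      ← Finset.sum_sub_distrib] at h1
    rw [← h1]
    refine Finset.sum_congr rfl fun i _ => ?_
    rw [Finset.mul_sum, ← Finset.sum_sub_distrib]
    refine Finset.sum_congr rfl fun j _ => ?_
    rw [Finset.mul_sum, ← Finset.sum_sub_distrib]
    refine Finset.sum_congr rfl fun k _ => ?_
    simp only [hW]; ring
  have hdot : ∀ b z, dotC (gsum m u 0 z) (gsum m u b z) =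
      (c' / c) ^ 2 * dotC (gsum m v 0 z) (gsum m v b z) := by
    intro b z
    simp only [dotC_gsum, hv.dot_eq hu, Finset.mul_sum]
    refine Finset.sum_congr rfl fun i _ => Finset.sum_congr rfl fun j _ => ?_
    ring
  have a1 : ∀ i j k, W i j k = -W j i k := fun i j k => by
    simp only [hW, crossC_anticomm (u i), crossC_anticomm (v i), dotC_neg_left]; ring
  have a2 : ∀ i j k, W i j k = -W i k j := fun i j k => by
    simp only [hW, dotC_crossC_left (u i) (u j), dotC_crossC_left (v i) (v j),
      dotC_comm (u j), dotC_comm (v j)]; ring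
  refine sub_eq_zero.1 (eq_zero_of_coeffThree hv.mono.injective (W := W) (fun s b d hb hd =>
    coeffThree_vanish a1 a2 (fun b d hb => ?_) b d hb hd) i j k)
  refine key 0 b d (fun z hz => ?_) s
  rcases Nat.lt_or_ge b 3 with hb | hb'
  · rw [hv.cross b z (by omega) hz, hu.cross b z (by omega) hz, dotC_zero_left, dotC_zero_left,
      mul_zero]
  · obtain rfl : b = 3 := by omega
    rw [hv.cross' z hz, hu.cross' z hz, dotC_smul_left, dotC_smul_left, hdot]
    field_simp

/-- The linear map A with A v_i = u_i multiplies the bilinear form by κ² and the triple product by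
κ³. Nondegeneracy then gives Ax × Ay = κ A(x × y), and division by κ makes A an automorphism. -/
theorem exists_equiv (hv : IsNullSystem m v c e) (hu : IsNullSystem m u c' e) :
    ∃ A ∈ G2C, ∀ i, A (v i) = (c' / c)⁻¹ • u i := by
  set κ := c' / c with hκ
  have hκ0 : κ ≠ 0 := div_ne_zero hu.ne_zero hv.ne_zero
  set bv := Module.Basis.mk hv.indep hv.span_eq_top with hbv
  set bu := Module.Basis.mk hu.indep hu.span_eq_top with hbu
  set A : C7 ≃ₗ[ℂ] C7 := bv.equiv bu (Equiv.refl _) with hA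
  have hAv : ∀ i, A (v i) = u i := fun i => by
    have := bv.equiv_apply i bu (Equiv.refl _)
    simpa [hbv, hbu] using this
  have hdot : ∀ x y, dotC (A x) (A y) = κ ^ 2 * dotC x y := by
    intro x y
    rw [← bv.sum_repr x, ← bv.sum_repr y]
    simp only [map_sum, map_smul, dotC_sum_left, dotC_sum_right, dotC_smul_left, dotC_smul_right,
      Finset.mul_sum, hbv, Module.Basis.mk_apply, hAv, hv.dot_eq hu]
    refine Finset.sum_congr rfl fun i _ => Finset.sum_congr rfl fun j _ => ?_
    ring
  have hcr : ∀ i j, crossC (u i) (u j) = κ • A (crossC (v i) (v j)) := by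
    intro i j
    rw [← sub_eq_zero]
    refine hu.eq_zero_of_dot fun k => ?_
    rw [dotC_sub_left, hv.cross_eq hu, dotC_smul_left, ← hAv k, hdot]
    ring
  have hcross : ∀ x y, crossC (A x) (A y) = κ • A (crossC x y) := by
    intro x y
    rw [← bv.sum_repr x, ← bv.sum_repr y]
    simp only [map_sum, map_smul, crossC_sum_left, crossC_sum_right, crossC_smul_left,
      crossC_smul_right, Finset.smul_sum, hbv, Module.Basis.mk_apply, hAv, hcr]
    refine Finset.sum_congr rfl fun i _ => Finset.sum_congr rfl fun j _ => ?_
    module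
  refine ⟨A.trans (LinearEquiv.smulOfNeZero ℂ C7 κ⁻¹ (inv_ne_zero hκ0)), fun x y => ?_, fun i => ?_⟩
  · simp only [LinearEquiv.trans_apply, LinearEquiv.smulOfNeZero_apply, crossC_smul_left,
      crossC_smul_right, hcross, smul_smul]
    congr 1
    field_simp
  · simp [hAv]

/-- Rescaling the coordinate. -/
theorem rescale (hv : IsNullSystem m v c e) :
    IsNullSystem m (fun i => (2 : ℂ) ^ m i • v i) (c * 2 ^ e) e := by
  have hg : ∀ a z, gsum m (fun i => (2 : ℂ) ^ m i • v i) a z = gsum m v a (2 * z) := by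
    intro a z
    simp only [gsum, smul_smul, mul_pow]
    exact Finset.sum_congr rfl fun i _ => by congr 1; ring
  have h2 : ∀ {z : ℂ}, z ≠ 0 → 2 * z ≠ 0 := fun hz => mul_ne_zero two_ne_zero hz
  refine ⟨hv.mono, ?_, mul_ne_zero hv.ne_zero (pow_ne_zero _ two_ne_zero), ?_, ?_, ?_, ?_⟩
  · exact hv.indep.units_smul fun i => Units.mk0 ((2 : ℂ) ^ m i) (pow_ne_zero _ two_ne_zero)
  · intro a b z ha hb hz
    rw [hg, hg, hv.dot a b _ ha hb (h2 hz)]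
  · intro z hz
    rw [hg, hg, hv.dot' _ (h2 hz)]
  · intro b z hb hz
    rw [hg, hg, hv.cross b _ hb (h2 hz)]
  · intro z hz
    rw [hg, hg, hv.cross' _ (h2 hz), mul_pow, mul_assoc]

/-- Comparing the system with its image under z ↦ 2z multiplies v_i · v_j by 2^(m_i + m_j) on one
side and by (2^e)² on the other. -/
theorem add_eq_of_dot_ne_zero (hv : IsNullSystem m v c e) {i j : Fin 7}
    (h : dotC (v i) (v j) ≠ 0) : m i + m j = 2 * e := by
  have h1 := hv.dot_eq hv.rescale i j
  rw [mul_div_cancel_left₀ _ hv.ne_zero, dotC_smul_left, dotC_smul_right, ← mul_assoc, ← pow_add,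
    ← pow_mul] at h1
  have h2 := mul_right_cancel₀ h h1
  have h3 : (2 : ℕ) ^ (m i + m j) = 2 ^ (e * 2) := by exact_mod_cast h2
  have := Nat.pow_right_injective le_rfl h3
  omega

/-- Nondegeneracy gives every index a partner with exponent sum 2e. Partnership reverses the order,
and `Fin.rev` is the only order-reversing self-map of seven points that is strict. -/
theorem add_rev (hv : IsNullSystem m v c e) (i : Fin 7) : m i + m i.rev = 2 * e := by
  have h1 : ∀ i, ∃ j, m i + m j = 2 * e := fun i => by
    by_contra hcon
    push Not at hcon
    exact hv.indep.ne_zero i (hv.eq_zero_of_dot fun j => by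
      by_contra h; exact hcon j (hv.add_eq_of_dot_ne_zero h))
  choose τ hτ using h1
  have hanti : StrictAnti τ := fun i j hij => by
    have := hv.mono hij
    rw [← hv.mono.lt_iff_lt]
    have e1 := hτ i
    have e2 := hτ j
    omega
  have hmono : StrictMono fun i => (τ i).rev := fun i j hij => Fin.rev_lt_rev.2 (hanti hij)
  have hid : ∀ i, (τ i).rev = i := fun i => by
    have := Subsingleton.elim (OrderIso.refl (Fin 7))
      (hmono.orderIsoOfSurjective _ (Finite.injective_iff_surjective.1 hmono.injective))
    exact (congrArg (fun g : Fin 7 ≃o Fin 7 => g i) this).symm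
  have h2 := hτ i
  rwa [show τ i = i.rev by rw [← hid i, Fin.rev_rev, hid]] at h2

theorem apply_three (hv : IsNullSystem m v c e) : m 3 = e := by
  have h := hv.add_rev 3
  have h3 : (3 : Fin 7).rev = 3 := rfl
  rw [h3] at h
  omega

theorem hasDerivAt_gsum (m : Fin 7 → ℕ) (v : Fin 7 → C7) (a : ℕ) {z : ℂ} (hz : z ≠ 0) :
    HasDerivAt (gsum m v a) (z⁻¹ • gsum m v (a + 1) z) z := by
  have h : ∀ i, HasDerivAt (fun z : ℂ => ((m i : ℂ) ^ a * z ^ m i) • v i)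
      (z⁻¹ • ((m i : ℂ) ^ (a + 1) * z ^ m i) • v i) z := by
    intro i
    convert! (((hasDerivAt_pow (m i) z).const_mul ((m i : ℂ) ^ a)).smul_const (v i)) using 1
    rw [smul_smul]
    congr 1
    rcases Nat.eq_zero_or_pos (m i) with h0 | h0
    · simp [h0]
    · obtain ⟨d, hd⟩ := Nat.exists_eq_add_of_lt h0
      rw [zero_add] at hd
      rw [hd, Nat.add_sub_cancel]
      field_simp
      ring
  rw [gsum, Finset.smul_sum]
  exact HasDerivAt.fun_sum fun i _ => h i

/-- Apply z d/dz to P × θ²P = 0. -/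
theorem cross_one_two (hv : IsNullSystem m v c e) {z : ℂ} (hz : z ≠ 0) :
    crossC (gsum m v 1 z) (gsum m v 2 z) = -(c * z ^ e) • gsum m v 0 z := by
  have h0 := hasDerivAt_gsum m v 0 hz
  have h2 := hasDerivAt_gsum m v 2 hz
  have h4 : (fun w => crossC (gsum m v 0 w) (gsum m v 2 w)) =ᶠ[𝓝 z] fun _ => 0 := by
    filter_upwards [isOpen_ne.mem_nhds hz] with w hw using hv.cross 2 w le_rfl hw
  have h5 := Dz_crossC (h0.differentiableAt.restrictScalars ℝ)
    (h2.differentiableAt.restrictScalars ℝ)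
  rw [Dz_congr h4, Dz_const, Dz_of_differentiableAt h0.differentiableAt,
    Dz_of_differentiableAt h2.differentiableAt, h0.deriv, h2.deriv, crossC_smul_left,
    crossC_smul_right, ← smul_add, hv.cross' z hz, eq_comm] at h5
  have h6 := (smul_eq_zero.1 h5).resolve_left (inv_ne_zero hz)
  rw [neg_smul]
  exact eq_neg_of_add_eq_zero_left h6

/-- Compare the coefficients of z^e in θP × θ²P = -c z^e P. On the right this is -c v_0 ≠ 0. On the
left θ removes the index 0, and since m_3 = e a pair of distinct positive indices with exponent sum
e must be {1, 2}. -/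
theorem add_one_two (hv : IsNullSystem m v c e) (h0 : m 0 = 0) : m 1 + m 2 = e := by
  by_contra hne
  refine hv.indep.ne_zero 0 (dotC_nondegenerate fun w => ?_)
  have h3 := hv.apply_three
  -- Both sides, paired with an arbitrary w, form a single vanishing sum; the summands on the right
  -- carry the exponents e + m_k.
  have h := sum_coeff_eq_zero (ι := (Fin 7 × Fin 7) ⊕ Fin 7)
    (Sum.elim (fun x => m x.1 + m x.2) fun k => e + m k)
    (Sum.elim (fun x => (m x.1 : ℂ) ^ 1 * (m x.2 : ℂ) ^ 2 * dotC (crossC (v x.1) (v x.2)) w)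
      fun k => c * dotC (v k) w) (fun z hz => ?_) e
  · rw [Fintype.sum_sum_type] at h
    simp only [Sum.elim_inl, Sum.elim_inr] at h
    rw [Finset.sum_eq_zero, Finset.sum_eq_single 0, zero_add] at h
    · simp only [h0, add_zero, if_true] at h
      exact (mul_eq_zero.1 h).resolve_left hv.ne_zero
    · intro k _ hk
      have := hv.mono (Fin.pos_iff_ne_zero.2 hk)
      exact if_neg (by omega)
    · simp
    · rintro ⟨i, j⟩ -
      by_cases hi : i = 0
      · simp [hi, h0]
      by_cases hj : j = 0
      · simp [hj, h0]
      by_cases hij : i = j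
      · simp [hij]
      refine if_neg ?_
      change m i + m j ≠ e
      have key : ∀ i j : Fin 7, i ≠ 0 → i < j → m i + m j ≠ e := by
        intro i j hi hij hs
        have i1 : m 0 < m i := hv.mono (Fin.pos_iff_ne_zero.2 hi)
        have j2 : j < 3 := by
          by_contra hj
          have := hv.mono.monotone (not_lt.1 hj)
          omega
        have : i = 1 ∧ j = 2 := by omega
        rw [this.1, this.2] at hs
        exact hne hs
      rcases lt_or_gt_of_ne hij with hlt | hlt
      · exact key i j hi hlt
      · rw [add_comm]; exact key j i hj hlt
  · have h4 := congrArg (fun x => dotC x w) (hv.cross_one_two hz)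
    simp only [gsum, crossC_sum_left, dotC_sum_left, dotC_smul_left] at h4
    simp only [crossC_sum_right, dotC_sum_left, crossC_smul_left, crossC_smul_right,
      dotC_smul_left] at h4
    rw [← sub_eq_zero] at h4
    rw [← h4, Fintype.sum_sum_type, Fintype.sum_prod_type, sub_eq_add_neg, Finset.mul_sum,
      ← Finset.sum_neg_distrib]
    congr 1
    · refine Finset.sum_congr rfl fun i _ => Finset.sum_congr rfl fun j _ => ?_
      simp only [Sum.elim_inl]; ring
    · refine Finset.sum_congr rfl fun k _ => ?_
      simp only [Sum.elim_inr]; ring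

/-- The exponents are determined by two positive integers. -/
theorem exists_exponents (hv : IsNullSystem m v c e) (h0 : m 0 = 0) : ∃ k l : ℕ+,
    e = 2 * k + l ∧ m = ![0, (k : ℕ), k + l, 2 * k + l, 3 * k + l, 3 * k + 2 * l, 4 * k + 2 * l] := by
  have h1 : m 0 < m 1 := hv.mono (by decide)
  have h2 : m 1 < m 2 := hv.mono (by decide)
  have h3 := hv.apply_three
  have h4 := hv.add_one_two h0
  have a0 : m 0 + m 6 = 2 * e := hv.add_rev 0
  have a1 : m 1 + m 5 = 2 * e := hv.add_rev 1
  have a2 : m 2 + m 4 = 2 * e := hv.add_rev 2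
  refine ⟨⟨m 1, by omega⟩, ⟨m 2 - m 1, by omega⟩, ?_, ?_⟩
  · simp only [PNat.mk_coe]; omega
  · ext i
    fin_cases i <;> simp [-Nat.sub_add_cancel] <;> omega

end IsNullSystem

/-! ### The null system of the directrix polynomial -/

open Polynomial in
theorem deriv_dotC_pvec (p q : Fin 7 → ℂ[X]) {z : ℂ}
    (h : ∀ z, dotC (pvec p z) (pvec q z) = 0) :
    dotC (pvec (pderiv p) z) (pvec q z) + dotC (pvec p z) (pvec (pderiv q) z) = 0 := by
  have h1 := Dz_dotC (Smooth.diff (smooth_pvec p) z) (Smooth.diff (smooth_pvec q) z)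
  simp only [h, Dz_const, Dz_pvec] at h1
  exact h1.symm

open Polynomial in
theorem wronski_eq_det (p : Fin 7 → ℂ[X]) (z : ℂ) : wronski p z =
    Matrix.det (Matrix.of fun i j : Fin 7 => pvec (pderiv^[(j : ℕ)] p) z i) := by
  have h : ∀ (j : ℕ) (p : Fin 7 → ℂ[X]) (i : Fin 7), (pderiv^[j] p) i = derivative^[j] (p i) := by
    intro j
    induction j with
    | zero => intro p i; rfl
    | succ j ih => intro p i; rw [Function.iterate_succ_apply, ih, Function.iterate_succ_apply]; rfl
  simp only [wronski, pvec_apply, h]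

open Polynomial in
theorem eq_zero_of_dotC_derivs {p : Fin 7 → ℂ[X]} {z : ℂ} (hw : wronski p z ≠ 0) {x : C7}
    (h : ∀ j ≤ 6, dotC x (pvec (pderiv^[j] p) z) = 0) : x = 0 := by
  rw [wronski_eq_det] at hw
  have := Matrix.eq_zero_of_vecMul_eq_zero (v := x.ofLp) hw (by
    ext j
    exact h j (by omega))
  ext i
  exact congrFun this i

open Polynomial in
theorem IsDirectrixPoly.exists_isNullSystem {F : ℂ → C7} {p : Fin 7 → ℂ[X]} (hF : IsACLift F)
    (hne : ∃ z, binormal F z ≠ 0) (hp : IsDirectrixPoly F p)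
    (hw : ∀ z, z ≠ 0 → wronski p z ≠ 0) :
    ∃ (m : Fin 7 → ℕ) (v : Fin 7 → C7) (c : ℂ) (e : ℕ), IsNullSystem m v c e ∧ m 0 = 0 ∧
      ∀ z, pvec p z = gsum m v 0 z := by
  obtain ⟨m, v, hm, hm0, hv, hP⟩ := exists_monomial_form hw (hp.ne_zero 0)
  have hP0 : ∀ z, pvec p z = gsum m v 0 z := fun z => by rw [hP]; simp [gsum]
  set P : ℕ → ℂ → C7 := fun j => pvec (pderiv^[j] p) with hPd
  have hPs : ∀ j, pderiv (pderiv^[j] p) = pderiv^[j + 1] p := fun j =>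
    (Function.iterate_succ_apply' pderiv j p).symm
  have hder : ∀ j z, HasDerivAt (P j) (P (j + 1) z) z := fun j z => by
    have := hasDerivAt_pvec (pderiv^[j] p) z
    rwa [hPs] at this
  have step : ∀ a (X : ℂ → C7) (X' : C7) (z : ℂ), z ≠ 0 → (∀ z, z ≠ 0 → gsum m v a z = X z) →
      HasDerivAt X X' z → gsum m v (a + 1) z = z • X' := by
    intro a X X' z hz h1 h2
    have h3 := IsNullSystem.hasDerivAt_gsum m v a hz
    have h4 : gsum m v a =ᶠ[𝓝 z] X := by
      filter_upwards [isOpen_ne.mem_nhds hz] with w hw using h1 w hw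
    have h5 := h3.unique (h2.congr_of_eventuallyEq h4)
    rw [← h5, smul_smul, mul_inv_cancel₀ hz, one_smul]
  have g1 : ∀ z, z ≠ 0 → gsum m v 1 z = z • P 1 z := fun z hz =>
    step 0 (P 0) _ z hz (fun z _ => (hP0 z).symm) (hder 0 z)
  have g2 : ∀ z, z ≠ 0 → gsum m v 2 z = z • P 1 z + z ^ 2 • P 2 z := fun z hz => by
    rw [step 1 _ _ z hz g1 ((hasDerivAt_id z).fun_smul (hder 1 z))]
    simp only [id]; module
  have g3 : ∀ z, z ≠ 0 → gsum m v 3 z = z • P 1 z + (3 * z ^ 2) • P 2 z + z ^ 3 • P 3 z :=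
    fun z hz => by
      rw [step 2 _ _ z hz g2 (((hasDerivAt_id z).fun_smul (hder 1 z)).fun_add
        (((hasDerivAt_id z).fun_pow 2).fun_smul (hder 2 z)))]
      simp only [id]; module
  have dl : ∀ a b, (∀ z, dotC (P a z) (P b z) = 0) → ∀ z,
      dotC (P (a + 1) z) (P b z) + dotC (P a z) (P (b + 1) z) = 0 := by
    intro a b h z
    have := deriv_dotC_pvec (pderiv^[a] p) (pderiv^[b] p) (z := z) h
    rwa [hPs, hPs] at this
  have dd : ∀ a b, a ≤ 2 → b ≤ 2 → ∀ z, dotC (P a z) (P b z) = 0 := fun a b ha hb =>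
    hp.dot_deriv hF hne ha hb
  have d03 : ∀ z, dotC (P 0 z) (P 3 z) = 0 := fun z => by
    have := dl 0 2 (dd 0 2 (by norm_num) le_rfl) z
    rwa [dd 1 2 (by norm_num) le_rfl, zero_add] at this
  have d13 : ∀ z, dotC (P 1 z) (P 3 z) = 0 := fun z => by
    have := dl 1 2 (dd 1 2 (by norm_num) le_rfl) z
    rwa [dd 2 2 le_rfl le_rfl, zero_add] at this
  have d23 : ∀ z, dotC (P 2 z) (P 3 z) = 0 := fun z => by
    have := dl 2 2 (dd 2 2 le_rfl le_rfl) z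
    rw [dotC_comm (P (2 + 1) z)] at this
    linear_combination (1 / 2 : ℂ) * this
  have d04 : ∀ z, dotC (P 0 z) (P 4 z) = 0 := fun z => by
    have := dl 0 3 d03 z
    rwa [d13, zero_add] at this
  have d14 : ∀ z, dotC (P 1 z) (P 4 z) = 0 := fun z => by
    have := dl 1 3 d13 z
    rwa [d23, zero_add] at this
  have d24 : ∀ z, dotC (P 3 z) (P 3 z) + dotC (P 2 z) (P 4 z) = 0 := dl 2 3 d23
  have d05 : ∀ z, dotC (P 0 z) (P 5 z) = 0 := fun z => by
    have := dl 0 4 d04 z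
    rwa [d14, zero_add] at this
  have d15 : ∀ z, dotC (P 2 z) (P 4 z) + dotC (P 1 z) (P 5 z) = 0 := dl 1 4 d14
  have d06 : ∀ z, dotC (P 1 z) (P 5 z) + dotC (P 0 z) (P 6 z) = 0 := dl 0 5 d05
  obtain ⟨g, hg⟩ := hp.cross_deriv_three hF hne
  have hgP : ∀ z, crossC (P 0 z) (P 3 z) = g.eval z • P 0 z := hg
  -- If g vanished at z, then p × p''' = 0 would force p''' · p''' = 0. Then p would be orthogonal
  -- to all its derivatives up to order 6, which span ℂ⁷ where the Wronskian is nonzero.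
  have hg0 : ∀ z, z ≠ 0 → g.eval z ≠ 0 := by
    intro z hz hgz
    have h1 := crossC_crossC_self (P 3 z) (P 0 z)
    rw [crossC_anticomm (P 3 z) (P 0 z), hgP, hgz, zero_smul, neg_zero, crossC_zero_right,
      dotC_comm (P 3 z) (P 0 z), d03, zero_smul, add_zero] at h1
    have h2 : dotC (P 3 z) (P 3 z) = 0 :=
      neg_eq_zero.1 ((smul_eq_zero.1 h1.symm).resolve_right (hp.ne_zero z))
    refine hp.ne_zero z (eq_zero_of_dotC_derivs (hw z hz) fun j hj => ?_)
    change dotC (P 0 z) (P j z) = 0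
    interval_cases j
    · exact dd 0 0 (by norm_num) (by norm_num) z
    · exact dd 0 1 (by norm_num) (by norm_num) z
    · exact dd 0 2 (by norm_num) (by norm_num) z
    · exact d03 z
    · exact d04 z
    · exact d05 z
    -- Successive differentiation gives p · p⁽⁶⁾ = -p' · p⁽⁵⁾ = p'' · p⁽⁴⁾ = -p''' · p'''.
    · linear_combination d06 z - d15 z + d24 z - h2
  obtain ⟨c, n, hc, hcn⟩ := eq_monomial_of_eval_ne_zero hg0
  have cc : ∀ b z, b ≤ 2 → crossC (P 0 z) (P b z) = 0 := fun b z hb => hp.cross_deriv hF hne hb z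
  have g0 : ∀ z, gsum m v 0 z = P 0 z := fun z => (hP0 z).symm
  -- The only part of θ³p contributing to p × θ³p is z³ p''', which raises the exponent of g by 3.
  refine ⟨m, v, c, n + 3, ⟨hm, hv, hc, ?_, ?_, ?_, ?_⟩, hm0, hP0⟩
  · have e00 := dd 0 0 (by norm_num) (by norm_num)
    have e01 := dd 0 1 (by norm_num) (by norm_num)
    have e02 := dd 0 2 (by norm_num) (by norm_num)
    have e10 := dd 1 0 (by norm_num) (by norm_num)
    have e11 := dd 1 1 (by norm_num) (by norm_num)
    have e12 := dd 1 2 (by norm_num) (by norm_num)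
    have e20 := dd 2 0 (by norm_num) (by norm_num)
    have e21 := dd 2 1 (by norm_num) (by norm_num)
    have e22 := dd 2 2 (by norm_num) (by norm_num)
    intro a b z ha hb hz
    interval_cases a <;> interval_cases b <;>
      simp [g0, g1 z hz, g2 z hz, e00, e01, e02, e10, e11, e12, e20, e21, e22]
  · intro z hz
    simp [g0, g3 z hz, d03, dd 0 1, dd 0 2]
  · intro b z hb hz
    interval_cases b
    · simp
    · simp [g0, g1 z hz, cc 1]
    · simp [g0, g2 z hz, cc 1, cc 2]
  · intro z hz
    simp only [g0, g3 z hz, crossC_add_right, crossC_smul_right, cc 1 z (by norm_num),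
      cc 2 z le_rfl, hgP, hcn, eval_mul, eval_C, eval_pow, eval_X]
    module

/-! ### Holomorphic frames of the osculating spaces -/

/-- `s` is, near `a`, a combination of `e 0, …, e (n - 1)` with analytic coefficients. -/
def AnSpan (a : ℂ) (e : ℕ → ℂ → C7) (n : ℕ) (s : ℂ → C7) : Prop :=
  ∃ b : ℕ → ℂ → ℂ, (∀ k, AnalyticAt ℂ (b k) a) ∧
    ∀ᶠ z in 𝓝 a, s z = ∑ k ∈ Finset.range n, b k z • e k z

section AnSpan

variable {a : ℂ} {e : ℕ → ℂ → C7} {n N : ℕ} {s t : ℂ → C7}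

theorem AnSpan.add (hs : AnSpan a e n s) (ht : AnSpan a e n t) :
    AnSpan a e n (fun z => s z + t z) := by
  obtain ⟨b, hb, hs⟩ := hs
  obtain ⟨c, hc, ht⟩ := ht
  refine ⟨fun k z => b k z + c k z, fun k => (hb k).add (hc k), ?_⟩
  filter_upwards [hs, ht] with z h1 h2
  rw [h1, h2, ← Finset.sum_add_distrib]
  simp only [add_smul]

theorem AnSpan.smul {f : ℂ → ℂ} (hf : AnalyticAt ℂ f a) (hs : AnSpan a e n s) :
    AnSpan a e n (fun z => f z • s z) := by
  obtain ⟨b, hb, hs⟩ := hs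
  refine ⟨fun k z => f z * b k z, fun k => hf.mul (hb k), ?_⟩
  filter_upwards [hs] with z h1
  rw [h1, Finset.smul_sum]
  simp only [mul_smul]

theorem AnSpan.zero : AnSpan a e n (fun _ => 0) :=
  ⟨fun _ _ => 0, fun _ => analyticAt_const, by simp⟩

theorem AnSpan.sum {ι : Type*} {S : Finset ι} {s : ι → ℂ → C7}
    (h : ∀ i ∈ S, AnSpan a e n (s i)) : AnSpan a e n (fun z => ∑ i ∈ S, s i z) := by
  classical
  induction S using Finset.induction_on with
  | empty => simpa using AnSpan.zero
  | insert i S hi ih =>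
    simp only [Finset.sum_insert hi]
    exact (h i (Finset.mem_insert_self i S)).add
      (ih fun j hj => h j (Finset.mem_insert_of_mem hj))

theorem AnSpan.congr (hs : AnSpan a e n s) (h : t =ᶠ[𝓝 a] s) : AnSpan a e n t := by
  obtain ⟨b, hb, hs⟩ := hs
  exact ⟨b, hb, by filter_upwards [h, hs] with z h1 h2 using h1.trans h2⟩

theorem AnSpan.self {k : ℕ} (hk : k < n) : AnSpan a e n (e k) := by
  refine ⟨fun i _ => if i = k then 1 else 0, fun i => analyticAt_const, ?_⟩
  exact Filter.Eventually.of_forall fun z => by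
    simp [Finset.sum_ite_eq', ite_smul, hk]

theorem AnSpan.mono (hs : AnSpan a e n s) (h : n ≤ N) : AnSpan a e N s := by
  obtain ⟨b, hb, hs⟩ := hs
  have : AnSpan a e N fun z => ∑ k ∈ Finset.range n, b k z • e k z :=
    AnSpan.sum fun k hk => (AnSpan.self ((Finset.mem_range.1 hk).trans_le h)).smul (hb k)
  exact this.congr hs

theorem AnSpan.update (hs : AnSpan a e n s) (h : n ≤ N) (u : ℂ → C7) :
    AnSpan a (Function.update e N u) n s := by
  obtain ⟨b, hb, hs⟩ := hs
  refine ⟨b, hb, ?_⟩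
  filter_upwards [hs] with z h1
  rw [h1]
  refine Finset.sum_congr rfl fun k hk => ?_
  rw [Function.update_of_ne (by have := Finset.mem_range.1 hk; omega)]

theorem AnSpan.deriv (he : ∀ k < n, AnalyticAt ℂ (e k) a)
    (hd : ∀ k < n, AnSpan a e N (deriv (e k))) (hN : n ≤ N) (hs : AnSpan a e n s) :
    AnSpan a e N (deriv s) := by
  obtain ⟨b, hb, hs⟩ := hs
  have h1 : AnSpan a e N fun z => ∑ k ∈ Finset.range n, (_root_.deriv (b k) z • e k z +
      b k z • _root_.deriv (e k) z) := AnSpan.sum fun k hk => by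
    have hk' := Finset.mem_range.1 hk
    exact ((AnSpan.self (hk'.trans_le hN)).smul (hb k).deriv).add ((hd k hk').smul (hb k))
  refine h1.congr ?_
  have hb' : ∀ᶠ z in 𝓝 a, ∀ k ∈ Finset.range n, AnalyticAt ℂ (b k) z ∧ AnalyticAt ℂ (e k) z :=
    (Filter.eventually_all_finset _).2 fun k hk =>
      (hb k).eventually_analyticAt.and (he k (Finset.mem_range.1 hk)).eventually_analyticAt
  filter_upwards [hs.eventually_nhds, hb'] with z h2 h3
  rw [Filter.EventuallyEq.deriv_eq h2, deriv_fun_sum fun k hk =>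
    (h3 k hk).1.differentiableAt.fun_smul (h3 k hk).2.differentiableAt]
  refine Finset.sum_congr rfl fun k hk => ?_
  rw [deriv_fun_smul (h3 k hk).1.differentiableAt (h3 k hk).2.differentiableAt, add_comm]

theorem AnSpan.mem_span (hs : AnSpan a e n s) :
    ∀ᶠ z in 𝓝 a, s z ∈ Submodule.span ℂ (Set.range fun i : Fin n => e i z) := by
  obtain ⟨b, -, hs⟩ := hs
  filter_upwards [hs] with z h1
  rw [h1]
  exact Submodule.sum_mem _ fun k hk => Submodule.smul_mem _ _
    (Submodule.subset_span ⟨⟨k, Finset.mem_range.1 hk⟩, rfl⟩)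

theorem analyticAt_clm_apply {E F : Type*} [NormedAddCommGroup E] [NormedSpace ℂ E]
    [NormedAddCommGroup F] [NormedSpace ℂ F] {A : ℂ → E →L[ℂ] F} {x : ℂ → E} {a : ℂ}
    (hA : AnalyticAt ℂ A a) (hx : AnalyticAt ℂ x a) : AnalyticAt ℂ (fun z => A z (x z)) a :=
  AnalyticAt.comp₂ (h := fun p : (E →L[ℂ] F) × E => p.1 p.2)
    ((ContinuousLinearMap.id ℂ (E →L[ℂ] F)).analyticAt_bilinear (A a, x a)) hA hx

/-- Reduction of an analytic vector function modulo analytic vector functions which are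
independent at `a`. -/
theorem exists_reduction {X : ℂ → C7} (he : ∀ k < n, AnalyticAt ℂ (e k) a)
    (hX : AnalyticAt ℂ X a) (hi : LinearIndependent ℂ fun i : Fin n => e i a) :
    AnSpan a e n X ∨ ∃ (u : ℂ → C7) (m : ℕ), AnalyticAt ℂ u a ∧
      LinearIndependent ℂ (fun i : Fin (n + 1) => Function.update e n u i a) ∧
      AnSpan a e n (fun z => X z - (z - a) ^ m • u z) := by
  set V := Fin n → ℂ
  set E : ℂ → V →L[ℂ] C7 := fun z => ∑ i : Fin n,
    ContinuousLinearMap.smulRightL ℂ V C7 (ContinuousLinearMap.proj i) (e i z) with hE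
  have hEapp : ∀ z (x : V), E z x = ∑ i : Fin n, x i • e i z := fun z x => by
    simp [hE, sum_apply]
    rfl
  have hEan : AnalyticAt ℂ E a := by
    refine Finset.analyticAt_fun_sum _ fun i _ => ?_
    exact ((ContinuousLinearMap.smulRightL ℂ V C7 (ContinuousLinearMap.proj i)).analyticAt _).comp
      (he i i.2)
  have hinj : Function.Injective (E a) := by
    rw [← ContinuousLinearMap.coe_coe, ← LinearMap.ker_eq_bot, LinearMap.ker_eq_bot']
    intro x hx
    rw [ContinuousLinearMap.coe_coe, hEapp] at hx
    ext i
    exact Fintype.linearIndependent_iff.1 hi x hx i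
  obtain ⟨Λ', hΛ'⟩ := LinearMap.exists_leftInverse_of_injective (E a : V →ₗ[ℂ] C7)
    (LinearMap.ker_eq_bot.2 hinj)
  set Λ : C7 →L[ℂ] V := LinearMap.toContinuousLinearMap Λ' with hΛ
  have hΛE : ∀ x, Λ (E a x) = x := fun x => LinearMap.congr_fun hΛ' x
  -- With Λ a left inverse of the frame at a, the composite with the moving frame is invertible near
  -- a. This provides an analytic splitting into the span of the frame and the kernel of Λ.
  set A : ℂ → V →L[ℂ] V := fun z => Λ ∘L E z with hA
  have hAa : A a = 1 := by ext1 x; exact hΛE x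
  have hAan : AnalyticAt ℂ A a :=
    ((ContinuousLinearMap.compL ℂ V C7 V Λ).analyticAt _).comp hEan
  have hinv : AnalyticAt ℂ (fun z => Ring.inverse (A z)) a := by
    refine AnalyticAt.comp (g := Ring.inverse) ?_ hAan
    rw [hAa]; exact analyticAt_inverse (1 : (V →L[ℂ] V)ˣ)
  have hunit : ∀ᶠ z in 𝓝 a, A z * Ring.inverse (A z) = 1 := by
    have h1 : ∀ᶠ y in 𝓝 (A a), IsUnit y := by
      rw [hAa]; exact (1 : (V →L[ℂ] V)ˣ).nhds
    filter_upwards [hAan.continuousAt.eventually h1] with z hz using Ring.mul_inverse_cancel _ hz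
  set x : ℂ → V := fun z => Ring.inverse (A z) (Λ (X z)) with hx
  have hxan : AnalyticAt ℂ x a := by
    have h1 : AnalyticAt ℂ (fun z => Λ (X z)) a := (Λ.analyticAt _).comp hX
    exact analyticAt_clm_apply hinv h1
  have hxi : ∀ i : Fin n, AnalyticAt ℂ (fun z => x z i) a := fun i =>
    ((ContinuousLinearMap.proj (R := ℂ) (φ := fun _ : Fin n => ℂ) i).analyticAt _).comp hxan
  set Y : ℂ → C7 := fun z => X z - E z (x z) with hY
  have hYan : AnalyticAt ℂ Y a := hX.sub (analyticAt_clm_apply hEan hxan)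
  have hΛY : ∀ᶠ z in 𝓝 a, Λ (Y z) = 0 := by
    filter_upwards [hunit] with z hz
    have h1 := congrArg (fun B : V →L[ℂ] V => B (Λ (X z))) hz
    rw [hY, map_sub, sub_eq_zero]
    exact h1.symm
  have hEx : AnSpan a e n fun z => E z (x z) := by
    refine ⟨fun k z => if h : k < n then x z ⟨k, h⟩ else 0, fun k => ?_, ?_⟩
    · by_cases h : k < n
      · simpa [h] using hxi ⟨k, h⟩
      · simpa [h] using analyticAt_const
    · refine Filter.Eventually.of_forall fun z => ?_
      simp only [hEapp, Finset.sum_range]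
      simp
  by_cases hY0 : ∀ᶠ z in 𝓝 a, Y z = 0
  · left
    refine hEx.congr ?_
    filter_upwards [hY0] with z hz using sub_eq_zero.1 hz
  · right
    obtain ⟨m, u, hu, hu0, hYu⟩ := hYan.exists_eventuallyEq_pow_smul_nonzero_iff.2 hY0
    refine ⟨u, m, hu, ?_, hEx.congr ?_⟩
    -- After a power of z - a is divided out, the remaining vector still lies in ker Λ at a by
    -- continuity, and ker Λ meets the span of the frame trivially.
    · have hΛu : Λ (u a) = 0 := by
        have h1 : ∀ᶠ z in 𝓝[≠] a, Λ (u z) = 0 := by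
          filter_upwards [nhdsWithin_le_nhds hΛY, nhdsWithin_le_nhds hYu, self_mem_nhdsWithin]
            with z h1 h2 h3
          rw [h2, map_smul] at h1
          exact (smul_eq_zero.1 h1).resolve_left (pow_ne_zero _ (sub_ne_zero.2 h3))
        have h2 : Filter.Tendsto (fun z => Λ (u z)) (𝓝[≠] a) (𝓝 (Λ (u a))) :=
          (Λ.continuous.continuousAt.comp hu.continuousAt).tendsto.mono_left nhdsWithin_le_nhds
        exact tendsto_nhds_unique (h2.congr' h1) tendsto_const_nhds
      have hfun : (fun i : Fin (n + 1) => Function.update e n u i a) =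
          Fin.snoc (fun i : Fin n => e i a) (u a) := by
        ext1 i
        refine Fin.lastCases ?_ (fun j => ?_) i
        · simp
        · have : (j : ℕ) ≠ n := j.2.ne
          simp [Function.update_of_ne this]
      rw [hfun]
      refine hi.finSnoc fun hmem => hu0 ?_
      obtain ⟨y, hy⟩ := (Submodule.mem_span_range_iff_exists_fun ℂ).1 hmem
      rw [← hEapp] at hy
      rw [← hy, hΛE] at hΛu
      rw [← hy, hΛu, map_zero]
    · filter_upwards [hYu] with z hz
      rw [← hz]; simp [hY]

end AnSpan

/-- A holomorphic frame near `a` adapted to the osculating spaces of `P`. -/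
structure IsFrame (a : ℂ) (P : ℂ → C7) (n : ℕ) (e : ℕ → ℂ → C7) (m : ℕ → ℕ) : Prop where
  an : ∀ i < n, AnalyticAt ℂ (e i) a
  zero : e 0 = P
  indep : LinearIndependent ℂ fun i : Fin n => e i a
  der : ∀ i, i + 1 < n → AnSpan a e (i + 1) fun z => deriv (e i) z - (z - a) ^ m i • e (i + 1) z

namespace IsFrame

variable {a : ℂ} {P : ℂ → C7} {n : ℕ} {e : ℕ → ℂ → C7} {m : ℕ → ℕ}

theorem anSpan_deriv (h : IsFrame a P n e m) {i : ℕ} (hi : i + 1 < n) :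
    AnSpan a e (i + 2) (deriv (e i)) := by
  have h1 : AnalyticAt ℂ (fun z : ℂ => (z - a) ^ m i) a := by fun_prop
  have := ((h.der i hi).mono (Nat.le_succ (i + 1))).add
    ((AnSpan.self (e := e) (Nat.lt_succ_self (i + 1))).smul h1)
  simpa using this

theorem anSpan_iteratedDeriv (h : IsFrame a P n e m) {j : ℕ} (hj : j < n) :
    AnSpan a e (j + 1) (iteratedDeriv j P) := by
  induction j with
  | zero => rw [iteratedDeriv_zero, ← h.zero]; exact AnSpan.self (Nat.lt_succ_self 0)
  | succ j ih =>
    rw [iteratedDeriv_succ]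
    exact AnSpan.deriv (fun k hk => h.an k (by omega))
      (fun k hk => (h.anSpan_deriv (by omega)).mono (by omega)) (Nat.le_succ _) (ih (by omega))

/-- Reduce the derivative of the last frame vector modulo the frame. If nothing remained, all
derivatives of P would stay in a span of n + 1 vectors, contrary to generic independence. Otherwise
the reduced leading vector extends the frame. -/
theorem exists_succ (h : IsFrame a P (n + 1) e m)
    (hgen : ∃ᶠ z in 𝓝 a, LinearIndependent ℂ fun i : Fin (n + 2) => iteratedDeriv i P z) :
    ∃ (u : ℂ → C7) (k : ℕ), IsFrame a P (n + 2) (Function.update e (n + 1) u)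
      (Function.update m n k) := by
  rcases exists_reduction h.an (h.an n (Nat.lt_succ_self n)).deriv h.indep with hX | hX
  · exfalso
    have hd : ∀ k < n + 1, AnSpan a e (n + 1) (deriv (e k)) := by
      intro k hk
      rcases Nat.lt_succ_iff_lt_or_eq.1 hk with hk | rfl
      · exact (h.anSpan_deriv (by omega)).mono (by omega)
      · exact hX
    have hall : ∀ j, AnSpan a e (n + 1) (iteratedDeriv j P) := by
      intro j
      induction j with
      | zero => rw [iteratedDeriv_zero, ← h.zero]; exact AnSpan.self (Nat.succ_pos n)
      | succ j ih =>
        rw [iteratedDeriv_succ]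
        exact AnSpan.deriv h.an hd le_rfl ih
    have hev : ∀ᶠ z in 𝓝 a, ∀ j : Fin (n + 2), iteratedDeriv j P z ∈
        Submodule.span ℂ (Set.range fun i : Fin (n + 1) => e i z) :=
      Filter.eventually_all.2 fun j => (hall j).mem_span
    obtain ⟨z, hz1, hz2⟩ := (hgen.and_eventually hev).exists
    have h1 := finrank_span_eq_card hz1
    have h2 : Submodule.span ℂ (Set.range fun i : Fin (n + 2) => iteratedDeriv i P z) ≤
        Submodule.span ℂ (Set.range fun i : Fin (n + 1) => e i z) :=
      Submodule.span_le.2 (by rintro _ ⟨j, rfl⟩; exact hz2 j)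
    have h3 := Submodule.finrank_mono h2
    have h4 := finrank_range_le_card (R := ℂ) (fun i : Fin (n + 1) => e i z)
    rw [h1] at h3
    rw [Set.finrank] at h4
    simp only [Fintype.card_fin] at h3 h4
    omega
  · obtain ⟨u, k, hu, hind, hXu⟩ := hX
    refine ⟨u, k, ⟨fun i hi => ?_, ?_, hind, fun i hi => ?_⟩⟩
    · rcases Nat.lt_succ_iff_lt_or_eq.1 hi with hi | rfl
      · rw [Function.update_of_ne (by omega)]; exact h.an i hi
      · rwa [Function.update_self]
    · rw [Function.update_of_ne (by omega)]; exact h.zero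
    · rcases eq_or_ne i n with rfl | hin
      · rw [Function.update_of_ne (by omega), Function.update_self, Function.update_self]
        exact hXu.update le_rfl u
      · rw [Function.update_of_ne (by omega), Function.update_of_ne hin,
          Function.update_of_ne (by omega)]
        exact (h.der i (by omega)).update (by omega) u

theorem exists_frame (hP : AnalyticAt ℂ P a) (hPa : P a ≠ 0) (n : ℕ)
    (hgen : ∃ᶠ z in 𝓝 a, LinearIndependent ℂ fun i : Fin (n + 1) => iteratedDeriv i P z) :
    ∃ e m, IsFrame a P (n + 1) e m := by
  induction n with
  | zero =>
    refine ⟨fun _ => P, fun _ => 0, fun _ _ => hP, rfl, ?_, fun i hi => by omega⟩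
    exact show LinearIndependent ℂ (fun _ : Fin 1 => P a) from
      LinearIndependent.of_subsingleton (0 : Fin 1) hPa
  | succ n ih =>
    obtain ⟨e, m, h⟩ := ih (hgen.mono fun z hz =>
      hz.comp (Fin.castLE (Nat.le_succ _)) (Fin.castLE_injective _))
    obtain ⟨u, k, h'⟩ := h.exists_succ hgen
    exact ⟨_, _, h'⟩

end IsFrame

/-! ### Orthogonalization of holomorphic frames -/

/-- Gram-Schmidt orthogonalization of a moving frame. -/
def gs (e : ℕ → ℂ → C7) (j : ℕ) (z : ℂ) : C7 :=
  InnerProductSpace.gramSchmidt ℂ (fun i => e i z) j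

/-- The span of the first `j` vectors of a moving frame. -/
def flag (e : ℕ → ℂ → C7) (j : ℕ) (z : ℂ) : Submodule ℂ C7 :=
  Submodule.span ℂ ((fun i => e i z) '' Set.Iio j)

section GramSchmidt

variable {e : ℕ → ℂ → C7} {U : Set ℂ} {n : ℕ} {z : ℂ}

theorem flag_mono {i j : ℕ} (h : i ≤ j) (z : ℂ) : flag e i z ≤ flag e j z :=
  Submodule.span_mono (Set.image_mono (Set.Iio_subset_Iio h))

theorem flag_eq_gs (e : ℕ → ℂ → C7) (j : ℕ) (z : ℂ) :
    flag e j z = Submodule.span ℂ ((fun i => gs e i z) '' Set.Iio j) :=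
  (InnerProductSpace.span_gramSchmidt_Iio ℂ (fun i => e i z) j).symm

theorem mem_flag {i j : ℕ} (h : i < j) (z : ℂ) : e i z ∈ flag e j z :=
  Submodule.subset_span ⟨i, h, rfl⟩

theorem gs_mem_flag {i j : ℕ} (h : i < j) (z : ℂ) : gs e i z ∈ flag e j z := by
  rw [flag_eq_gs]
  exact Submodule.subset_span ⟨i, h, rfl⟩

theorem inner_gs_of_mem_flag {i j : ℕ} (hij : i ≤ j) {x : C7} (hx : x ∈ flag e i z) :
    inner ℂ x (gs e j z) = 0 := by
  rw [flag_eq_gs] at hx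
  induction hx using Submodule.span_induction with
  | mem x hx =>
    obtain ⟨k, hk, rfl⟩ := hx
    exact InnerProductSpace.gramSchmidt_orthogonal ℂ _ (by have : k < i := hk; omega)
  | zero => simp
  | add x y _ _ hx hy => rw [inner_add_left, hx, hy, add_zero]
  | smul a x _ hx => rw [inner_smul_left, hx, mul_zero]

theorem gs_ne_zero (hi : LinearIndependent ℂ fun i : Fin n => e i z) {j : ℕ} (hj : j < n) :
    gs e j z ≠ 0 := by
  have hinj : Function.Injective fun i : Set.Iic j => (⟨i, lt_of_le_of_lt i.2 hj⟩ : Fin n) :=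
    fun a b h => Subtype.ext (congrArg Fin.val h)
  have h : LinearIndependent ℂ ((fun i => e i z) ∘ ((↑) : Set.Iic j → ℕ)) := by
    have := hi.comp _ hinj
    exact this
  exact InnerProductSpace.gramSchmidt_ne_zero_coe j h

/-- The coefficients of the Gram-Schmidt process. -/
def gsCoeff (e : ℕ → ℂ → C7) (i j : ℕ) (z : ℂ) : ℂ :=
  dotC (conjC (gs e i z)) (e j z) * (dotC (conjC (gs e i z)) (gs e i z))⁻¹

theorem gs_eq (e : ℕ → ℂ → C7) (j : ℕ) (z : ℂ) :
    gs e j z = e j z - ∑ i ∈ Finset.range j, gsCoeff e i j z • gs e i z := by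
  have h := InnerProductSpace.gramSchmidt_def'' ℂ (fun i => e i z) j
  rw [eq_sub_iff_add_eq]
  have hI : Finset.range j = Finset.Iio j := by ext; simp
  refine Eq.trans ?_ h.symm
  rw [hI]
  congr 1
  refine Finset.sum_congr rfl fun i _ => ?_
  rw [gsCoeff, ← inner_eq_dotC, ← inner_eq_dotC, inner_self_eq_norm_sq_to_K, ← div_eq_mul_inv]
  rfl

theorem sub_gs_mem_flag (e : ℕ → ℂ → C7) (j : ℕ) (z : ℂ) : e j z - gs e j z ∈ flag e j z := by
  rw [gs_eq, sub_sub_cancel]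
  exact Submodule.sum_mem _ fun i hi => Submodule.smul_mem _ _
    (gs_mem_flag (Finset.mem_range.1 hi) z)

theorem smooth_of_differentiableOn {s : ℂ → C7} (hU : IsOpen U) (hs : DifferentiableOn ℂ s U) :
    ContDiffOn ℝ ∞ s U := (hs.contDiffOn hU).restrict_scalars ℝ

theorem gs_smooth (hU : IsOpen U) (he : ∀ i < n, DifferentiableOn ℂ (e i) U)
    (hi : ∀ z ∈ U, LinearIndependent ℂ fun i : Fin n => e i z) {j : ℕ} (hj : j < n) :
    ContDiffOn ℝ ∞ (gs e j) U := by
  induction j using Nat.strong_induction_on with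
  | _ j ih =>
    have h1 : gs e j = fun z => e j z - ∑ i ∈ Finset.range j, gsCoeff e i j z • gs e i z :=
      funext fun z => gs_eq e j z
    rw [h1]
    refine (smooth_of_differentiableOn hU (he j hj)).sub (ContDiffOn.sum fun i hij => ?_)
    have hij := Finset.mem_range.1 hij
    have h2 := ih i hij (hij.trans hj)
    refine ContDiffOn.smul (ContDiffOn.mul (contDiffOn_dotC (contDiffOn_conjC h2)
      (smooth_of_differentiableOn hU (he j hj))) ((contDiffOn_dotC (contDiffOn_conjC h2) h2).inv
      fun z hz => ?_)) h2
    rw [dotC_conjC_self]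
    simpa using gs_ne_zero (hi z hz) (hij.trans hj)

theorem gsCoeff_smooth (hU : IsOpen U) (he : ∀ i < n, DifferentiableOn ℂ (e i) U)
    (hi : ∀ z ∈ U, LinearIndependent ℂ fun i : Fin n => e i z) {i j : ℕ} (hin : i < n) (hj : j < n) :
    ContDiffOn ℝ ∞ (gsCoeff e i j) U := by
  have h2 := gs_smooth hU he hi hin
  refine ContDiffOn.mul (contDiffOn_dotC (contDiffOn_conjC h2)
    (smooth_of_differentiableOn hU (he j hj))) ((contDiffOn_dotC (contDiffOn_conjC h2) h2).inv
    fun z hz => ?_)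
  rw [dotC_conjC_self]
  simpa using gs_ne_zero (hi z hz) hin

theorem differentiableAt_conjC {s : ℂ → C7} {z : ℂ} (hs : DifferentiableAt ℝ s z) :
    DifferentiableAt ℝ (fun w => conjC (s w)) z := conjL.differentiableAt.comp z hs

/-- The frame is holomorphic, so ∂_z̄ sees only the Gram–Schmidt corrections, which involve earlier
vectors. -/
theorem Db_gs_mem (hU : IsOpen U) (he : ∀ i < n, DifferentiableOn ℂ (e i) U)
    (hi : ∀ z ∈ U, LinearIndependent ℂ fun i : Fin n => e i z) {j : ℕ} (hj : j < n) (hz : z ∈ U) :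
    Db (gs e j) z ∈ flag e j z := by
  induction j using Nat.strong_induction_on with
  | _ j ih =>
    have h1 : gs e j = fun z => e j z - ∑ i ∈ Finset.range j, gsCoeff e i j z • gs e i z :=
      funext fun z => gs_eq e j z
    have hc : ∀ i ∈ Finset.range j, DifferentiableAt ℝ (gsCoeff e i j) z := fun i hij =>
      SmoothOn.diff hU (gsCoeff_smooth hU he hi ((Finset.mem_range.1 hij).trans hj) hj) hz
    have hg : ∀ i ∈ Finset.range j, DifferentiableAt ℝ (gs e i) z := fun i hij =>
      SmoothOn.diff hU (gs_smooth hU he hi ((Finset.mem_range.1 hij).trans hj)) hz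
    have hs : ∀ i ∈ Finset.range j, DifferentiableAt ℝ (fun z => gsCoeff e i j z • gs e i z) z :=
      fun i hij => (hc i hij).fun_smul (hg i hij)
    have hed := (he j hj).differentiableAt (hU.mem_nhds hz)
    rw [h1, Db_sub (hed.restrictScalars ℝ) (DifferentiableAt.fun_sum hs), Db_sum hs,
      Db_of_differentiableAt hed, zero_sub]
    refine Submodule.neg_mem _ (Submodule.sum_mem _ fun i hij => ?_)
    have hij' := Finset.mem_range.1 hij
    rw [Db_smul (hc i hij) (hg i hij)]
    exact Submodule.add_mem _ (Submodule.smul_mem _ _ (gs_mem_flag hij' z))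
      (Submodule.smul_mem _ _ (flag_mono hij'.le z (ih i hij' (hij'.trans hj))))

variable {a : ℂ} {m : ℕ → ℕ}

theorem Dz_gs_mem (hU : IsOpen U) (he : ∀ i < n, DifferentiableOn ℂ (e i) U)
    (hi : ∀ z ∈ U, LinearIndependent ℂ fun i : Fin n => e i z) {j : ℕ} (hz : z ∈ U)
    (hd : ∀ i ≤ j, deriv (e i) z - (z - a) ^ m i • e (i + 1) z ∈ flag e (i + 1) z)
    (hj : j < n) :
    Dz (gs e j) z - (z - a) ^ m j • gs e (j + 1) z ∈ flag e (j + 1) z := by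
  induction j using Nat.strong_induction_on with
  | _ j ih =>
    have h1 : gs e j = fun z => e j z - ∑ i ∈ Finset.range j, gsCoeff e i j z • gs e i z :=
      funext fun z => gs_eq e j z
    have hc : ∀ i ∈ Finset.range j, DifferentiableAt ℝ (gsCoeff e i j) z := fun i hij =>
      SmoothOn.diff hU (gsCoeff_smooth hU he hi ((Finset.mem_range.1 hij).trans hj) hj) hz
    have hg : ∀ i ∈ Finset.range j, DifferentiableAt ℝ (gs e i) z := fun i hij =>
      SmoothOn.diff hU (gs_smooth hU he hi ((Finset.mem_range.1 hij).trans hj)) hz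
    have hs : ∀ i ∈ Finset.range j, DifferentiableAt ℝ (fun z => gsCoeff e i j z • gs e i z) z :=
      fun i hij => (hc i hij).fun_smul (hg i hij)
    have hed := (he j hj).differentiableAt (hU.mem_nhds hz)
    have h2 : Dz (gs e j) z - (z - a) ^ m j • gs e (j + 1) z =
        (deriv (e j) z - (z - a) ^ m j • e (j + 1) z) +
        (z - a) ^ m j • (e (j + 1) z - gs e (j + 1) z) -
        ∑ i ∈ Finset.range j, (Dz (gsCoeff e i j) z • gs e i z + gsCoeff e i j z • Dz (gs e i) z) := by
      conv_lhs => rw [h1]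
      rw [Dz_sub (hed.restrictScalars ℝ) (DifferentiableAt.fun_sum hs), Dz_sum hs,
        Dz_of_differentiableAt hed]
      have h3 : ∀ i ∈ Finset.range j, Dz (fun z => gsCoeff e i j z • gs e i z) z =
          Dz (gsCoeff e i j) z • gs e i z + gsCoeff e i j z • Dz (gs e i) z := fun i hij =>
        Dz_smul (hc i hij) (hg i hij)
      rw [Finset.sum_congr rfl h3]
      module
    rw [h2]
    refine Submodule.sub_mem _ (Submodule.add_mem _ (hd j le_rfl)
      (Submodule.smul_mem _ _ (sub_gs_mem_flag e (j + 1) z))) (Submodule.sum_mem _ fun i hij => ?_)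
    have hij' := Finset.mem_range.1 hij
    refine Submodule.add_mem _ (Submodule.smul_mem _ _ (gs_mem_flag (by omega) z))
      (Submodule.smul_mem _ _ ?_)
    have h4 := flag_mono (e := e) (show i + 1 ≤ j + 1 by omega) z (ih i hij' (fun l hl => hd l (by omega)) (by omega))
    have h5 : (z - a) ^ m i • gs e (i + 1) z ∈ flag e (j + 1) z :=
      Submodule.smul_mem _ _ (gs_mem_flag (by omega) z)
    simpa using Submodule.add_mem _ h4 h5

/-- The remainder of ∂_z g_j after subtracting (z - a)^{m_j} g_{j+1} lies in the span of g_0, …,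
g_j. Differentiating ⟨g_i, g_j⟩ = 0 for i < j shows that it is orthogonal to g_i. It is thus a
multiple of g_j and disappears under the projection. -/
theorem delPerp_gs (hU : IsOpen U) (he : ∀ i < n, DifferentiableOn ℂ (e i) U)
    (hi : ∀ z ∈ U, LinearIndependent ℂ fun i : Fin n => e i z) {j : ℕ} (hz : z ∈ U)
    (hd : ∀ i ≤ j, deriv (e i) z - (z - a) ^ m i • e (i + 1) z ∈ flag e (i + 1) z)
    (hj : j < n) : delPerp (gs e j) z = (z - a) ^ m j • gs e (j + 1) z := by
  set r := Dz (gs e j) z - (z - a) ^ m j • gs e (j + 1) z with hr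
  have hrm : r ∈ flag e (j + 1) z := Dz_gs_mem hU he hi hz hd hj
  have hdiff : ∀ i, i < n → DifferentiableAt ℝ (gs e i) z := fun i hin =>
    SmoothOn.diff hU (gs_smooth hU he hi hin) hz
  have horth : ∀ i < j, inner ℂ (gs e i z) r = 0 := by
    intro i hij
    have h1 := Dz_dotC (differentiableAt_conjC (hdiff i (by omega))) (hdiff j (by omega))
    have h0 : ∀ w, dotC (conjC (gs e i w)) (gs e j w) = 0 := fun w => by
      rw [← inner_eq_dotC]
      exact inner_gs_of_mem_flag hij (gs_mem_flag (Nat.lt_succ_self i) w)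
    simp only [h0, Dz_const] at h1
    rw [Dz_conjC (hdiff i (by omega)), ← inner_eq_dotC, ← inner_eq_dotC,
      inner_gs_of_mem_flag hij.le (Db_gs_mem hU he hi (by omega) hz), zero_add] at h1
    rw [hr, inner_sub_right, ← h1, inner_smul_right,
      inner_gs_of_mem_flag (show i + 1 ≤ j + 1 by omega) (gs_mem_flag (Nat.lt_succ_self i) z)]
    simp
  have hrs : ∃ c : ℂ, r = c • gs e j z := by
    rw [flag_eq_gs, show Set.Iio (j + 1) = insert j (Set.Iio j) by ext; simp,
      Set.image_insert_eq, Submodule.mem_span_insert] at hrm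
    obtain ⟨c, y, hy, hry⟩ := hrm
    refine ⟨c, ?_⟩
    have hy' : y ∈ flag e j z := by rwa [flag_eq_gs]
    have h1 : inner ℂ y r = 0 := by
      clear hry
      induction hy using Submodule.span_induction with
      | mem x hx => obtain ⟨k, hk, rfl⟩ := hx; exact horth k hk
      | zero => simp
      | add x y hx' hy' hx hy =>
        rw [inner_add_left, hx (by rwa [flag_eq_gs]), hy (by rwa [flag_eq_gs]), add_zero]
      | smul a x hx' hx => rw [inner_smul_left, hx (by rwa [flag_eq_gs]), mul_zero]
    rw [hry, inner_add_right, inner_smul_right, inner_gs_of_mem_flag le_rfl hy', mul_zero,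
      zero_add, inner_self_eq_zero] at h1
    rw [hry, h1, add_zero]
  obtain ⟨c, hc⟩ := hrs
  have h1 : dz (gs e j) z = c • gs e j z + (z - a) ^ m j • gs e (j + 1) z := by
    rw [dz_eq_Dz, ← hc, hr]; module
  rw [delPerp, h1, map_add]
  have h2 : (Submodule.span ℂ {gs e j z})ᗮ.starProjection (c • gs e j z) = 0 := by
    rw [map_smul, Submodule.starProjection_orthogonalComplement_singleton_eq_zero, smul_zero]
  have h3 : (Submodule.span ℂ {gs e j z})ᗮ.starProjection ((z - a) ^ m j • gs e (j + 1) z) =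
      (z - a) ^ m j • gs e (j + 1) z := by
    rw [Submodule.starProjection_eq_self_iff]
    refine Submodule.smul_mem _ _ (Submodule.mem_orthogonal_singleton_iff_inner_right.2 ?_)
    exact inner_gs_of_mem_flag le_rfl (gs_mem_flag (Nat.lt_succ_self j) z)
  rw [h2, h3, zero_add]

end GramSchmidt

/-! ### The harmonic sequence of an almost complex curve -/

/-- Sections of the first four elements of the harmonic sequence of the directrix curve. -/
def harm (F : ℂ → C7) : ℕ → ℂ → C7
  | 0, z => conjC (binormal F z)
  | 1, z => conjC (Db (binormal F) z)
  | 2, z => conjC (Dz F z)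
  | _, z => F z

theorem IsACPair.harm_eq {F G : ℂ → C7} (h : IsACPair F G) (j : ℕ) {w : ℂ} (hw : w ≠ 0) :
    harm G j w ∈ Submodule.span ℂ {harm F j w⁻¹} := by
  rw [Submodule.mem_span_singleton]
  match j with
  | 0 => exact ⟨(starRingEnd ℂ) (-(w ^ 6)⁻¹), by rw [harm, harm, h.binormal_eq hw, conjC_smul]⟩
  | 1 =>
    have h1 : binormal G =ᶠ[𝓝 w] fun w => (-(w ^ 6)⁻¹) • binormal F w⁻¹ := by
      filter_upwards [isOpen_ne.mem_nhds hw] with v hv using h.binormal_eq hv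
    have hc : DifferentiableAt ℂ (fun w : ℂ => -(w ^ 6)⁻¹) w := (differentiableAt_inv_pow 6 hw).neg
    have hi : DifferentiableAt ℂ (fun w : ℂ => w⁻¹) w := differentiableAt_inv hw
    have hb := Smooth.diff h.left.smooth_binormal w⁻¹
    refine ⟨(starRingEnd ℂ) ((-(w ^ 6)⁻¹) * (starRingEnd ℂ) (deriv (fun w : ℂ => w⁻¹) w)), ?_⟩
    have hcomp : DifferentiableAt ℝ (fun w => binormal F w⁻¹) w :=
      DifferentiableAt.comp (g := binormal F) (f := fun w : ℂ => w⁻¹) w hb (hi.restrictScalars ℝ)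
    rw [harm, harm, Db_congr h1, Db_smul (hc.restrictScalars ℝ) hcomp, Db_of_differentiableAt hc,
      zero_smul, zero_add, Db_comp_holo (φ := fun w : ℂ => w⁻¹) hb hi, smul_smul, conjC_smul]
  | 2 => exact ⟨-(starRingEnd ℂ) (w ^ 2)⁻¹, by
      rw [harm, harm, h.Dz_eq hw, conjC_neg, conjC_smul, neg_smul]⟩
  | n + 3 => exact ⟨1, by rw [harm, harm, one_smul, h.inv w hw] <;> simp⟩

/-- The double cross product identity gives w × (x × y) = 0, so w is parallel to x × y; the last
pairing then excludes a nonzero multiple. -/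
theorem eq_zero_of_annihilates_neg {F x y w : C7} (hF : conjC F = F)
    (hx : crossC F x = Complex.I • x) (hy : crossC F y = Complex.I • y)
    (hw : crossC F w = -Complex.I • w) (h0 : crossC x y ≠ 0) (h1 : dotC w x = 0)
    (h2 : dotC w y = 0) (h3 : dotC w (conjC (crossC x y)) = 0) : w = 0 := by
  have hxy := crossC_eigen_eigen hx hy
  have h4 := crossC_crossC_add w x y
  rw [h1, h2, dotC_eigen_eigen hx hy, crossC_anticomm w y, crossC_eigen_eigen_neg hy hw,
    dotC_comm y w, h2] at h4
  simp at h4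
  have h5 := parallel_of_crossC_eq_zero hF hxy hw (by rw [crossC_anticomm, h4, neg_zero])
  rw [dotC_comm _ w, h3, zero_smul, dotC_conjC_self] at h5
  refine (smul_eq_zero.1 h5).resolve_left ?_
  simpa using h0

/-- Remove the F-component of v and split the rest into eigenvectors of F ×. The part with
eigenvalue -i, and the conjugate of the part with eigenvalue i, satisfy the previous lemma. -/
theorem eq_smul_of_annihilates {F x y v : C7} (hF : conjC F = F) (hu : dotC F F = 1)
    (hx : crossC F x = Complex.I • x) (hy : crossC F y = Complex.I • y) (h0 : crossC x y ≠ 0)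
    (h1 : dotC v x = 0) (h2 : dotC v y = 0) (h3 : dotC v (crossC x y) = 0)
    (h1' : dotC v (conjC x) = 0) (h2' : dotC v (conjC y) = 0)
    (h3' : dotC v (conjC (crossC x y)) = 0) : v = dotC F v • F := by
  set v' := v - dotC F v • F with hv'
  have hxy := crossC_eigen_eigen hx hy
  have hFv : dotC F v' = 0 := by rw [hv', dotC_sub_right, dotC_smul_right, hu]; ring
  have hFF : crossC F (crossC F v') = -v' := by
    rw [crossC_crossC_self, hu, hFv]; simp
  have k1 : dotC v' x = 0 := by
    rw [hv', dotC_sub_left, dotC_smul_left, h1, dotC_eigen hx]; simp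
  have k2 : dotC v' y = 0 := by
    rw [hv', dotC_sub_left, dotC_smul_left, h2, dotC_eigen hy]; simp
  have k3 : dotC v' (crossC x y) = 0 := by
    rw [hv', dotC_sub_left, dotC_smul_left, h3, dotC_eigen_neg hxy]; simp
  have k1' : dotC v' (conjC x) = 0 := by
    rw [hv', dotC_sub_left, dotC_smul_left, h1', dotC_eigen_neg (eigen_conj hF hx)]; simp
  have k2' : dotC v' (conjC y) = 0 := by
    rw [hv', dotC_sub_left, dotC_smul_left, h2', dotC_eigen_neg (eigen_conj hF hy)]; simp
  have k3' : dotC v' (conjC (crossC x y)) = 0 := by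
    rw [hv', dotC_sub_left, dotC_smul_left, h3', dotC_eigen (eigen_neg_conj hF hxy)]; simp
  have a1 : v' + Complex.I • crossC F v' = 0 := by
    refine eq_zero_of_annihilates_neg hF hx hy ?_ h0 ?_ ?_ ?_
    · rw [crossC_add_right, crossC_smul_right, hFF]
      have := Complex.I_mul_I
      linear_combination (norm := module) this • crossC F v'
    · rw [dotC_add_left, dotC_smul_left, dotC_crossC_left, hx, dotC_smul_right, k1]; simp
    · rw [dotC_add_left, dotC_smul_left, dotC_crossC_left, hy, dotC_smul_right, k2]; simp
    · rw [dotC_add_left, dotC_smul_left, dotC_crossC_left, eigen_neg_conj hF hxy,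
        dotC_smul_right, k3']; simp
  have a2 : conjC (v' - Complex.I • crossC F v') = 0 := by
    have hc : ∀ u, dotC (conjC (v' - Complex.I • crossC F v')) u =
        (starRingEnd ℂ) (dotC (v' - Complex.I • crossC F v') (conjC u)) := fun u => by
      rw [conj_dotC, conjC_conjC]
    refine eq_zero_of_annihilates_neg hF hx hy (eigen_conj hF ?_) h0 ?_ ?_ ?_
    · rw [crossC_sub_right, crossC_smul_right, hFF]
      linear_combination (norm := module) Complex.I_sq • crossC F v'
    · rw [hc, dotC_sub_left, dotC_smul_left, dotC_crossC_left, eigen_conj hF hx,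
        dotC_smul_right, k1']; simp
    · rw [hc, dotC_sub_left, dotC_smul_left, dotC_crossC_left, eigen_conj hF hy,
        dotC_smul_right, k2']; simp
    · rw [hc, conjC_conjC, dotC_sub_left, dotC_smul_left, dotC_crossC_left, hxy,
        dotC_smul_right, k3]; simp
  have a3 := conjC_eq_zero.1 a2
  have : v' = 0 := by
    linear_combination (norm := module) (1 / 2 : ℂ) • a1 + (1 / 2 : ℂ) • a3
  rwa [hv', sub_eq_zero] at this

theorem linearIndependent_derivs {p : Fin 7 → Polynomial ℂ} {z : ℂ} (hw : wronski p z ≠ 0) :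
    LinearIndependent ℂ fun j : Fin 7 => pvec (pderiv^[(j : ℕ)] p) z := by
  rw [wronski_eq_det, ← Matrix.det_transpose] at hw
  exact linearIndependent_of_det_ne_zero hw

open Polynomial in
theorem IsDirectrixPoly.eventually_wronski_ne_zero {F : ℂ → C7} {p : Fin 7 → ℂ[X]}
    (hp : IsDirectrixPoly F p) (hF : IsACLift F) (hfull : IsFullLift F)
    (hne : ∃ z, binormal F z ≠ 0) (a : ℂ) : ∀ᶠ z in 𝓝[≠] a, wronski p z ≠ 0 := by
  obtain ⟨w, hw⟩ := exists_wronski_polynomial p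
  obtain ⟨z₁, hz₁⟩ := exists_wronski_ne_zero (p := p) fun v hv => by
    have : (WithLp.toLp 2 v : C7) = 0 := hp.eq_zero_of_dot_eq_zero hF hfull hne fun z => by
      have := congrArg (eval z) hv
      simpa [eval_finsetSum, dotC, pvec_apply] using this
    funext i
    exact congrArg (fun x : C7 => x i) this
  have hw0 : w ≠ 0 := by rintro rfl; exact hz₁ (by rw [hw, eval_zero])
  have hfin : (↑w.roots.toFinset \ {a} : Set ℂ).Finite := (Finset.finite_toSet _).subset
    Set.sdiff_subset
  filter_upwards [nhdsWithin_le_nhds (hfin.isClosed.isOpen_compl.mem_nhds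
    (show a ∈ (↑w.roots.toFinset \ {a} : Set ℂ)ᶜ by simp)), self_mem_nhdsWithin] with z h1 h2 h3
  rw [hw] at h3
  exact h1 ⟨by simpa [hw0] using h3, h2⟩

theorem flag_eq_span {e q : ℕ → ℂ → C7} {z : ℂ} {n : ℕ}
    (he : LinearIndependent ℂ fun i : Fin n => e i z)
    (hq : LinearIndependent ℂ fun i : Fin n => q i z)
    (h : ∀ j < n, q j z ∈ flag e (j + 1) z) {j : ℕ} (hj : j ≤ n) : flag q j z = flag e j z := by
  have hle : flag q j z ≤ flag e j z := Submodule.span_le.2 (by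
    rintro _ ⟨i, hi, rfl⟩
    have hi : i < j := hi
    exact flag_mono (Nat.succ_le_of_lt hi) z (h i (by omega)))
  have hfr : ∀ u : ℕ → ℂ → C7, LinearIndependent ℂ (fun i : Fin n => u i z) →
      Module.finrank ℂ (flag u j z) = j := by
    intro u hu
    have h1 := finrank_span_eq_card (hu.comp (Fin.castLE hj) (Fin.castLE_injective hj))
    have h2 : (fun i => u i z) '' Set.Iio j =
        Set.range ((fun i : Fin n => u i z) ∘ Fin.castLE hj) := by
      ext x; constructor
      · rintro ⟨i, hi, rfl⟩; exact ⟨⟨i, hi⟩, rfl⟩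
      · rintro ⟨i, rfl⟩; exact ⟨i, i.2, rfl⟩
    rw [flag, h2, h1, Fintype.card_fin]
  exact Submodule.eq_of_le_of_finrank_eq hle ((hfr q hq).trans (hfr e he).symm)

namespace IsDirectrixPoly

open Polynomial

variable {F : ℂ → C7} {p : Fin 7 → ℂ[X]}

theorem pderiv_eq (hF : IsACLift F) (hp : IsDirectrixPoly F p) {z : ℂ} (hz : binormal F z ≠ 0) :
    ∃ a b : ℂ, pvec (pderiv p) z = a • conjC (binormal F z) + b • conjC (Db (binormal F) z) := by
  obtain ⟨κ, hκ⟩ := hp.exists_smooth hF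
  have hBs := hF.smooth_binormal
  have he : pvec p =ᶠ[𝓝 z] fun w => κ w • conjC (binormal F w) := by
    filter_upwards [(isClosed_eq hBs.continuous continuous_const).isOpen_compl.mem_nhds hz]
      with v hv using (hκ v hv).2.2
  refine ⟨Dz κ z, κ z, ?_⟩
  rw [← Dz_pvec, Dz_congr he, Dz_smul ((hκ z hz).1.differentiableAt (by simp))
    (Smooth.diff (contDiff_conjC hBs) z), Dz_conjC (Smooth.diff hBs z)]

theorem dot_deriv_three (hF : IsACLift F) (hne : ∃ z, binormal F z ≠ 0) (hp : IsDirectrixPoly F p)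
    {i : ℕ} (hi : i ≤ 2) (z : ℂ) :
    dotC (pvec (pderiv^[3] p) z) (pvec (pderiv^[i] p) z) = 0 := by
  have h1 := deriv_dotC_pvec (pderiv^[2] p) (pderiv^[i] p) (z := z)
    fun z => hp.dot_deriv hF hne le_rfl hi z
  rw [← Function.iterate_succ_apply' pderiv 2 p, ← Function.iterate_succ_apply' pderiv i p] at h1
  rcases Nat.lt_succ_iff_lt_or_eq.1 (Nat.lt_succ_of_le hi) with hi' | rfl
  · rwa [hp.dot_deriv hF hne le_rfl (by omega), add_zero] at h1
  · rw [dotC_comm (pvec (pderiv^[2] p) z)] at h1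
    linear_combination (1 / 2 : ℂ) * h1

theorem flag_three (hF : IsACLift F) (hp : IsDirectrixPoly F p) {z : ℂ}
    (hz : binormal F z ≠ 0) (hw : wronski p z ≠ 0) :
    flag (fun j => pvec (pderiv^[j] p)) 3 z = Submodule.span ℂ (Set.range
      ![conjC (binormal F z), conjC (Dz F z), conjC (Dz (Dz F) z)]) := by
  have hle : flag (fun j => pvec (pderiv^[j] p)) 3 z ≤ Submodule.span ℂ (Set.range
      ![conjC (binormal F z), conjC (Dz F z), conjC (Dz (Dz F) z)]) := by
    refine Submodule.span_le.2 ?_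
    rintro _ ⟨i, hi, rfl⟩
    obtain ⟨a, b, c, h⟩ := hp.mem_conj_span hF hz (Nat.le_of_lt_succ hi)
    simp only [h]
    exact Submodule.add_mem _ (Submodule.add_mem _
      (Submodule.smul_mem _ _ (Submodule.subset_span ⟨0, rfl⟩))
      (Submodule.smul_mem _ _ (Submodule.subset_span ⟨1, rfl⟩)))
      (Submodule.smul_mem _ _ (Submodule.subset_span ⟨2, rfl⟩))
  refine Submodule.eq_of_le_of_finrank_le hle ?_
  have h1 := finrank_span_eq_card ((linearIndependent_derivs hw).comp (Fin.castLE (by norm_num))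
    (Fin.castLE_injective (show 3 ≤ 7 by norm_num)))
  have h2 : (fun i => pvec (pderiv^[i] p) z) '' Set.Iio 3 = Set.range
      ((fun j : Fin 7 => pvec (pderiv^[(j : ℕ)] p) z) ∘ Fin.castLE (show 3 ≤ 7 by norm_num)) := by
    ext x; constructor
    · rintro ⟨i, hi, rfl⟩; exact ⟨⟨i, hi⟩, rfl⟩
    · rintro ⟨i, rfl⟩; exact ⟨i, i.2, rfl⟩
  rw [flag, h2, h1, Fintype.card_fin]
  exact (finrank_range_le_card _).trans (by simp)

/-- Gram–Schmidt depends only on the flag. The first three steps of the flag of p are spanned by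
conj H, then conj ∂_z̄H as well, then conj F_z and conj F_zz; orthogonality singles out the sections
of `harm`. -/
theorem gs_mem_harm (hF : IsACLift F) (hne : ∃ z, binormal F z ≠ 0) (hp : IsDirectrixPoly F p)
    {z : ℂ} (hz : binormal F z ≠ 0) (hw : wronski p z ≠ 0) {e : ℕ → ℂ → C7}
    (hflag : ∀ j ≤ 4, flag e j z = flag (fun j => pvec (pderiv^[j] p)) j z) {j : ℕ} (hj : j < 4) :
    gs e j z ∈ Submodule.span ℂ {harm F j z} := by
  have hreal := hF.real z
  have hxe := hF.eigen z
  have hye := hF.eigen2 z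
  have hbe := hF.eigen_binormal z
  have hbb : dotC (conjC (binormal F z)) (binormal F z) ≠ 0 := by
    rw [dotC_conjC_self]; simpa using hz
  have hmem : gs e j z ∈ flag (fun j => pvec (pderiv^[j] p)) (j + 1) z := by
    rw [← hflag (j + 1) hj]; exact gs_mem_flag (Nat.lt_succ_self j) z
  have horth : ∀ i ≤ j, ∀ x ∈ flag (fun j => pvec (pderiv^[j] p)) i z,
      dotC (conjC x) (gs e j z) = 0 := fun i hi x hx => by
    rw [← inner_eq_dotC]
    exact inner_gs_of_mem_flag hi (by rwa [hflag i (by omega)])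
  obtain ⟨κ, hκ0, hκ⟩ := (hp.exists_deriv hF hz).1
  have hbm : ∀ i, 1 ≤ i → conjC (binormal F z) ∈ flag (fun j => pvec (pderiv^[j] p)) i z := by
    intro i hi
    have h1 : pvec p z ∈ flag (fun j => pvec (pderiv^[j] p)) i z :=
      mem_flag (e := fun j => pvec (pderiv^[j] p)) (i := 0) hi z
    rw [hκ] at h1
    exact (Submodule.smul_mem_iff _ hκ0).1 h1
  have hb0 : ∀ a b c : ℂ, 1 ≤ j →
      gs e j z = a • conjC (binormal F z) + b • conjC (Dz F z) + c • conjC (Dz (Dz F) z) →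
      a = 0 := by
    intro a b c h1 h2
    have h3 := horth 1 h1 _ (hbm 1 le_rfl)
    rw [conjC_conjC, h2, dotC_add_right, dotC_add_right, dotC_smul_right, dotC_smul_right,
      dotC_smul_right, dotC_eigen_neg_neg hbe (eigen_conj hreal hxe),
      dotC_eigen_neg_neg hbe (eigen_conj hreal hye), dotC_comm] at h3
    simpa [hbb] using h3
  obtain ⟨a, b, hab⟩ := hp.pderiv_eq hF hz
  have h2le : flag (fun j => pvec (pderiv^[j] p)) 2 z ≤
      Submodule.span ℂ {conjC (binormal F z), conjC (Db (binormal F) z)} := by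
    refine Submodule.span_le.2 ?_
    rintro _ ⟨i, hi, rfl⟩
    have hi : i < 2 := hi
    interval_cases i
    · simp only [Function.iterate_zero, id, hκ]
      exact Submodule.smul_mem _ _ (Submodule.subset_span (by simp))
    · simp only [Function.iterate_one, hab]
      exact Submodule.add_mem _ (Submodule.smul_mem _ _ (Submodule.subset_span (by simp)))
        (Submodule.smul_mem _ _ (Submodule.subset_span (by simp)))
  rw [Submodule.mem_span_singleton]
  have hDb : conjC (Db (binormal F) z) =
      (Complex.I * (starRingEnd ℂ) (energy F z)) • conjC (Dz (Dz F) z) +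
      (-Complex.I * (starRingEnd ℂ) (Dz (energy F) z)) • conjC (Dz F z) := by
    rw [hF.Db_binormal]
    simp
  interval_cases j
  · have h1 : gs e 0 z ∈ Submodule.span ℂ {pvec p z} := by
      have : (fun i => pvec (pderiv^[i] p) z) '' Set.Iio (0 + 1) = {pvec p z} := by
        ext x; simp
      rwa [flag, this] at hmem
    obtain ⟨c, hc⟩ := Submodule.mem_span_singleton.1 h1
    exact ⟨c * κ, by rw [← hc, hκ, smul_smul]; rfl⟩
  · obtain ⟨c, d, hcd⟩ := Submodule.mem_span_pair.1 (h2le hmem)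
    have hc : c = 0 := by
      refine hb0 c (d * (-Complex.I * (starRingEnd ℂ) (Dz (energy F) z)))
        (d * (Complex.I * (starRingEnd ℂ) (energy F z))) le_rfl ?_
      rw [← hcd, hDb]; module
    exact ⟨d, by rw [← hcd, hc, zero_smul, zero_add]; rfl⟩
  · rw [flag_three hF hp hz hw] at hmem
    obtain ⟨c, hc⟩ := (Submodule.mem_span_range_iff_exists_fun ℂ).1 hmem
    simp only [Fin.sum_univ_three, Matrix.cons_val_zero, Matrix.cons_val_one, Matrix.cons_val] at hc
    have hc0 := hb0 _ _ _ (by norm_num) hc.symm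
    rw [hc0, zero_smul, zero_add] at hc
    have hb : b ≠ 0 := by
      rintro rfl
      have hind := (linearIndependent_derivs hw).comp (Fin.castLE (show 2 ≤ 7 by norm_num))
        (Fin.castLE_injective _)
      have := (LinearIndependent.pair_iff.1 (show LinearIndependent ℂ
        ![pvec p z, pvec (pderiv p) z] by
          convert hind using 1; ext i; fin_cases i <;> rfl)) a (-κ) (by
            rw [hab, hκ]; module)
      exact hκ0 (neg_eq_zero.1 this.2)
    have h1 : conjC (Db (binormal F) z) ∈ flag (fun j => pvec (pderiv^[j] p)) 2 z := by
      have h2 : pvec (pderiv p) z ∈ flag (fun j => pvec (pderiv^[j] p)) 2 z :=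
        mem_flag (e := fun j => pvec (pderiv^[j] p)) (i := 1) (by norm_num) z
      rw [hab] at h2
      have h3 := Submodule.sub_mem _ h2 (Submodule.smul_mem _ a (hbm 2 (by norm_num)))
      rw [add_sub_cancel_left] at h3
      exact (Submodule.smul_mem_iff _ hb).1 h3
    have h4 := horth 2 le_rfl _ h1
    rw [conjC_conjC, ← hc, hF.Db_binormal] at h4
    simp only [dotC_add_left, dotC_add_right, dotC_smul_left, dotC_smul_right] at h4
    have hnb := hF.norm_binormal z
    rw [hF.Db_energy, hF.Dz_energy] at hnb
    rw [hF.Dz_energy, dotC_comm (Dz (Dz F) z) (conjC (Dz F z)),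
      show dotC (Dz F z) (conjC (Dz F z)) = energy F z from rfl] at h4
    rw [dotC_comm (Dz (Dz F) z) (conjC (Dz F z))] at hnb
    -- Orthogonality to conj ∂_z̄H leaves the coefficient of conj F_zz multiplied by the Gram
    -- determinant of F_z and F_zz, which is |H|²/2.
    have h5 : c 2 * dotC (conjC (binormal F z)) (binormal F z) = 0 := by
      rw [hnb]
      linear_combination (2 * Complex.I) * h4 + (2 * c 2) * (energy F z *
        dotC (Dz (Dz F) z) (conjC (Dz (Dz F) z)) - dotC (conjC (Dz F z)) (Dz (Dz F) z) *
        dotC (Dz F z) (conjC (Dz (Dz F) z))) * Complex.I_sq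
    have h6 : c 2 = 0 := (mul_eq_zero.1 h5).resolve_right hbb
    exact ⟨c 1, by rw [← hc, h6, zero_smul, add_zero]; rfl⟩
  -- The fourth vector annihilates the isotropic three-space, by the null relations of p, and also
  -- its conjugate, by Hermitian orthogonality. Only the line of F remains.
  · have h3 := flag_three hF hp hz hw
    have ha : ∀ x ∈ flag (fun j => pvec (pderiv^[j] p)) 3 z, dotC (gs e 3 z) x = 0 := by
      have hQ : ∀ x ∈ flag (fun j => pvec (pderiv^[j] p)) 3 z,
          ∀ y ∈ flag (fun j => pvec (pderiv^[j] p)) 4 z, dotC y x = 0 := by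
        intro x hx y hy
        induction hx using Submodule.span_induction with
        | zero => simp
        | add x x' _ _ h h' => rw [dotC_add_right, h, h', add_zero]
        | smul c x _ h => rw [dotC_smul_right, h, mul_zero]
        | mem x hx =>
          obtain ⟨i, hi, rfl⟩ := hx
          have hi : i < 3 := hi
          induction hy using Submodule.span_induction with
          | zero => simp
          | add x x' _ _ h h' => rw [dotC_add_left, h, h', add_zero]
          | smul c x _ h => rw [dotC_smul_left, h, mul_zero]
          | mem y hy =>
            obtain ⟨k, hk, rfl⟩ := hy
            have hk : k < 4 := hk
            rcases Nat.lt_succ_iff_lt_or_eq.1 hk with hk | rfl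
            · exact hp.dot_deriv hF hne (by omega) (by omega) z
            · exact hp.dot_deriv_three hF hne (by omega) z
      exact fun x hx => hQ x hx _ hmem
    have hb : ∀ x ∈ flag (fun j => pvec (pderiv^[j] p)) 3 z, dotC (gs e 3 z) (conjC x) = 0 :=
      fun x hx => by rw [dotC_comm]; exact horth 3 le_rfl x hx
    rw [h3] at ha hb
    have s0 := ha _ (Submodule.subset_span ⟨0, rfl⟩)
    have s1 := ha _ (Submodule.subset_span ⟨1, rfl⟩)
    have s2 := ha _ (Submodule.subset_span ⟨2, rfl⟩)
    have t0 := hb _ (Submodule.subset_span ⟨0, rfl⟩)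
    have t1 := hb _ (Submodule.subset_span ⟨1, rfl⟩)
    have t2 := hb _ (Submodule.subset_span ⟨2, rfl⟩)
    simp only [Matrix.cons_val_zero, Matrix.cons_val_one, Matrix.cons_val, conjC_conjC]
      at s0 s1 s2 t0 t1 t2
    exact ⟨_, (eq_smul_of_annihilates hreal (hF.unit z) hxe hye hz t1 t2 t0 s1 s2 s0).symm⟩

end IsDirectrixPoly

theorem AnSpan.mem_flag {a : ℂ} {e : ℕ → ℂ → C7} {n : ℕ} {s : ℂ → C7} (hs : AnSpan a e n s) :
    ∀ᶠ z in 𝓝 a, s z ∈ flag e n z := by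
  filter_upwards [hs.mem_span] with z hz
  refine Submodule.span_mono ?_ hz
  rintro _ ⟨i, rfl⟩
  exact ⟨i, i.2, rfl⟩

theorem gs_zero (e : ℕ → ℂ → C7) : gs e 0 = e 0 := by
  ext1 z
  simpa using gs_eq e 0 z

open Polynomial in
/-- Near each point the first four elements of the harmonic sequence of a directrix curve have
smooth nowhere vanishing sections. -/
theorem IsDirectrixPoly.exists_sections {F : ℂ → C7} {p : Fin 7 → ℂ[X]} (hF : IsACLift F)
    (hfull : IsFullLift F) (hp : IsDirectrixPoly F p) (a : ℂ) :
    ∃ (U : Set ℂ) (t : ℕ → ℂ → C7) (m : ℕ → ℕ), IsOpen U ∧ a ∈ U ∧ t 0 = pvec p ∧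
      (∀ j < 4, ContDiffOn ℝ ∞ (t j) U ∧ (∀ z ∈ U, t j z ≠ 0) ∧
        ∀ z ∈ U, z ≠ a → t j z ∈ Submodule.span ℂ {harm F j z}) ∧
      ∀ j < 3, ∀ z ∈ U, delPerp (t j) z = (z - a) ^ m j • t (j + 1) z := by
  have hne := hF.binormal_ne_zero hfull
  have hPan : AnalyticAt ℂ (pvec p) a := (differentiable_pvec p).analyticAt a
  have hev : ∀ᶠ z in 𝓝[≠] a, binormal F z ≠ 0 := by
    obtain ⟨r, hr, h⟩ := hF.isolated_binormal hne a
    filter_upwards [nhdsWithin_le_nhds (Metric.ball_mem_nhds a hr), self_mem_nhdsWithin]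
      with z h1 h2 h3
    exact h2 (h z h3 (by simpa [dist_eq_norm] using h1))
  have hwr := hp.eventually_wronski_ne_zero hF hfull hne a
  have hgen : ∃ᶠ z in 𝓝 a, LinearIndependent ℂ fun i : Fin 4 => iteratedDeriv i (pvec p) z := by
    refine (Filter.Eventually.frequently (f := 𝓝[≠] a) ?_).filter_mono nhdsWithin_le_nhds
    filter_upwards [hwr] with z hz
    have := (linearIndependent_derivs hz).comp (Fin.castLE (show 4 ≤ 7 by norm_num))
      (Fin.castLE_injective _)
    simp only [iteratedDeriv_pvec]
    exact this
  obtain ⟨e, m, he⟩ := IsFrame.exists_frame hPan (hp.ne_zero a) 3 hgen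
  have h1 : ∀ᶠ z in 𝓝 a, ∀ i : Fin 4, AnalyticAt ℂ (e i) z :=
    Filter.eventually_all.2 fun i => (he.an i i.2).eventually_analyticAt
  have h2 : ∀ᶠ z in 𝓝 a, LinearIndependent ℂ fun i : Fin 4 => e i z := by
    have hc : ContinuousAt (fun z => fun i : Fin 4 => e i z) a :=
      continuousAt_pi.2 fun i => (he.an i i.2).continuousAt
    exact hc.eventually (isOpen_setOfPred_linearIndependent.mem_nhds he.indep)
  have h3 : ∀ᶠ z in 𝓝 a, ∀ i : Fin 3,
      deriv (e i) z - (z - a) ^ m i • e (i + 1) z ∈ flag e (i + 1) z :=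
    Filter.eventually_all.2 fun i => (he.der i (by omega)).mem_flag
  have h4 : ∀ᶠ z in 𝓝 a, ∀ j : Fin 4, pvec (pderiv^[(j : ℕ)] p) z ∈ flag e (j + 1) z :=
    Filter.eventually_all.2 fun j => by
      have := (he.anSpan_iteratedDeriv j.2).mem_flag
      simpa only [iteratedDeriv_pvec] using this
  have h5 : ∀ᶠ z in 𝓝 a, z ≠ a → binormal F z ≠ 0 ∧ wronski p z ≠ 0 :=
    eventually_nhdsWithin_iff.1 (hev.and hwr)
  obtain ⟨U, hU, hUo, haU⟩ := eventually_nhds_iff.1 (h1.and (h2.and (h3.and (h4.and h5))))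
  have hd : ∀ i < 4, DifferentiableOn ℂ (e i) U := fun i hi z hz =>
    ((hU z hz).1 ⟨i, hi⟩).differentiableAt.differentiableWithinAt
  have hi : ∀ z ∈ U, LinearIndependent ℂ fun i : Fin 4 => e i z := fun z hz => (hU z hz).2.1
  refine ⟨U, gs e, m, hUo, haU, by rw [gs_zero, he.zero], fun j hj => ⟨gs_smooth hUo hd hi hj,
    fun z hz => gs_ne_zero (hi z hz) hj, fun z hz hza => ?_⟩, fun j hj z hz => ?_⟩
  · obtain ⟨-, -, -, k4, k5⟩ := hU z hz
    obtain ⟨hb, hw⟩ := k5 hza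
    have hq := (linearIndependent_derivs hw).comp (Fin.castLE (show 4 ≤ 7 by norm_num))
      (Fin.castLE_injective _)
    refine hp.gs_mem_harm hF hne hb hw (fun i hi4 => ?_) hj
    exact (flag_eq_span (q := fun j => pvec (pderiv^[j] p)) (hi z hz) hq
      (fun j hj => k4 ⟨j, hj⟩) hi4).symm
  · exact delPerp_gs hUo hd hi hz (fun i hij => (hU z hz).2.2.1 ⟨i, by omega⟩) (by omega)

/-! ### Curves in projective space from local sections -/

theorem span_eq_of_mem_span {x y g : C7} (hx : x ≠ 0) (hy : y ≠ 0)
    (h1 : x ∈ Submodule.span ℂ {g}) (h2 : y ∈ Submodule.span ℂ {g}) :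
    Submodule.span ℂ {x} = Submodule.span ℂ {y} := by
  have h : ∀ u, u ≠ 0 → u ∈ Submodule.span ℂ {g} →
      Submodule.span ℂ {u} = Submodule.span ℂ {g} := by
    intro u hu h
    obtain ⟨c, rfl⟩ := Submodule.mem_span_singleton.1 h
    exact Submodule.span_singleton_smul_eq (IsUnit.mk0 c (left_ne_zero_of_smul hu)) g
  rw [h x hx h1, h y hy h2]

theorem mem_span_of_wedge {x y : C7} (hx : x ≠ 0)
    (h : ∀ i j, x i * y j = x j * y i) : y ∈ Submodule.span ℂ {x} := by
  obtain ⟨i, hi⟩ : ∃ i, x i ≠ 0 := by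
    by_contra hcon
    push Not at hcon
    exact hx (PiLp.ext fun i => hcon i)
  refine Submodule.mem_span_singleton.2 ⟨y i / x i, PiLp.ext fun j => ?_⟩
  simp only [PiLp.smul_apply, smul_eq_mul]
  field_simp
  linear_combination h j i

theorem wedge_of_mem_span {x y g : C7} (h1 : x ∈ Submodule.span ℂ {g})
    (h2 : y ∈ Submodule.span ℂ {g}) (i j : Fin 7) : x i * y j = x j * y i := by
  obtain ⟨a, rfl⟩ := Submodule.mem_span_singleton.1 h1
  obtain ⟨b, rfl⟩ := Submodule.mem_span_singleton.1 h2
  simp only [PiLp.smul_apply, smul_eq_mul]; ring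

/-- Proportionality is the vanishing of 2 × 2 minors, which passes to the limit at a. -/
theorem span_eq_of_eventually {g t t' : ℂ → C7} {a : ℂ} (ht : ContinuousAt t a) (h0 : t a ≠ 0)
    (hg : ∀ᶠ ζ in 𝓝[≠] a, t ζ ∈ Submodule.span ℂ {g ζ}) (ht' : ContinuousAt t' a) (h0' : t' a ≠ 0)
    (hg' : ∀ᶠ ζ in 𝓝[≠] a, t' ζ ∈ Submodule.span ℂ {g ζ}) :
    Submodule.span ℂ {t a} = Submodule.span ℂ {t' a} := by
  have hw : ∀ i j, t a i * t' a j = t a j * t' a i := by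
    intro i j
    have hc : ∀ {s : ℂ → C7}, ContinuousAt s a → ∀ i, ContinuousAt (fun z => s z i) a :=
      fun hs i => (EuclideanSpace.proj (𝕜 := ℂ) i).continuous.continuousAt.comp hs
    have h1 := ((hc ht i).mul (hc ht' j)).tendsto.mono_left (nhdsWithin_le_nhds (s := {a}ᶜ))
    have h2 := ((hc ht j).mul (hc ht' i)).tendsto.mono_left (nhdsWithin_le_nhds (s := {a}ᶜ))
    refine tendsto_nhds_unique (h1.congr' ?_) h2
    filter_upwards [hg, hg'] with z k1 k2 using wedge_of_mem_span k1 k2 i j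
  exact span_eq_of_mem_span h0 h0' (Submodule.mem_span_singleton_self _) (mem_span_of_wedge h0 hw)

theorem tendsto_inv_punctured {w : ℂ} (hw : w ≠ 0) :
    Filter.Tendsto (fun z : ℂ => z⁻¹) (𝓝[≠] w) (𝓝[≠] w⁻¹) := by
  refine tendsto_nhdsWithin_of_tendsto_nhds_of_eventually_within _
    ((tendsto_inv₀ hw).mono_left nhdsWithin_le_nhds) ?_
  filter_upwards [self_mem_nhdsWithin] with z hz h
  exact hz (inv_injective h)

/-- A family of generic local sections, compatible with the change of coordinate, which can be
made continuous and nowhere vanishing, determines a curve in `ℂP⁶`. -/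
theorem exists_curve (g : Bool → ℂ → C7)
    (hg : ∀ c w, w ≠ 0 → g (!c) w ∈ Submodule.span ℂ {g c w⁻¹})
    (hloc : ∀ c a, ∃ t : ℂ → C7, ContinuousAt t a ∧ t a ≠ 0 ∧
      ∀ᶠ ζ in 𝓝[≠] a, t ζ ∈ Submodule.span ℂ {g c ζ}) :
    ∃ Ψ : OnePoint ℂ → CP6, ∀ c a (t : ℂ → C7), ContinuousAt t a → t a ≠ 0 →
      (∀ᶠ ζ in 𝓝[≠] a, t ζ ∈ Submodule.span ℂ {g c ζ}) →
      (Ψ (chart c a)).submodule = Submodule.span ℂ {t a} := by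
  choose t ht h0 htg using hloc
  refine ⟨fun p => match p with
    | OnePoint.infty => Projectivization.mk ℂ (t true 0 0) (h0 true 0)
    | OnePoint.some z => Projectivization.mk ℂ (t false z z) (h0 false z),
    fun c a s hs hs0 hsg => ?_⟩
  cases c with
  | false =>
    change (Projectivization.mk ℂ _ _).submodule = _
    rw [Projectivization.submodule_mk]
    exact span_eq_of_eventually (ht _ _) (h0 _ _) (htg _ _) hs hs0 hsg
  | true =>
    by_cases ha : a = 0
    · subst ha
      have : chart true 0 = OnePoint.infty := by simp [chart]
      rw [this]
      change (Projectivization.mk ℂ _ _).submodule = _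
      rw [Projectivization.submodule_mk]
      exact span_eq_of_eventually (ht _ _) (h0 _ _) (htg _ _) hs hs0 hsg
    · have : chart true a = ((a⁻¹ : ℂ) : OnePoint ℂ) := by simp [chart, ha]
      rw [this]
      change (Projectivization.mk ℂ _ _).submodule = _
      rw [Projectivization.submodule_mk]
      have hai : (a⁻¹ : ℂ) ≠ 0 := inv_ne_zero ha
      have hs1 : ContinuousAt (fun z : ℂ => s z⁻¹) a⁻¹ :=
        ContinuousAt.comp (g := s) (f := fun z : ℂ => z⁻¹) (by rwa [inv_inv])
          (continuousAt_inv₀ hai)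
      have h2 := span_eq_of_eventually (ht false a⁻¹) (h0 _ _) (htg _ _) hs1
        (by simpa using hs0) (by
          have h3 := tendsto_inv_punctured hai
          rw [inv_inv] at h3
          filter_upwards [h3.eventually hsg, nhdsWithin_le_nhds (isOpen_ne.mem_nhds hai)]
            with z h4 h5
          have h6 := hg false z⁻¹ (inv_ne_zero h5)
          rw [inv_inv] at h6
          exact Submodule.span_le.2 (Set.singleton_subset_iff.2 h6) h4)
      rw [h2, inv_inv]

open Polynomial in
/-- A linearly full almost complex curve has a directrix curve. -/
theorem exists_directrix {f : OnePoint ℂ → S6} (hfull : IsLinearlyFull f)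
    (hac : IsAlmostComplexCurve f) {p : Bool → Fin 7 → ℂ[X]}
    (hp : ∀ c, IsDirectrixPoly (coordLift f c) (p c)) :
    ∃ φ, IsDirectrix φ (projMap f) ∧ ∀ c z,
      (φ (chart c z)).submodule = Submodule.span ℂ {pvec (p c) z} := by
  have hP := fun c => isACPair_coordLift hac c
  have hF := fun c => isFullLift_coordLift hfull hac c
  choose U t m hU haU ht0 ht hdel using fun c a =>
    (hp c).exists_sections (hP c).left (hF c) a
  have hpt : ∀ c a b j, j < 4 → b ∈ U c a → ContinuousAt (t c a j) b ∧ t c a j b ≠ 0 ∧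
      ∀ᶠ ζ in 𝓝[≠] b, t c a j ζ ∈ Submodule.span ℂ {harm (coordLift f c) j ζ} := by
    intro c a b j hj hb
    obtain ⟨h1, h2, h3⟩ := ht c a j hj
    refine ⟨(h1.continuousOn).continuousAt ((hU c a).mem_nhds hb), h2 b hb, ?_⟩
    have h4 : ∀ᶠ ζ in 𝓝[≠] b, ζ ≠ a := by
      by_cases hba : b = a
      · subst hba; exact self_mem_nhdsWithin
      · exact nhdsWithin_le_nhds (isOpen_ne.mem_nhds hba)
    filter_upwards [h4, nhdsWithin_le_nhds ((hU c a).mem_nhds hb)] with ζ h5 h6 using h3 ζ h6 h5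
  have hcurve : ∀ j, ∃ Ψ : OnePoint ℂ → CP6, j < 4 → ∀ c a (s : ℂ → C7), ContinuousAt s a →
      s a ≠ 0 → (∀ᶠ ζ in 𝓝[≠] a, s ζ ∈ Submodule.span ℂ {harm (coordLift f c) j ζ}) →
      (Ψ (chart c a)).submodule = Submodule.span ℂ {s a} := by
    intro j
    by_cases hj : j < 4
    · obtain ⟨Ψ, hΨ⟩ := exists_curve (fun c => harm (coordLift f c) j)
        (fun c w hw => (hP c).harm_eq j hw)
        (fun c a => ⟨t c a j, hpt c a a j hj (haU c a)⟩)
      exact ⟨Ψ, fun _ => hΨ⟩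
    · exact ⟨projMap f, fun h => absurd h hj⟩
  choose Ψ hΨ using hcurve
  have hlift : ∀ c a j, j < 4 → IsLift (Ψ j) c (U c a) (t c a j) := fun c a j hj =>
    ⟨hU c a, fun z hz => by
      obtain ⟨h1, h2, h3⟩ := hpt c a z j hj hz
      exact hΨ j hj c z _ h1 h2 h3⟩
  have h0 : ∀ c z, (Ψ 0 (chart c z)).submodule = Submodule.span ℂ {pvec (p c) z} := fun c z => by
    rw [(hlift c z 0 (by norm_num)).2 z (haU c z), ht0]
  have h3 : Ψ 3 = projMap f := by
    ext1 q
    obtain ⟨c, z, rfl⟩ : ∃ c z, chart c z = q := by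
      rcases chart_surj false q with ⟨z, hz⟩ | h
      · exact ⟨_, z, hz⟩
      · exact ⟨_, _, h⟩
    have h1 : (projMap f (chart c z)).submodule = Submodule.span ℂ {coordLift f c z} :=
      Projectivization.submodule_mk _ _
    apply Projectivization.submodule_injective
    rw [h1]
    exact hΨ 3 (by norm_num) c z (coordLift f c) (hP c).left.continuous.continuousAt
      (toC_ne_zero _) (Filter.Eventually.of_forall fun ζ => Submodule.mem_span_singleton_self _)
  refine ⟨Ψ 0, ⟨fun c z₀ => ⟨U c z₀, t c z₀ 0, haU c z₀, hlift c z₀ 0 (by norm_num), ?_⟩,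
    3, Ψ, rfl, h3, fun j hj c z₀ => ⟨U c z₀, t c z₀ j, t c z₀ (j + 1), m c z₀ j, haU c z₀,
      hlift c z₀ j (by omega), (ht c z₀ j (by omega)).1, hlift c z₀ (j + 1) (by omega),
      (ht c z₀ (j + 1) (by omega)).1, hdel c z₀ j hj⟩⟩, h0⟩
  rw [ht0]
  exact (differentiable_pvec _).differentiableOn

/-! ### Uniqueness of the directrix curve -/

theorem delPerp_smul {s t : ℂ → C7} {μ : ℂ → ℂ} {z : ℂ} (hs : s =ᶠ[𝓝 z] fun w => μ w • t w)
    (hμ : DifferentiableAt ℝ μ z) (ht : DifferentiableAt ℝ t z) (h0 : μ z ≠ 0) :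
    delPerp s z = μ z • delPerp t z := by
  have h1 : dz s z = Dz μ z • t z + μ z • dz t z := by
    rw [dz_eq_Dz, dz_eq_Dz, Dz_congr hs, Dz_smul hμ ht]
  have h2 : Submodule.span ℂ {s z} = Submodule.span ℂ {t z} := by
    rw [hs.eq_of_nhds]
    exact Submodule.span_singleton_smul_eq (IsUnit.mk0 _ h0) _
  rw [delPerp, h1, delPerp]
  simp only [h2]
  rw [map_add, map_smul, map_smul, Submodule.starProjection_orthogonalComplement_singleton_eq_zero,
    smul_zero, zero_add]

/-- Two smooth sections of the same line bundle differ by a smooth factor. -/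
theorem exists_smooth_factor {s t : ℂ → C7} {W : Set ℂ} (hs : ContDiffOn ℝ ∞ s W)
    (ht : ContDiffOn ℝ ∞ t W) (h0 : ∀ z ∈ W, t z ≠ 0)
    (h : ∀ z ∈ W, s z ∈ Submodule.span ℂ {t z}) :
    ∃ μ : ℂ → ℂ, ContDiffOn ℝ ∞ μ W ∧ ∀ z ∈ W, s z = μ z • t z := by
  have hq : ∀ z ∈ W, dotC (conjC (t z)) (t z) ≠ 0 := fun z hz => by
    rw [dotC_conjC_self]; simpa using h0 z hz
  refine ⟨fun z => dotC (conjC (t z)) (s z) * (dotC (conjC (t z)) (t z))⁻¹,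
    (contDiffOn_dotC (contDiffOn_conjC ht) hs).mul
      ((contDiffOn_dotC (contDiffOn_conjC ht) ht).inv hq), fun z hz => ?_⟩
  obtain ⟨c, hc⟩ := Submodule.mem_span_singleton.1 (h z hz)
  simp only [← hc, dotC_smul_right, mul_inv_cancel_right₀ (hq z hz)]

theorem linearIndependent_succ_of_gs_ne_zero {e : ℕ → ℂ → C7} {j : ℕ} {z : ℂ}
    (hi : LinearIndependent ℂ fun i : Fin j => e i z) (h0 : gs e j z ≠ 0) :
    LinearIndependent ℂ fun i : Fin (j + 1) => e i z := by
  have h1 : (fun i : Fin (j + 1) => e i z) = Fin.snoc (fun i : Fin j => e i z) (e j z) := by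
    ext1 i
    refine Fin.lastCases ?_ (fun i => ?_) i <;> simp
  rw [h1]
  refine hi.finSnoc fun hmem => h0 ?_
  have h2 : e j z ∈ flag e j z := by
    refine Submodule.span_mono ?_ hmem
    rintro _ ⟨i, rfl⟩
    exact ⟨i, i.2, rfl⟩
  have h3 : gs e j z ∈ flag e j z := by
    have := Submodule.sub_mem _ h2 (sub_gs_mem_flag e j z)
    rwa [sub_sub_cancel] at this
  exact inner_self_eq_zero.1 (inner_gs_of_mem_flag le_rfl h3)

/-- Away from a point, the harmonic sequence of a holomorphic curve is the orthogonalization of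
the derivatives of a local holomorphic section. -/
theorem exists_chain {Ψ : ℕ → OnePoint ℂ → CP6} {k : ℕ} (hφ : IsHolomorphicCurve (Ψ 0))
    (hn : ∀ j < k, IsNext (Ψ j) (Ψ (j + 1))) (c : Bool) (z₀ : ℂ) :
    ∃ (V : Set ℂ) (e : ℕ → ℂ → C7), IsOpen V ∧ z₀ ∈ V ∧ (∀ i, DifferentiableOn ℂ (e i) V) ∧
      (∀ i z, deriv (e i) z = e (i + 1) z) ∧
      (∀ z ∈ V, (Ψ 0 (chart c z)).submodule = Submodule.span ℂ {e 0 z}) ∧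
      ∀ j ≤ k, ∀ z ∈ V, z ≠ z₀ → LinearIndependent ℂ (fun i : Fin (j + 1) => e i z) ∧
        (Ψ j (chart c z)).submodule = Submodule.span ℂ {gs e j z} := by
  obtain ⟨U, s, hzU, hsU, hsd⟩ := hφ c z₀
  choose! U' s' t' m' hz' hls' hs' hlt' ht' hd' using fun j hj => hn j hj c z₀
  set V : Set ℂ := U ∩ ⋂ j : Fin k, U' j with hV
  have hVo : IsOpen V := hsU.1.inter (isOpen_iInter_of_finite fun j => (hls' j j.2).1)
  have hzV : z₀ ∈ V := ⟨hzU, Set.mem_iInter.2 fun j => hz' j j.2⟩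
  have hV' : ∀ j < k, V ⊆ U' j := fun j hj z hz => Set.mem_iInter.1 hz.2 ⟨j, hj⟩
  set e : ℕ → ℂ → C7 := fun i => iteratedDeriv i s with he
  have hsucc : ∀ i z, deriv (e i) z = e (i + 1) z := fun i z => by
    exact (congrFun iteratedDeriv_succ z).symm
  have hed : ∀ i, DifferentiableOn ℂ (e i) V := by
    intro i
    induction i with
    | zero =>
      rw [show e 0 = s from iteratedDeriv_zero]
      exact hsd.mono Set.inter_subset_left
    | succ i ih =>
      rw [show e (i + 1) = deriv (e i) from funext fun z => (hsucc i z).symm]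
      exact ih.deriv hVo
  have he0 : ∀ z ∈ V, (Ψ 0 (chart c z)).submodule = Submodule.span ℂ {e 0 z} := fun z hz => by
    simpa only [he, iteratedDeriv_zero] using hsU.2 z hz.1
  refine ⟨V, e, hVo, hzV, hed, hsucc, he0, fun j => ?_⟩
  set W : Set ℂ := V ∩ {z₀}ᶜ with hW
  have hWo : IsOpen W := hVo.inter isOpen_compl_singleton
  have hne : ∀ {ψ : CP6} {x : C7}, ψ.submodule = Submodule.span ℂ {x} → x ≠ 0 := by
    rintro ψ x h rfl
    have := ψ.finrank_submodule
    rw [h, Submodule.span_zero_singleton, finrank_bot] at this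
    exact zero_ne_one this
  induction j with
  | zero =>
    intro _ z hz _
    refine ⟨show LinearIndependent ℂ (fun i : Fin 1 => e i z) from
      LinearIndependent.of_subsingleton (0 : Fin 1) (hne (he0 z hz)), ?_⟩
    rw [gs_zero]; exact he0 z hz
  | succ j ih =>
    intro hj z hz hzz
    have hjk : j < k := by omega
    have ih := ih hjk.le
    have hdW : ∀ i < j + 1, DifferentiableOn ℂ (e i) W := fun i _ =>
      (hed i).mono Set.inter_subset_left
    have hiW : ∀ z ∈ W, LinearIndependent ℂ fun i : Fin (j + 1) => e i z := fun z hz =>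
      (ih z hz.1 hz.2).1
    have hgW : ContDiffOn ℝ ∞ (gs e j) W := gs_smooth hWo hdW hiW (Nat.lt_succ_self j)
    have hs'W := (hs' j hjk).mono (fun z (hz : z ∈ W) => hV' j hjk hz.1)
    have hsp : ∀ z ∈ W, Submodule.span ℂ {gs e j z} = Submodule.span ℂ {s' j z} := fun z hz => by
      rw [← (ih z hz.1 hz.2).2, (hls' j hjk).2 z (hV' j hjk hz.1)]
    obtain ⟨μ, hμ, hμs⟩ := exists_smooth_factor hgW hs'W
      (fun z hz => hne ((hls' j hjk).2 z (hV' j hjk hz.1)))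
      (fun z hz => by rw [← hsp z hz]; exact Submodule.mem_span_singleton_self _)
    have hzW : z ∈ W := ⟨hz, hzz⟩
    have hgz : gs e j z ≠ 0 := gs_ne_zero (hiW z hzW) (Nat.lt_succ_self j)
    have hμz : μ z ≠ 0 := fun h => hgz (by rw [hμs z hzW, h, zero_smul])
    have h1 : gs e j =ᶠ[𝓝 z] fun w => μ w • s' j w := by
      filter_upwards [hWo.mem_nhds hzW] with w hw using hμs w hw
    have h2 := delPerp_smul h1 (SmoothOn.diff hWo hμ hzW) (SmoothOn.diff hWo hs'W hzW) hμz
    -- The frame consists of successive derivatives, so all its exponents are zero.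
    have h3 := delPerp_gs (a := z₀) (m := fun _ => 0) hWo hdW hiW hzW (j := j)
      (fun i _ => by rw [hsucc, pow_zero, one_smul, sub_self]; exact Submodule.zero_mem _)
      (Nat.lt_succ_self j)
    rw [pow_zero, one_smul, h2, hd' j hjk z (hV' j hjk hz), smul_smul] at h3
    have h4 := (hlt' j hjk).2 z (hV' j hjk hz)
    have h5 : μ z * (z - z₀) ^ m' j ≠ 0 := mul_ne_zero hμz (pow_ne_zero _ (sub_ne_zero.2 hzz))
    refine ⟨linearIndependent_succ_of_gs_ne_zero (hiW z hzW) ?_, ?_⟩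
    · rw [← h3]; exact smul_ne_zero h5 (hne h4)
    · rw [h4, ← h3]; exact (Submodule.span_singleton_smul_eq (IsUnit.mk0 _ h5) _).symm

/-- The antiholomorphic derivative in an orthogonalized holomorphic frame. -/
theorem Db_gs_succ {e : ℕ → ℂ → C7} {W : Set ℂ} {j : ℕ} (hW : IsOpen W)
    (he : ∀ i < j + 2, DifferentiableOn ℂ (e i) W)
    (hi : ∀ z ∈ W, LinearIndependent ℂ fun i : Fin (j + 2) => e i z)
    (hd : ∀ i z, deriv (e i) z = e (i + 1) z) {z : ℂ} (hz : z ∈ W) :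
    ∃ c : ℂ, c ≠ 0 ∧ Db (gs e (j + 1)) z = c • gs e j z := by
  have hdiff : ∀ i < j + 2, DifferentiableAt ℝ (gs e i) z := fun i hin =>
    SmoothOn.diff hW (gs_smooth hW he hi hin) hz
  have hDz : ∀ i ≤ j, Dz (gs e i) z - gs e (i + 1) z ∈ flag e (i + 1) z := fun i hij => by
    have := Dz_gs_mem (a := z) (m := fun _ => 0) hW he hi hz (j := i)
      (fun i _ => by rw [hd, pow_zero, one_smul, sub_self]; exact Submodule.zero_mem _) (by omega)
    rwa [pow_zero, one_smul] at this
  -- Adjointness of ∂_z and -∂_z̄ along orthogonal sections. The right side is nonzero only for i =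
  -- j, so ∂_z̄ g_{j+1} has a component along g_j alone.
  have h1 : ∀ i ≤ j, inner ℂ (gs e i z) (Db (gs e (j + 1)) z) =
      -inner ℂ (gs e (i + 1) z) (gs e (j + 1) z) := by
    intro i hij
    have h2 := Db_dotC (differentiableAt_conjC (hdiff i (by omega))) (hdiff (j + 1) (by omega))
    have h0 : ∀ w, dotC (conjC (gs e i w)) (gs e (j + 1) w) = 0 := fun w => by
      rw [← inner_eq_dotC]
      exact inner_gs_of_mem_flag (Nat.succ_le_succ hij) (gs_mem_flag (Nat.lt_succ_self i) w)
    simp only [h0, Db_const] at h2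
    rw [Db_conjC (hdiff i (by omega)), ← inner_eq_dotC, ← inner_eq_dotC] at h2
    have h3 := inner_gs_of_mem_flag (show i + 1 ≤ j + 1 by omega) (hDz i hij)
    rw [inner_sub_left, sub_eq_zero] at h3
    rw [h3] at h2
    exact eq_neg_of_add_eq_zero_right h2.symm
  set r := Db (gs e (j + 1)) z with hr
  have hrm : r ∈ flag e (j + 1) z := Db_gs_mem hW he hi (by omega) hz
  rw [flag_eq_gs, show Set.Iio (j + 1) = insert j (Set.Iio j) by ext; simp,
    Set.image_insert_eq, Submodule.mem_span_insert] at hrm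
  obtain ⟨c, y, hy, hry⟩ := hrm
  have hy' : y ∈ flag e j z := by rwa [flag_eq_gs]
  have hyr : inner ℂ y r = 0 := by
    clear hry
    induction hy using Submodule.span_induction with
    | mem x hx =>
      obtain ⟨k, hk, rfl⟩ := hx
      have hk : k < j := hk
      rw [h1 k hk.le, inner_gs_of_mem_flag (i := k + 2) (by omega) (gs_mem_flag (by omega) z),
        neg_zero]
    | zero => simp
    | add x y hx' hy' hx hy =>
      rw [inner_add_left, hx (by rwa [flag_eq_gs]), hy (by rwa [flag_eq_gs]), add_zero]
    | smul a x hx' hx => rw [inner_smul_left, hx (by rwa [flag_eq_gs]), mul_zero]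
  rw [hry, inner_add_right, inner_smul_right, inner_gs_of_mem_flag le_rfl hy', mul_zero,
    zero_add, inner_self_eq_zero] at hyr
  rw [hyr, add_zero] at hry
  refine ⟨c, ?_, hry⟩
  rintro rfl
  have h2 := h1 j le_rfl
  rw [hry, zero_smul, inner_zero_right, eq_comm, neg_eq_zero, inner_self_eq_zero] at h2
  exact gs_ne_zero (hi z hz) (by omega) h2

theorem contDiff_harm {F : ℂ → C7} (hF : IsACLift F) (j : ℕ) : ContDiff ℝ ∞ (harm F j) := by
  match j with
  | 0 => exact contDiff_conjC hF.smooth_binormal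
  | 1 => exact contDiff_conjC (contDiff_Db hF.smooth_binormal)
  | 2 => exact contDiff_conjC hF.smooth_Dz
  | n + 3 => exact hF.smooth

theorem energy_ne_zero {F : ℂ → C7} {z : ℂ} (hz : binormal F z ≠ 0) : energy F z ≠ 0 := by
  rw [IsACLift.energy_eq]
  have : Dz F z ≠ 0 := fun h => hz (by rw [binormal, h, crossC_zero_left])
  simpa using this

theorem Db_binormal_ne_zero {F : ℂ → C7} (hF : IsACLift F) {z : ℂ} (hz : binormal F z ≠ 0) :
    Db (binormal F) z ≠ 0 := by
  intro h
  have h1 := hF.norm_Db_binormal z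
  have h2 : Dz F z ≠ 0 := fun h => hz (by rw [binormal, h, crossC_zero_left])
  rw [h, norm_zero] at h1
  have h3 : ‖Dz F z‖ ^ 2 * ‖binormal F z‖ ^ 2 ≠ 0 := by
    simp [h2, hz]
  exact h3 (by rw [← h1]; ring)

theorem harm_ne_zero {F : ℂ → C7} (hF : IsACLift F) {z : ℂ} (hz : binormal F z ≠ 0) (j : ℕ) :
    harm F j z ≠ 0 := by
  match j with
  | 0 => exact fun h => hz (conjC_eq_zero.1 h)
  | 1 => exact fun h => Db_binormal_ne_zero hF hz (conjC_eq_zero.1 h)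
  | 2 => exact fun h => hz (by rw [binormal, conjC_eq_zero.1 h, crossC_zero_left])
  | n + 3 =>
    intro h
    have h1 := hF.unit z
    rw [show F z = 0 from h] at h1
    simp at h1

theorem Dz_binormal_eq {F G : ℂ → C7} (hP : IsACPair F G) {z : ℂ} (hz : binormal F z ≠ 0) :
    Dz (binormal F) z = (dotC (conjC (binormal F z)) (Dz (binormal F) z) *
      (dotC (conjC (binormal F z)) (binormal F z))⁻¹) • binormal F z := by
  have hq : dotC (conjC (binormal F z)) (binormal F z) ≠ 0 := by
    rw [dotC_conjC_self]; simpa using hz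
  have h := congrArg (fun v => (dotC (conjC (binormal F z)) (binormal F z))⁻¹ • v)
    (hP.Dz_binormal_parallel z)
  simp only [smul_smul, inv_mul_cancel₀ hq, one_smul] at h
  rw [mul_comm]
  exact h

/-- The antiholomorphic derivative along the harmonic sequence. -/
theorem Db_harm_succ {F G : ℂ → C7} (hP : IsACPair F G) {z : ℂ} (hz : binormal F z ≠ 0) {i : ℕ}
    (hi : i < 3) : (∃ a b : ℂ, b ≠ 0 ∧ Db (harm F (i + 1)) z = a • harm F (i + 1) z + b • harm F i z) ∧
      inner ℂ (harm F (i + 1) z) (harm F i z) = 0 := by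
  have hF := hP.left
  have hE := energy_ne_zero hz
  have hEr : (starRingEnd ℂ) (energy F z) = energy F z := by
    rw [IsACLift.energy_eq, Complex.conj_ofReal]
  have hE' : (starRingEnd ℂ) (Dz (energy F) z) = Db (energy F) z := by
    rw [hF.Dz_energy, hF.Db_energy, conj_dotC, conjC_conjC, dotC_comm]
  have hDb : conjC (Db (binormal F) z) = (Complex.I * energy F z) • conjC (Dz (Dz F) z) +
      (-Complex.I * Db (energy F) z) • conjC (Dz F z) := by
    rw [hF.Db_binormal]
    simp [hEr, hE']
  have hBd := fun w => Smooth.diff hF.smooth_binormal w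
  have hDBd := fun w => Smooth.diff (contDiff_Db hF.smooth_binormal) w
  interval_cases i
  · refine ⟨?_, ?_⟩
    · set q : ℂ → ℂ := fun w => dotC (conjC (binormal F w)) (binormal F w) with hqd
      set α : ℂ → ℂ := fun w => dotC (conjC (binormal F w)) (Dz (binormal F) w) * (q w)⁻¹ with hα
      have hqz : q z ≠ 0 := by simp only [hqd, dotC_conjC_self]; simpa using hz
      have hcs := contDiff_conjC hF.smooth_binormal
      have hαd : DifferentiableAt ℝ α z := DifferentiableAt.fun_mul
        (Smooth.diff (contDiff_dotC hcs (contDiff_Dz hF.smooth_binormal)) z)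
        ((Smooth.diff (contDiff_dotC hcs hF.smooth_binormal) z).fun_inv hqz)
      have he : Dz (binormal F) =ᶠ[𝓝 z] fun w => α w • binormal F w := by
        filter_upwards [(isClosed_eq hF.smooth_binormal.continuous
          continuous_const).isOpen_compl.mem_nhds hz] with w hw using Dz_binormal_eq hP hw
      have h1 : Dz (Db (binormal F)) z = Db α z • binormal F z + α z • Db (binormal F) z := by
        rw [Dz_Db_comm hF.smooth_binormal.contDiffAt, Db_congr he, Db_smul hαd (hBd z)]
      refine ⟨(starRingEnd ℂ) (α z), (starRingEnd ℂ) (Db α z), ?_, ?_⟩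
      -- If this coefficient vanished, ∂_z ∂_z̄ H would be a multiple of ∂_z̄ H. Differentiating ⟨H,
      -- ∂_z̄ H⟩ = 0 would then give |∂_z̄ H|² = 0.
      · intro h0
        rw [map_eq_zero] at h0
        rw [h0, zero_smul, zero_add] at h1
        have h2 := Dz_dotC (Smooth.diff hcs z) (hDBd z)
        have h3 : ∀ w, dotC (conjC (binormal F w)) (Db (binormal F) w) = 0 := fun w => by
          rw [← inner_eq_dotC, hF.inner_Db_binormal]
        simp only [h3, Dz_const] at h2
        rw [Dz_conjC (hBd z), h1, dotC_smul_right, h3, mul_zero, add_zero, dotC_conjC_self] at h2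
        have := Db_binormal_ne_zero hF hz
        exact this (by simpa using h2.symm)
      · change Db (fun w => conjC (Db (binormal F) w)) z = _
        rw [Db_conjC (hDBd z), h1, conjC_add, conjC_smul, conjC_smul, add_comm]
        rfl
    · change inner ℂ (conjC (Db (binormal F) z)) (conjC (binormal F z)) = 0
      rw [inner_eq_dotC, conjC_conjC, dotC_comm, ← inner_eq_dotC, hF.inner_Db_binormal]
  · refine ⟨⟨Db (energy F) z * (energy F z)⁻¹, -Complex.I * (energy F z)⁻¹, ?_, ?_⟩, ?_⟩
    · simp [hE]
    · change Db (fun w => conjC (Dz F w)) z = _ • conjC (Dz F z) + _ • conjC (Db (binormal F) z)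
      rw [Db_conjC (Smooth.diff hF.smooth_Dz z), hDb]
      have e1 : -Complex.I * (energy F z)⁻¹ * (Complex.I * energy F z) = 1 := by
        field_simp
        linear_combination -Complex.I_sq
      have e2 : -Complex.I * (energy F z)⁻¹ * (-Complex.I * Db (energy F) z) =
          -(Db (energy F) z * (energy F z)⁻¹) := by
        linear_combination (energy F z)⁻¹ * Db (energy F) z * Complex.I_sq
      rw [smul_add, smul_smul, smul_smul, e1, e2]
      module
    · change inner ℂ (conjC (Dz F z)) (conjC (Db (binormal F) z)) = 0
      rw [inner_eq_dotC, conjC_conjC, hDb, dotC_add_right, dotC_smul_right, dotC_smul_right,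
        hF.Db_energy, show dotC (Dz F z) (conjC (Dz F z)) = energy F z from rfl]
      ring
  · refine ⟨⟨0, 1, one_ne_zero, ?_⟩, ?_⟩
    · change Db F z = _ • F z + _ • conjC (Dz F z)
      rw [hF.Db_eq, zero_smul, zero_add, one_smul]
    · change inner ℂ (F z) (conjC (Dz F z)) = 0
      rw [inner_eq_dotC, hF.real, hF.dot_F_conj]

theorem Db_harm_zero {F G : ℂ → C7} (hP : IsACPair F G) {z : ℂ} (hz : binormal F z ≠ 0) :
    ∃ a : ℂ, Db (harm F 0) z = a • harm F 0 z := by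
  change ∃ a : ℂ, Db (fun w => conjC (binormal F w)) z = a • conjC (binormal F z)
  rw [Db_conjC (Smooth.diff hP.left.smooth_binormal z), Dz_binormal_eq hP hz, conjC_smul]
  exact ⟨_, rfl⟩

/-- A holomorphic curve whose harmonic sequence contains an almost complex curve is generically
spanned by the conjugate of the binormal. -/
theorem mem_span_harm_of_chain {F G : ℂ → C7} (hP : IsACPair F G) {W : Set ℂ} (hW : IsOpen W)
    (hWn : W.Nonempty) (hb : ∀ z ∈ W, binormal F z ≠ 0) {e : ℕ → ℂ → C7} {k : ℕ}
    (he : ∀ i, DifferentiableOn ℂ (e i) W)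
    (hi : ∀ z ∈ W, LinearIndependent ℂ fun i : Fin (k + 1) => e i z)
    (hd : ∀ i z, deriv (e i) z = e (i + 1) z)
    (hk : ∀ z ∈ W, gs e k z ∈ Submodule.span ℂ {F z}) :
    ∀ z ∈ W, e 0 z ∈ Submodule.span ℂ {harm F 0 z} := by
  have hF := hP.left
  have hii : ∀ j ≤ k, ∀ z ∈ W, LinearIndependent ℂ fun i : Fin (j + 1) => e i z :=
    fun j hj z hz => (hi z hz).comp (Fin.castLE (by omega)) (Fin.castLE_injective _)
  have hgs : ∀ j ≤ k, ContDiffOn ℝ ∞ (gs e j) W := fun j hj =>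
    gs_smooth hW (fun i _ => he i) hi (Nat.lt_succ_of_le hj)
  have hg0 : ∀ j ≤ k, ∀ z ∈ W, gs e j z ≠ 0 := fun j hj z hz =>
    gs_ne_zero (hi z hz) (Nat.lt_succ_of_le hj)
  have hfac : ∀ j ≤ k, ∀ i, (∀ z ∈ W, gs e j z ∈ Submodule.span ℂ {harm F i z}) →
      ∀ z ∈ W, ∃ a b : ℂ, b ≠ 0 ∧ gs e j z = b • harm F i z ∧
        Db (gs e j) z = a • harm F i z + b • Db (harm F i) z := by
    intro j hj i h z hz
    obtain ⟨μ, hμ, hμs⟩ := exists_smooth_factor (hgs j hj) (contDiff_harm hF i).contDiffOn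
      (fun z hz => harm_ne_zero hF (hb z hz) i) h
    refine ⟨Db μ z, μ z, fun h0 => hg0 j hj z hz (by rw [hμs z hz, h0, zero_smul]), hμs z hz, ?_⟩
    rw [Db_congr (t := fun w => μ w • harm F i w)
      (by filter_upwards [hW.mem_nhds hz] with w hw using hμs w hw),
      Db_smul (SmoothOn.diff hW hμ hz) (Smooth.diff (contDiff_harm hF i) z)]
  have hstep : ∀ j, j + 1 ≤ k → ∀ z ∈ W, ∃ c : ℂ, c ≠ 0 ∧ Db (gs e (j + 1)) z = c • gs e j z :=
    fun j hj z hz => Db_gs_succ hW (fun i _ => he i) (hii (j + 1) hj) hd hz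
  have hgo : ∀ j z, inner ℂ (gs e (j + 1) z) (gs e j z) = 0 := fun j z =>
    InnerProductSpace.gramSchmidt_orthogonal ℂ _ (by omega)
  have hnz : ∀ z ∈ W, ∀ i < 3, ∀ a b : ℂ, b ≠ 0 → a • harm F (i + 1) z + b • Db (harm F (i + 1)) z ≠ 0 := by
    intro z hz i hi a b hb0 h0
    obtain ⟨⟨a', b', hb', h1⟩, h2⟩ := Db_harm_succ hP (hb z hz) hi
    rw [h1] at h0
    have h3 : (a + b * a') • harm F (i + 1) z + (b * b') • harm F i z = 0 := by
      rw [← h0]; module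
    have h4 := congrArg (fun v => inner ℂ v (harm F i z)) h3
    simp only [inner_add_left, inner_smul_left, h2, mul_zero, zero_add, inner_zero_left] at h4
    rcases mul_eq_zero.1 h4 with h5 | h5
    · simp [hb0, hb'] at h5
    · exact harm_ne_zero hF (hb z hz) i (inner_self_eq_zero.1 h5)
  -- Both ∂_z̄ g_{j+1} and ∂_z̄ `harm F (i+1)`, modulo the line of the latter, point to the
  -- preceding element. Orthogonality to that line removes the ambiguity, so the preceding lines
  -- agree.
  have hdesc : ∀ j, j + 1 ≤ k → ∀ i < 3,
      (∀ z ∈ W, gs e (j + 1) z ∈ Submodule.span ℂ {harm F (i + 1) z}) →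
      ∀ z ∈ W, gs e j z ∈ Submodule.span ℂ {harm F i z} := by
    intro j hj i hi h z hz
    obtain ⟨a, b, hb0, hg, hDg⟩ := hfac (j + 1) hj (i + 1) h z hz
    obtain ⟨⟨a', b', hb', h1⟩, h2⟩ := Db_harm_succ hP (hb z hz) hi
    obtain ⟨c, hc0, hc⟩ := hstep j hj z hz
    rw [h1, hc] at hDg
    have h3 : inner ℂ (harm F (i + 1) z) (gs e j z) = 0 := by
      have := hgo j z
      rw [hg, inner_smul_left] at this
      exact (mul_eq_zero.1 this).resolve_left (by simpa using hb0)
    have h4 := congrArg (inner ℂ (harm F (i + 1) z)) hDg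
    rw [inner_smul_right, h3, smul_add, inner_add_right, inner_add_right, inner_smul_right,
      inner_smul_right, inner_smul_right, inner_smul_right, inner_smul_right, h2] at h4
    have h5 : (a + b * a') * inner ℂ (harm F (i + 1) z) (harm F (i + 1) z) = 0 := by
      linear_combination -h4
    have h6 := (mul_eq_zero.1 h5).resolve_right
      (fun h => harm_ne_zero hF (hb z hz) _ (inner_self_eq_zero.1 h))
    refine Submodule.mem_span_singleton.2 ⟨c⁻¹ * (b * b'), ?_⟩
    have h7 : c • gs e j z = (b * b') • harm F i z := by
      rw [hDg]
      linear_combination (norm := module) h6 • harm F (i + 1) z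
    rw [mul_smul, ← h7, smul_smul, inv_mul_cancel₀ hc0, one_smul]
  have hDb0 : ∀ z ∈ W, Db (gs e 0) z = 0 := fun z hz => by
    rw [gs_zero, Db_of_differentiableAt ((he 0).differentiableAt (hW.mem_nhds hz))]
  -- A sequence cannot begin at one of the last three elements: its first section is holomorphic,
  -- whereas ∂_z̄ of any section of those lines has a nonzero component along the preceding line.
  have hend : ∀ i < 3, ¬ ∀ z ∈ W, gs e 0 z ∈ Submodule.span ℂ {harm F (i + 1) z} := by
    intro i hi h
    obtain ⟨z, hz⟩ := hWn
    obtain ⟨a, b, hb0, -, hDg⟩ := hfac 0 (Nat.zero_le k) (i + 1) h z hz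
    rw [hDb0 z hz] at hDg
    exact hnz z hz i hi a b hb0 hDg.symm
  match k, hk with
  | 0, hk => exact absurd hk (hend 2 (by norm_num))
  | 1, hk => exact absurd (hdesc 0 le_rfl 2 (by norm_num) hk) (hend 1 (by norm_num))
  | 2, hk => exact absurd (hdesc 0 (by norm_num) 1 (by norm_num)
      (hdesc 1 le_rfl 2 (by norm_num) hk)) (hend 0 (by norm_num))
  | k + 3, hk =>
    have h0 := hdesc k (by omega) 0 (by norm_num) (hdesc (k + 1) (by omega) 1 (by norm_num)
      (hdesc (k + 2) (by omega) 2 (by norm_num) hk))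
    match k, h0 with
    | 0, h0 => rwa [gs_zero] at h0
    -- Nor can it extend before conj H: ∂_z̄ preserves the line of conj H but would have to map it
    -- to an orthogonal nonzero line.
    | k + 1, h0 =>
      exfalso
      obtain ⟨z, hz⟩ := hWn
      obtain ⟨a, b, hb0, hg, hDg⟩ := hfac (k + 1) (by omega) 0 h0 z hz
      obtain ⟨a', h1⟩ := Db_harm_zero hP (hb z hz)
      obtain ⟨c, hc0, hc⟩ := hstep k (by omega) z hz
      have h2 := hgo k z
      have h3 : c • gs e k z = ((a + b * a') * b⁻¹) • gs e (k + 1) z := by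
        rw [← hc, hDg, h1, hg, smul_smul, smul_smul, mul_assoc _ b⁻¹ b, inv_mul_cancel₀ hb0]
        module
      have h4 := congrArg (fun v => inner ℂ v (gs e k z)) h3
      simp only [inner_smul_left, h2, mul_zero] at h4
      rcases mul_eq_zero.1 h4 with h5 | h5
      · simp [hc0] at h5
      · exact hg0 k (by omega) z hz (inner_self_eq_zero.1 h5)

open Polynomial in
/-- The directrix curve is unique. -/
theorem directrix_unique {f : OnePoint ℂ → S6} (hfull : IsLinearlyFull f)
    (hac : IsAlmostComplexCurve f) {p : Bool → Fin 7 → ℂ[X]}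
    (hp : ∀ c, IsDirectrixPoly (coordLift f c) (p c)) {φ : OnePoint ℂ → CP6}
    (hφ : IsDirectrix φ (projMap f)) (c : Bool) (z₀ : ℂ) :
    (φ (chart c z₀)).submodule = Submodule.span ℂ {pvec (p c) z₀} := by
  obtain ⟨hol, k, Ψ, rfl, hΨ, hn⟩ := hφ
  have hP := isACPair_coordLift hac c
  have hne := hP.left.binormal_ne_zero (isFullLift_coordLift hfull hac c)
  obtain ⟨V, e, hV, hzV, he, hd, h0, hch⟩ := exists_chain hol hn c z₀
  obtain ⟨r, hr, hiso⟩ := hP.left.isolated_binormal hne z₀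
  set W : Set ℂ := (V ∩ Metric.ball z₀ r) ∩ {z₀}ᶜ with hWd
  have hW : IsOpen W := (hV.inter Metric.isOpen_ball).inter isOpen_compl_singleton
  have hWev : ∀ᶠ ζ in 𝓝[≠] z₀, ζ ∈ W := by
    filter_upwards [nhdsWithin_le_nhds ((hV.inter Metric.isOpen_ball).mem_nhds
      ⟨hzV, Metric.mem_ball_self hr⟩), self_mem_nhdsWithin] with ζ h1 h2 using ⟨h1, h2⟩
  have hbW : ∀ z ∈ W, binormal (coordLift f c) z ≠ 0 := fun z hz h =>
    hz.2 (hiso z h (by simpa [dist_eq_norm] using hz.1.2))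
  have hmem := mem_span_harm_of_chain hP hW hWev.exists hbW
    (fun i => (he i).mono fun z hz => hz.1.1) (fun z hz => (hch k le_rfl z hz.1.1 hz.2).1) hd
    fun z hz => by
      have h1 := (hch k le_rfl z hz.1.1 hz.2).2
      rw [hΨ, show (projMap f (chart c z)).submodule = Submodule.span ℂ {coordLift f c z} from
        Projectivization.submodule_mk _ _] at h1
      rw [h1]
      exact Submodule.mem_span_singleton_self _
  rw [h0 z₀ hzV]
  refine span_eq_of_eventually (g := harm (coordLift f c) 0)
    ((he 0).differentiableAt (hV.mem_nhds hzV)).continuousAt ?_ ?_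
    (continuous_pvec _).continuousAt ((hp c).ne_zero z₀) ?_
  · intro h
    have h1 := (Ψ 0 (chart c z₀)).finrank_submodule
    rw [h0 z₀ hzV, h, Submodule.span_zero_singleton, finrank_bot] at h1
    exact zero_ne_one h1
  · filter_upwards [hWev] with z hz using hmem z hz
  · filter_upwards [hWev] with z hz
    obtain ⟨κ, hκ⟩ := (hp c).parallel z (hbW z hz)
    exact Submodule.mem_span_singleton.2 ⟨κ, hκ.symm⟩

/-! ### Ramification of osculating curves and adapted frames -/

/-- The Plücker coordinates of `n` vectors of `ℂ⁷`. -/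
def minor {n : ℕ} (q : Fin n → C7) (I : Fin n ↪o Fin 7) : ℂ :=
  Matrix.det (Matrix.of fun a b : Fin n => q a (I b))

section Minor

variable {n : ℕ} {q q' : Fin n → C7}

theorem exists_minor_ne_zero (hq : LinearIndependent ℂ q) : ∃ I, minor q I ≠ 0 := by
  set A : Matrix (Fin n) (Fin 7) ℂ := Matrix.of fun a i => q a i with hA
  have hrow : LinearIndependent ℂ A.row :=
    hq.map' (WithLp.linearEquiv 2 ℂ (Fin 7 → ℂ)).toLinearMap (LinearEquiv.ker _)
  have hr := hrow.rank_matrix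
  rw [A.rank_eq_finrank_span_cols, Fintype.card_fin] at hr
  obtain ⟨κ, b, hb, hsp, hli⟩ := exists_linearIndependent' ℂ A.col
  have : Finite κ := Finite.of_injective b hb
  have : Fintype κ := Fintype.ofFinite κ
  have hc : Fintype.card κ = n := by
    rw [← hr, ← hsp, finrank_span_eq_card hli]
  set S : Finset (Fin 7) := Finset.univ.map ⟨b, hb⟩ with hS
  have hSc : S.card = n := by rw [hS, Finset.card_map, Finset.card_univ, hc]
  set I := S.orderEmbOfFin hSc with hI
  have hmem : ∀ i, ∃ k, b k = I i := fun i => by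
    obtain ⟨k, -, hk⟩ := Finset.mem_map.1 (Finset.orderEmbOfFin_mem S hSc i)
    exact ⟨k, hk⟩
  choose k hk using hmem
  refine ⟨I, ?_⟩
  have h1 : LinearIndependent ℂ (fun i => A.col (I i)) := by
    have h2 := hli.comp k fun i j hij => I.injective (by rw [← hk, ← hk, hij])
    simpa only [Function.comp_def, hk] using h2
  have h2 : IsUnit (Matrix.of fun a b : Fin n => q a (I b)) :=
    Matrix.linearIndependent_cols_iff_isUnit.1 h1
  exact ((Matrix.isUnit_iff_isUnit_det _).1 h2).ne_zero

theorem minor_update_add (q : Fin n → C7) (a : Fin n) (x y : C7) (I : Fin n ↪o Fin 7) :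
    minor (Function.update q a (x + y)) I =
      minor (Function.update q a x) I + minor (Function.update q a y) I := by
  have h : ∀ x : C7, Matrix.of (fun c b : Fin n => Function.update q a x c (I b)) =
      Matrix.updateRow (Matrix.of fun c b : Fin n => q c (I b)) a fun b => x (I b) := by
    intro x
    ext c b
    by_cases hc : c = a
    · subst hc; simp
    · simp [hc]
  simp only [minor, h]
  exact Matrix.det_updateRow_add _ a _ _

theorem minor_update_smul (q : Fin n → C7) (a : Fin n) (c : ℂ) (x : C7) (I : Fin n ↪o Fin 7) :
    minor (Function.update q a (c • x)) I = c * minor (Function.update q a x) I := by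
  have h : ∀ x : C7, Matrix.of (fun c b : Fin n => Function.update q a x c (I b)) =
      Matrix.updateRow (Matrix.of fun c b : Fin n => q c (I b)) a fun b => x (I b) := by
    intro x
    ext c b
    by_cases hc : c = a
    · subst hc; simp
    · simp [hc]
  simp only [minor, h]
  exact Matrix.det_updateRow_smul _ a _ _

theorem minor_update_sum (q : Fin n → C7) (a : Fin n) (c : Fin n → ℂ) (I : Fin n ↪o Fin 7) :
    minor (Function.update q a (∑ k, c k • q k)) I = c a * minor q I := by
  have h : Matrix.of (fun d b : Fin n => Function.update q a (∑ k, c k • q k) d (I b)) =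
      Matrix.updateRow (Matrix.of fun c b : Fin n => q c (I b)) a
        (∑ k, c k • (Matrix.of fun c b : Fin n => q c (I b)) k) := by
    ext d b
    by_cases hd : d = a
    · subst hd; simp [Finset.sum_apply]
    · simp [hd]
  rw [minor, h, Matrix.det_updateRow_sum]
  rfl

theorem minor_triangular (T : Matrix (Fin n) (Fin n) ℂ) (hT : ∀ a k, a < k → T a k = 0)
    (h : ∀ a, q' a = ∑ k, T a k • q k) (I : Fin n ↪o Fin 7) :
    minor q' I = (∏ a, T a a) * minor q I := by
  have h1 : Matrix.of (fun a b : Fin n => q' a (I b)) =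
      T * Matrix.of fun a b : Fin n => q a (I b) := by
    ext a b
    simp [h, Matrix.mul_apply]
  rw [minor, h1, Matrix.det_mul, Matrix.det_of_isLowerTriangular]
  · rfl
  · intro a k hak
    exact hT a k hak

end Minor

theorem hasDerivAt_det {n : ℕ} {M : ℂ → Matrix (Fin n) (Fin n) ℂ} {M' : Matrix (Fin n) (Fin n) ℂ}
    {z : ℂ} (h : ∀ i j, HasDerivAt (fun w => M w i j) (M' i j) z) :
    HasDerivAt (fun w => (M w).det) (∑ i, ((M z).updateRow i (M' i)).det) z := by
  have h1 : ∀ N : Matrix (Fin n) (Fin n) ℂ, N.det =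
      ∑ σ : Equiv.Perm (Fin n), (Equiv.Perm.sign σ : ℂ) * ∏ i, N i (σ i) := fun N => by
    rw [← Matrix.det_transpose, Matrix.det_apply']
    rfl
  simp only [h1]
  rw [Finset.sum_comm]
  refine HasDerivAt.fun_sum fun σ _ => ?_
  rw [← Finset.mul_sum]
  refine HasDerivAt.const_mul _ ?_
  have h2 := HasDerivAt.fun_finsetProd (u := Finset.univ) (f := fun i w => M w i (σ i))
    (f' := fun i => M' i (σ i)) (x := z) fun i _ => h i (σ i)
  refine h2.congr_deriv (Finset.sum_congr rfl fun i _ => ?_)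
  rw [← Finset.mul_prod_erase _ _ (Finset.mem_univ i), Matrix.updateRow_self, smul_eq_mul, mul_comm]
  congr 1
  refine Finset.prod_congr rfl fun j hj => ?_
  rw [Matrix.updateRow_ne (Finset.ne_of_mem_erase hj)]

theorem hasDerivAt_minor {n : ℕ} {q : Fin n → ℂ → C7} {q' : Fin n → C7} {z : ℂ}
    (h : ∀ a, HasDerivAt (q a) (q' a) z) (I : Fin n ↪o Fin 7) :
    HasDerivAt (fun w => minor (fun a => q a w) I)
      (∑ a, minor (Function.update (fun a => q a z) a (q' a)) I) z := by
  have h1 := hasDerivAt_det (M := fun w => Matrix.of fun a b : Fin n => q a w (I b))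
    (M' := Matrix.of fun a b : Fin n => q' a (I b)) (z := z) fun a b =>
      ((EuclideanSpace.proj (𝕜 := ℂ) (I b)).hasFDerivAt.comp_hasDerivAt z (h a))
  refine h1.congr_deriv (Finset.sum_congr rfl fun a _ => ?_)
  rw [minor]
  congr 1
  ext c b
  by_cases hc : c = a
  · subst hc; simp
  · simp [hc]

theorem analyticAt_minor {n : ℕ} {q : Fin n → ℂ → C7} {z : ℂ} (h : ∀ a, AnalyticAt ℂ (q a) z)
    (I : Fin n ↪o Fin 7) : AnalyticAt ℂ (fun w => minor (fun a => q a w) I) z := by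
  simp only [minor, Matrix.det_apply']
  refine Finset.analyticAt_fun_sum _ fun σ _ => analyticAt_const.mul
    (Finset.analyticAt_fun_prod _ fun i _ => ?_)
  exact ((EuclideanSpace.proj (𝕜 := ℂ) (I i)).analyticAt _).comp (h (σ i))

namespace IsFrame

variable {a : ℂ} {P : ℂ → C7} {n : ℕ} {e : ℕ → ℂ → C7} {m : ℕ → ℕ}

/-- Each differentiation moves the leading frame vector one step up and contributes the factor (z -
a)^{m_i} of that step. -/
theorem anSpan_iteratedDeriv_sub (h : IsFrame a P n e m) {j : ℕ} (hj : j < n) :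
    AnSpan a e j fun z => iteratedDeriv j P z - (z - a) ^ (∑ i ∈ Finset.range j, m i) • e j z := by
  induction j with
  | zero =>
    refine AnSpan.zero.congr (Filter.Eventually.of_forall fun z => ?_)
    simp [iteratedDeriv_zero, h.zero]
  | succ j ih =>
    set M := ∑ i ∈ Finset.range j, m i with hM
    have h1 := ih (by omega)
    have hpa : ∀ k, AnalyticAt ℂ (fun z : ℂ => (z - a) ^ k) a := fun k => by fun_prop
    have hea := h.an j (by omega)
    have hPa : AnalyticAt ℂ (iteratedDeriv j P) a := by
      have h2 := (h.anSpan_iteratedDeriv (show j < n by omega))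
      obtain ⟨b, hb, hs⟩ := h2
      exact (Finset.analyticAt_fun_sum _ fun k hk => (hb k).smul
        (h.an k (by have := Finset.mem_range.1 hk; omega))).congr (hs.mono fun z hz => hz.symm)
    have h2 : AnSpan a e (j + 1) (deriv fun z => iteratedDeriv j P z - (z - a) ^ M • e j z) :=
      AnSpan.deriv (fun k hk => h.an k (by omega))
        (fun k hk => (h.anSpan_deriv (by omega)).mono (by omega)) (Nat.le_succ j) h1
    have h3 := ((AnSpan.self (e := e) (a := a) (Nat.lt_succ_self j)).smul (hpa M).deriv).add
      ((h.der j hj).smul (hpa M))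
    refine (h2.add h3).congr ?_
    filter_upwards [hPa.eventually_analyticAt, hea.eventually_analyticAt,
      (hpa M).eventually_analyticAt] with z k1 k2 k3
    rw [deriv_fun_sub k1.differentiableAt (k3.differentiableAt.fun_smul k2.differentiableAt),
      deriv_fun_smul k3.differentiableAt k2.differentiableAt, iteratedDeriv_succ,
      Finset.sum_range_succ, ← hM, pow_add]
    module

/-- The derivatives are expressed in the frame by a triangular matrix whose diagonal entries are
powers of z - a. -/
theorem osculating_eq (h : IsFrame a P n e m) {j : ℕ} (hj : j < n) :
    ∀ᶠ z in 𝓝 a, osculating j P z =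
      (z - a) ^ (∑ i : Fin (j + 1), ∑ l ∈ Finset.range i, m l) •
        fun I => minor (fun i : Fin (j + 1) => e i z) I := by
  choose! b hb hs using fun i (hi : i < n) => h.anSpan_iteratedDeriv_sub hi
  have h1 : ∀ᶠ z in 𝓝 a, ∀ i : Fin (j + 1), iteratedDeriv i P z -
      (z - a) ^ (∑ l ∈ Finset.range i, m l) • e i z =
      ∑ k ∈ Finset.range i, b i k z • e k z :=
    Filter.eventually_all.2 fun i => hs i (by omega)
  filter_upwards [h1] with z hz
  funext I
  set T : Matrix (Fin (j + 1)) (Fin (j + 1)) ℂ := Matrix.of fun i k =>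
    if k < i then b i k z else if k = i then (z - a) ^ (∑ l ∈ Finset.range i, m l) else 0 with hT
  have h2 := minor_triangular (q' := fun i : Fin (j + 1) => iteratedDeriv i P z)
    (q := fun i : Fin (j + 1) => e i z) T ?_ ?_ I
  · change minor (fun i : Fin (j + 1) => iteratedDeriv i P z) I = _
    rw [h2]
    simp [hT, Finset.prod_pow_eq_pow_sum]
  · intro i k hik
    simp [hT, hik.not_gt, hik.ne']
  · intro i
    have h3 := sub_eq_iff_eq_add.1 (hz i)
    simp only [h3]
    have h4 : ∀ k : Fin (j + 1), T i k • e k z = (if k < i then b i k z • e k z else 0) +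
        if k = i then (z - a) ^ (∑ l ∈ Finset.range i, m l) • e k z else 0 := by
      intro k
      by_cases h5 : k < i
      · simp [hT, h5, h5.ne]
      · by_cases h6 : k = i
        · subst h6; simp [hT]
        · simp [hT, h5, h6]
    rw [Finset.sum_congr rfl fun k _ => h4 k, Finset.sum_add_distrib]
    congr 1
    · rw [← Finset.sum_filter]
      refine Finset.sum_bij' (fun k hk => ⟨k, by have := Finset.mem_range.1 hk; omega⟩)
        (fun k _ => k) ?_ ?_ ?_ ?_ ?_
      · intro k hk
        have := Finset.mem_range.1 hk
        exact Finset.mem_filter.2 ⟨Finset.mem_univ _, this⟩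
      · intro k hk
        have := (Finset.mem_filter.1 hk).2
        exact Finset.mem_range.2 this
      · intros; rfl
      · intros; rfl
      · intros; rfl
    · simp

/-- The ramification indices are the exponents of an adapted frame. -/
theorem hasRamificationIndex (h : IsFrame a P n e m) {j : ℕ} (hj : j + 1 < n)
    {φ : OnePoint ℂ → CP6} {c : Bool} {U : Set ℂ} (ha : a ∈ U) (hlift : IsLift φ c U P)
    (hd : DifferentiableOn ℂ P U) : HasRamificationIndex φ j (chart c a) (m j) := by
  set g : ℂ → (Fin (j + 1) ↪o Fin 7) → ℂ := fun z I => minor (fun i : Fin (j + 1) => e i z) I with hg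
  set f : ℂ → Fin (j + 1) → C7 := fun z =>
    Function.update (fun i : Fin (j + 1) => e i z) (Fin.last j) (e (j + 1) z) with hf
  set g₁ : ℂ → (Fin (j + 1) ↪o Fin 7) → ℂ := fun z I => minor (f z) I with hg₁
  have hind : ∀ k ≤ n, LinearIndependent ℂ fun i : Fin k => e i a := fun k hk =>
    h.indep.comp (Fin.castLE hk) (Fin.castLE_injective hk)
  have han : ∀ i : Fin (j + 1), AnalyticAt ℂ (e i) a := fun i => h.an i (by omega)
  have hgI : ∀ I, AnalyticAt ℂ (fun z => g z I) a := fun I => analyticAt_minor han I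
  have hfan : ∀ i, AnalyticAt ℂ (fun z => f z i) a := by
    intro i
    by_cases hi : i = Fin.last j
    · subst hi; simpa [hf] using h.an (j + 1) hj
    · simpa [hf, hi] using han i
  have hgan : AnalyticAt ℂ g a := analyticAt_pi_iff.2 hgI
  have hg1I : ∀ I, AnalyticAt ℂ (fun z => g₁ z I) a := fun I =>
    analyticAt_minor (q := fun i z => f z i) hfan I
  obtain ⟨I₀, hI₀⟩ := exists_minor_ne_zero (hind (j + 1) (by omega))
  have hga : g a ≠ 0 := fun h0 => hI₀ (congrFun h0 I₀)
  refine ⟨c, a, U, P, _, g, rfl, ha, hlift, hd, hgan, hga,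
    h.osculating_eq (show j < n by omega), ?_⟩
  choose! b hb hs using fun i (hi : i < j) => h.anSpan_deriv (show i + 1 < n by omega)
  obtain ⟨b', hb', hs'⟩ := h.der j hj
  -- Differentiating a row other than the last produces only vectors already present, hence a
  -- multiple of g. The last row contributes a multiple of g and (z - a)^{m_j} times the minors g₁
  -- with e_{j+1} in place of e_j.
  have hderiv : ∀ᶠ z in 𝓝 a, ∃ τ : ℂ, ∀ I,
      HasDerivAt (fun w => g w I) (τ * g z I + (z - a) ^ m j * g₁ z I) z := by
    have k1 : ∀ᶠ z in 𝓝 a, ∀ i : Fin (j + 1), AnalyticAt ℂ (e i) z :=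
      Filter.eventually_all.2 fun i => (han i).eventually_analyticAt
    have k2 : ∀ᶠ z in 𝓝 a, ∀ i : Fin j, deriv (e i) z = ∑ k ∈ Finset.range (i + 2), b i k z • e k z :=
      Filter.eventually_all.2 fun i => hs i i.2
    filter_upwards [k1, k2, hs'] with z k1 k2 k3
    have hlow : ∀ i : Fin (j + 1), i ≠ Fin.last j → ∃ τ : ℂ, ∀ I,
        minor (Function.update (fun i : Fin (j + 1) => e i z) i (deriv (e i) z)) I = τ * g z I := by
      intro i hi
      have hij : (i : ℕ) < j := by
        have := i.2
        have : (i : ℕ) ≠ j := fun h => hi (Fin.ext h)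
        omega
      refine ⟨if (i : ℕ) < i + 2 then b i i z else 0, fun I => ?_⟩
      have h1 : deriv (e i) z =
          ∑ k : Fin (j + 1), (if (k : ℕ) < i + 2 then b i k z else 0) • e k z := by
        rw [k2 ⟨i, hij⟩, Fin.sum_univ_eq_sum_range
          (fun k => (if k < (i : ℕ) + 2 then b i k z else 0) • e k z) (j + 1)]
        simp only [ite_smul, zero_smul]
        rw [← Finset.sum_filter]
        refine Finset.sum_congr ?_ fun _ _ => rfl
        ext k; simp; omega
      rw [h1, minor_update_sum (q := fun i : Fin (j + 1) => e i z) i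
        (fun k => if (k : ℕ) < i + 2 then b i k z else 0) I]
    choose! τ hτ using hlow
    have htop : ∀ I, minor (Function.update (fun i : Fin (j + 1) => e i z) (Fin.last j)
        (deriv (e j) z)) I = b' j z * g z I + (z - a) ^ m j * g₁ z I := by
      intro I
      have h1 : deriv (e j) z = ∑ k : Fin (j + 1), b' k z • e k z + (z - a) ^ m j • e (j + 1) z := by
        rw [Fin.sum_univ_eq_sum_range (fun k => b' k z • e k z) (j + 1), ← k3]
        module
      rw [h1, minor_update_add, minor_update_smul,
        minor_update_sum (q := fun i : Fin (j + 1) => e i z) (Fin.last j) (fun k => b' k z) I]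
      rfl
    refine ⟨∑ i ∈ Finset.univ.erase (Fin.last j), τ i + b' j z, fun I => ?_⟩
    refine (hasDerivAt_minor (q := fun i : Fin (j + 1) => e i) (q' := fun i => deriv (e i) z)
      (fun i => (k1 i).differentiableAt.hasDerivAt) I).congr_deriv ?_
    rw [← Finset.sum_erase_add _ _ (Finset.mem_univ (Fin.last j)),
      Finset.sum_congr rfl fun i hi => hτ i (Finset.ne_of_mem_erase hi) I]
    have h2 := htop I
    rw [show (Fin.last j : ℕ) = j from rfl, h2, ← Finset.sum_mul]
    ring
  set H : ℂ → (Fin (j + 1) ↪o Fin 7) × (Fin (j + 1) ↪o Fin 7) → ℂ := fun z I =>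
    g z I.1 * g₁ z I.2 - g z I.2 * g₁ z I.1 with hH
  have hHan : AnalyticAt ℂ H a := analyticAt_pi_iff.2 fun I =>
    ((hgI I.1).mul (hg1I I.2)).sub ((hgI I.2).mul (hg1I I.1))
  have hW : ∀ᶠ z in 𝓝 a, wedgeDeriv g z = (z - a) ^ m j • H z := by
    filter_upwards [hderiv] with z hz
    obtain ⟨τ, hτ⟩ := hz
    have h1 : deriv g z = fun I => τ * g z I + (z - a) ^ m j * g₁ z I :=
      (hasDerivAt_pi.2 hτ).deriv
    funext I
    simp only [wedgeDeriv, h1, hH, Pi.smul_apply, smul_eq_mul]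
    ring
  have hpan : AnalyticAt ℂ (fun z => (z - a) ^ m j • H z) a := by
    have : AnalyticAt ℂ (fun z : ℂ => (z - a) ^ m j) a := by fun_prop
    exact this.smul hHan
  have hWan : AnalyticAt ℂ (wedgeDeriv g) a := hpan.congr (hW.mono fun z hz => hz.symm)
  refine (hWan.analyticOrderAt_eq_natCast).2 ⟨H, hHan, fun h0 => ?_, hW⟩
  -- If g ∧ g₁ vanished at a, g₁ would be a multiple of g. The independent vectors e_0, …, e_{j-1},
  -- e_{j+1} + κ e_j would then have all minors zero.
  have hpar : ∀ I, minor (Function.update (fun i : Fin (j + 1) => e i a) (Fin.last j)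
      (e (j + 1) a + (-(g₁ a I₀ / g a I₀)) • e j a)) I = 0 := by
    intro I
    have h1 := congrFun h0 (I₀, I)
    simp only [hH, Pi.zero_apply] at h1
    have h2 : Function.update (fun i : Fin (j + 1) => e i a) (Fin.last j) (e j a) =
        fun i : Fin (j + 1) => e i a := Function.update_eq_self (Fin.last j) _
    rw [minor_update_add, minor_update_smul, h2]
    change g₁ a I + -(g₁ a I₀ / g a I₀) * g a I = 0
    have h3 : g a I₀ ≠ 0 := hI₀
    field_simp
    linear_combination h1
  have hli : LinearIndependent ℂ (Function.update (fun i : Fin (j + 1) => e i a) (Fin.last j)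
      (e (j + 1) a + (-(g₁ a I₀ / g a I₀)) • e j a)) := by
    have h1 := hind (j + 2) hj
    rw [Fintype.linearIndependent_iff] at h1 ⊢
    set κ := -(g₁ a I₀ / g a I₀)
    intro w hw
    have h2 := h1 (Fin.snoc (fun i : Fin (j + 1) => if i = Fin.last j then w (Fin.last j) * κ
      else w i) (w (Fin.last j))) (by
        rw [Fin.sum_univ_castSucc, Fin.sum_univ_castSucc]
        rw [Fin.sum_univ_castSucc] at hw
        simp only [Fin.snoc_castSucc, Fin.snoc_last, Function.update_self, Fin.val_castSucc,
          Fin.val_last, (Fin.castSucc_lt_last _).ne, Function.update_of_ne, ne_eq,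
          not_false_eq_true, if_true, if_false] at hw ⊢
        rw [← hw]
        module)
    intro i
    have h3 := h2 (Fin.last (j + 1))
    rw [Fin.snoc_last] at h3
    by_cases hi : i = Fin.last j
    · rw [hi, h3]
    · have := h2 i.castSucc
      rw [Fin.snoc_castSucc, if_neg hi] at this
      exact this
  obtain ⟨I, hI⟩ := exists_minor_ne_zero hli
  exact hI (hpar I)

end IsFrame

/-! ### Points without higher order singularities -/

theorem IsFrame.det_iteratedDeriv_ne_zero {a : ℂ} {P : ℂ → C7} {e : ℕ → ℂ → C7} {m : ℕ → ℕ}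
    (h : IsFrame a P 7 e m) (hm : ∀ j < 6, m j = 0) :
    Matrix.det (Matrix.of fun i j : Fin 7 => iteratedDeriv i P a j) ≠ 0 := by
  obtain ⟨I, hI⟩ := exists_minor_ne_zero h.indep
  have h1 := congrFun (h.osculating_eq (show 6 < 7 by norm_num)).self_of_nhds I
  have h2 : ∑ i : Fin 7, ∑ l ∈ Finset.range i, m l = 0 :=
    Finset.sum_eq_zero fun i _ => Finset.sum_eq_zero fun l hl =>
      hm l (by have := Finset.mem_range.1 hl; omega)
  change _ = (a - a) ^ (∑ i : Fin 7, ∑ l ∈ Finset.range i, m l) * _ at h1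
  rw [h2, pow_zero, one_mul] at h1
  have h3 : osculating 6 P a I ≠ 0 := by rw [h1]; exact hI
  intro h0
  obtain ⟨v, hv, hv0⟩ := Matrix.exists_vecMul_eq_zero_iff.2 h0
  refine h3 (Matrix.exists_vecMul_eq_zero_iff.1 ⟨v, hv, ?_⟩)
  ext b
  exact congrFun hv0 (I b)

open Polynomial in
theorem IsDirectrixPoly.wronski_ne_zero {F : ℂ → C7} {p : Fin 7 → ℂ[X]} (hF : IsACLift F)
    (hfull : IsFullLift F) (hp : IsDirectrixPoly F p) {φ : OnePoint ℂ → CP6} {c : Bool}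
    (hφ : ∀ z, (φ (chart c z)).submodule = Submodule.span ℂ {pvec p z}) {a : ℂ}
    (ha : ∀ (j : Fin 6) (r : ℕ∞), HasRamificationIndex φ j (chart c a) r → r = 0) :
    wronski p a ≠ 0 := by
  have hgen : ∃ᶠ z in 𝓝 a, LinearIndependent ℂ fun i : Fin 7 => iteratedDeriv i (pvec p) z := by
    refine (Filter.Eventually.frequently (f := 𝓝[≠] a) ?_).filter_mono nhdsWithin_le_nhds
    filter_upwards [hp.eventually_wronski_ne_zero hF hfull (hF.binormal_ne_zero hfull) a] with z hz
    simpa only [iteratedDeriv_pvec] using linearIndependent_derivs hz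
  obtain ⟨e, m, h⟩ := IsFrame.exists_frame ((differentiable_pvec p).analyticAt a)
    (hp.ne_zero a) 6 hgen
  have hm : ∀ j < 6, m j = 0 := fun j hj => by
    have := ha ⟨j, hj⟩ _ (h.hasRamificationIndex (show j + 1 < 7 by omega) (Set.mem_univ a)
      ⟨isOpen_univ, fun z _ => hφ z⟩ (differentiable_pvec p).differentiableOn)
    exact_mod_cast this
  have h1 := h.det_iteratedDeriv_ne_zero hm
  rw [wronski_eq_det, ← Matrix.det_transpose]
  simp only [iteratedDeriv_pvec] at h1
  exact h1

/-! ### The singularity type of a curve in monomial form -/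

/-- The adapted frame at `0` of `∑ z ^ m_i v_i`. -/
def monomialFrame (m : ℕ → ℕ) (v : Fin 7 → C7) (j : ℕ) (z : ℂ) : C7 :=
  ∑ i : Fin 7, ((∏ l ∈ Finset.range j, ((m i : ℂ) - m l)) * z ^ (m i - m j)) • v i

/-- The product of differences kills the terms with i < j, where the truncated exponent m_i - m_j
would be wrong. The derivative of the j-th vector is then exactly z^{m_{j+1} - m_j - 1} times the
next. -/
theorem isFrame_monomialFrame {m : ℕ → ℕ} (hm : StrictMonoOn m (Set.Iio 7)) (hm0 : m 0 = 0)
    {v : Fin 7 → C7} (hv : LinearIndependent ℂ v) :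
    IsFrame 0 (fun z => ∑ i : Fin 7, z ^ m i • v i) 7 (monomialFrame m v)
      (fun j => m (j + 1) - m j - 1) := by
  have hprod : ∀ {i j : ℕ}, i < j → ∏ l ∈ Finset.range j, ((m i : ℂ) - m l) = 0 := fun {i j} hij =>
    Finset.prod_eq_zero (Finset.mem_range.2 hij) (sub_self _)
  refine ⟨fun j _ => ?_, ?_, ?_, fun j hj => ?_⟩
  · have : Differentiable ℂ (monomialFrame m v j) := by
      unfold monomialFrame
      fun_prop
    exact this.analyticAt 0
  · ext1 z
    simp [monomialFrame, hm0]
  · have h1 : ∀ j : Fin 7, monomialFrame m v j 0 =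
        (∏ l ∈ Finset.range j, ((m j : ℂ) - m l)) • v j := by
      intro j
      rw [monomialFrame, Finset.sum_eq_single j]
      · simp
      · intro i _ hij
        rcases lt_or_gt_of_ne hij with h | h
        · rw [hprod h, zero_mul, zero_smul]
        · have : m j < m i := hm (show (j : ℕ) < 7 from j.2) (show (i : ℕ) < 7 from i.2) h
          rw [zero_pow (by omega), mul_zero, zero_smul]
      · simp
    have h2 : ∀ j : Fin 7, ∏ l ∈ Finset.range j, ((m j : ℂ) - m l) ≠ 0 := fun j => by
      refine Finset.prod_ne_zero_iff.2 fun l hl => sub_ne_zero.2 ?_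
      have hl := Finset.mem_range.1 hl
      have : m l < m j := hm (show l < 7 by omega) (show (j : ℕ) < 7 from j.2) hl
      exact_mod_cast this.ne'
    have h3 := hv.units_smul fun j => Units.mk0 _ (h2 j)
    convert h3 using 1
    ext1 j
    rw [h1]
    rfl
  · have h0 : ∀ z, deriv (monomialFrame m v j) z =
        z ^ (m (j + 1) - m j - 1) • monomialFrame m v (j + 1) z := by
      intro z
      have h1 : HasDerivAt (monomialFrame m v j) (∑ i : Fin 7,
          ((∏ l ∈ Finset.range j, ((m i : ℂ) - m l)) *
            (((m i - m j : ℕ) : ℂ) * z ^ (m i - m j - 1))) • v i) z := by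
        unfold monomialFrame
        exact HasDerivAt.fun_sum fun i _ =>
          ((hasDerivAt_pow (m i - m j) z).const_mul _).smul_const (v i)
      rw [h1.deriv, monomialFrame, Finset.smul_sum]
      refine Finset.sum_congr rfl fun i _ => ?_
      rw [smul_smul]
      congr 1
      rw [Finset.prod_range_succ]
      rcases lt_trichotomy (i : ℕ) j with h | h | h
      · rw [hprod h]; ring
      · rw [h]; simp
      · have k1 : m j < m (j + 1) := hm (show j < 7 by omega) hj (Nat.lt_succ_self j)
        have k2 : m (j + 1) ≤ m i := hm.monotoneOn hj (show (i : ℕ) < 7 from i.2) h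
        have k3 : m i - m j - 1 = (m (j + 1) - m j - 1) + (m i - m (j + 1)) := by omega
        rw [k3, pow_add, Nat.cast_sub (by omega)]
        ring
    refine AnSpan.zero.congr (Filter.Eventually.of_forall fun z => ?_)
    simp only [h0, sub_zero, sub_self]

theorem hasSingularityType_of_monomial {m : Fin 7 → ℕ} (hm : StrictMono m) (hm0 : m 0 = 0)
    {v : Fin 7 → C7} (hv : LinearIndependent ℂ v) {φ : OnePoint ℂ → CP6} {c : Bool}
    (hφ : ∀ z, (φ (chart c z)).submodule = Submodule.span ℂ {gsum m v 0 z}) :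
    HasSingularityType φ (chart c 0) fun j => m j.succ - m j.castSucc - 1 := by
  set M : ℕ → ℕ := fun j => if h : j < 7 then m ⟨j, h⟩ else 0 with hM
  have hMm : ∀ i : Fin 7, M i = m i := fun i => by simp [hM]
  have h1 := isFrame_monomialFrame (m := M) (fun i hi j hj hij => by
    simp only [hM, dif_pos (show i < 7 from hi), dif_pos (show j < 7 from hj)]
    exact hm hij) (by simp [hM, hm0]) hv
  have hP : (fun z : ℂ => ∑ i : Fin 7, z ^ M i • v i) = gsum m v 0 := by
    ext1 z
    simp [gsum, hMm]
  rw [hP] at h1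
  intro j
  have h2 := h1.hasRamificationIndex (show (j : ℕ) + 1 < 7 by omega) (Set.mem_univ 0)
    (φ := φ) (c := c) ⟨isOpen_univ, fun z _ => hφ z⟩ (by
      rw [← hP]
      fun_prop)
  have h3 : M (j + 1) - M j - 1 = m j.succ - m j.castSucc - 1 := by
    rw [← hMm, ← hMm]
    rfl
  rwa [h3] at h2

/-- The monomial form of a curve at infinity. -/
theorem gsum_rev {m : Fin 7 → ℕ} {v : Fin 7 → C7} {d : ℕ} (h : ∀ i, m i + m i.rev = d) {w : ℂ}
    (hw : w ≠ 0) : gsum m (v ∘ Fin.rev) 0 w = w ^ d • gsum m v 0 w⁻¹ := by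
  simp only [gsum, Finset.smul_sum, pow_zero, one_mul, smul_smul, Function.comp_apply]
  rw [← Equiv.sum_comp Fin.revPerm]
  refine Finset.sum_congr rfl fun i _ => ?_
  simp only [Fin.revPerm_apply, Fin.rev_rev]
  congr 1
  rw [← h i, pow_add, inv_pow]
  field_simp

/-! ### The explicit curve in monomial form -/

theorem csqrt_sq (n : ℕ) : csqrt n ^ 2 = n := by
  rw [csqrt, ← Complex.ofReal_pow, Real.sq_sqrt (Nat.cast_nonneg n)]
  simp

theorem csqrt_thirty : csqrt 30 = csqrt 2 * csqrt 3 * csqrt 5 := by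
  simp only [csqrt, ← Complex.ofReal_mul]
  rw [← Real.sqrt_mul (by positivity), ← Real.sqrt_mul (by positivity)]
  norm_num

/-- A basis of `ℂ⁷` adapted to the complexified cross product. -/
def nullVec (α β ε : ℂ) : Fin 7 → C7 :=
  ![!₂[0, 0, Complex.I * (45 * csqrt 2 * (α * β)), 0, 0, 0, -(45 * csqrt 2 * (α * β))],
    !₂[0, 15 * csqrt 3 * β, 0, 0, 0, -Complex.I * (15 * csqrt 3 * β), 0],
    !₂[-(3 * csqrt 30 * α), 0, 0, 0, Complex.I * (3 * csqrt 30 * α), 0, 0],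
    !₂[0, 0, 0, -(6 * csqrt 5 * ε), 0, 0, 0],
    !₂[csqrt 30 / 2, 0, 0, 0, Complex.I * (csqrt 30 / 2), 0, 0],
    !₂[0, csqrt 3, 0, 0, 0, Complex.I * csqrt 3, 0],
    !₂[0, 0, Complex.I * (csqrt 2 / 2), 0, 0, 0, csqrt 2 / 2]]

theorem dotC_nullVec (α β ε : ℂ) (s t : Fin 7 → ℂ) :
    dotC (∑ i, s i • nullVec α β ε i) (∑ i, t i • nullVec α β ε i) =
      90 * (-(α * β) * (s 0 * t 6 + s 6 * t 0) + β * (s 1 * t 5 + s 5 * t 1) -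
        α * (s 2 * t 4 + s 4 * t 2) + 2 * ε ^ 2 * (s 3 * t 3)) := by
  have h2 := csqrt_sq 2
  have h3 := csqrt_sq 3
  have h5 := csqrt_sq 5
  have hI := Complex.I_sq
  simp only [dotC, nullVec, Fin.sum_univ_seven, PiLp.add_apply, PiLp.smul_apply,
    Matrix.cons_val, smul_eq_mul, csqrt_thirty, mul_zero, add_zero, zero_add, Nat.cast_ofNat]
    at h2 h3 h5 ⊢
  generalize csqrt 2 = p at *
  generalize csqrt 3 = q at *
  generalize csqrt 5 = r at *
  generalize Complex.I = J at *
  grind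

/-- The structure constants of the cross product in the basis `nullVec`. -/
def nullCross (α β ε : ℂ) (s t : Fin 7 → ℂ) : Fin 7 → ℂ :=
  ![6 * ε * (s 0 * t 3 - s 3 * t 0) - 6 * (s 1 * t 2 - s 2 * t 1),
    6 * α * (s 0 * t 4 - s 4 * t 0) - 6 * ε * (s 1 * t 3 - s 3 * t 1),
    6 * β * (s 0 * t 5 - s 5 * t 0) - 6 * ε * (s 2 * t 3 - s 3 * t 2),
    3 * (α * β * (s 0 * t 6 - s 6 * t 0) + β * (s 1 * t 5 - s 5 * t 1) -
      α * (s 2 * t 4 - s 4 * t 2)) / ε,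
    6 * β * (s 1 * t 6 - s 6 * t 1) - 6 * ε * (s 3 * t 4 - s 4 * t 3),
    6 * α * (s 2 * t 6 - s 6 * t 2) - 6 * ε * (s 3 * t 5 - s 5 * t 3),
    6 * ε * (s 3 * t 6 - s 6 * t 3) - 6 * (s 4 * t 5 - s 5 * t 4)]

theorem crossC_nullVec {α β ε : ℂ} (hε : ε ≠ 0) (s t : Fin 7 → ℂ) :
    crossC (∑ i, s i • nullVec α β ε i) (∑ i, t i • nullVec α β ε i) =
      (Complex.I * csqrt 5) • ∑ i, nullCross α β ε s t i • nullVec α β ε i := by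
  have h2 := csqrt_sq 2
  have h3 := csqrt_sq 3
  have h5 := csqrt_sq 5
  have hI := Complex.I_sq
  have hw : 3 * (α * β * (s 0 * t 6 - s 6 * t 0) + β * (s 1 * t 5 - s 5 * t 1) -
      α * (s 2 * t 4 - s 4 * t 2)) / ε * ε = 3 * (α * β * (s 0 * t 6 - s 6 * t 0) +
      β * (s 1 * t 5 - s 5 * t 1) - α * (s 2 * t 4 - s 4 * t 2)) := div_mul_cancel₀ _ hε
  ext i
  fin_cases i <;>
  · simp only [crossC, cross, nullVec, nullCross, Fin.sum_univ_seven, PiLp.add_apply,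
      PiLp.smul_apply, PiLp.toLp_apply, Matrix.cons_val, smul_eq_mul, csqrt_thirty, mul_zero,
      add_zero, zero_add, Nat.cast_ofNat, Fin.zero_eta, Fin.mk_one, Fin.reduceFinMk] at h2 h3 h5 ⊢
    generalize 3 * (α * β * (s 0 * t 6 - s 6 * t 0) + β * (s 1 * t 5 - s 5 * t 1) -
      α * (s 2 * t 4 - s 4 * t 2)) / ε = W at *
    generalize csqrt 2 = p at *
    generalize csqrt 3 = q at *
    generalize csqrt 5 = r at *
    generalize Complex.I = J at *
    grind

/-- The exponents of the explicit curve. -/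
def exampleExponent (k l : ℕ) : Fin 7 → ℕ :=
  ![0, k, k + l, 2 * k + l, 3 * k + l, 3 * k + 2 * l, 4 * k + 2 * l]

/-- The coefficient vectors of the explicit curve. -/
def exampleVec (k l : ℕ) : Fin 7 → C7 :=
  nullVec ((l : ℂ) * (k + l) / ((3 * k + l) * (2 * k + l)))
    ((k : ℂ) * l / ((3 * k + 2 * l) * (2 * k + l))) ((l : ℂ) / (2 * k + l))

theorem examplePoly_eq_gsum (k l : ℕ) (z : ℂ) :
    examplePoly k l z = gsum (exampleExponent k l) (exampleVec k l) 0 z := by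
  ext i
  fin_cases i <;>
    simp [examplePoly, gsum, exampleVec, nullVec, exampleExponent, Fin.sum_univ_seven]
  all_goals
    generalize (3 * (k : ℂ) + 2 * l) = D
    generalize (3 * (k : ℂ) + l) = E
    generalize (2 * (k : ℂ) + l) = F
    ring

theorem exampleVec_six (k l : ℕ) : exampleVec k l 6 = exampleLead := rfl

section

variable (k l : ℕ+)

theorem cast_pnat_ne_zero : ((k : ℕ) : ℂ) ≠ 0 := by exact_mod_cast k.pos.ne'

theorem cast_add_ne_zero (a b : ℕ) : ((a * (k : ℕ) + b * (l : ℕ) + (k : ℕ) : ℕ) : ℂ) ≠ 0 := by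
  have := k.pos
  exact_mod_cast (by omega : a * (k : ℕ) + b * (l : ℕ) + (k : ℕ) ≠ 0)

theorem cast_two_ne_zero : (2 * (k : ℕ) + (l : ℕ) : ℂ) ≠ 0 := by
  have := cast_add_ne_zero k l 1 1
  push_cast at this
  convert this using 1; ring

theorem cast_three_ne_zero : (3 * (k : ℕ) + (l : ℕ) : ℂ) ≠ 0 := by
  have := cast_add_ne_zero k l 2 1
  push_cast at this
  convert this using 1; ring

theorem cast_three_two_ne_zero : (3 * (k : ℕ) + 2 * (l : ℕ) : ℂ) ≠ 0 := by
  have := cast_add_ne_zero k l 2 2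
  push_cast at this
  convert this using 1; ring

theorem cast_one_ne_zero : ((k : ℕ) + (l : ℕ) : ℂ) ≠ 0 := by
  have := cast_add_ne_zero k l 0 1
  push_cast at this
  convert this using 1; ring

/-- This orthogonality gives linear independence of the coefficients and makes the weighted circle
action unitary. -/
theorem inner_exampleVec {i j : Fin 7} (hij : i ≠ j) :
    inner ℂ (exampleVec k l i) (exampleVec k l j) = 0 := by
  have hc : ∀ n, (starRingEnd ℂ) (csqrt n) = csqrt n := fun n => Complex.conj_ofReal _
  have hI := Complex.I_sq
  fin_cases i <;> fin_cases j <;> first | exact absurd rfl hij | skip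
  all_goals
    simp [inner_eq_dotC, dotC, conjC, exampleVec, nullVec, Fin.sum_univ_seven, hc]
  all_goals
    generalize Complex.I = J at *
    grind

theorem exampleVec_ne_zero (i : Fin 7) : exampleVec k l i ≠ 0 := by
  have hs : ∀ n, n ≠ 0 → csqrt n ≠ 0 := fun n hn => csqrt_ne_zero hn
  have k0 := cast_pnat_ne_zero k
  have k1 := cast_pnat_ne_zero l
  have k2 := cast_two_ne_zero k l
  have k3 := cast_three_ne_zero k l
  have k4 := cast_three_two_ne_zero k l
  have k5 := cast_one_ne_zero k l
  intro h
  have h0 := congrArg (fun v : C7 => v 0) h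
  have h1 := congrArg (fun v : C7 => v 1) h
  have h3 := congrArg (fun v : C7 => v 3) h
  have h6 := congrArg (fun v : C7 => v 6) h
  fin_cases i <;>
    simp [exampleVec, nullVec, hs, k0, k1, k2, k3, k4, k5] at h0 h1 h3 h6

theorem linearIndependent_exampleVec : LinearIndependent ℂ (exampleVec k l) :=
  linearIndependent_of_ne_zero_of_inner_eq_zero (exampleVec_ne_zero k l)
    fun _ _ hij => inner_exampleVec k l hij

theorem isNullSystem_exampleVec : ∃ c,
    IsNullSystem (exampleExponent k l) (exampleVec k l) c (2 * k + l) := by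
  have k0 := cast_pnat_ne_zero k
  have k1 := cast_pnat_ne_zero l
  have k2 := cast_two_ne_zero k l
  have k3 := cast_three_ne_zero k l
  have k4 := cast_three_two_ne_zero k l
  have k5 := cast_one_ne_zero k l
  have hk := k.pos
  have hl := l.pos
  have hε : ((l : ℕ) : ℂ) / (2 * (k : ℕ) + (l : ℕ)) ≠ 0 := div_ne_zero k1 k2
  have hdot : ∀ a b, (a ≤ 2 ∧ b ≤ 2 ∨ a = 0 ∧ b = 3) → ∀ z,
      dotC (gsum (exampleExponent k l) (exampleVec k l) a z)
        (gsum (exampleExponent k l) (exampleVec k l) b z) = 0 := by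
    intro a b hab z
    rw [gsum, gsum, exampleVec, dotC_nullVec]
    simp only [exampleExponent, Matrix.cons_val, Nat.cast_add, Nat.cast_mul, Nat.cast_ofNat,
      Nat.cast_zero, pow_add, pow_zero, pow_mul']
    generalize z ^ (k : ℕ) = X
    generalize z ^ (l : ℕ) = Y
    generalize ((k : ℕ) : ℂ) = K at *
    generalize ((l : ℕ) : ℂ) = L at *
    generalize hD : 2 * K + L = D at *
    generalize hE : 3 * K + L = E at *
    generalize hG : 3 * K + 2 * L = G at *
    rcases hab with ⟨ha, hb⟩ | ⟨rfl, rfl⟩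
    · interval_cases a <;> interval_cases b <;> (field_simp; subst D E G; ring)
    · field_simp; subst D E G; ring
  have hcross : ∀ b d z, (∀ s t, s = (fun i => ((exampleExponent k l i : ℕ) : ℂ) ^ 0 *
        z ^ exampleExponent k l i) → t = (fun i => ((exampleExponent k l i : ℕ) : ℂ) ^ b *
        z ^ exampleExponent k l i) → ∀ i, nullCross
          (((l : ℕ) : ℂ) * ((k : ℕ) + (l : ℕ)) / ((3 * (k : ℕ) + (l : ℕ)) * (2 * (k : ℕ) + (l : ℕ))))
          (((k : ℕ) : ℂ) * (l : ℕ) / ((3 * (k : ℕ) + 2 * (l : ℕ)) * (2 * (k : ℕ) + (l : ℕ))))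
          (((l : ℕ) : ℂ) / (2 * (k : ℕ) + (l : ℕ))) s t i = d * s i) →
      crossC (gsum (exampleExponent k l) (exampleVec k l) 0 z)
        (gsum (exampleExponent k l) (exampleVec k l) b z) =
        (Complex.I * csqrt 5 * d) • gsum (exampleExponent k l) (exampleVec k l) 0 z := by
    intro b d z h
    rw [gsum, gsum, exampleVec, crossC_nullVec hε, mul_smul (Complex.I * csqrt 5) d]
    congr 1
    rw [Finset.smul_sum]
    refine Finset.sum_congr rfl fun i _ => ?_
    rw [h _ _ rfl rfl i, smul_smul]
  -- The factor i√5 comes from `crossC_nullVec`. The remaining 6kl(k+l) is the v_0-coefficient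
  -- 6l(2k+l)² - 6((k+l)³ - k³) of P × θ³P.
  refine ⟨Complex.I * csqrt 5 * (6 * (k : ℕ) * (l : ℕ) * ((k : ℕ) + (l : ℕ))), ?_,
    linearIndependent_exampleVec k l, ?_, fun a b z ha hb _ => hdot a b (Or.inl ⟨ha, hb⟩) z,
    fun z _ => hdot 0 3 (Or.inr ⟨rfl, rfl⟩) z, fun b z hb _ => ?_, fun z _ => ?_⟩
  · rw [Fin.strictMono_iff_lt_succ]
    intro i
    fin_cases i <;> simp [exampleExponent]
  · have := csqrt_ne_zero (n := 5) (by norm_num)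
    simp [this, k0, k1, k5]
  · have h := hcross b 0 z ?_
    · rw [h, mul_zero, zero_smul]
    · rintro s t rfl rfl i
      fin_cases i <;> simp only [nullCross, exampleExponent, Matrix.cons_val, Nat.cast_add,
        Nat.cast_mul, Nat.cast_ofNat, Nat.cast_zero, pow_add, pow_zero, pow_mul', Fin.zero_eta,
        Fin.mk_one, Fin.reduceFinMk]
      all_goals
        generalize z ^ (k : ℕ) = X
        generalize z ^ (l : ℕ) = Y
        generalize ((k : ℕ) : ℂ) = K at *
        generalize ((l : ℕ) : ℂ) = L at *
        generalize hD : 2 * K + L = D at *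
        generalize hE : 3 * K + L = E at *
        generalize hG : 3 * K + 2 * L = G at *
        interval_cases b <;> (field_simp; subst D E G; ring)
  · have h := hcross 3 (6 * (k : ℕ) * (l : ℕ) * ((k : ℕ) + (l : ℕ)) * z ^ (2 * (k : ℕ) + l)) z ?_
    · rw [h]; congr 1; ring
    · rintro s t rfl rfl i
      fin_cases i <;> simp only [nullCross, exampleExponent, Matrix.cons_val, Nat.cast_add,
        Nat.cast_mul, Nat.cast_ofNat, Nat.cast_zero, pow_add, pow_zero, pow_mul', Fin.zero_eta,
        Fin.mk_one, Fin.reduceFinMk]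
      all_goals
        generalize z ^ (k : ℕ) = X
        generalize z ^ (l : ℕ) = Y
        generalize ((k : ℕ) : ℂ) = K at *
        generalize ((l : ℕ) : ℂ) = L at *
        generalize hD : 2 * K + L = D at *
        generalize hE : 3 * K + L = E at *
        generalize hG : 3 * K + 2 * L = G at *
        field_simp
        subst D E G
        ring

/-! ### Circle symmetry -/

/-- The orthonormal basis of `ℂ⁷` given by the coefficients of the explicit curve. -/
theorem exists_orthonormalBasis : ∃ (b : OrthonormalBasis (Fin 7) ℂ C7) (r : Fin 7 → ℂ),
    ∀ i, exampleVec k l i = r i • b i := by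
  have h0 := exampleVec_ne_zero k l
  have hon : Orthonormal ℂ fun i => ((‖exampleVec k l i‖⁻¹ : ℝ) : ℂ) • exampleVec k l i := by
    refine ⟨fun i => ?_, fun i j hij => ?_⟩
    · rw [norm_smul, Complex.norm_real, norm_inv, norm_norm, inv_mul_cancel₀ (norm_ne_zero_iff.2 (h0 i))]
    · change inner ℂ (_ • _) (_ • _) = (0 : ℂ)
      rw [inner_smul_left, inner_smul_right, inner_exampleVec k l hij, mul_zero, mul_zero]
  refine ⟨OrthonormalBasis.mk hon
    (hon.linearIndependent.span_eq_top_of_card_eq_finrank (by simp)).ge,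
    fun i => (‖exampleVec k l i‖ : ℂ), fun i => ?_⟩
  rw [OrthonormalBasis.coe_mk, smul_smul, ← Complex.ofReal_mul,
    mul_inv_cancel₀ (norm_ne_zero_iff.2 (h0 i)), Complex.ofReal_one, one_smul]

end

/-- The diagonal action of the circle with given weights. -/
def diagAction (m : Fin 7 → ℕ) : Circle →* (C7 ≃ₗᵢ[ℂ] C7) where
  toFun θ :=
    { toFun := fun v => WithLp.toLp 2 fun i => (θ : ℂ) ^ m i * v i
      invFun := fun v => WithLp.toLp 2 fun i => ((θ : ℂ) ^ m i)⁻¹ * v i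
      map_add' := fun x y => by ext i; simp [mul_add]
      map_smul' := fun c x => by ext i; simp; ring
      left_inv := fun x => by ext i; simp
      right_inv := fun x => by ext i; simp
      norm_map' := fun x => by simp [EuclideanSpace.norm_eq, Circle.norm_coe] }
  map_one' := by ext x i; simp
  map_mul' := fun θ θ' => by
    ext x i
    simp [LinearIsometryEquiv.coe_mul, mul_pow, mul_assoc]

theorem diagAction_apply (m : Fin 7 → ℕ) (θ : Circle) (v : C7) (i : Fin 7) :
    diagAction m θ v i = (θ : ℂ) ^ m i * v i := rfl

/-- The circle action with given weights on the vectors of an orthonormal basis. -/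
def basisAction (b : OrthonormalBasis (Fin 7) ℂ C7) (m : Fin 7 → ℕ) :
    Circle →* (C7 ≃ₗᵢ[ℂ] C7) where
  toFun θ := (b.repr.trans (diagAction m θ)).trans b.repr.symm
  map_one' := by ext1 x; simp
  map_mul' := fun θ θ' => by ext1 x; simp [LinearIsometryEquiv.coe_mul]

theorem basisAction_apply (b : OrthonormalBasis (Fin 7) ℂ C7) (m : Fin 7 → ℕ) (θ : Circle)
    (i : Fin 7) : basisAction b m θ (b i) = (θ : ℂ) ^ m i • b i := by
  change b.repr.symm (diagAction m θ (b.repr (b i))) = _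
  rw [LinearIsometryEquiv.symm_apply_eq, map_smul]
  ext j
  rw [diagAction_apply, b.repr_self]
  by_cases h : j = i
  · subst h; simp
  · simp [h]

theorem continuous_basisAction (b : OrthonormalBasis (Fin 7) ℂ C7) (m : Fin 7 → ℕ) (v : C7) :
    Continuous fun θ => basisAction b m θ v := by
  have h : Continuous fun θ : Circle => diagAction m θ (b.repr v) := by
    refine (PiLp.continuous_toLp 2 _).comp (continuous_pi fun i => ?_)
    exact ((continuous_subtype_val).pow _).mul continuous_const
  exact b.repr.symm.continuous.comp h

theorem mk_eq_of_span {φ : CP6} {x : C7} (hx : x ≠ 0)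
    (h : φ.submodule = Submodule.span ℂ {x}) : φ = Projectivization.mk ℂ x hx :=
  Projectivization.submodule_injective (h.trans (Projectivization.submodule_mk x hx).symm)

theorem isS1Symmetric_exampleCurve (k l : ℕ+) : IsS1Symmetric (exampleCurve k l) := by
  obtain ⟨b, r, hb⟩ := exists_orthonormalBasis k l
  set m := exampleExponent k l with hm
  set ρ := basisAction b m with hρ
  have hu : ∀ θ i, ρ θ (exampleVec k l i) = (θ : ℂ) ^ m i • exampleVec k l i := fun θ i => by
    rw [hb, map_smul, basisAction_apply, smul_comm]
  refine ⟨ρ, continuous_basisAction b m, ?_, fun θ p => ?_⟩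
  · have hk : ((k : ℕ) : ℝ) ≠ 0 := by exact_mod_cast k.pos.ne'
    -- This rotation acts by 1 on the first coefficient vector and by -1 on the second, so it moves
    -- the line of their sum.
    set θ : Circle := Circle.exp (Real.pi / (k : ℕ)) with hθ
    have hθk : (θ : ℂ) ^ (k : ℕ) = -1 := by
      rw [← Circle.coe_pow, hθ, ← Circle.exp_nsmul]
      rw [nsmul_eq_mul, mul_div_cancel₀ _ hk]
      simp [Circle.coe_exp]
    have hli := linearIndependent_exampleVec k l
    have hne : exampleVec k l 0 + exampleVec k l 1 ≠ 0 := fun h => by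
      have := (LinearIndependent.pair_iff.1 (show LinearIndependent ℂ
        ![exampleVec k l 0, exampleVec k l 1] by
          convert hli.comp ![0, 1] (by decide) using 1; ext i; fin_cases i <;> rfl)) 1 1
          (by simpa using h)
      exact one_ne_zero this.1
    refine ⟨θ, Projectivization.mk ℂ _ hne, fun h => ?_⟩
    rw [projAct, Projectivization.map_mk, Projectivization.mk_eq_mk_iff'] at h
    obtain ⟨a, ha⟩ := h
    change a • (exampleVec k l 0 + exampleVec k l 1) =
      ρ θ (exampleVec k l 0 + exampleVec k l 1) at ha
    rw [map_add, hu, hu, show m 0 = 0 from rfl, show m 1 = k from rfl, hθk] at ha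
    have := (LinearIndependent.pair_iff.1 (show LinearIndependent ℂ
      ![exampleVec k l 0, exampleVec k l 1] by
        convert hli.comp ![0, 1] (by decide) using 1; ext i; fin_cases i <;> rfl)) (a - 1) (a + 1)
        (by linear_combination (norm := module) ha)
    have h2 : (2 : ℂ) = 0 := by linear_combination this.2 - this.1
    norm_num at h2
  · induction p using OnePoint.rec with
    | infty =>
      change Projectivization.mk ℂ exampleLead exampleLead_ne_zero =
        projAct _ (Projectivization.mk ℂ exampleLead exampleLead_ne_zero)
      rw [projAct, Projectivization.map_mk, Projectivization.mk_eq_mk_iff']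
      refine ⟨((θ : ℂ) ^ m 6)⁻¹, ?_⟩
      change _ • ρ θ exampleLead = exampleLead
      rw [← exampleVec_six k l, hu, smul_smul, inv_mul_cancel₀ (pow_ne_zero _ θ.coe_ne_zero),
        one_smul]
    | coe z =>
      change Projectivization.mk ℂ (examplePoly k l (θ * z)) _ =
        projAct _ (Projectivization.mk ℂ (examplePoly k l z) (examplePoly_ne_zero k l z))
      rw [projAct, Projectivization.map_mk, Projectivization.mk_eq_mk_iff']
      refine ⟨1, ?_⟩
      change (1 : ℂ) • ρ θ (examplePoly k l z) = _
      rw [one_smul, examplePoly_eq_gsum, examplePoly_eq_gsum, gsum, gsum, map_sum]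
      refine Finset.sum_congr rfl fun i _ => ?_
      rw [map_smul, hu, smul_smul, mul_pow]
      congr 1
      ring

/-! ### The curve at infinity, equivalence with the explicit curve, and the theorem. -/

open scoped Polynomial

theorem gsum_at_zero {m : Fin 7 → ℕ} (hm : StrictMono m) (hm0 : m 0 = 0) (v : Fin 7 → C7) :
    gsum m v 0 0 = v 0 := by
  rw [gsum, Finset.sum_eq_single 0]
  · simp [hm0]
  · intro i _ hi
    have : m i ≠ 0 := fun h => by
      have := hm (Fin.pos_of_ne_zero hi)
      omega
    simp [this]
  · simp

theorem map_gsum {m : Fin 7 → ℕ} {v u : Fin 7 → C7} {A : C7 ≃ₗ[ℂ] C7} {κ : ℂ}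
    (hA : ∀ i, A (v i) = κ • u i) (z : ℂ) : A (gsum m v 0 z) = κ • gsum m u 0 z := by
  rw [gsum, gsum, map_sum, Finset.smul_sum]
  refine Finset.sum_congr rfl fun i _ => ?_
  rw [map_smul, hA, smul_comm]

/-- A curve given by monomials in one chart is given by the reversed monomials in the other. -/
theorem span_gsum_rev {m : Fin 7 → ℕ} (hm : StrictMono m) (hm0 : m 0 = 0) {v : Fin 7 → C7}
    (hv : LinearIndependent ℂ v) {d : ℕ} (hd : ∀ i, m i + m i.rev = d) {φ : OnePoint ℂ → CP6}
    {p : Bool → Fin 7 → ℂ[X]} (hp : ∀ z, pvec (p true) z ≠ 0)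
    (hφ : ∀ c z, (φ (chart c z)).submodule = Submodule.span ℂ {pvec (p c) z})
    (hP : ∀ z, pvec (p false) z = gsum m v 0 z) (w : ℂ) :
    (φ (chart true w)).submodule = Submodule.span ℂ {gsum m (v ∘ Fin.rev) 0 w} := by
  have key : ∀ w, w ≠ 0 →
      (φ (chart true w)).submodule = Submodule.span ℂ {gsum m (v ∘ Fin.rev) 0 w} := fun w hw => by
    have h1 : chart true w = chart false w⁻¹ := by simp [chart, hw]
    rw [h1, hφ, hP, gsum_rev hd hw,
      Submodule.span_singleton_smul_eq (pow_ne_zero d hw).isUnit]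
  by_cases hw : w = 0
  · subst hw
    have hc : Continuous (gsum m (v ∘ Fin.rev) 0) := by
      unfold gsum
      fun_prop
    rw [hφ]
    refine span_eq_of_eventually (g := pvec (p true)) (differentiable_pvec _).continuous.continuousAt
      (hp 0) (Filter.Eventually.of_forall fun ζ => Submodule.mem_span_singleton_self _)
      hc.continuousAt (by rw [gsum_at_zero hm hm0]; exact hv.ne_zero 6) ?_
    filter_upwards [self_mem_nhdsWithin] with ζ hζ
    rw [← hφ, key ζ hζ]
    exact Submodule.mem_span_singleton_self _
  · exact key w hw

theorem exampleExponent_sub (k l : ℕ) :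
    (fun j : Fin 6 => exampleExponent k l j.succ - exampleExponent k l j.castSucc - 1) =
      ![k - 1, l - 1, k - 1, k - 1, l - 1, k - 1] := by
  ext j
  fin_cases j <;> simp [exampleExponent] <;> omega

theorem projAct_eq_of_span {φ : CP6} {A : C7 ≃ₗ[ℂ] C7} {x y : C7} (hx : x ≠ 0) (hy : y ≠ 0)
    (h : φ.submodule = Submodule.span ℂ {x}) {κ : ℂ} (hA : A x = κ • y) :
    projAct A φ = Projectivization.mk ℂ y hy := by
  rw [mk_eq_of_span hx h, projAct, Projectivization.map_mk, Projectivization.mk_eq_mk_iff']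
  exact ⟨κ, hA.symm⟩

theorem g2CEquivalent_exampleCurve {k l : ℕ+} {v : Fin 7 → C7} {c : ℂ}
    (hv : IsNullSystem (exampleExponent k l) v c (2 * k + l)) {φ : OnePoint ℂ → CP6}
    (h0 : ∀ z, (φ (chart false z)).submodule = Submodule.span ℂ {gsum (exampleExponent k l) v 0 z})
    (h1 : (φ (chart true 0)).submodule = Submodule.span ℂ {v 6}) :
    G2CEquivalent φ (exampleCurve k l) := by
  obtain ⟨c', hu⟩ := isNullSystem_exampleVec k l
  obtain ⟨A, hA, hAv⟩ := hv.exists_equiv hu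
  refine ⟨A, hA, fun p => (?_ : projAct A (φ p) = exampleCurve k l p).symm⟩
  induction p using OnePoint.rec with
  | infty =>
    exact projAct_eq_of_span (hv.indep.ne_zero 6) exampleLead_ne_zero (by simpa [chart] using h1) (hAv 6)
  | coe z =>
    have hx : gsum (exampleExponent k l) v 0 z ≠ 0 := fun h => by
      by_cases hz : z = 0
      · subst hz
        rw [gsum_at_zero hv.mono rfl] at h
        exact hv.indep.ne_zero 0 h
      · exact hv.gsum_ne_zero hz h
    exact projAct_eq_of_span hx (examplePoly_ne_zero k l z) (h0 z)
      ((map_gsum hAv z).trans (by rw [examplePoly_eq_gsum]))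

end SixSphere

end

theorem mainTheorem2 (f : OnePoint ℂ → SixSphere.S6) (k : ℕ) (hk : k ≤ 2)
    (hfull : SixSphere.IsLinearlyFull f)
    (hac : SixSphere.IsAlmostComplexCurve f)
    (hram : SixSphere.IsPointRamified k (SixSphere.projMap f))
    (hsing : SixSphere.higherOrderSingularities (SixSphere.projMap f) ⊆
      {((0 : ℂ) : OnePoint ℂ), OnePoint.infty}) :
    ∃ φ : OnePoint ℂ → SixSphere.CP6,
      SixSphere.IsDirectrix φ (SixSphere.projMap f) ∧
      (∀ φ', SixSphere.IsDirectrix φ' (SixSphere.projMap f) → φ' = φ) ∧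
      ∃ k₁ k₂ : ℕ+,
        SixSphere.HasSingularityType φ ((0 : ℂ) : OnePoint ℂ)
          ![(k₁ : ℕ) - 1, (k₂ : ℕ) - 1, (k₁ : ℕ) - 1, (k₁ : ℕ) - 1, (k₂ : ℕ) - 1, (k₁ : ℕ) - 1] ∧
        SixSphere.HasSingularityType φ OnePoint.infty
          ![(k₁ : ℕ) - 1, (k₂ : ℕ) - 1, (k₁ : ℕ) - 1, (k₁ : ℕ) - 1, (k₂ : ℕ) - 1, (k₁ : ℕ) - 1] ∧
        SixSphere.G2CEquivalent φ (SixSphere.exampleCurve k₁ k₂) ∧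
        SixSphere.IsS1Symmetric (SixSphere.exampleCurve k₁ k₂) := by
  have hP := fun c => SixSphere.isACPair_coordLift hac c
  have hF := fun c => SixSphere.isFullLift_coordLift hfull hac c
  choose p hp using fun c => (hP c).exists_directrixPoly (hF c)
  obtain ⟨φ, hφ, hφp⟩ := SixSphere.exists_directrix hfull hac hp
  refine ⟨φ, hφ, fun φ' hφ' => ?_, ?_⟩
  · have h : ∀ c z, φ' (SixSphere.chart c z) = φ (SixSphere.chart c z) := fun c z =>
      Projectivization.submodule_injective <|
        (SixSphere.directrix_unique hfull hac hp hφ' c z).trans (hφp c z).symm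
    ext1 q
    obtain ⟨z, rfl⟩ | rfl := SixSphere.chart_surj false q
    exacts [h _ z, h _ 0]
  -- A zero of the Wronskian outside 0 would be a higher order singularity outside {0, ∞}.
  have hw : ∀ z, z ≠ 0 → SixSphere.wronski (p false) z ≠ 0 := fun a ha =>
    (hp false).wronski_ne_zero (hP false).left (hF false) (hφp false) fun j r hr => by
      by_contra hr0
      have hmem := hsing ⟨φ, hφ, j, r, hr, hr0⟩
      simp [SixSphere.chart, ha] at hmem
  obtain ⟨m, v, c, e, hv, hm0, hPv⟩ := (hp false).exists_isNullSystem (hP false).left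
    ((hP false).left.binormal_ne_zero (hF false)) hw
  obtain ⟨k₁, k₂, rfl, hm⟩ := hv.exists_exponents hm0
  obtain rfl : m = SixSphere.exampleExponent k₁ k₂ := hm
  have h0 : ∀ z, (φ (SixSphere.chart false z)).submodule =
      Submodule.span ℂ {SixSphere.gsum (SixSphere.exampleExponent k₁ k₂) v 0 z} := fun z => by
    rw [hφp, hPv]
  -- Since m_i + m_{6-i} is constant, reversing the coefficient vectors gives a monomial form at ∞
  -- with the same exponents, hence the same singularity type.
  have h1 := SixSphere.span_gsum_rev hv.mono hm0 hv.indep hv.add_rev (hp true).ne_zero hφp hPv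
  refine ⟨k₁, k₂, ?_, ?_, ?_, SixSphere.isS1Symmetric_exampleCurve k₁ k₂⟩
  · rw [← SixSphere.exampleExponent_sub]
    exact SixSphere.hasSingularityType_of_monomial hv.mono hm0 hv.indep h0
  · rw [← SixSphere.exampleExponent_sub]
    have := SixSphere.hasSingularityType_of_monomial hv.mono hm0
      (hv.indep.comp Fin.rev Fin.rev_injective) h1
    simpa [SixSphere.chart] using this
  · refine SixSphere.g2CEquivalent_exampleCurve hv h0 ?_
    rw [h1, SixSphere.gsum_at_zero hv.mono hm0]
    rfl
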